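/- Let $n>2$, let $\Omega\subset\mathbb{R}^n$ be a bounded domain (open, connected, nonempty) with smooth boundary and outer unit normal $\nu$, let $W(s)=\frac12(1-s^2)^2$, and let $\mathcal{H}^{n-1}$ be the $(n-1)$-dimensional Hausdorff measure. Let $(\varepsilon_j)_{j\in\mathbb N},(\sigma_j)_{j\in\mathbb N}\subset(0,1)$ with $\varepsilon_j\to0$ and $\sigma_j\to0$. For each $j$ let $u_0^j\in W^{1,2}(\Omega)$ with $|u_0^j|\le 1$ a.e. in $\Omega$, and suppose that there is a constant $D$ with $$\int_\Omega\Big(\frac{\varepsilon_j|\nabla u_0^j|^2}{2}+\frac{W(u_0^j)}{\varepsilon_j}\Big)dx\le D\qquad\text{for all } j.$$ For each $j$ let $u^j$ be a solution of $$\partial_t u^j=\Delta u^j-\varepsilon_j^{-2}W'(u^j)\ \text{ in }\Omega\times(0,\infty),\qquad \partial_t u^j+\sigma_j\nabla u^j\cdot\nu=0\ \text{ on }\partial\Omega\times(0,\infty),\qquad u^j(\cdot,0)=u_0^j\ \text{ in }\Omega,$$ where the equations hold almost everywhere (the values on $\partial\Omega$ being traces), $u^j\in L^2_{loc}([0,\infty);W^{2,2}(\Omega))\cap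 L^2_{loc}([0,\infty);W^{1,2}(\partial\Omega,\mathcal{H}^{n-1}))$ and $\partial_tu^j\in L^2_{loc}([0,\infty);L^2(\Omega))\cap L^2_{loc}([0,\infty);L^2(\partial\Omega,\mathcal{H}^{n-1}))$. Suppose that for all $0\le s_1<s_2<\infty$ there is a constant $C_0(s_1,s_2)$ with $$\sup_j\int_{s_1}^{s_2}\int_{\partial\Omega}\frac{\varepsilon_j}{2}\Big(\frac{\partial u^j}{\partial\nu}\Big)^2d\mathcal{H}^{n-1}\,dt\le C_0(s_1,s_2).$$ Let $\alpha^j:=\varepsilon_j|\nabla_{\partial\Omega}u^j|^2\,\mathcal{H}^{n-1}\lfloor_{\partial\Omega}\otimes\mathcal{L}^1$ on $\partial\Omega\times[0,\infty)$, where $\nabla_{\partial\Omega}$ is the tangential gradient, and let $\alpha$ be a Radon measure on $\partial\Omega\times[0,\infty)$ such that $\int\varphi\,d\alpha^j\to\int\varphi\,d\alpha$ for every $\varphi\in C_c(\partial\Omega\times[0,\infty))$. Put $w^j:=u^j-\frac13(u^j)^3$, and suppose that there are $0\le t_1<t_2<\infty$ and a connected component $\Gamma_1$ of $\partial\Omega$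 such that $$\limsup_{j\to\infty}\int_{t_1}^{t_2}\Big|\int_{\Gamma_1}w^j\,d\mathcal{H}^{n-1}\Big|\,dt<\frac23\,\mathcal{H}^{n-1}(\Gamma_1)\,(t_2-t_1).$$ Then there is a constant $\tilde C>0$ such that $\alpha(\Gamma_1\times[t_1,t_2])\ge\tilde C$; in particular, $\alpha$ is not identically zero. -/

import Mathlib

open MeasureTheory Set Filter Topology
open scoped ContDiff ENNReal

noncomputable section

namespace AllenCahn

/-- The double-well potential `W(s) = (1 - s²)² / 2`. -/
def doubleWell (s : ℝ) : ℝ := (1 / 2) * (1 - s ^ 2) ^ 2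

/-- `ρ` is a smooth local defining function of `Ω` in the open neighbourhood `U` of the boundary
point `p`: `Ω ∩ U = {ρ < 0} ∩ U` and `∇ρ(p) ≠ 0`. -/
structure IsLocalDefiningFunction {n : ℕ} (Ω : Set (EuclideanSpace ℝ (Fin n)))
    (p : EuclideanSpace ℝ (Fin n)) (U : Set (EuclideanSpace ℝ (Fin n)))
    (ρ : EuclideanSpace ℝ (Fin n) → ℝ) : Prop where
  mem_frontier : p ∈ frontier Ω
  isOpen : IsOpen U
  mem : p ∈ U
  contDiffOn : ContDiffOn ℝ ∞ ρ U
  gradient_ne_zero : gradient ρ p ≠ 0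
  inter_eq : Ω ∩ U = {x ∈ U | ρ x < 0}

/-- A bounded domain (open, connected, nonempty) with smooth boundary. -/
structure IsSmoothBoundedDomain {n : ℕ} (Ω : Set (EuclideanSpace ℝ (Fin n))) : Prop where
  isOpen : IsOpen Ω
  isConnected : IsConnected Ω
  isBounded : Bornology.IsBounded Ω
  smooth_boundary : ∀ p ∈ frontier Ω, ∃ U ρ, IsLocalDefiningFunction Ω p U ρ

/-- `v` is the outer unit normal `∇ρ(p) / |∇ρ(p)|` of `Ω` at the boundary point `p`. -/
def IsOuterUnitNormal {n : ℕ} (Ω : Set (EuclideanSpace ℝ (Fin n)))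
    (p v : EuclideanSpace ℝ (Fin n)) : Prop :=
  ∃ U ρ, IsLocalDefiningFunction Ω p U ρ ∧ v = ‖gradient ρ p‖⁻¹ • gradient ρ p

open Classical in
/-- The outer unit normal `ν` of `Ω` (zero where there is none, in particular off `∂Ω`). -/
def outerNormal {n : ℕ} (Ω : Set (EuclideanSpace ℝ (Fin n))) (p : EuclideanSpace ℝ (Fin n)) :
    EuclideanSpace ℝ (Fin n) :=
  if h : ∃ v, IsOuterUnitNormal Ω p v then h.choose else 0

/-- The part of the vector `v` that is tangential to `∂Ω` at `p`. -/
def tangentialPart {n : ℕ} (Ω : Set (EuclideanSpace ℝ (Fin n)))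
    (p v : EuclideanSpace ℝ (Fin n)) : EuclideanSpace ℝ (Fin n) :=
  v - inner ℝ v (outerNormal Ω p) • outerNormal Ω p

/-- The measure `𝓗ⁿ⁻¹` restricted to `∂Ω`, with `𝓗ⁿ⁻¹` normalized to agree with Lebesgue measure on
`(n-1)`-dimensional planes. -/
def boundaryMeasure {n : ℕ} (Ω : Set (EuclideanSpace ℝ (Fin n))) :
    Measure (EuclideanSpace ℝ (Fin n)) :=
  (Measure.euclideanHausdorffMeasure (n - 1)).restrict (frontier Ω)

/-- `f ∈ W^{1,2}(Ω)` with weak gradient `F`. -/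
structure IsSobolev {n : ℕ} (Ω : Set (EuclideanSpace ℝ (Fin n)))
    (f : EuclideanSpace ℝ (Fin n) → ℝ)
    (F : EuclideanSpace ℝ (Fin n) → EuclideanSpace ℝ (Fin n)) : Prop where
  memLp : MemLp f 2 (volume.restrict Ω)
  memLp_gradient : MemLp F 2 (volume.restrict Ω)
  weak_gradient : ∀ φ : EuclideanSpace ℝ (Fin n) → ℝ, ContDiff ℝ ∞ φ → HasCompactSupport φ →
    tsupport φ ⊆ Ω → ∫ x in Ω, f x • gradient φ x = -∫ x in Ω, φ x • F x

/-- `g : ∂Ω → ℝ` is the boundary trace of the function `f ∈ W^{1,2}(Ω)` with weak gradient `F`: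
functions smooth up to the boundary approximate `f` in `W^{1,2}(Ω)` while their restrictions
approximate `g` in `L²(∂Ω)`. -/
def HasTrace {n : ℕ} (Ω : Set (EuclideanSpace ℝ (Fin n)))
    (f : EuclideanSpace ℝ (Fin n) → ℝ)
    (F : EuclideanSpace ℝ (Fin n) → EuclideanSpace ℝ (Fin n))
    (g : EuclideanSpace ℝ (Fin n) → ℝ) : Prop :=
  IsSobolev Ω f F ∧
  ∃ φ : ℕ → EuclideanSpace ℝ (Fin n) → ℝ, (∀ k, ContDiff ℝ ∞ (φ k)) ∧
    Tendsto (fun k => eLpNorm (fun x => φ k x - f x) 2 (volume.restrict Ω)) atTop (𝓝 0) ∧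
    Tendsto (fun k => eLpNorm (fun x => gradient (φ k) x - F x) 2 (volume.restrict Ω))
      atTop (𝓝 0) ∧
    Tendsto (fun k => eLpNorm (fun x => φ k x - g x) 2 (boundaryMeasure Ω)) atTop (𝓝 0)

/-- `g ∈ W^{1,2}(∂Ω, 𝓗ⁿ⁻¹)` with tangential gradient `G = ∇_{∂Ω} g`, where `W^{1,2}(∂Ω)` is the
completion of the smooth functions on `∂Ω`. -/
def IsBoundarySobolev {n : ℕ} (Ω : Set (EuclideanSpace ℝ (Fin n)))
    (g : EuclideanSpace ℝ (Fin n) → ℝ)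
    (G : EuclideanSpace ℝ (Fin n) → EuclideanSpace ℝ (Fin n)) : Prop :=
  MemLp g 2 (boundaryMeasure Ω) ∧ MemLp G 2 (boundaryMeasure Ω) ∧
  ∃ φ : ℕ → EuclideanSpace ℝ (Fin n) → ℝ, (∀ k, ContDiff ℝ ∞ (φ k)) ∧
    Tendsto (fun k => eLpNorm (fun x => φ k x - g x) 2 (boundaryMeasure Ω)) atTop (𝓝 0) ∧
    Tendsto (fun k => eLpNorm (fun x => tangentialPart Ω x (gradient (φ k) x) - G x) 2
      (boundaryMeasure Ω)) atTop (𝓝 0)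

/-- A function `u` on `Ω̄ × [0,∞)` together with functions that play the role of its derivatives;
`IsSolution` says that they are. The values at `x ∈ ∂Ω` of `u` and `grad` are those of the boundary
traces of `u` and `∇u`, and `dt` at `x ∈ ∂Ω` is the time derivative of the trace of `u`. -/
structure PhaseField (n : ℕ) where
  /-- `u(x,t)` -/
  u : EuclideanSpace ℝ (Fin n) → ℝ → ℝ
  /-- `∇u(x,t)` -/
  grad : EuclideanSpace ℝ (Fin n) → ℝ → EuclideanSpace ℝ (Fin n)
  /-- `∇(∂ᵢu)(x,t)` -/
  hess : EuclideanSpace ℝ (Fin n) → ℝ → Fin n → EuclideanSpace ℝ (Fin n)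
  /-- `∂ₜu(x,t)` -/
  dt : EuclideanSpace ℝ (Fin n) → ℝ → ℝ
  /-- `∇_{∂Ω}u(x,t)`, for `x ∈ ∂Ω` -/
  tgrad : EuclideanSpace ℝ (Fin n) → ℝ → EuclideanSpace ℝ (Fin n)

/-- `v` is a solution of
`∂ₜu = Δu - ε⁻² W'(u)` in `Ω × (0,∞)`, `∂ₜu + σ ∇u·ν = 0` on `∂Ω × (0,∞)`, `u(·,0) = u₀` in `Ω`,
with `u ∈ L²_loc([0,∞); W^{2,2}(Ω)) ∩ L²_loc([0,∞); W^{1,2}(∂Ω))` and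
`∂ₜu ∈ L²_loc([0,∞); L²(Ω)) ∩ L²_loc([0,∞); L²(∂Ω))`. -/
structure IsSolution {n : ℕ} (Ω : Set (EuclideanSpace ℝ (Fin n))) (ε σ : ℝ)
    (u₀ : EuclideanSpace ℝ (Fin n) → ℝ) (v : PhaseField n) : Prop where
  -- `u ∈ L²_loc([0,∞); W^{2,2}(Ω))`, and the traces of `u` and `∇u`
  memLp_u : ∀ T > 0, MemLp (fun z : EuclideanSpace ℝ (Fin n) × ℝ => v.u z.1 z.2) 2
    ((volume.restrict Ω).prod (volume.restrict (Ioc 0 T)))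
  memLp_grad : ∀ T > 0, MemLp (fun z : EuclideanSpace ℝ (Fin n) × ℝ => v.grad z.1 z.2) 2
    ((volume.restrict Ω).prod (volume.restrict (Ioc 0 T)))
  memLp_hess : ∀ T > 0, ∀ i,
    MemLp (fun z : EuclideanSpace ℝ (Fin n) × ℝ => v.hess z.1 z.2 i) 2
      ((volume.restrict Ω).prod (volume.restrict (Ioc 0 T)))
  trace_u : ∀ᵐ t ∂(volume.restrict (Ioi (0 : ℝ))),
    HasTrace Ω (fun x => v.u x t) (fun x => v.grad x t) (fun x => v.u x t)
  trace_grad : ∀ᵐ t ∂(volume.restrict (Ioi (0 : ℝ))), ∀ i,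
    HasTrace Ω (fun x => v.grad x t i) (fun x => v.hess x t i) (fun x => v.grad x t i)
  measurable_grad_boundary :
    AEStronglyMeasurable (fun z : EuclideanSpace ℝ (Fin n) × ℝ => v.grad z.1 z.2)
      ((boundaryMeasure Ω).prod (volume.restrict (Ioi 0)))
  -- `u ∈ L²_loc([0,∞); W^{1,2}(∂Ω))`
  memLp_u_boundary : ∀ T > 0, MemLp (fun z : EuclideanSpace ℝ (Fin n) × ℝ => v.u z.1 z.2) 2
    ((boundaryMeasure Ω).prod (volume.restrict (Ioc 0 T)))
  memLp_tgrad : ∀ T > 0, MemLp (fun z : EuclideanSpace ℝ (Fin n) × ℝ => v.tgrad z.1 z.2) 2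
    ((boundaryMeasure Ω).prod (volume.restrict (Ioc 0 T)))
  tangential_gradient : ∀ᵐ t ∂(volume.restrict (Ioi (0 : ℝ))),
    IsBoundarySobolev Ω (fun x => v.u x t) (fun x => v.tgrad x t)
  -- `∂ₜu ∈ L²_loc([0,∞); L²(Ω))`, with initial value `u₀`
  memLp_dt : ∀ T > 0, MemLp (fun z : EuclideanSpace ℝ (Fin n) × ℝ => v.dt z.1 z.2) 2
    ((volume.restrict Ω).prod (volume.restrict (Ioc 0 T)))
  time_derivative : ∀ t ≥ 0, ∀ᵐ x ∂(volume.restrict Ω),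
    v.u x t = u₀ x + ∫ s in (0 : ℝ)..t, v.dt x s
  -- `∂ₜu ∈ L²_loc([0,∞); L²(∂Ω))`
  memLp_dt_boundary : ∀ T > 0, MemLp (fun z : EuclideanSpace ℝ (Fin n) × ℝ => v.dt z.1 z.2) 2
    ((boundaryMeasure Ω).prod (volume.restrict (Ioc 0 T)))
  time_derivative_boundary : ∀ t ≥ 0, ∀ᵐ x ∂(boundaryMeasure Ω),
    v.u x t = v.u x 0 + ∫ s in (0 : ℝ)..t, v.dt x s
  -- the equation in `Ω` and the boundary condition
  equation : ∀ᵐ z ∂((volume.restrict Ω).prod (volume.restrict (Ioi (0 : ℝ)))),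
    v.dt z.1 z.2 = (∑ i, v.hess z.1 z.2 i i) - (ε ^ 2)⁻¹ * deriv doubleWell (v.u z.1 z.2)
  boundary_condition : ∀ᵐ z ∂((boundaryMeasure Ω).prod (volume.restrict (Ioi (0 : ℝ)))),
    v.dt z.1 z.2 + σ * inner ℝ (v.grad z.1 z.2) (outerNormal Ω z.1) = 0

/-- The energy `∫_Ω (ε|∇f|²/2 + W(f)/ε) dx` of `f` with weak gradient `F`. -/
def energy {n : ℕ} (Ω : Set (EuclideanSpace ℝ (Fin n))) (ε : ℝ)
    (f : EuclideanSpace ℝ (Fin n) → ℝ)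
    (F : EuclideanSpace ℝ (Fin n) → EuclideanSpace ℝ (Fin n)) : ℝ :=
  ∫ x in Ω, (ε * ‖F x‖ ^ 2 / 2 + doubleWell (f x) / ε)

/-- The measure `α^{ε,σ} = ε |∇_{∂Ω} u|² 𝓗ⁿ⁻¹⌊∂Ω ⊗ 𝓛¹` on `∂Ω × [0,∞)`, as a measure on
`ℝⁿ × ℝ`. -/
def weightedBoundaryArea {n : ℕ} (Ω : Set (EuclideanSpace ℝ (Fin n))) (ε : ℝ)
    (v : PhaseField n) : Measure (EuclideanSpace ℝ (Fin n) × ℝ) :=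
  ((boundaryMeasure Ω).prod (volume.restrict (Ici 0))).withDensity
    (fun z => ENNReal.ofReal (ε * ‖v.tgrad z.1 z.2‖ ^ 2))

/-- Convergence of Radon measures tested against continuous functions with compact support. -/
def VagueTendsto {X : Type*} [TopologicalSpace X] [MeasurableSpace X] (α : ℕ → Measure X)
    (β : Measure X) : Prop :=
  ∀ φ : X → ℝ, Continuous φ → HasCompactSupport φ →
    Tendsto (fun j => ∫ z, φ z ∂(α j)) atTop (𝓝 (∫ z, φ z ∂β))

end AllenCahn

end

/-! Argue by contradiction and let `α` vanish on `Γ₁ × [t₁, t₂]`. Let `h = wellPrimitive` be the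
primitive of `√(2W)`, with the integrand set to zero outside `[-1, 1]`. The tangential gradient of
`h(u)` is at most `√(2W(u)) |∇_{∂Ω} u|`. Hence the `L¹` Poincaré inequality on the connected set
`Γ₁` and Cauchy–Schwarz in space-time bound the time-integrated oscillation of `h(uʲ)` on `Γ₁` by a
constant times `(∫∫ 2W(uʲ)/εⱼ)^(1/2) αʲ(Γ₁ × [t₁, t₂])^(1/2)` (`exists_poincare_wellPrimitive`,
`exists_mean_lower_bound`).

If the boundary potential energy `∫∫ W(uʲ)/εⱼ` stays bounded, then the oscillation tends to zero and
so does `∫∫ W(uʲ)`. Where `W(u)` is small, `|h(u)|` is close to `h(1) = 2/3`. A function that is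
almost constant, with modulus almost `2/3`, has a mean of modulus almost `2/3`. Since `|h(u) - w| ≤
2W(u)`, the same holds for `w`, against the assumption on the means (`le_limsup_mean`).

The bound on the boundary potential energy is a Rellich–Pohozaev estimate
(`exists_boundary_potential_le`). At a fixed time the equation is multiplied by `X · ∇u`, where the
smooth field `X` satisfies `X · ν ≥ c > 0` on `∂Ω`. After integration by parts the boundary term
`-(1/2)|∇u|² X · ν` absorbs the full gradient on the boundary, and `∫_{∂Ω} W(u)/ε` is controlled by
the energy, by `ε ∫_Ω (∂ₜu)²` and by `ε ∫_{∂Ω} (∂u/∂ν)²`. The last term is bounded by hypothesis,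
the others by the energy inequality `IsSolution.energy_le`.

Low regularity shapes two points. No bound `|u| ≤ 1` is available for positive times, so `W` and the
primitive of `√(2W)` are truncated. The energy inequality uses the convexity of the Dirichlet
integral: its time increments are bounded by pairing `(-Δu, ∂u/∂ν)` with increments of `u` in `L²(Ω)
⊕ L²(∂Ω)`, and these are Steklov averages of `∂ₜu`.

Boundary integrals are taken with respect to a measure glued from graph charts
(`exists_isDivergenceMeasure`). It satisfies the divergence theorem and is comparable to the
Hausdorff measure, which is all that the estimates need. -/

open scoped NNReal Manifold

noncomputable section

namespace AllenCahn

section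

/-! ### Local graph representation of the boundary -/

/-- The sublevel set of a function with positive vertical derivative is locally a subgraph. -/
theorem exists_subgraph_of_fderiv_pos {G : Type*} [NormedAddCommGroup G] [InnerProductSpace ℝ G]
    [FiniteDimensional ℝ G] {g : G × ℝ → ℝ} {u : G × ℝ} (hg : ContDiffAt ℝ ∞ g u)
    (hu : g u = 0) (hpos : 0 < fderiv ℝ g u (0, 1)) :
    ∃ f : G → ℝ, ContDiff ℝ 1 f ∧ HasCompactSupport f ∧ f u.1 = u.2 ∧
      ∀ᶠ v in 𝓝 u, (g v < 0 ↔ v.2 < f v.1) := by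
  have hg1 : ContDiffAt ℝ 1 g u := hg.of_le (by norm_cast)
  have hinv : (fderiv ℝ g u ∘L .inr ℝ G ℝ).IsInvertible := by
    refine ⟨ContinuousLinearEquiv.unitsEquivAut ℝ (Units.mk0 _ hpos.ne'), ?_⟩
    ext
    simp
  set ψ := hg1.implicitFunction one_ne_zero hinv with hψ
  have hψu : ψ u.1 = u.2 := hg1.implicitFunction_apply_self one_ne_zero hinv
  have hψc : ContDiffAt ℝ 1 ψ u.1 := hg1.contDiffAt_implicitFunction one_ne_zero hinv
  have hψ0 : ∀ᶠ y in 𝓝 u.1, g (y, ψ y) = 0 := by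
    simpa [hu] using hg1.eventually_apply_implicitFunction one_ne_zero hinv
  -- a box where the vertical derivative is positive
  have hd : ∀ᶠ v in 𝓝 u, ContDiffAt ℝ 1 g v ∧ 0 < fderiv ℝ g v (0, 1) := by
    refine (hg1.eventually (by simp)).and ?_
    have hc : ContinuousAt (fun v => fderiv ℝ g v (0, 1)) u :=
      (hg1.continuousAt_fderiv one_ne_zero).clm_apply continuousAt_const
    exact hc.eventually (lt_mem_nhds hpos)
  obtain ⟨r, hr, hbox⟩ := Metric.eventually_nhds_iff_ball.1 hd
  have hlt : ∀ᶠ v in 𝓝 u, (g v < 0 ↔ v.2 < ψ v.1) := by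
    have h1 : ∀ᶠ v in 𝓝 u, dist (ψ v.1) u.2 < r := by
      have : Tendsto (fun v : G × ℝ => ψ v.1) (𝓝 u) (𝓝 u.2) := by
        have := hψc.continuousAt.tendsto
        rw [hψu] at this
        exact this.comp (continuous_fst.tendsto u)
      exact this.eventually (Metric.ball_mem_nhds _ hr)
    have h2 : ∀ᶠ v in 𝓝 u, g (v.1, ψ v.1) = 0 := (continuous_fst.tendsto u).eventually hψ0
    filter_upwards [h1, h2, Metric.ball_mem_nhds u hr] with v hv1 hv2 hv3
    have hv3' : dist v.1 u.1 < r ∧ dist v.2 u.2 < r := by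
      simpa [Prod.dist_eq] using hv3
    -- On a vertical segment in the box, `g` increases strictly and vanishes at height `ψ`, so its
    -- sign tells on which side of the graph a point lies.
    have hmono : StrictMonoOn (fun s => g (v.1, s)) (Metric.ball u.2 r) := by
      have hder : ∀ s ∈ Metric.ball u.2 r,
          HasDerivAt (fun s => g (v.1, s)) (fderiv ℝ g (v.1, s) (0, 1)) s := by
        intro s hs
        have hm : (v.1, s) ∈ Metric.ball u r := by
          simp only [Metric.mem_ball, Prod.dist_eq] at hs ⊢
          exact max_lt hv3'.1 hs
        have := ((hbox _ hm).1.differentiableAt one_ne_zero).hasFDerivAt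
        have h3 : HasDerivAt (fun s : ℝ => (v.1, s)) ((0 : G), (1 : ℝ)) s :=
          (hasDerivAt_const s v.1).prodMk (hasDerivAt_id s)
        exact this.comp_hasDerivAt s h3
      refine strictMonoOn_of_deriv_pos (convex_ball _ _)
        (fun s hs => (hder s hs).continuousAt.continuousWithinAt) ?_
      intro s hs
      have hs := interior_subset hs
      rw [(hder s hs).deriv]
      refine (hbox (v.1, s) ?_).2
      simp only [Metric.mem_ball, Prod.dist_eq] at hs ⊢
      exact max_lt hv3'.1 hs
    have := hmono.lt_iff_lt (a := v.2) (b := ψ v.1) hv3'.2 hv1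
    simp only [hv2] at this
    exact this
  obtain ⟨r₁, hr₁, hb₁⟩ := Metric.eventually_nhds_iff_ball.1 (hψc.eventually (by simp))
  -- The bump makes the implicit function globally `C¹` with compact support, hence Lipschitz, and
  -- leaves it unchanged near `u.1`.
  let χ : ContDiffBump u.1 := ⟨r₁ / 4, r₁ / 2, by positivity, by linarith⟩
  refine ⟨fun y => χ y * ψ y, ?_, ?_, ?_, ?_⟩
  · rw [contDiff_iff_contDiffAt]
    intro y
    by_cases hy : y ∈ Metric.ball u.1 r₁
    · exact χ.contDiffAt.mul (hb₁ y hy)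
    · have hy' : y ∉ tsupport χ := by
        rw [χ.tsupport_eq]
        intro h
        simp only [Metric.mem_closedBall, Metric.mem_ball, χ] at h hy
        linarith
      have : (fun y => χ y * ψ y) =ᶠ[𝓝 y] fun _ => 0 := by
        filter_upwards [notMem_tsupport_iff_eventuallyEq.1 hy'] with z hz
        simp [hz]
      exact contDiffAt_const.congr_of_eventuallyEq this
  · exact χ.hasCompactSupport.mul_right
  · simp [χ.one_of_mem_closedBall (Metric.mem_closedBall_self χ.rIn_pos.le), hψu]
  · have : ∀ᶠ v in 𝓝 u, χ v.1 = 1 :=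
      (continuous_fst.tendsto u).eventually χ.eventuallyEq_one
    filter_upwards [hlt, this] with v h1 h2
    simpa [h2] using h1

/-- In the open set `Q`, after the linear change of variables `T`, the set `Ω` is the subgraph of
the function `f`. -/
structure IsGraphChart {n : ℕ} (Ω Q : Set (EuclideanSpace ℝ (Fin n)))
    (T : (EuclideanSpace ℝ (Fin (n - 1)) × ℝ) ≃L[ℝ] EuclideanSpace ℝ (Fin n))
    (f : EuclideanSpace ℝ (Fin (n - 1)) → ℝ) : Prop where
  isOpen : IsOpen Q
  contDiff : ContDiff ℝ 1 f
  hasCompactSupport : HasCompactSupport f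
  mem_iff : ∀ v, T v ∈ Q → (T v ∈ Ω ↔ v.2 < f v.1)

variable {n : ℕ} {Ω Q : Set (EuclideanSpace ℝ (Fin n))}

/-- The inequality `≤ 0` passes to the closure, and a negative value would put the point into the
open set `Ω`, which is disjoint from its frontier. -/
theorem IsLocalDefiningFunction.apply_eq_zero {p q : EuclideanSpace ℝ (Fin n)}
    {U : Set (EuclideanSpace ℝ (Fin n))} {ρ : EuclideanSpace ℝ (Fin n) → ℝ} (hΩ : IsOpen Ω)
    (h : IsLocalDefiningFunction Ω p U ρ) (hq : q ∈ frontier Ω) (hqU : q ∈ U) : ρ q = 0 := by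
  have hU := h.isOpen.mem_nhds hqU
  have hc : ContinuousAt ρ q := h.contDiffOn.continuousOn.continuousAt hU
  refine le_antisymm ?_ ?_
  · have h1 : ∃ᶠ x in 𝓝 q, x ∈ Ω := mem_closure_iff_frequently.1 hq.1
    refine le_of_tendsto_of_frequently hc.tendsto ?_
    refine (h1.and_eventually hU).mono fun x hx => ?_
    have : x ∈ Ω ∩ U := hx
    rw [h.inter_eq] at this
    exact this.2.le
  · by_contra! hlt
    have : q ∈ Ω ∩ U := by
      rw [h.inter_eq]
      exact ⟨hqU, hlt⟩
    rw [hΩ.frontier_eq] at hq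
    exact hq.2 this.1

/-- The vertical axis is `e = ∇ρ(p)` and the horizontal space is the kernel of `dρ(p)`. The vertical
derivative at `p` is then `|e|² > 0`, as the implicit function argument requires. -/
theorem exists_isGraphChart (hn : 0 < n) (hΩ : IsSmoothBoundedDomain Ω)
    {p : EuclideanSpace ℝ (Fin n)} (hp : p ∈ frontier Ω) :
    ∃ Q T f, p ∈ Q ∧ IsGraphChart Ω Q T f := by
  obtain ⟨U, ρ, h⟩ := hΩ.smooth_boundary p hp
  have hρc : ContDiffAt ℝ ∞ ρ p := h.contDiffOn.contDiffAt (h.isOpen.mem_nhds h.mem)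
  set ℓ := fderiv ℝ ρ p with hℓ
  set e := gradient ρ p with he
  have hℓe : ∀ x, ℓ x = inner ℝ e x := by
    intro x
    simp [he, hℓ, gradient, InnerProductSpace.toDual_symm_apply]
  have hee : 0 < ℓ e := by
    rw [hℓe]
    exact real_inner_self_pos.2 h.gradient_ne_zero
  have hrank : Module.finrank ℝ (EuclideanSpace ℝ (Fin (n - 1))) =
      Module.finrank ℝ (LinearMap.ker (ℓ : EuclideanSpace ℝ (Fin n) →ₗ[ℝ] ℝ)) := by
    have h1 := LinearMap.finrank_range_add_finrank_ker (ℓ : EuclideanSpace ℝ (Fin n) →ₗ[ℝ] ℝ)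
    have h2 : LinearMap.range (ℓ : EuclideanSpace ℝ (Fin n) →ₗ[ℝ] ℝ) = ⊤ := by
      refine LinearMap.range_eq_top.2 (LinearMap.surjective ?_)
      intro h0
      have : ℓ e = 0 := by
        have := congrArg (fun l => l e) h0
        simpa using this
      exact hee.ne' this
    rw [h2] at h1
    simp at h1 ⊢
    omega
  let ι := LinearEquiv.ofFinrankEq _ _ hrank
  let T₀ : (EuclideanSpace ℝ (Fin (n - 1)) × ℝ) →ₗ[ℝ] EuclideanSpace ℝ (Fin n) :=
    (Submodule.subtype _ ∘ₗ ι.toLinearMap).coprod (LinearMap.toSpanSingleton ℝ _ e)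
  have hT₀ : ∀ y s, T₀ (y, s) = (ι y : EuclideanSpace ℝ (Fin n)) + s • e := fun y s => by simp [T₀]
  have hker : ∀ y, ℓ (ι y) = 0 := fun y => (ι y).2
  have hinj : Function.Injective T₀ := by
    rw [← LinearMap.ker_eq_bot, LinearMap.ker_eq_bot']
    rintro ⟨y, s⟩ hys
    rw [hT₀] at hys
    have hs : s = 0 := by
      have := congrArg ℓ hys
      simp [hker, hee.ne'] at this
      exact this
    subst hs
    simpa using hys
  let T := (LinearEquiv.ofInjectiveOfFinrankEq T₀ hinj (by simp; omega)).toContinuousLinearEquiv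
  have hT : ∀ v, T v = T₀ v := fun v => rfl
  set u := T.symm p with hu
  have hTu : T u = p := by simp [hu]
  have hρT : ContDiffAt ℝ ∞ (fun v => ρ (T v)) u := by
    refine ContDiffAt.comp u ?_ T.contDiff.contDiffAt
    rw [hTu]
    exact hρc
  have hfd : fderiv ℝ (fun v => ρ (T v)) u (0, 1) = ℓ e := by
    have h1 : HasFDerivAt (fun v => ρ (T v)) (ℓ ∘L (T : _ →L[ℝ] EuclideanSpace ℝ (Fin n))) u := by
      refine HasFDerivAt.comp u ?_ T.hasFDerivAt
      rw [hTu]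
      exact (hρc.differentiableAt (by simp)).hasFDerivAt
    rw [h1.fderiv]
    simp [hT, hT₀]
  obtain ⟨f, hf, hfs, hfu, hlt⟩ := exists_subgraph_of_fderiv_pos hρT
    (by rw [hTu]; exact h.apply_eq_zero hΩ.isOpen hp h.mem) (by rw [hfd]; exact hee)
  have hev : ∀ᶠ x in 𝓝 p, x ∈ U ∧ (ρ x < 0 ↔ (T.symm x).2 < f (T.symm x).1) := by
    have h1 := (T.symm.continuous.tendsto p).eventually hlt
    filter_upwards [h.isOpen.mem_nhds h.mem, h1] with x hx hx'
    exact ⟨hx, by simpa using hx'⟩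
  obtain ⟨Q, hQ, hQo, hpQ⟩ := eventually_nhds_iff.1 hev
  refine ⟨Q, T, f, hpQ, hQo, hf, hfs, fun v hv => ?_⟩
  obtain ⟨h1, h2⟩ := hQ _ hv
  simp only [ContinuousLinearEquiv.symm_apply_apply] at h2
  rw [← h2]
  have : T v ∈ Ω ∩ U ↔ T v ∈ {x ∈ U | ρ x < 0} := by rw [h.inter_eq]
  simpa [h1] using this

end

/-! ### Graph parametrization of the boundary, conormal and outer unit normal. -/

section

/-- The parametrization `y ↦ T (y, f y)` of the graph of `f`. -/
def graphMap {n : ℕ}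
    (T : (EuclideanSpace ℝ (Fin (n - 1)) × ℝ) ≃L[ℝ] EuclideanSpace ℝ (Fin n))
    (f : EuclideanSpace ℝ (Fin (n - 1)) → ℝ) (y : EuclideanSpace ℝ (Fin (n - 1))) :
    EuclideanSpace ℝ (Fin n) := T (y, f y)

/-- The conormal functional `T (w, τ) ↦ τ - Df(y) w` of the graph of `f`. -/
def conormal {n : ℕ}
    (T : (EuclideanSpace ℝ (Fin (n - 1)) × ℝ) ≃L[ℝ] EuclideanSpace ℝ (Fin n))
    (f : EuclideanSpace ℝ (Fin (n - 1)) → ℝ) (y : EuclideanSpace ℝ (Fin (n - 1))) :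
    EuclideanSpace ℝ (Fin n) →L[ℝ] ℝ :=
  (ContinuousLinearMap.snd ℝ _ ℝ - (fderiv ℝ f y) ∘L ContinuousLinearMap.fst ℝ _ ℝ) ∘L
    (T.symm : EuclideanSpace ℝ (Fin n) →L[ℝ] EuclideanSpace ℝ (Fin (n - 1)) × ℝ)

namespace IsGraphChart

variable {n : ℕ} {Ω Q : Set (EuclideanSpace ℝ (Fin n))}
  {T : (EuclideanSpace ℝ (Fin (n - 1)) × ℝ) ≃L[ℝ] EuclideanSpace ℝ (Fin n)}
  {f : EuclideanSpace ℝ (Fin (n - 1)) → ℝ}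

/-- A point strictly above the graph has a neighbourhood that misses `Ω`, and a point on the graph
is approached vertically from below. -/
theorem mem_frontier_iff (h : IsGraphChart Ω Q T f) (hΩ : IsOpen Ω)
    {v : EuclideanSpace ℝ (Fin (n - 1)) × ℝ} (hv : T v ∈ Q) :
    T v ∈ frontier Ω ↔ v.2 = f v.1 := by
  have hQ : ∀ᶠ w in 𝓝 v, T w ∈ Q :=
    T.continuous.continuousAt.eventually (h.isOpen.mem_nhds hv)
  rw [hΩ.frontier_eq]
  constructor
  · rintro ⟨h1, h2⟩
    rw [h.mem_iff v hv, not_lt] at h2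
    refine le_antisymm ?_ h2
    by_contra! hlt
    have h3 : ∀ᶠ w in 𝓝 v, f w.1 < w.2 :=
      ((h.contDiff.continuous.comp continuous_fst).tendsto v).eventually_lt
        (continuous_snd.tendsto v) hlt
    have h4 : ∀ᶠ x in 𝓝 (T v), x ∉ Ω := by
      have := (T.symm.continuous.tendsto (T v))
      rw [T.symm_apply_apply] at this
      filter_upwards [this.eventually (h3.and hQ)] with x hx
      rw [T.apply_symm_apply] at hx
      intro hxΩ
      have := (h.mem_iff (T.symm x) (by simpa using hx.2)).1 (by simpa using hxΩ)
      linarith [hx.1]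
    exact (mem_closure_iff_frequently.1 h1) h4
  · intro hv2
    refine ⟨?_, by rw [h.mem_iff v hv]; simp [hv2]⟩
    have hseq : Tendsto (fun s : ℝ => T (v.1, v.2 - s)) (𝓝[>] 0) (𝓝 (T v)) := by
      have : Tendsto (fun s : ℝ => T (v.1, v.2 - s)) (𝓝 0) (𝓝 (T (v.1, v.2 - 0))) :=
        Continuous.tendsto (by fun_prop) 0
      simp only [sub_zero] at this
      exact this.mono_left nhdsWithin_le_nhds
    refine mem_closure_of_tendsto hseq ?_
    filter_upwards [hseq.eventually (h.isOpen.mem_nhds hv), self_mem_nhdsWithin] with s hs hs0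
    rw [h.mem_iff _ hs]
    simp only [mem_Ioi] at hs0
    simp only
    linarith

theorem frontier_inter_eq (h : IsGraphChart Ω Q T f) (hΩ : IsOpen Ω) :
    frontier Ω ∩ Q = range (graphMap T f) ∩ Q := by
  ext x
  obtain ⟨v, rfl⟩ := T.surjective x
  simp only [mem_inter_iff, and_congr_left_iff]
  intro hv
  rw [h.mem_frontier_iff hΩ hv]
  simp only [mem_range, graphMap, T.injective.eq_iff]
  exact ⟨fun h => ⟨v.1, by ext1 <;> simp [h]⟩, by rintro ⟨y, rfl⟩; rfl⟩

theorem continuous_graphMap (h : IsGraphChart Ω Q T f) : Continuous (graphMap T f) := by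
  have := h.contDiff.continuous
  unfold graphMap
  fun_prop

theorem exists_lipschitzWith (h : IsGraphChart Ω Q T f) :
    ∃ K : ℝ≥0, LipschitzWith K (graphMap T f) := by
  obtain ⟨K, hK⟩ := h.contDiff.lipschitzWith_of_hasCompactSupport h.hasCompactSupport one_ne_zero
  exact ⟨_, T.lipschitz.comp (LipschitzWith.id.prodMk hK)⟩

/-- No regularity of `f` enters: the first component of `T⁻¹` is a Lipschitz left inverse. -/
theorem _root_.AllenCahn.exists_antilipschitzWith_graphMap
    (T : (EuclideanSpace ℝ (Fin (n - 1)) × ℝ) ≃L[ℝ] EuclideanSpace ℝ (Fin n))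
    (f : EuclideanSpace ℝ (Fin (n - 1)) → ℝ) :
    ∃ K : ℝ≥0, AntilipschitzWith K (graphMap T f) := by
  have h1 := LipschitzWith.prod_fst.comp T.symm.lipschitz
  exact ⟨_, h1.to_rightInverse (g := graphMap T f) (fun y => by simp [graphMap])⟩

/-- On the graph of `f` the Hausdorff measure is comparable to the Lebesgue measure of the
parameter domain. -/
theorem exists_measure_le (h : IsGraphChart Ω Q T f) :
    ∃ C : ℝ≥0,
      (Measure.euclideanHausdorffMeasure (n - 1)).restrict (range (graphMap T f)) ≤
        C • Measure.map (graphMap T f) volume ∧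
      Measure.map (graphMap T f) volume ≤
        C • (Measure.euclideanHausdorffMeasure (n - 1)).restrict (range (graphMap T f)) := by
  obtain ⟨K, hK⟩ := h.exists_lipschitzWith
  obtain ⟨K', hK'⟩ := exists_antilipschitzWith_graphMap T f
  have hm : Measurable (graphMap T f) := h.continuous_graphMap.measurable
  have hvol := EuclideanSpace.euclideanHausdorffMeasure_eq_volume (n - 1)
  -- A Lipschitz map with constant `K` enlarges the `(n-1)`-dimensional Hausdorff measure by at most
  -- `K ^ (n - 1)`. The antilipschitz constant `K'` gives the reverse comparison.
  refine ⟨max (K ^ (n - 1)) (K' ^ (n - 1)), ?_, ?_⟩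
  · refine Measure.le_iff.2 fun s hs => ?_
    rw [Measure.restrict_apply hs, Measure.smul_apply, Measure.map_apply hm hs, ← hvol,
      inter_comm, ← image_preimage_eq_range_inter, Measure.euclideanHausdorffMeasure_def,
      Measure.euclideanHausdorffMeasure_def, Measure.smul_apply, Measure.smul_apply]
    have := hK.hausdorffMeasure_image_le (d := ((n - 1 : ℕ) : ℝ)) (by positivity)
      (graphMap T f ⁻¹' s)
    rw [smul_comm]
    gcongr
    refine this.trans ?_
    rw [ENNReal.smul_def, smul_eq_mul]
    gcongr
    rw [ENNReal.rpow_natCast]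
    exact_mod_cast le_max_left _ _
  · refine Measure.le_iff.2 fun s hs => ?_
    rw [Measure.smul_apply, Measure.restrict_apply hs, Measure.map_apply hm hs, ← hvol,
      ← preimage_inter_range, Measure.euclideanHausdorffMeasure_def,
      Measure.euclideanHausdorffMeasure_def, Measure.smul_apply, Measure.smul_apply]
    have := hK'.hausdorffMeasure_preimage_le (d := ((n - 1 : ℕ) : ℝ)) (by positivity)
      (s ∩ range (graphMap T f))
    rw [smul_comm]
    gcongr
    refine this.trans ?_
    rw [ENNReal.smul_def, smul_eq_mul]
    gcongr
    rw [ENNReal.rpow_natCast]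
    exact_mod_cast le_max_right _ _

end IsGraphChart

theorem conormal_apply {n : ℕ}
    (T : (EuclideanSpace ℝ (Fin (n - 1)) × ℝ) ≃L[ℝ] EuclideanSpace ℝ (Fin n))
    (f : EuclideanSpace ℝ (Fin (n - 1)) → ℝ) (y : EuclideanSpace ℝ (Fin (n - 1)))
    (v : EuclideanSpace ℝ (Fin (n - 1)) × ℝ) :
    conormal T f y (T v) = v.2 - fderiv ℝ f y v.1 := by
  simp [conormal]

/-- `outerNormal` is a choice among the normals of all local defining functions. The choice is
immaterial, because `IsGraphChart.conormal_eq` identifies the result with the normalized conormal of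
any graph chart. -/
theorem isOuterUnitNormal_outerNormal {n : ℕ} {Ω : Set (EuclideanSpace ℝ (Fin n))}
    (hΩ : IsSmoothBoundedDomain Ω) {p : EuclideanSpace ℝ (Fin n)} (hp : p ∈ frontier Ω) :
    IsOuterUnitNormal Ω p (outerNormal Ω p) := by
  have h : ∃ v, IsOuterUnitNormal Ω p v := by
    obtain ⟨U, ρ, h⟩ := hΩ.smooth_boundary p hp
    exact ⟨_, U, ρ, h, rfl⟩
  rw [outerNormal, dif_pos h]
  exact h.choose_spec

theorem norm_outerNormal {n : ℕ} {Ω : Set (EuclideanSpace ℝ (Fin n))}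
    (hΩ : IsSmoothBoundedDomain Ω) {p : EuclideanSpace ℝ (Fin n)} (hp : p ∈ frontier Ω) :
    ‖outerNormal Ω p‖ = 1 := by
  obtain ⟨U, ρ, h, hv⟩ := isOuterUnitNormal_outerNormal hΩ hp
  rw [hv, norm_smul, norm_inv, norm_norm,
    inv_mul_cancel₀ (norm_ne_zero_iff.2 h.gradient_ne_zero)]

/-- A unit vector that is nonpositive on the open half-space where `N < 0` is the normalized
Riesz representative of `N`. -/
theorem eq_norm_mul_inner_of_halfspace {E : Type*} [NormedAddCommGroup E] [InnerProductSpace ℝ E]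
    [CompleteSpace E] {N : E →L[ℝ] ℝ} (hN : N ≠ 0) {ν : E} (hν : ‖ν‖ = 1)
    (h : ∀ d, N d < 0 → inner ℝ ν d ≤ 0) (v : E) : N v = ‖N‖ * inner ℝ ν v := by
  set a := (InnerProductSpace.toDual ℝ E).symm N with ha
  have haN : ∀ d, N d = inner ℝ a d := fun d => by
    rw [ha, InnerProductSpace.toDual_symm_apply]
  have hnorm : ‖a‖ = ‖N‖ := by simp [ha]
  have hapos : 0 < ‖N‖ := norm_pos_iff.2 hN
  have hav : a = ‖N‖ • ν := by
    by_contra hne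
    have hc : inner ℝ a ν < ‖N‖ := by
      have h1 := real_inner_le_norm a ν
      rw [hν, mul_one, hnorm] at h1
      refine lt_of_le_of_ne h1 fun h2 => hne ?_
      have h3 : inner ℝ a ν = ‖a‖ * ‖ν‖ := by rw [h2, hν, mul_one, hnorm]
      have := (inner_eq_norm_mul_iff_real).1 h3
      rw [hν, hnorm, one_smul] at this
      exact this
    -- If `a ≠ ‖N‖ • ν`, this vector lies in the half-space `N < 0`, yet its inner product with `ν`
    -- is `‖N‖ - ⟪a, ν⟫ > 0`.
    have h1 : N (‖N‖ • ν - a) < 0 := by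
      rw [haN, inner_sub_right, inner_smul_right, real_inner_self_eq_norm_sq, hnorm]
      nlinarith
    have h2 := h _ h1
    rw [inner_sub_right, inner_smul_right, real_inner_self_eq_norm_sq, hν,
      real_inner_comm] at h2
    linarith
  rw [haN, hav, inner_smul_left]
  simp

namespace IsGraphChart

variable {n : ℕ} {Ω Q : Set (EuclideanSpace ℝ (Fin n))}
  {T : (EuclideanSpace ℝ (Fin (n - 1)) × ℝ) ≃L[ℝ] EuclideanSpace ℝ (Fin n)}
  {f : EuclideanSpace ℝ (Fin (n - 1)) → ℝ}

theorem _root_.AllenCahn.conormal_ne_zero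
    (T : (EuclideanSpace ℝ (Fin (n - 1)) × ℝ) ≃L[ℝ] EuclideanSpace ℝ (Fin n))
    (f : EuclideanSpace ℝ (Fin (n - 1)) → ℝ) (y : EuclideanSpace ℝ (Fin (n - 1))) :
    conormal T f y ≠ 0 := by
  intro h
  have := conormal_apply T f y (0, 1)
  simp [h] at this

/-- The conormal of the graph is a positive multiple of the outer unit normal. -/
theorem conormal_eq (h : IsGraphChart Ω Q T f) (hΩ : IsSmoothBoundedDomain Ω)
    {y : EuclideanSpace ℝ (Fin (n - 1))} (hy : graphMap T f y ∈ Q)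
    (v : EuclideanSpace ℝ (Fin n)) :
    conormal T f y v = ‖conormal T f y‖ * inner ℝ (outerNormal Ω (graphMap T f y)) v := by
  have hp : graphMap T f y ∈ frontier Ω := (h.mem_frontier_iff hΩ.isOpen hy).2 rfl
  obtain ⟨U, ρ, hρ, hν⟩ := isOuterUnitNormal_outerNormal hΩ hp
  refine eq_norm_mul_inner_of_halfspace (conormal_ne_zero T f y) (norm_outerNormal hΩ hp) ?_ v
  intro d hd
  set p := graphMap T f y with hpdef
  have hdρ : HasFDerivAt ρ (fderiv ℝ ρ p) p :=
    ((hρ.contDiffOn.contDiffAt (hρ.isOpen.mem_nhds hρ.mem)).differentiableAt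
      (by simp)).hasFDerivAt
  have hline : HasDerivAt (fun s : ℝ => p + s • d) d 0 := by
    simpa using ((hasDerivAt_id (0 : ℝ)).smul_const d).const_add p
  have hρline : HasDerivAt (fun s : ℝ => ρ (p + s • d)) (fderiv ℝ ρ p d) 0 := by
    have : HasFDerivAt ρ (fderiv ℝ ρ p) (p + (0 : ℝ) • d) := by simpa using hdρ
    exact this.comp_hasDerivAt (0 : ℝ) hline
  -- A direction with negative conormal value enters the subgraph, hence `Ω`, so `ρ` is negative
  -- along it for small positive times. Therefore `dρ` is nonpositive on the half-space, which
  -- determines the normal.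
  have hlt : ∀ᶠ s in 𝓝[>] (0 : ℝ), ρ (p + s • d) < 0 := by
    obtain ⟨w, rfl⟩ := T.surjective d
    rw [conormal_apply] at hd
    have hcont : Tendsto (fun s : ℝ => p + s • T w) (𝓝[>] 0) (𝓝 p) := by
      have := hline.continuousAt.tendsto
      simp only [zero_smul, add_zero] at this
      exact this.mono_left nhdsWithin_le_nhds
    have hfl : HasDerivAt (fun s : ℝ => f y + s * w.2 - f (y + s • w.1))
        (w.2 - fderiv ℝ f y w.1) 0 := by
      have h1 : HasDerivAt (fun s : ℝ => y + s • w.1) w.1 0 := by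
        simpa using ((hasDerivAt_id (0 : ℝ)).smul_const w.1).const_add y
      have h2 : HasFDerivAt f (fderiv ℝ f y) (y + (0 : ℝ) • w.1) := by
        simpa using (h.contDiff.differentiable one_ne_zero y).hasFDerivAt
      have h3 := h2.comp_hasDerivAt (0 : ℝ) h1
      have h4 : HasDerivAt (fun s : ℝ => f y + s * w.2) w.2 0 := by
        simpa using ((hasDerivAt_id (0 : ℝ)).mul_const w.2).const_add (f y)
      exact h4.sub h3
    have hneg : ∀ᶠ s in 𝓝[>] (0 : ℝ), f y + s * w.2 - f (y + s • w.1) < 0 := by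
      have := hfl.tendsto_slope_zero_right
      filter_upwards [this.eventually (gt_mem_nhds hd), self_mem_nhdsWithin] with s hs hs0
      simp only [zero_add, zero_mul, zero_smul, add_zero, sub_self, sub_zero, smul_eq_mul] at hs
      have hs0 : 0 < s := hs0
      by_contra! hge
      exact absurd hs (not_lt.2 (by positivity))
    filter_upwards [hneg, hcont.eventually (hρ.isOpen.mem_nhds hρ.mem),
      hcont.eventually (h.isOpen.mem_nhds hy)] with s h1 h2 h3
    have h4 : p + s • T w = T (y + s • w.1, f y + s * w.2) := by
      rw [hpdef, graphMap, ← map_smul, ← map_add]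
      rfl
    have h5 : p + s • T w ∈ Ω := by
      rw [h4, h.mem_iff _ (by rw [← h4]; exact h3)]
      simp only
      linarith
    have : p + s • T w ∈ Ω ∩ U := ⟨h5, h2⟩
    rw [hρ.inter_eq] at this
    exact this.2
  have hρp : ρ p = 0 := hρ.apply_eq_zero hΩ.isOpen hp hρ.mem
  have hle : fderiv ℝ ρ p d ≤ 0 := by
    refine le_of_tendsto hρline.tendsto_slope_zero_right ?_
    filter_upwards [hlt, self_mem_nhdsWithin] with s hs hs0
    simp only [zero_add, zero_smul, add_zero, hρp, sub_zero, smul_eq_mul]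
    have hs0 : 0 < s := hs0
    exact mul_nonpos_of_nonneg_of_nonpos (by positivity) hs.le
  rw [hν, inner_smul_left]
  have : inner ℝ (gradient ρ p) d = fderiv ℝ ρ p d := by
    simp [gradient, InnerProductSpace.toDual_symm_apply]
  rw [this]
  exact mul_nonpos_of_nonneg_of_nonpos (by simp) hle

theorem continuous_conormal (h : IsGraphChart Ω Q T f) : Continuous (conormal T f) := by
  have := h.contDiff.continuous_fderiv one_ne_zero
  unfold conormal
  fun_prop

end IsGraphChart

/-- In a chart the normal is the normalized Riesz representative of the conormal, which depends
continuously on the point because `f` is `C¹`. -/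
theorem continuousOn_outerNormal {n : ℕ} (hn : 0 < n) {Ω : Set (EuclideanSpace ℝ (Fin n))}
    (hΩ : IsSmoothBoundedDomain Ω) : ContinuousOn (outerNormal Ω) (frontier Ω) := by
  intro p hp
  obtain ⟨Q, T, f, hpQ, h⟩ := exists_isGraphChart hn hΩ hp
  have hc : Continuous fun x => ‖conormal T f (T.symm x).1‖⁻¹ •
      (InnerProductSpace.toDual ℝ (EuclideanSpace ℝ (Fin n))).symm
        (conormal T f (T.symm x).1) := by
    have h1 := h.continuous_conormal.comp (continuous_fst.comp T.symm.continuous)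
    refine Continuous.smul (h1.norm.inv₀ fun x => ?_) (by fun_prop)
    exact norm_ne_zero_iff.2 (conormal_ne_zero _ _ _)
  refine hc.continuousAt.continuousWithinAt.congr_of_eventuallyEq_of_mem ?_ hp
  filter_upwards [self_mem_nhdsWithin, mem_nhdsWithin_of_mem_nhds (h.isOpen.mem_nhds hpQ)]
    with x hx hxQ
  have hxg : graphMap T f (T.symm x).1 = x := by
    have := (h.mem_frontier_iff hΩ.isOpen (v := T.symm x) (by simpa using hxQ)).1 (by simpa using hx)
    rw [graphMap, ← this]
    simp
  rw [eq_inv_smul_iff₀ (norm_ne_zero_iff.2 (conormal_ne_zero _ _ _))]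
  refine ext_inner_right ℝ fun v => ?_
  rw [InnerProductSpace.toDual_symm_apply, h.conormal_eq hΩ (by rw [hxg]; exact hxQ), hxg,
    inner_smul_left]
  simp

end

section

/-! ### The divergence theorem -/

theorem integral_fderiv_eq_zero_of_hasCompactSupport {G : Type*} [NormedAddCommGroup G]
    [NormedSpace ℝ G] [FiniteDimensional ℝ G] [MeasurableSpace G] [BorelSpace G]
    (μ : Measure G) [μ.IsAddHaarMeasure] {φ : G → ℝ} (hφ : ContDiff ℝ 1 φ)
    (hc : HasCompactSupport φ) (v : G) : ∫ x, fderiv ℝ φ x v ∂μ = 0 := by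
  have h1 : Continuous fun x => fderiv ℝ φ x v :=
    (hφ.continuous_fderiv one_ne_zero).clm_apply continuous_const
  have := integral_mul_fderiv_eq_neg_fderiv_mul_of_integrable (𝕜 := ℝ) (μ := μ)
    (f := fun _ => (1 : ℝ)) (g := φ) (v := v) (by simp)
    (by simpa using h1.integrable_of_hasCompactSupport (hc.fderiv_apply ℝ v))
    (by simpa using hφ.continuous.integrable_of_hasCompactSupport hc)
    (fun x _ => by fun_prop) (fun x _ => hφ.differentiable one_ne_zero x)
  simpa using this

/-- The divergence theorem below the graph of `f`. -/
theorem integral_prod_subgraph_fderiv {G : Type*} [NormedAddCommGroup G]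
    [NormedSpace ℝ G] [FiniteDimensional ℝ G] [MeasurableSpace G] [BorelSpace G]
    (μ : Measure G) [μ.IsAddHaarMeasure] {f : G → ℝ} (hf : ContDiff ℝ 1 f) {Φ : G × ℝ → ℝ}
    (hΦ : ContDiff ℝ 1 Φ) (hc : HasCompactSupport Φ) (w : G) (τ : ℝ) :
    ∫ z, (if z.2 ≤ f z.1 then fderiv ℝ Φ z (w, τ) else 0) ∂(μ.prod volume) =
      ∫ y, Φ (y, f y) * (τ - fderiv ℝ f y w) ∂μ := by
  have hcont : Continuous f := hf.continuous
  have hDcont : Continuous fun z => fderiv ℝ Φ z (w, τ) :=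
    (hΦ.continuous_fderiv one_ne_zero).clm_apply continuous_const
  have hint : Integrable (fun z : G × ℝ => if z.2 ≤ f z.1 then fderiv ℝ Φ z (w, τ) else 0)
      (μ.prod volume) := by
    have h1 : Integrable (fun z => fderiv ℝ Φ z (w, τ)) (μ.prod volume) :=
      hDcont.integrable_of_hasCompactSupport (hc.fderiv_apply ℝ _)
    have hs : MeasurableSet {z : G × ℝ | z.2 ≤ f z.1} :=
      measurableSet_le measurable_snd (hcont.measurable.comp measurable_fst)
    exact h1.indicator hs
  -- This vertical shear straightens the subgraph to the half-space `s ≤ 0` and preserves the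
  -- measure. It splits the derivative of `Φ` into a horizontal derivative of `Ψ` and a multiple of
  -- the vertical one.
  set S : (G × ℝ) ≃ₜ (G × ℝ) :=
    { toFun := fun z => (z.1, z.2 + f z.1)
      invFun := fun z => (z.1, z.2 - f z.1)
      left_inv := fun z => by simp
      right_inv := fun z => by simp
      continuous_toFun := by fun_prop
      continuous_invFun := by fun_prop } with hS
  set Ψ : G × ℝ → ℝ := fun z => Φ (z.1, z.2 + f z.1) with hΨ
  have hΨ1 : ContDiff ℝ 1 Ψ := by fun_prop
  have hΨc : HasCompactSupport Ψ := hc.comp_homeomorph S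
  have hΨd : ∀ y s, fderiv ℝ Φ (y, s + f y) (w, τ) =
      fderiv ℝ Ψ (y, s) (w, 0) + (τ - fderiv ℝ f y w) * fderiv ℝ Ψ (y, s) (0, 1) := by
    intro y s
    have h1 : HasFDerivAt (fun z : G × ℝ => (z.1, z.2 + f z.1))
        ((ContinuousLinearMap.fst ℝ G ℝ).prod
          (ContinuousLinearMap.snd ℝ G ℝ + fderiv ℝ f y ∘L ContinuousLinearMap.fst ℝ G ℝ))
        (y, s) := by
      refine hasFDerivAt_fst.prodMk (hasFDerivAt_snd.add ?_)
      exact HasFDerivAt.comp (y, s) (g := f) (hf.differentiable one_ne_zero y).hasFDerivAt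
        hasFDerivAt_fst
    have h2 : HasFDerivAt Ψ _ (y, s) := HasFDerivAt.comp (y, s) (g := Φ)
      (hΦ.differentiable one_ne_zero (y, s + f y)).hasFDerivAt h1
    rw [h2.fderiv]
    simp only [ContinuousLinearMap.comp_apply, ContinuousLinearMap.prod_apply,
      add_apply, ContinuousLinearMap.coe_fst', ContinuousLinearMap.coe_snd',
      map_zero, zero_add, add_zero]
    rw [← smul_eq_mul, ← map_smul, ← map_add]
    congr 1
    simp
  have hDΨ : ∀ u, Continuous fun z => fderiv ℝ Ψ z u := fun u =>
    (hΨ1.continuous_fderiv one_ne_zero).clm_apply continuous_const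
  have hIΨ : ∀ u, Integrable (fun z => fderiv ℝ Ψ z u) (μ.prod volume) := fun u =>
    (hDΨ u).integrable_of_hasCompactSupport (hΨc.fderiv_apply ℝ _)
  have hIΨ' : ∀ u, Integrable (fun z => fderiv ℝ Ψ z u) (μ.prod (volume.restrict (Iic 0))) :=
    fun u => (hIΨ u).mono_measure (Measure.prod_mono le_rfl Measure.restrict_le_self)
  have hIc : Integrable (fun z : G × ℝ => (τ - fderiv ℝ f z.1 w) * fderiv ℝ Ψ z (0, 1))
      (μ.prod (volume.restrict (Iic 0))) := by
    have : Continuous fun z : G × ℝ => (τ - fderiv ℝ f z.1 w) * fderiv ℝ Ψ z (0, 1) := by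
      have h2 : Continuous fun z : G × ℝ => fderiv ℝ f z.1 w :=
        ((hf.continuous_fderiv one_ne_zero).comp continuous_fst).clm_apply continuous_const
      have := hDΨ (0, 1)
      fun_prop
    exact (this.integrable_of_hasCompactSupport
      ((hΨc.fderiv_apply ℝ _).mul_left)).mono_measure
        (Measure.prod_mono le_rfl Measure.restrict_le_self)
  have hslice : ∀ s : ℝ, Topology.IsClosedEmbedding (fun y : G => (y, s)) := fun s =>
    .of_continuous_injective_isClosedMap (by fun_prop) (fun a b h => by simpa using h)
      (isClosedMap_prodMk_right s)
  have hslice' : ∀ y : G, Topology.IsClosedEmbedding (fun s : ℝ => (y, s)) := fun y =>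
    .of_continuous_injective_isClosedMap (by fun_prop) (fun a b h => by simpa using h)
      (isClosedMap_prodMk_left y)
  calc
    _ = ∫ y, (∫ s, (if s ≤ f y then fderiv ℝ Φ (y, s) (w, τ) else 0)) ∂μ := integral_prod _ hint
    _ = ∫ y, (∫ s in Iic (0 : ℝ), (fderiv ℝ Ψ (y, s) (w, 0) +
          (τ - fderiv ℝ f y w) * fderiv ℝ Ψ (y, s) (0, 1))) ∂μ := by
        congr 1 with y
        rw [← integral_indicator measurableSet_Iic,
          ← integral_add_right_eq_self (fun s => if s ≤ f y then fderiv ℝ Φ (y, s) (w, τ) else 0)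
            (f y)]
        congr 1 with s
        simp only [add_le_iff_nonpos_left, indicator, mem_Iic, hΨd]
    _ = (∫ z, fderiv ℝ Ψ z (w, 0) ∂(μ.prod (volume.restrict (Iic (0 : ℝ))))) +
          ∫ z, (τ - fderiv ℝ f z.1 w) * fderiv ℝ Ψ z (0, 1)
            ∂(μ.prod (volume.restrict (Iic (0 : ℝ)))) := by
        rw [← integral_add (hIΨ' _) hIc]
        exact (integral_prod _ ((hIΨ' (w, 0)).add hIc)).symm
    -- The horizontal derivative integrates to zero over each slice of constant height. The vertical
    -- one leaves the value of `Ψ` at height `0`, which is the value of `Φ` on the graph.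
    _ = 0 + ∫ y, Φ (y, f y) * (τ - fderiv ℝ f y w) ∂μ := by
        congr 1
        · rw [integral_prod_symm _ (hIΨ' _)]
          refine integral_eq_zero_of_ae (Eventually.of_forall fun s => ?_)
          have h1 : ContDiff ℝ 1 (fun y => Ψ (y, s)) := by fun_prop
          have := integral_fderiv_eq_zero_of_hasCompactSupport μ h1
            (hΨc.comp_isClosedEmbedding (hslice s)) w
          have h2 : ∀ y, fderiv ℝ (fun y => Ψ (y, s)) y w = fderiv ℝ Ψ (y, s) (w, 0) := by
            intro y
            have h3 : HasFDerivAt (fun y : G => (y, s)) (ContinuousLinearMap.inl ℝ G ℝ) y :=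
              hasFDerivAt_prodMk_left y s
            have h4 := HasFDerivAt.comp y (g := Ψ)
              (hΨ1.differentiable one_ne_zero (y, s)).hasFDerivAt h3
            rw [show (fun y => Ψ (y, s)) = Ψ ∘ fun y => (y, s) from rfl, h4.fderiv]
            simp
          simp only [h2] at this
          exact this
        · rw [integral_prod _ hIc]
          congr 1 with y
          simp only
          rw [integral_const_mul, mul_comm]
          congr 1
          have h1 : ContDiff ℝ 1 (fun s => Ψ (y, s)) := by fun_prop
          have := HasCompactSupport.integral_Iic_deriv_eq h1
            (hΨc.comp_isClosedEmbedding (hslice' y)) 0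
          have h2 : ∀ s, deriv (fun s => Ψ (y, s)) s = fderiv ℝ Ψ (y, s) (0, 1) := by
            intro s
            have h3 : HasDerivAt (fun s : ℝ => (y, s)) ((0 : G), (1 : ℝ)) s :=
              (hasDerivAt_const s y).prodMk (hasDerivAt_id s)
            exact ((hΨ1.differentiable one_ne_zero (y, s)).hasFDerivAt.comp_hasDerivAt s h3).deriv
          simp only [h2] at this
          rw [this]
          simp [hΨ]
    _ = _ := zero_add _

namespace IsGraphChart

variable {n : ℕ} {Ω Q : Set (EuclideanSpace ℝ (Fin n))}
  {T : (EuclideanSpace ℝ (Fin (n - 1)) × ℝ) ≃L[ℝ] EuclideanSpace ℝ (Fin n)}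
  {f : EuclideanSpace ℝ (Fin (n - 1)) → ℝ}

/-- The constant `c` is the factor by which `T` scales volume, so it depends on the chart only. In
the coordinates of `T` the claim is `integral_prod_subgraph_fderiv`. -/
theorem integral_fderiv_eq (h : IsGraphChart Ω Q T f) (hΩ : MeasurableSet Ω) :
    ∃ c : ℝ≥0, 0 < c ∧ ∀ φ : EuclideanSpace ℝ (Fin n) → ℝ, ContDiff ℝ 1 φ →
      HasCompactSupport φ → tsupport φ ⊆ Q → ∀ v,
      ∫ x in Ω, fderiv ℝ φ x v = c * ∫ y, φ (graphMap T f y) * conormal T f y v := by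
  let μ : Measure (EuclideanSpace ℝ (Fin n)) :=
    Measure.map T ((volume : Measure (EuclideanSpace ℝ (Fin (n - 1)))).prod volume)
  have hμ : μ.IsAddHaarMeasure := T.isAddHaarMeasure_map _
  obtain ⟨c, hc0, hvol⟩ : ∃ c : ℝ≥0, 0 < c ∧
      (volume : Measure (EuclideanSpace ℝ (Fin n))) = c • μ :=
    ⟨_, Measure.addHaarScalarFactor_pos_of_isAddHaarMeasure _ _,
      Measure.isAddLeftInvariant_eq_smul _ _⟩
  refine ⟨c, hc0, fun φ hφ hc hs v => ?_⟩
  obtain ⟨⟨w, τ⟩, rfl⟩ := T.surjective v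
  rw [← integral_indicator hΩ, hvol, integral_smul_nnreal_measure, NNReal.smul_def, smul_eq_mul]
  congr 1
  have hemb : MeasurableEmbedding T := T.toHomeomorph.measurableEmbedding
  rw [hemb.integral_map]
  have hΦ : ContDiff ℝ 1 (fun z => φ (T z)) := hφ.comp T.contDiff
  have hfd : ∀ z u, fderiv ℝ (fun z => φ (T z)) z u = fderiv ℝ φ (T z) (T u) := by
    intro z u
    have := HasFDerivAt.comp z (g := φ) (hφ.differentiable one_ne_zero (T z)).hasFDerivAt
      T.hasFDerivAt
    rw [show (fun z => φ (T z)) = φ ∘ T from rfl, this.fderiv]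
    rfl
  have key := integral_prod_subgraph_fderiv volume h.contDiff hΦ
    (hc.comp_homeomorph T.toHomeomorph) w τ
  have hgraph : ∀ᵐ z ∂((volume : Measure (EuclideanSpace ℝ (Fin (n - 1)))).prod volume),
      z.2 ≠ f z.1 := by
    have hm : MeasurableSet {z : EuclideanSpace ℝ (Fin (n - 1)) × ℝ | z.2 ≠ f z.1} := by
      have : IsOpen {z : EuclideanSpace ℝ (Fin (n - 1)) × ℝ | z.2 ≠ f z.1} :=
        isOpen_ne_fun continuous_snd (h.contDiff.continuous.comp continuous_fst)
      exact this.measurableSet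
    rw [Measure.ae_prod_iff_ae_ae hm]
    refine Eventually.of_forall fun y => ?_
    simp [ae_iff]
  have : ∫ z, Ω.indicator (fun x => fderiv ℝ φ x (T (w, τ))) (T z)
      ∂((volume : Measure (EuclideanSpace ℝ (Fin (n - 1)))).prod volume) = ∫ z,
      (if z.2 ≤ f z.1 then fderiv ℝ (fun z => φ (T z)) z (w, τ) else 0)
      ∂((volume : Measure (EuclideanSpace ℝ (Fin (n - 1)))).prod volume) := by
    refine integral_congr_ae ?_
    filter_upwards [hgraph] with z hz
    rw [hfd]
    by_cases hQ : T z ∈ Q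
    · simp only [indicator, h.mem_iff z hQ, le_iff_lt_or_eq, hz, or_false]
    · have h0 : fderiv ℝ φ (T z) = 0 := by
        by_contra hne
        exact hQ (hs (support_fderiv_subset ℝ hne))
      simp [indicator, h0]
  refine this.trans (key.trans ?_)
  congr 1 with y
  rw [conormal_apply]
  rfl

end IsGraphChart

end

/-! ### Partition of unity, a surface measure for the divergence theorem, and a transversal field.
-/

section

variable {n : ℕ} {Ω : Set (EuclideanSpace ℝ (Fin n))}

theorem IsGraphChart.mono {Q Q' : Set (EuclideanSpace ℝ (Fin n))}
    {T : (EuclideanSpace ℝ (Fin (n - 1)) × ℝ) ≃L[ℝ] EuclideanSpace ℝ (Fin n)}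
    {f : EuclideanSpace ℝ (Fin (n - 1)) → ℝ} (h : IsGraphChart Ω Q T f) (hQ' : IsOpen Q')
    (hsub : Q' ⊆ Q) : IsGraphChart Ω Q' T f :=
  ⟨hQ', h.contDiff, h.hasCompactSupport, fun v hv => h.mem_iff v (hsub hv)⟩

theorem IsSmoothBoundedDomain.isCompact_frontier (hΩ : IsSmoothBoundedDomain Ω) :
    IsCompact (frontier Ω) :=
  Metric.isCompact_of_isClosed_isBounded isClosed_frontier
    (hΩ.isBounded.closure.subset frontier_subset_closure)

/-- A smooth partition of unity on `Ω̄` subordinate to `Ω` and finitely many boundary charts. -/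
theorem exists_chart_partition (hn : 0 < n) (hΩ : IsSmoothBoundedDomain Ω) :
    ∃ (ι : Type) (_ : Fintype ι) (χ₀ : EuclideanSpace ℝ (Fin n) → ℝ)
      (χ : ι → EuclideanSpace ℝ (Fin n) → ℝ) (Q : ι → Set (EuclideanSpace ℝ (Fin n)))
      (T : ι → (EuclideanSpace ℝ (Fin (n - 1)) × ℝ) ≃L[ℝ] EuclideanSpace ℝ (Fin n))
      (f : ι → EuclideanSpace ℝ (Fin (n - 1)) → ℝ),
      (ContDiff ℝ ∞ χ₀ ∧ HasCompactSupport χ₀ ∧ tsupport χ₀ ⊆ Ω) ∧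
      (∀ i, IsGraphChart Ω (Q i) (T i) (f i) ∧ ContDiff ℝ ∞ (χ i) ∧ HasCompactSupport (χ i) ∧
        tsupport (χ i) ⊆ Q i ∧ ∀ x, 0 ≤ χ i x) ∧
      ∀ x ∈ closure Ω, χ₀ x + ∑ i, χ i x = 1 := by
  have hloc : ∀ p : frontier Ω, ∃ Q T f, (p : EuclideanSpace ℝ (Fin n)) ∈ Q ∧
      IsGraphChart Ω Q T f ∧ Bornology.IsBounded Q := by
    rintro ⟨p, hp⟩
    obtain ⟨Q, T, f, hpQ, h⟩ := exists_isGraphChart hn hΩ hp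
    exact ⟨Q ∩ Metric.ball p 1, T, f, ⟨hpQ, Metric.mem_ball_self one_pos⟩,
      h.mono (h.isOpen.inter Metric.isOpen_ball) inter_subset_left,
      Metric.isBounded_ball.subset inter_subset_right⟩
  choose Q T f hpQ hchart hbdd using hloc
  obtain ⟨t, ht⟩ := hΩ.isCompact_frontier.elim_finite_subcover Q (fun p => (hchart p).isOpen)
    (fun p hp => mem_iUnion.2 ⟨⟨p, hp⟩, hpQ _⟩)
  -- a finite index type in the lowest universe
  let e := t.equivFin
  -- The index `none` stands for the interior set `Ω`, the indices `some i` for the boundary charts.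
  let U : Option (Fin t.card) → Set (EuclideanSpace ℝ (Fin n)) :=
    fun o => o.elim Ω fun i => Q (e.symm i)
  have hUo : ∀ o, IsOpen (U o) := by
    rintro (_ | i)
    · exact hΩ.isOpen
    · exact (hchart _).isOpen
  have hUc : closure Ω ⊆ ⋃ o, U o := by
    intro x hx
    by_cases hxΩ : x ∈ Ω
    · exact mem_iUnion.2 ⟨none, hxΩ⟩
    · have hx' : x ∈ frontier Ω := by
        rw [hΩ.isOpen.frontier_eq]
        exact ⟨hx, hxΩ⟩
      obtain ⟨p, hp, hxp⟩ := mem_iUnion₂.1 (ht hx')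
      exact mem_iUnion.2 ⟨some (e ⟨p, hp⟩), by simpa [U] using hxp⟩
  obtain ⟨χ, hχ⟩ := SmoothPartitionOfUnity.exists_isSubordinate
    𝓘(ℝ, EuclideanSpace ℝ (Fin n)) isClosed_closure U hUo hUc
  have hcs : ∀ o, HasCompactSupport (χ o) := by
    intro o
    refine Metric.isCompact_of_isClosed_isBounded (isClosed_tsupport _) ?_
    refine Bornology.IsBounded.subset ?_ (hχ o)
    rcases o with (_ | i)
    · exact hΩ.isBounded
    · exact hbdd _
  refine ⟨Fin t.card, inferInstance, χ none, fun i => χ (some i), fun i => Q (e.symm i),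
    fun i => T (e.symm i), fun i => f (e.symm i),
    ⟨(χ none).contMDiff.contDiff, hcs none, hχ none⟩,
    fun i => ⟨hchart _, (χ (some i)).contMDiff.contDiff, hcs _, hχ (some i),
      fun x => χ.nonneg _ x⟩, fun x hx => ?_⟩
  have := χ.sum_eq_one hx
  rwa [finsum_eq_sum_of_fintype, Fintype.sum_option] at this

/-- In each chart the Hausdorff measure is dominated by Lebesgue measure of a bounded parameter set,
and `∂Ω` is compact. -/
theorem boundaryMeasure_lt_top (hn : 0 < n) (hΩ : IsSmoothBoundedDomain Ω) :
    IsFiniteMeasure (boundaryMeasure Ω) := by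
  constructor
  rw [boundaryMeasure, Measure.restrict_apply_univ]
  refine hΩ.isCompact_frontier.measure_lt_top_of_nhdsWithin fun p hp => ?_
  obtain ⟨Q, T, f, hpQ, h⟩ := exists_isGraphChart hn hΩ hp
  obtain ⟨C, hC, -⟩ := h.exists_measure_le
  obtain ⟨K, hK⟩ := exists_antilipschitzWith_graphMap T f
  refine ⟨frontier Ω ∩ (Q ∩ Metric.ball p 1), inter_mem_nhdsWithin _
    (inter_mem (h.isOpen.mem_nhds hpQ) (Metric.ball_mem_nhds p one_pos)), ?_⟩
  have hsub : frontier Ω ∩ (Q ∩ Metric.ball p 1) ⊆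
      Metric.ball p 1 ∩ range (graphMap T f) := by
    rw [← inter_assoc, h.frontier_inter_eq hΩ.isOpen]
    exact fun x hx => ⟨hx.2, hx.1.1⟩
  refine (measure_mono hsub).trans_lt ?_
  rw [← Measure.restrict_apply measurableSet_ball]
  refine (hC _).trans_lt ?_
  rw [Measure.smul_apply, Measure.map_apply h.continuous_graphMap.measurable measurableSet_ball,
    ENNReal.smul_def, smul_eq_mul]
  exact ENNReal.mul_lt_top ENNReal.coe_lt_top
    (hK.isBounded_preimage Metric.isBounded_ball).measure_lt_top

theorem _root_.ContinuousOn.integrable_boundaryMeasure (hn : 0 < n)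
    (hΩ : IsSmoothBoundedDomain Ω) {g : EuclideanSpace ℝ (Fin n) → ℝ}
    (hg : ContinuousOn g (frontier Ω)) : Integrable g (boundaryMeasure Ω) := by
  have hfin := boundaryMeasure_lt_top hn hΩ
  obtain ⟨C, hC⟩ := hΩ.isCompact_frontier.exists_bound_of_continuousOn hg
  refine Integrable.of_bound (C := C)
    (hg.aestronglyMeasurable isClosed_frontier.measurableSet) ?_
  exact (ae_restrict_iff' isClosed_frontier.measurableSet).2 (Eventually.of_forall hC)

/-- The surface measure of a boundary chart, weighted by `χ`. -/
def chartMeasure (T : (EuclideanSpace ℝ (Fin (n - 1)) × ℝ) ≃L[ℝ] EuclideanSpace ℝ (Fin n))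
    (f : EuclideanSpace ℝ (Fin (n - 1)) → ℝ) (χ : EuclideanSpace ℝ (Fin n) → ℝ) (c : ℝ≥0) :
    Measure (EuclideanSpace ℝ (Fin n)) :=
  Measure.map (graphMap T f) (volume.withDensity fun y =>
    ENNReal.ofReal (c * χ (graphMap T f y) * ‖conormal T f y‖))

namespace IsGraphChart

variable {Q : Set (EuclideanSpace ℝ (Fin n))}
  {T : (EuclideanSpace ℝ (Fin (n - 1)) × ℝ) ≃L[ℝ] EuclideanSpace ℝ (Fin n)}
  {f : EuclideanSpace ℝ (Fin (n - 1)) → ℝ}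

theorem isClosedEmbedding_graphMap (h : IsGraphChart Ω Q T f) :
    IsClosedEmbedding (graphMap T f) := by
  obtain ⟨K, hK⟩ := exists_antilipschitzWith_graphMap T f
  obtain ⟨K', hK'⟩ := h.exists_lipschitzWith
  exact hK.isClosedEmbedding hK'.uniformContinuous

theorem measurable_density (h : IsGraphChart Ω Q T f) {χ : EuclideanSpace ℝ (Fin n) → ℝ}
    (hχ : Continuous χ) (c : ℝ≥0) :
    Continuous fun y => c * χ (graphMap T f y) * ‖conormal T f y‖ := by
  have h1 := h.continuous_graphMap
  have h2 := h.continuous_conormal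
  fun_prop

theorem chartMeasure_apply (h : IsGraphChart Ω Q T f) (χ : EuclideanSpace ℝ (Fin n) → ℝ) (c : ℝ≥0) {s : Set (EuclideanSpace ℝ (Fin n))} (hs : MeasurableSet s) :
    chartMeasure T f χ c s = ∫⁻ y in graphMap T f ⁻¹' s,
      ENNReal.ofReal (c * χ (graphMap T f y) * ‖conormal T f y‖) := by
  rw [chartMeasure, Measure.map_apply h.continuous_graphMap.measurable hs,
    withDensity_apply _ (h.continuous_graphMap.measurable hs)]

theorem chartMeasure_le (h : IsGraphChart Ω Q T f) (hΩ : IsOpen Ω)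
    {χ : EuclideanSpace ℝ (Fin n) → ℝ} (hχ : Continuous χ) (hχc : HasCompactSupport χ)
    (hχQ : tsupport χ ⊆ Q) (c : ℝ≥0) :
    ∃ C : ℝ≥0, chartMeasure T f χ c ≤ C • boundaryMeasure Ω := by
  obtain ⟨C, -, hC⟩ := h.exists_measure_le
  have hcont := h.measurable_density hχ c
  have hcs : HasCompactSupport fun y => c * χ (graphMap T f y) * ‖conormal T f y‖ :=
    ((hχc.comp_isClosedEmbedding h.isClosedEmbedding_graphMap).mul_left).mul_right
  obtain ⟨B, hB⟩ := hcs.exists_bound_of_continuous hcont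
  refine ⟨B.toNNReal * C, Measure.le_iff.2 fun s hs => ?_⟩
  have hpre : MeasurableSet (graphMap T f ⁻¹' Q) :=
    h.continuous_graphMap.measurable h.isOpen.measurableSet
  rw [h.chartMeasure_apply χ c hs]
  calc
    _ ≤ ∫⁻ y in graphMap T f ⁻¹' s, (graphMap T f ⁻¹' Q).indicator
          (fun _ => ENNReal.ofReal B) y := by
        refine lintegral_mono fun y => ?_
        by_cases hy : graphMap T f y ∈ Q
        · simp only [indicator, mem_preimage, hy, if_true]
          exact ENNReal.ofReal_le_ofReal ((le_abs_self _).trans (hB y))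
        · have : χ (graphMap T f y) = 0 := image_eq_zero_of_notMem_tsupport fun h' => hy (hχQ h')
          simp [this]
    _ = ENNReal.ofReal B * Measure.map (graphMap T f) volume (Q ∩ s) := by
        rw [lintegral_indicator_const hpre, Measure.restrict_apply hpre,
          Measure.map_apply h.continuous_graphMap.measurable (h.isOpen.measurableSet.inter hs),
          preimage_inter]
    _ ≤ ENNReal.ofReal B * (C • (Measure.euclideanHausdorffMeasure (n - 1)).restrict
          (range (graphMap T f))) (Q ∩ s) := by
        gcongr
    _ ≤ _ := by
        rw [Measure.smul_apply, Measure.smul_apply, boundaryMeasure,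
          Measure.restrict_apply (h.isOpen.measurableSet.inter hs),
          Measure.restrict_apply hs, ENNReal.smul_def, ENNReal.smul_def, smul_eq_mul, smul_eq_mul,
          ENNReal.coe_mul, mul_assoc]
        refine mul_le_mul_right (mul_le_mul_right (measure_mono fun x hx => ?_) _) _
        have : x ∈ range (graphMap T f) ∩ Q := ⟨hx.2, hx.1.1⟩
        rw [← h.frontier_inter_eq hΩ] at this
        exact ⟨hx.1.2, this.1⟩

theorem lintegral_boundaryMeasure_le (h : IsGraphChart Ω Q T f) (hΩ : IsOpen Ω)
    {χ : EuclideanSpace ℝ (Fin n) → ℝ} (hχ : Continuous χ) (hχ0 : ∀ x, 0 ≤ χ x)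
    (hχQ : tsupport χ ⊆ Q) {c : ℝ≥0} (hc : 0 < c) :
    ∃ C : ℝ≥0, ∀ s, MeasurableSet s →
      ∫⁻ x in s, ENNReal.ofReal (χ x) ∂(boundaryMeasure Ω) ≤ C * chartMeasure T f χ c s := by
  obtain ⟨C, hC, -⟩ := h.exists_measure_le
  set b : ℝ≥0 := ‖T (0, 1)‖₊ with hb
  -- The conormal takes the value `1` at `T (0, 1)`, so its norm is at least `1 / ‖T (0, 1)‖` and
  -- the density of the chart measure does not degenerate.
  have hN : ∀ y, 1 ≤ b * ‖conormal T f y‖ := by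
    intro y
    have h1 := (conormal T f y).le_opNorm (T (0, 1))
    rw [conormal_apply] at h1
    simp only [map_zero, sub_zero, norm_one] at h1
    rw [mul_comm]
    exact h1
  refine ⟨C * (b * c⁻¹), fun s hs => ?_⟩
  rw [h.chartMeasure_apply χ c hs]
  have hm : Measurable fun x => ENNReal.ofReal (χ x) := hχ.measurable.ennreal_ofReal
  have hqm := h.continuous_graphMap.measurable
  calc
    _ = ∫⁻ x in s ∩ Q, ENNReal.ofReal (χ x) ∂(boundaryMeasure Ω) := by
        rw [inter_comm, ← setLIntegral_indicator h.isOpen.measurableSet]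
        refine lintegral_congr fun x => ?_
        by_cases hx : x ∈ Q
        · simp [hx]
        · have : χ x = 0 := image_eq_zero_of_notMem_tsupport fun h' => hx (hχQ h')
          simp [this, hx]
    _ = ∫⁻ x in s ∩ Q, ENNReal.ofReal (χ x)
          ∂((Measure.euclideanHausdorffMeasure (n - 1)).restrict (range (graphMap T f))) := by
        rw [boundaryMeasure, Measure.restrict_restrict (hs.inter h.isOpen.measurableSet),
          Measure.restrict_restrict (hs.inter h.isOpen.measurableSet), inter_assoc, inter_assoc,
          inter_comm Q, inter_comm Q, h.frontier_inter_eq hΩ]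
    _ ≤ ∫⁻ x in s, ENNReal.ofReal (χ x) ∂(C • Measure.map (graphMap T f) volume) :=
        lintegral_mono' (Measure.restrict_mono inter_subset_left hC) le_rfl
    _ = C * ∫⁻ y in graphMap T f ⁻¹' s, ENNReal.ofReal (χ (graphMap T f y)) := by
        rw [Measure.restrict_smul, lintegral_smul_measure, setLIntegral_map hs hm hqm,
          ENNReal.smul_def, smul_eq_mul]
    _ ≤ C * ∫⁻ y in graphMap T f ⁻¹' s, ((b * c⁻¹ : ℝ≥0) : ℝ≥0∞) *
          ENNReal.ofReal (c * χ (graphMap T f y) * ‖conormal T f y‖) := by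
        gcongr with y
        rw [← ENNReal.ofReal_coe_nnreal, ← ENNReal.ofReal_mul (by positivity)]
        refine ENNReal.ofReal_le_ofReal ?_
        have hc' : (c : ℝ) ≠ 0 := by exact_mod_cast hc.ne'
        have : ((b * c⁻¹ : ℝ≥0) : ℝ) * (c * χ (graphMap T f y) * ‖conormal T f y‖) =
            χ (graphMap T f y) * (b * ‖conormal T f y‖) := by
          push_cast
          field_simp
        rw [this]
        exact le_mul_of_one_le_right (hχ0 _) (hN y)
    _ = _ := by
        rw [lintegral_const_mul _ (h.measurable_density hχ c).measurable.ennreal_ofReal,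
          ← mul_assoc, ← ENNReal.coe_mul]

theorem integral_chartMeasure (h : IsGraphChart Ω Q T f) {χ : EuclideanSpace ℝ (Fin n) → ℝ}
    (hχ : Continuous χ) (hχ0 : ∀ x, 0 ≤ χ x) (c : ℝ≥0) (g : EuclideanSpace ℝ (Fin n) → ℝ) :
    ∫ x, g x ∂(chartMeasure T f χ c) =
      ∫ y, c * χ (graphMap T f y) * ‖conormal T f y‖ * g (graphMap T f y) := by
  rw [chartMeasure, h.isClosedEmbedding_graphMap.measurableEmbedding.integral_map,
    integral_withDensity_eq_integral_toReal_smul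
      (h.measurable_density hχ c).measurable.ennreal_ofReal (by simp)]
  congr 1 with y
  have := hχ0 (graphMap T f y)
  rw [ENNReal.toReal_ofReal (by positivity), smul_eq_mul]

end IsGraphChart

/-- The measure `m` is comparable to the surface measure, with constant `C`, and satisfies the
divergence theorem on `Ω`. -/
structure IsDivergenceMeasure (Ω : Set (EuclideanSpace ℝ (Fin n)))
    (m : Measure (EuclideanSpace ℝ (Fin n))) (C : ℝ≥0) : Prop where
  le : m ≤ C • boundaryMeasure Ω
  ge : boundaryMeasure Ω ≤ C • m
  integral_fderiv : ∀ φ : EuclideanSpace ℝ (Fin n) → ℝ, ContDiff ℝ 1 φ → ∀ v,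
    ∫ x in Ω, fderiv ℝ φ x v = ∫ x, φ x * inner ℝ (outerNormal Ω x) v ∂m

/-- The measure is the sum over the charts of `c χ ‖conormal‖ dy`, pushed forward to the graph.
Localizing `φ` by the partition of unity reduces the identity to the single charts, and the interior
part `χ₀ φ` contributes zero. Only comparability with the Hausdorff measure is asserted, so no area
formula is involved. -/
theorem exists_isDivergenceMeasure (hn : 0 < n) (hΩ : IsSmoothBoundedDomain Ω) :
    ∃ m C, IsDivergenceMeasure Ω m C := by
  obtain ⟨ι, _, χ₀, χ, Q, T, f, ⟨h0, h0c, h0Ω⟩, hχ, hsum⟩ := exists_chart_partition hn hΩ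
  choose hchart hχs hχc hχQ hχ0 using hχ
  choose c hc hdiv using fun i => (hchart i).integral_fderiv_eq hΩ.isOpen.measurableSet
  choose C₁ hC₁ using fun i => (hchart i).chartMeasure_le hΩ.isOpen (hχs i).continuous (hχc i)
    (hχQ i) (c i)
  choose C₂ hC₂ using fun i => (hchart i).lintegral_boundaryMeasure_le hΩ.isOpen
    (hχs i).continuous (hχ0 i) (hχQ i) (hc i)
  set m := ∑ i, chartMeasure (T i) (f i) (χ i) (c i) with hm
  have hmle : m ≤ (∑ i, C₁ i) • boundaryMeasure Ω := by
    rw [hm, Finset.sum_smul]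
    exact Finset.sum_le_sum fun i _ => hC₁ i
  have hχ₀ : ∀ x ∈ frontier Ω, χ₀ x = 0 := fun x hx =>
    image_eq_zero_of_notMem_tsupport fun h' => by
      rw [hΩ.isOpen.frontier_eq] at hx
      exact hx.2 (h0Ω h')
  refine ⟨m, max (∑ i, C₁ i) (∑ i, C₂ i), hmle.trans ?_, ?_, fun φ hφ v => ?_⟩
  · exact Measure.le_iff.2 fun s hs => by
      simp only [Measure.smul_apply, ENNReal.smul_def, smul_eq_mul]
      gcongr
      exact le_max_left _ _
  · refine Measure.le_iff.2 fun s hs => ?_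
    have h1 : boundaryMeasure Ω s =
        ∑ i, ∫⁻ x in s, ENNReal.ofReal (χ i x) ∂(boundaryMeasure Ω) := by
      rw [← lintegral_finsetSum _ fun i _ => (hχs i).continuous.measurable.ennreal_ofReal,
        ← setLIntegral_one]
      refine lintegral_congr_ae (ae_restrict_of_ae ?_)
      refine (ae_restrict_iff' isClosed_frontier.measurableSet).2 (Eventually.of_forall ?_)
      intro x hx
      simp only
      have := hsum x (frontier_subset_closure hx)
      rw [hχ₀ x hx, zero_add] at this
      rw [← ENNReal.ofReal_sum_of_nonneg fun i _ => hχ0 i x, this, ENNReal.ofReal_one]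
    rw [h1, Measure.smul_apply, hm, Measure.finsetSum_apply, Finset.smul_sum]
    refine Finset.sum_le_sum fun i _ => (hC₂ i s hs).trans ?_
    rw [ENNReal.smul_def, smul_eq_mul]
    gcongr
    exact (Finset.single_le_sum (f := C₂) (fun i _ => zero_le) (Finset.mem_univ i)).trans
      (le_max_right _ _)
  · have hint : Integrable (fun x => φ x * inner ℝ (outerNormal Ω x) v) (boundaryMeasure Ω) :=
      ContinuousOn.integrable_boundaryMeasure hn hΩ
        (hφ.continuous.continuousOn.mul ((continuousOn_outerNormal hn hΩ).inner continuousOn_const))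
    rw [hm, integral_finsetSum_measure fun i _ =>
      (hint.smul_measure_nnreal (c := C₁ i)).mono_measure (hC₁ i)]
    have hχ1 : ∀ i, ContDiff ℝ 1 (χ i) := fun i => (hχs i).of_le (by norm_cast)
    have h01 : ContDiff ℝ 1 χ₀ := h0.of_le (by norm_cast)
    have hloc : ∀ i, ∫ x in Ω, fderiv ℝ (fun x => χ i x * φ x) x v =
        ∫ x, φ x * inner ℝ (outerNormal Ω x) v ∂(chartMeasure (T i) (f i) (χ i) (c i)) := by
      intro i
      rw [hdiv i _ ((hχ1 i).mul hφ) (hχc i).mul_right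
        ((tsupport_mul_subset_left).trans (hχQ i)), (hchart i).integral_chartMeasure
          (hχs i).continuous (hχ0 i), ← integral_const_mul]
      congr 1 with y
      by_cases hy : graphMap (T i) (f i) y ∈ Q i
      · rw [(hchart i).conormal_eq hΩ hy]
        ring
      · have : χ i (graphMap (T i) (f i) y) = 0 :=
          image_eq_zero_of_notMem_tsupport fun h' => hy (hχQ i h')
        simp [this]
    have hloc0 : ∫ x in Ω, fderiv ℝ (fun x => χ₀ x * φ x) x v = 0 := by
      rw [setIntegral_eq_integral_of_forall_compl_eq_zero]
      · exact integral_fderiv_eq_zero_of_hasCompactSupport volume (h01.mul hφ) h0c.mul_right v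
      · intro x hx
        have : fderiv ℝ (fun x => χ₀ x * φ x) x = 0 := by
          by_contra hne
          exact hx (h0Ω (tsupport_mul_subset_left (support_fderiv_subset ℝ hne)))
        rw [this]
        rfl
    have hInt : ∀ ψ : EuclideanSpace ℝ (Fin n) → ℝ, ContDiff ℝ 1 ψ →
        IntegrableOn (fun x => fderiv ℝ ψ x v) Ω := fun ψ hψ =>
      (((hψ.continuous_fderiv one_ne_zero).clm_apply
        continuous_const).continuousOn.integrableOn_compact
          (hΩ.isBounded.isCompact_closure)).mono_set subset_closure
    simp_rw [← hloc]
    rw [← zero_add (∑ i, _), ← hloc0, ← integral_finsetSum _ fun i _ =>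
        hInt _ ((hχ1 i).mul hφ), ← integral_add (hInt _ (h01.mul hφ))
        (integrable_finsetSum _ fun i _ => hInt _ ((hχ1 i).mul hφ))]
    refine setIntegral_congr_fun hΩ.isOpen.measurableSet fun x hx => ?_
    have hd : ∀ ψ : EuclideanSpace ℝ (Fin n) → ℝ, ContDiff ℝ 1 ψ →
        HasFDerivAt ψ (fderiv ℝ ψ x) x := fun ψ hψ =>
      (hψ.differentiable one_ne_zero x).hasFDerivAt
    have h2 : HasFDerivAt (fun x => χ₀ x * φ x + ∑ i, χ i x * φ x)
        (fderiv ℝ (fun x => χ₀ x * φ x) x + ∑ i, fderiv ℝ (fun x => χ i x * φ x) x) x :=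
      (hd _ (h01.mul hφ)).add (HasFDerivAt.fun_sum fun i _ => hd _ ((hχ1 i).mul hφ))
    have h3 : φ =ᶠ[𝓝 x] fun x => χ₀ x * φ x + ∑ i, χ i x * φ x := by
      filter_upwards [hΩ.isOpen.mem_nhds hx] with z hz
      rw [← Finset.sum_mul, ← add_mul, hsum z (subset_closure hz), one_mul]
    rw [h3.fderiv_eq, h2.fderiv]
    simp

/-- There is a smooth vector field that is uniformly transversal to the boundary. -/
theorem exists_transversal_field (hn : 0 < n) (hΩ : IsSmoothBoundedDomain Ω) :
    ∃ (X : EuclideanSpace ℝ (Fin n) → EuclideanSpace ℝ (Fin n)) (c : ℝ), ContDiff ℝ ∞ X ∧ 0 < c ∧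
      ∀ x ∈ frontier Ω, c ≤ inner ℝ (X x) (outerNormal Ω x) := by
  obtain ⟨ι, _, χ₀, χ, Q, T, f, ⟨h0, h0c, h0Ω⟩, hχ, hsum⟩ := exists_chart_partition hn hΩ
  choose hchart hχs hχc hχQ hχ0 using hχ
  have hX : ContDiff ℝ ∞ fun x => ∑ i, χ i x • T i (0, 1) :=
    ContDiff.sum fun i _ => (hχs i).smul contDiff_const
  obtain ⟨c, hc, hcle⟩ := hΩ.isCompact_frontier.exists_forall_le' (a := 0)
    (f := fun x => inner ℝ (∑ i, χ i x • T i (0, 1)) (outerNormal Ω x))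
    (hX.continuous.continuousOn.inner (continuousOn_outerNormal hn hΩ)) (by
      intro x hx
      simp only [sum_inner, inner_smul_left]
      have hχ₀ : χ₀ x = 0 := image_eq_zero_of_notMem_tsupport fun h' => by
        rw [hΩ.isOpen.frontier_eq] at hx
        exact hx.2 (h0Ω h')
      have h1 := hsum x (frontier_subset_closure hx)
      rw [hχ₀, zero_add] at h1
      -- `T i (0, 1)` points out of the subgraph, so it has positive inner product with the outer
      -- normal throughout the chart. The convex combination is then pointwise positive, and
      -- compactness of `∂Ω` yields a uniform `c`.
      have hpos : ∀ i, χ i x ≠ 0 → 0 < inner ℝ (T i (0, 1)) (outerNormal Ω x) := by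
        intro i hi
        have hxQ : x ∈ Q i := hχQ i (subset_tsupport _ hi)
        obtain ⟨⟨y, rfl⟩, -⟩ : x ∈ range (graphMap (T i) (f i)) ∩ Q i := by
          rw [← (hchart i).frontier_inter_eq hΩ.isOpen]
          exact ⟨hx, hxQ⟩
        have := (hchart i).conormal_eq hΩ hxQ (T i (0, 1))
        rw [conormal_apply] at this
        simp only [map_zero, sub_zero] at this
        rw [real_inner_comm]
        by_contra! hle
        have := mul_nonpos_of_nonneg_of_nonpos (norm_nonneg (conormal (T i) (f i) y)) hle
        linarith
      obtain ⟨i, -, hi⟩ : ∃ i ∈ Finset.univ, χ i x ≠ 0 := by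
        refine Finset.exists_ne_zero_of_sum_ne_zero (s := Finset.univ) ?_
        rw [h1]
        exact one_ne_zero
      refine Finset.sum_pos' (fun j _ => ?_) ⟨i, Finset.mem_univ i, ?_⟩
      · by_cases hj : χ j x = 0
        · simp [hj]
        · exact mul_nonneg (hχ0 j x) (hpos j hj).le
      · exact mul_pos (lt_of_le_of_ne (hχ0 i x) (Ne.symm hi)) (hpos i hi))
  exact ⟨_, c, hX, hc, hcle⟩

end

section

/-! ### Convergence of products in `L²` -/

section L2

variable {α : Type*} [MeasurableSpace α] {μ : Measure α}

theorem integrable_mul_of_memLp {a b : α → ℝ} (ha : MemLp a 2 μ) (hb : MemLp b 2 μ) :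
    Integrable (fun x => a x * b x) μ :=
  ha.integrable_mul hb

/-- This is the continuity of the inner product of `L²` under norm convergence of both factors. -/
theorem tendsto_integral_mul_of_eLpNorm {a b : ℕ → α → ℝ} {a' b' : α → ℝ}
    (ha : ∀ k, MemLp (a k) 2 μ) (ha' : MemLp a' 2 μ) (hb : ∀ k, MemLp (b k) 2 μ)
    (hb' : MemLp b' 2 μ)
    (hat : Tendsto (fun k => eLpNorm (fun x => a k x - a' x) 2 μ) atTop (𝓝 0))
    (hbt : Tendsto (fun k => eLpNorm (fun x => b k x - b' x) 2 μ) atTop (𝓝 0)) :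
    Tendsto (fun k => ∫ x, a k x * b k x ∂μ) atTop (𝓝 (∫ x, a' x * b' x ∂μ)) := by
  have h1 := (Lp.tendsto_Lp_iff_tendsto_eLpNorm'' a ha a' ha').2 hat
  have h2 := (Lp.tendsto_Lp_iff_tendsto_eLpNorm'' b hb b' hb').2 hbt
  have h3 := h1.inner (𝕜 := ℝ) h2
  have key : ∀ {c d : α → ℝ} (hc : MemLp c 2 μ) (hd : MemLp d 2 μ),
      inner ℝ (hc.toLp c) (hd.toLp d) = ∫ x, c x * d x ∂μ := by
    intro c d hc hd
    rw [L2.inner_def]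
    refine integral_congr_ae ?_
    filter_upwards [hc.coeFn_toLp, hd.coeFn_toLp] with x hx hy
    rw [hx, hy]
    simp [mul_comm]
  simpa only [key] using h3

theorem tendsto_eLpNorm_zero_of_le {E F : Type*} [NormedAddCommGroup E] [NormedAddCommGroup F]
    {a : ℕ → α → E} {b : ℕ → α → F} (B : ℝ) (h : ∀ k, ∀ᵐ x ∂μ, ‖a k x‖ ≤ B * ‖b k x‖)
    (hb : Tendsto (fun k => eLpNorm (b k) 2 μ) atTop (𝓝 0)) :
    Tendsto (fun k => eLpNorm (a k) 2 μ) atTop (𝓝 0) := by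
  have h0 : Tendsto (fun k => ENNReal.ofReal B * eLpNorm (b k) 2 μ) atTop (𝓝 0) := by
    simpa using ENNReal.Tendsto.const_mul hb (Or.inr ENNReal.ofReal_ne_top)
  exact tendsto_of_tendsto_of_tendsto_of_le_of_le tendsto_const_nhds h0 (fun k => zero_le)
    fun k => eLpNorm_le_mul_eLpNorm_of_ae_le_mul (h k) 2

theorem memLp_two_comp [IsFiniteMeasure μ] {G : ℝ → ℝ} {L : ℝ≥0} (hG : LipschitzWith L G)
    {f : α → ℝ} (hf : MemLp f 2 μ) : MemLp (fun x => G (f x)) 2 μ := by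
  have h1 : MemLp (fun x => ‖G 0‖ + L * ‖f x‖) 2 μ :=
    (memLp_const (‖G 0‖)).add (hf.norm.const_mul (L : ℝ))
  refine h1.mono' (hG.continuous.comp_aestronglyMeasurable hf.1) (Eventually.of_forall fun x => ?_)
  have h2 := hG.dist_le_mul (f x) 0
  rw [dist_eq_norm, dist_zero_right] at h2
  have h3 := norm_add_le (G 0) (G (f x) - G 0)
  rw [add_sub_cancel] at h3
  linarith

theorem memLp_two_bdd_mul {b f : α → ℝ} {B : ℝ} (hb : AEStronglyMeasurable b μ)
    (hB : ∀ᵐ x ∂μ, ‖b x‖ ≤ B) (hf : MemLp f 2 μ) : MemLp (fun x => b x * f x) 2 μ := by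
  refine (hf.norm.const_mul B).mono' (hb.mul hf.1) ?_
  filter_upwards [hB] with x hx
  rw [norm_mul]
  exact mul_le_mul_of_nonneg_right hx (norm_nonneg _)

/-- If a sequence in `L²` converges in the `L²` norm to a measurable function, the limit is in
`L²`. -/
theorem memLp_of_tendsto_eLpNorm {E : Type*} [NormedAddCommGroup E] {a : ℕ → α → E} {a' : α → E}
    (ha : ∀ k, MemLp (a k) 2 μ) (ha' : AEStronglyMeasurable a' μ)
    (hat : Tendsto (fun k => eLpNorm (fun x => a k x - a' x) 2 μ) atTop (𝓝 0)) :
    MemLp a' 2 μ := by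
  obtain ⟨k, hk⟩ := (hat.eventually (gt_mem_nhds (zero_lt_one' ℝ≥0∞))).exists
  have h1 : MemLp (fun x => a k x - a' x) 2 μ :=
    ⟨(ha k).1.sub ha', hk.trans ENNReal.one_lt_top⟩
  have h2 := (ha k).sub h1
  rwa [show (a k - fun x => a k x - a' x) = a' from funext fun x => by simp] at h2

end L2

/-! ### Weak traces and Green's formula -/

variable {n : ℕ} {Ω : Set (EuclideanSpace ℝ (Fin n))}
  {m : Measure (EuclideanSpace ℝ (Fin n))} {C : ℝ≥0}

theorem inner_gradient (φ : EuclideanSpace ℝ (Fin n) → ℝ) (x v : EuclideanSpace ℝ (Fin n)) :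
    inner ℝ (gradient φ x) v = fderiv ℝ φ x v := by
  simp [gradient, InnerProductSpace.toDual_symm_apply]

theorem continuous_gradient {φ : EuclideanSpace ℝ (Fin n) → ℝ} (hφ : ContDiff ℝ 1 φ) :
    Continuous (gradient φ) :=
  (InnerProductSpace.toDual ℝ (EuclideanSpace ℝ (Fin n))).symm.continuous.comp
    (hφ.continuous_fderiv one_ne_zero)

theorem IsSmoothBoundedDomain.isFiniteMeasure (hΩ : IsSmoothBoundedDomain Ω) :
    IsFiniteMeasure (volume.restrict Ω) :=
  ⟨by rw [Measure.restrict_apply_univ]; exact hΩ.isBounded.measure_lt_top⟩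

theorem IsSmoothBoundedDomain.exists_bound (hΩ : IsSmoothBoundedDomain Ω) {F : Type*}
    [NormedAddCommGroup F] {g : EuclideanSpace ℝ (Fin n) → F} (hg : Continuous g) :
    ∃ B, 0 < B ∧ ∀ x ∈ closure Ω, ‖g x‖ ≤ B := by
  obtain ⟨B, hB⟩ := hΩ.isBounded.isCompact_closure.exists_bound_of_continuousOn hg.continuousOn
  exact ⟨max B 1, by positivity, fun x hx => (hB x hx).trans (le_max_left _ _)⟩

theorem IsSmoothBoundedDomain.memLp_of_continuous (hΩ : IsSmoothBoundedDomain Ω) {F : Type*}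
    [NormedAddCommGroup F] [SecondCountableTopology F]
    {g : EuclideanSpace ℝ (Fin n) → F} (hg : Continuous g) : MemLp g 2 (volume.restrict Ω) := by
  have := hΩ.isFiniteMeasure
  obtain ⟨B, -, hB⟩ := hΩ.exists_bound hg
  refine MemLp.of_bound hg.aestronglyMeasurable B ?_
  exact (ae_restrict_iff' hΩ.isOpen.measurableSet).2
    (Eventually.of_forall fun x hx => hB x (subset_closure hx))

namespace IsDivergenceMeasure

theorem absolutelyContinuous (h : IsDivergenceMeasure Ω m C) : m ≪ boundaryMeasure Ω :=
  Measure.absolutelyContinuous_of_le_smul (c := (C : ℝ≥0∞)) h.le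

theorem isFiniteMeasure (h : IsDivergenceMeasure Ω m C) (hn : 0 < n)
    (hΩ : IsSmoothBoundedDomain Ω) : IsFiniteMeasure m := by
  have := boundaryMeasure_lt_top hn hΩ
  exact isFiniteMeasure_of_le _ h.le

theorem ae_mem_frontier (h : IsDivergenceMeasure Ω m C) : ∀ᵐ x ∂m, x ∈ frontier Ω :=
  h.absolutelyContinuous (ae_restrict_mem isClosed_frontier.measurableSet)

theorem tendsto_eLpNorm {F : Type*} [NormedAddCommGroup F] (h : IsDivergenceMeasure Ω m C)
    {a : ℕ → EuclideanSpace ℝ (Fin n) → F}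
    (ha : Tendsto (fun k => eLpNorm (a k) 2 (boundaryMeasure Ω)) atTop (𝓝 0)) :
    Tendsto (fun k => eLpNorm (a k) 2 m) atTop (𝓝 0) := by
  have h0 : Tendsto (fun k => (C : ℝ≥0∞) ^ (1 / (2 : ℝ≥0∞)).toReal *
      eLpNorm (a k) 2 (boundaryMeasure Ω)) atTop (𝓝 0) := by
    simpa using ENNReal.Tendsto.const_mul ha
      (Or.inr (ENNReal.rpow_ne_top_of_nonneg (by simp) ENNReal.coe_ne_top))
  refine tendsto_of_tendsto_of_tendsto_of_le_of_le tendsto_const_nhds h0 (fun k => zero_le)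
    fun k => ?_
  refine (eLpNorm_mono_measure _ h.le).trans ?_
  exact (eLpNorm_smul_measure_of_ne_top (by simp) (a k) (C : ℝ≥0∞)).le

theorem aestronglyMeasurable_outerNormal (h : IsDivergenceMeasure Ω m C) (hn : 0 < n)
    (hΩ : IsSmoothBoundedDomain Ω) : AEStronglyMeasurable (outerNormal Ω) m := by
  have : AEStronglyMeasurable (outerNormal Ω) (boundaryMeasure Ω) :=
    (continuousOn_outerNormal hn hΩ).aestronglyMeasurable isClosed_frontier.measurableSet
  exact this.mono_ac h.absolutelyContinuous

theorem ae_norm_outerNormal (h : IsDivergenceMeasure Ω m C) (hΩ : IsSmoothBoundedDomain Ω) :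
    ∀ᵐ x ∂m, ‖outerNormal Ω x‖ = 1 :=
  h.ae_mem_frontier.mono fun _ hx => norm_outerNormal hΩ hx

theorem memLp_of_continuous (h : IsDivergenceMeasure Ω m C) (hn : 0 < n)
    (hΩ : IsSmoothBoundedDomain Ω) {F : Type*} [NormedAddCommGroup F]
    [SecondCountableTopology F] {g : EuclideanSpace ℝ (Fin n) → F} (hg : Continuous g) :
    MemLp g 2 m := by
  have := h.isFiniteMeasure hn hΩ
  obtain ⟨B, -, hB⟩ := hΩ.exists_bound hg
  exact MemLp.of_bound hg.aestronglyMeasurable B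
    (h.ae_mem_frontier.mono fun x hx => hB x (frontier_subset_closure hx))

end IsDivergenceMeasure

/-- `g` is the trace of `f ∈ W^{1,2}(Ω)` in the sense of the divergence theorem for `f φ v`. -/
structure HasWeakTrace (Ω : Set (EuclideanSpace ℝ (Fin n)))
    (m : Measure (EuclideanSpace ℝ (Fin n))) (f : EuclideanSpace ℝ (Fin n) → ℝ)
    (F : EuclideanSpace ℝ (Fin n) → EuclideanSpace ℝ (Fin n))
    (g : EuclideanSpace ℝ (Fin n) → ℝ) : Prop where
  memLp : MemLp f 2 (volume.restrict Ω)
  memLp_gradient : MemLp F 2 (volume.restrict Ω)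
  memLp_trace : MemLp g 2 m
  integral_eq : ∀ φ : EuclideanSpace ℝ (Fin n) → ℝ, ContDiff ℝ ∞ φ → ∀ v,
    ∫ x in Ω, (f x * fderiv ℝ φ x v + φ x * inner ℝ (F x) v) =
      ∫ x, φ x * g x * inner ℝ (outerNormal Ω x) v ∂m

theorem memLp_inner_const {α : Type*} [MeasurableSpace α] {μ : Measure α}
    {F : α → EuclideanSpace ℝ (Fin n)} (hF : MemLp F 2 μ) (v : EuclideanSpace ℝ (Fin n)) :
    MemLp (fun x => inner ℝ (F x) v) 2 μ := by
  refine (hF.norm.const_mul ‖v‖).mono' (hF.1.inner aestronglyMeasurable_const)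
    (Eventually.of_forall fun x => ?_)
  rw [mul_comm]
  exact norm_inner_le_norm _ _

theorem tendsto_eLpNorm_inner_const {α : Type*} [MeasurableSpace α] {μ : Measure α}
    {F : ℕ → α → EuclideanSpace ℝ (Fin n)} {F' : α → EuclideanSpace ℝ (Fin n)}
    (hF : Tendsto (fun k => eLpNorm (fun x => F k x - F' x) 2 μ) atTop (𝓝 0))
    (v : EuclideanSpace ℝ (Fin n)) :
    Tendsto (fun k => eLpNorm (fun x => inner ℝ (F k x) v - inner ℝ (F' x) v) 2 μ) atTop
      (𝓝 0) := by
  refine tendsto_eLpNorm_zero_of_le ‖v‖ (fun k => Eventually.of_forall fun x => ?_) hF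
  rw [← inner_sub_left, mul_comm]
  exact norm_inner_le_norm _ _

/-- `HasTrace` does not record that `g` is in `L²`. This follows because `g` is at finite `L²`
distance from a smooth function. -/
theorem memLp_of_hasTrace (h : IsDivergenceMeasure Ω m C) (hn : 0 < n)
    (hΩ : IsSmoothBoundedDomain Ω) {f g : EuclideanSpace ℝ (Fin n) → ℝ}
    {F : EuclideanSpace ℝ (Fin n) → EuclideanSpace ℝ (Fin n)} (hf : HasTrace Ω f F g)
    (hg : AEStronglyMeasurable g (boundaryMeasure Ω)) : MemLp g 2 m := by
  obtain ⟨-, φ, hφ, -, -, ht⟩ := hf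
  exact memLp_of_tendsto_eLpNorm (fun k => h.memLp_of_continuous hn hΩ (hφ k).continuous)
    (hg.mono_ac h.absolutelyContinuous) (h.tendsto_eLpNorm ht)

/-- The chain rule for traces. -/
theorem HasTrace.comp_hasWeakTrace (h : IsDivergenceMeasure Ω m C) (hn : 0 < n)
    (hΩ : IsSmoothBoundedDomain Ω) {f g : EuclideanSpace ℝ (Fin n) → ℝ}
    {F : EuclideanSpace ℝ (Fin n) → EuclideanSpace ℝ (Fin n)} (hf : HasTrace Ω f F g)
    (hg : AEStronglyMeasurable g (boundaryMeasure Ω)) {G G' : ℝ → ℝ} {L : ℝ≥0} {B : ℝ}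
    (hG : ∀ s, HasDerivAt G (G' s) s) (hG' : LipschitzWith L G') (hB : ∀ s, ‖G' s‖ ≤ B) :
    HasWeakTrace Ω m (fun x => G (f x)) (fun x => G' (f x) • F x) (fun x => G (g x)) := by
  have hgm := memLp_of_hasTrace h hn hΩ hf hg
  obtain ⟨hS, φ, hφ, h1, h2, h3⟩ := hf
  have := hΩ.isFiniteMeasure
  have := h.isFiniteMeasure hn hΩ
  have hB0 : 0 ≤ B := (norm_nonneg _).trans (hB 0)
  have hGL : LipschitzWith B.toNNReal G := by
    refine lipschitzWith_of_nnnorm_deriv_le (fun s => (hG s).differentiableAt) fun s => ?_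
    rw [(hG s).deriv, ← NNReal.coe_le_coe, coe_nnnorm, Real.coe_toNNReal _ hB0]
    exact hB s
  have hGC : ContDiff ℝ 1 G := by
    rw [contDiff_one_iff_deriv]
    refine ⟨fun s => (hG s).differentiableAt, ?_⟩
    rw [show deriv G = G' from funext fun s => (hG s).deriv]
    exact hG'.continuous
  have hφ1 : ∀ k, ContDiff ℝ 1 (φ k) := fun k => (hφ k).of_le (by norm_cast)
  refine ⟨memLp_two_comp hGL hS.memLp, ?_, memLp_two_comp hGL hgm, fun ψ hψs v => ?_⟩
  · refine (hS.memLp_gradient.norm.const_mul B).mono'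
      ((hG'.continuous.comp_aestronglyMeasurable hS.memLp.1).smul hS.memLp_gradient.1)
      (Eventually.of_forall fun x => ?_)
    rw [norm_smul]
    exact mul_le_mul_of_nonneg_right (hB _) (norm_nonneg _)
  have hψ : ContDiff ℝ 1 ψ := hψs.of_le (by norm_cast)
  obtain ⟨Bψ, -, hBψ⟩ := hΩ.exists_bound hψ.continuous
  have hBΩ : ∀ᵐ x ∂(volume.restrict Ω), ‖ψ x‖ ≤ Bψ :=
    (ae_restrict_iff' hΩ.isOpen.measurableSet).2
      (Eventually.of_forall fun x hx => hBψ x (subset_closure hx))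
  have hψ' : Continuous fun x => fderiv ℝ ψ x v :=
    (hψ.continuous_fderiv one_ne_zero).clm_apply continuous_const
  have hφ' : ∀ k, Continuous fun x => fderiv ℝ (φ k) x v := fun k =>
    ((hφ1 k).continuous_fderiv one_ne_zero).clm_apply continuous_const
  have hν : AEStronglyMeasurable (fun x => inner ℝ (outerNormal Ω x) v) m :=
    (h.aestronglyMeasurable_outerNormal hn hΩ).inner aestronglyMeasurable_const
  have hνB : ∀ᵐ x ∂m, ‖inner ℝ (outerNormal Ω x) v‖ ≤ ‖v‖ := by
    filter_upwards [h.ae_norm_outerNormal hΩ] with x hx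
    have := norm_inner_le_norm (𝕜 := ℝ) (outerNormal Ω x) v
    rwa [hx, one_mul] at this
  have hψm : MemLp (fun x => inner ℝ (outerNormal Ω x) v * ψ x) 2 m :=
    memLp_two_bdd_mul hν hνB (h.memLp_of_continuous hn hΩ hψ.continuous)
  -- the divergence theorem for the approximations
  have hk : ∀ k, (∫ x in Ω, G (φ k x) * fderiv ℝ ψ x v) +
      ∫ x in Ω, G' (φ k x) * (ψ x * fderiv ℝ (φ k) x v) =
      ∫ x, G (φ k x) * (inner ℝ (outerNormal Ω x) v * ψ x) ∂m := by
    intro k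
    have h4 := h.integral_fderiv (fun x => ψ x * G (φ k x)) (hψ.mul (hGC.comp (hφ1 k))) v
    have h5 : ∀ x, fderiv ℝ (fun x => ψ x * G (φ k x)) x v =
        G (φ k x) * fderiv ℝ ψ x v + G' (φ k x) * (ψ x * fderiv ℝ (φ k) x v) := by
      intro x
      have h6 : HasFDerivAt (fun x => G (φ k x)) (G' (φ k x) • fderiv ℝ (φ k) x) x :=
        (hG (φ k x)).comp_hasFDerivAt x ((hφ1 k).differentiable one_ne_zero x).hasFDerivAt
      rw [((hψ.differentiable one_ne_zero x).hasFDerivAt.fun_mul h6).fderiv]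
      simp
      ring
    simp only [h5] at h4
    rw [integral_add] at h4
    · rw [h4]
      congr 1 with x
      ring
    · exact (memLp_two_comp hGL (hΩ.memLp_of_continuous (hφ k).continuous)).integrable_mul
        (hΩ.memLp_of_continuous hψ')
    · exact (hΩ.memLp_of_continuous (hG'.continuous.comp (hφ k).continuous)).integrable_mul
        (hΩ.memLp_of_continuous (hψ.continuous.mul (hφ' k)))
  have hint1 : Integrable (fun x => G (f x) * fderiv ℝ ψ x v) (volume.restrict Ω) :=
    (memLp_two_comp hGL hS.memLp).integrable_mul (hΩ.memLp_of_continuous hψ')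
  have hm2 : MemLp (fun x => ψ x * inner ℝ (F x) v) 2 (volume.restrict Ω) :=
    memLp_two_bdd_mul hψ.continuous.aestronglyMeasurable hBΩ (memLp_inner_const hS.memLp_gradient v)
  have hint2 : Integrable (fun x => G' (f x) * (ψ x * inner ℝ (F x) v)) (volume.restrict Ω) :=
    (memLp_two_comp hG' hS.memLp).integrable_mul hm2
  have hGd : ∀ {a : ℕ → EuclideanSpace ℝ (Fin n) → ℝ} {b : EuclideanSpace ℝ (Fin n) → ℝ}
      {μ : Measure (EuclideanSpace ℝ (Fin n))} {K : ℝ≥0} {G : ℝ → ℝ} (_ : LipschitzWith K G)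
      (_ : Tendsto (fun k => eLpNorm (fun x => a k x - b x) 2 μ) atTop (𝓝 0)),
      Tendsto (fun k => eLpNorm (fun x => G (a k x) - G (b x)) 2 μ) atTop (𝓝 0) := by
    intro a b μ K G hG ht
    refine tendsto_eLpNorm_zero_of_le K (fun k => Eventually.of_forall fun x => ?_) ht
    simpa [dist_eq_norm] using hG.dist_le_mul (a k x) (b x)
  have hconst : ∀ {b : EuclideanSpace ℝ (Fin n) → ℝ} {μ : Measure (EuclideanSpace ℝ (Fin n))},
      Tendsto (fun _ : ℕ => eLpNorm (fun x => b x - b x) 2 μ) atTop (𝓝 0) := by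
    intro b μ
    simp
  have hgrad : Tendsto (fun k => eLpNorm (fun x => ψ x * fderiv ℝ (φ k) x v -
      ψ x * inner ℝ (F x) v) 2 (volume.restrict Ω)) atTop (𝓝 0) := by
    refine tendsto_eLpNorm_zero_of_le Bψ (fun k => ?_) (tendsto_eLpNorm_inner_const h2 v)
    filter_upwards [hBΩ] with x hx
    rw [← mul_sub, norm_mul, inner_gradient]
    exact mul_le_mul_of_nonneg_right hx (norm_nonneg _)
  have hlim1 := tendsto_integral_mul_of_eLpNorm
    (fun k => memLp_two_comp hGL (hΩ.memLp_of_continuous (hφ k).continuous))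
    (memLp_two_comp hGL hS.memLp) (fun _ => hΩ.memLp_of_continuous hψ')
    (hΩ.memLp_of_continuous hψ') (hGd hGL h1) hconst
  -- The Lipschitz bound on `G'` gives `G'(φ k) → G'(f)` in `L²`, which is what the product with the
  -- `L²`-convergent derivatives needs.
  have hlim2 := tendsto_integral_mul_of_eLpNorm
    (fun k => memLp_two_comp hG' (hΩ.memLp_of_continuous (hφ k).continuous))
    (memLp_two_comp hG' hS.memLp)
    (fun k => hΩ.memLp_of_continuous (hψ.continuous.mul (hφ' k))) hm2 (hGd hG' h1) hgrad
  have hlim3 := tendsto_integral_mul_of_eLpNorm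
    (fun k => memLp_two_comp hGL (h.memLp_of_continuous hn hΩ (hφ k).continuous))
    (memLp_two_comp hGL hgm) (fun _ => hψm) hψm (hGd hGL (h.tendsto_eLpNorm h3)) hconst
  have hfin := tendsto_nhds_unique (hlim1.add hlim2) (hlim3.congr fun k => (hk k).symm)
  rw [← integral_add hint1 hint2] at hfin
  calc
    _ = ∫ x in Ω, (G (f x) * fderiv ℝ ψ x v + G' (f x) * (ψ x * inner ℝ (F x) v)) := by
        congr 1 with x
        rw [real_inner_smul_left]
        ring
    _ = _ := hfin
    _ = _ := by
        congr 1 with x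
        ring

theorem HasTrace.hasWeakTrace (h : IsDivergenceMeasure Ω m C) (hn : 0 < n)
    (hΩ : IsSmoothBoundedDomain Ω) {f g : EuclideanSpace ℝ (Fin n) → ℝ}
    {F : EuclideanSpace ℝ (Fin n) → EuclideanSpace ℝ (Fin n)} (hf : HasTrace Ω f F g)
    (hg : AEStronglyMeasurable g (boundaryMeasure Ω)) : HasWeakTrace Ω m f F g := by
  simpa using hf.comp_hasWeakTrace h hn hΩ hg (G := id) (G' := fun _ => 1) (L := 0) (B := 1)
    (fun s => hasDerivAt_id s) (LipschitzWith.const 1) (by simp)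

/-- Green's formula. -/
theorem HasTrace.integral_mul (h : IsDivergenceMeasure Ω m C) (hn : 0 < n)
    (hΩ : IsSmoothBoundedDomain Ω) {f₁ g₁ f₂ g₂ : EuclideanSpace ℝ (Fin n) → ℝ}
    {F₁ F₂ : EuclideanSpace ℝ (Fin n) → EuclideanSpace ℝ (Fin n)} (h₁ : HasTrace Ω f₁ F₁ g₁)
    (hg₁ : AEStronglyMeasurable g₁ (boundaryMeasure Ω)) (h₂ : HasWeakTrace Ω m f₂ F₂ g₂)
    (v : EuclideanSpace ℝ (Fin n)) :
    ∫ x in Ω, (f₂ x * inner ℝ (F₁ x) v + f₁ x * inner ℝ (F₂ x) v) =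
      ∫ x, g₁ x * g₂ x * inner ℝ (outerNormal Ω x) v ∂m := by
  have hgm := memLp_of_hasTrace h hn hΩ h₁ hg₁
  obtain ⟨hS, φ, hφ, h1, h2, h3⟩ := h₁
  have hφ1 : ∀ k, ContDiff ℝ 1 (φ k) := fun k => (hφ k).of_le (by norm_cast)
  have hφ' : ∀ k, Continuous fun x => fderiv ℝ (φ k) x v := fun k =>
    ((hφ1 k).continuous_fderiv one_ne_zero).clm_apply continuous_const
  have hν : AEStronglyMeasurable (fun x => inner ℝ (outerNormal Ω x) v) m :=
    (h.aestronglyMeasurable_outerNormal hn hΩ).inner aestronglyMeasurable_const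
  have hνB : ∀ᵐ x ∂m, ‖inner ℝ (outerNormal Ω x) v‖ ≤ ‖v‖ := by
    filter_upwards [h.ae_norm_outerNormal hΩ] with x hx
    have := norm_inner_le_norm (𝕜 := ℝ) (outerNormal Ω x) v
    rwa [hx, one_mul] at this
  have hg₂ : MemLp (fun x => inner ℝ (outerNormal Ω x) v * g₂ x) 2 m :=
    memLp_two_bdd_mul hν hνB h₂.memLp_trace
  have hF₂ := memLp_inner_const h₂.memLp_gradient v
  have hF₁ := memLp_inner_const hS.memLp_gradient v
  -- The smooth approximations of the first factor serve as test functions in the weak trace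
  -- identity of the second. For this reason the second factor needs no smooth approximation of its
  -- own.
  have hk : ∀ k, (∫ x in Ω, f₂ x * fderiv ℝ (φ k) x v) + ∫ x in Ω, φ k x * inner ℝ (F₂ x) v =
      ∫ x, φ k x * (inner ℝ (outerNormal Ω x) v * g₂ x) ∂m := by
    intro k
    rw [← integral_add (integrable_mul_of_memLp h₂.memLp (hΩ.memLp_of_continuous (hφ' k)))
      (integrable_mul_of_memLp (hΩ.memLp_of_continuous (hφ k).continuous) hF₂), h₂.integral_eq _ (hφ k)]
    congr 1 with x
    ring
  have hconst : ∀ {b : EuclideanSpace ℝ (Fin n) → ℝ} {μ : Measure (EuclideanSpace ℝ (Fin n))},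
      Tendsto (fun _ : ℕ => eLpNorm (fun x => b x - b x) 2 μ) atTop (𝓝 0) := by
    intro b μ
    simp
  have hgrad : Tendsto (fun k => eLpNorm (fun x => fderiv ℝ (φ k) x v - inner ℝ (F₁ x) v) 2
      (volume.restrict Ω)) atTop (𝓝 0) := by
    simpa only [inner_gradient] using tendsto_eLpNorm_inner_const h2 v
  have hlim1 := tendsto_integral_mul_of_eLpNorm (fun _ => h₂.memLp) h₂.memLp
    (fun k => hΩ.memLp_of_continuous (hφ' k)) hF₁ hconst hgrad
  have hlim2 := tendsto_integral_mul_of_eLpNorm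
    (fun k => hΩ.memLp_of_continuous (hφ k).continuous) hS.memLp (fun _ => hF₂) hF₂ h1 hconst
  have hlim3 := tendsto_integral_mul_of_eLpNorm
    (fun k => h.memLp_of_continuous hn hΩ (hφ k).continuous) hgm (fun _ => hg₂) hg₂
    (h.tendsto_eLpNorm h3) hconst
  have hfin := tendsto_nhds_unique (hlim1.add hlim2) (hlim3.congr fun k => (hk k).symm)
  rw [integral_add (integrable_mul_of_memLp h₂.memLp hF₁)
    (integrable_mul_of_memLp hS.memLp hF₂)]
  refine hfin.trans ?_
  congr 1 with x
  ring

/-- The product `ψ φ` is again an admissible test function, and the product rule moves the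
derivative of `ψ` into the new gradient. -/
theorem HasWeakTrace.mul (h : IsDivergenceMeasure Ω m C) (hΩ : IsSmoothBoundedDomain Ω)
    {f g ψ : EuclideanSpace ℝ (Fin n) → ℝ}
    {F : EuclideanSpace ℝ (Fin n) → EuclideanSpace ℝ (Fin n)} (hf : HasWeakTrace Ω m f F g)
    (hψ : ContDiff ℝ ∞ ψ) :
    HasWeakTrace Ω m (fun x => ψ x * f x) (fun x => ψ x • F x + f x • gradient ψ x)
      (fun x => ψ x * g x) := by
  have hψ1 : ContDiff ℝ 1 ψ := hψ.of_le (by norm_cast)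
  obtain ⟨B, hB0, hB⟩ := hΩ.exists_bound hψ.continuous
  obtain ⟨B', hB'0, hB'⟩ := hΩ.exists_bound (continuous_gradient hψ1)
  have hΩae : ∀ᵐ x ∂(volume.restrict Ω), x ∈ Ω := ae_restrict_mem hΩ.isOpen.measurableSet
  refine ⟨memLp_two_bdd_mul hψ.continuous.aestronglyMeasurable
    (hΩae.mono fun x hx => hB x (subset_closure hx)) hf.memLp, ?_,
    memLp_two_bdd_mul hψ.continuous.aestronglyMeasurable
    (h.ae_mem_frontier.mono fun x hx => hB x (frontier_subset_closure hx)) hf.memLp_trace,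
    fun φ hφ v => ?_⟩
  · refine MemLp.add ?_ ?_
    · refine (hf.memLp_gradient.norm.const_mul B).mono'
        (hψ.continuous.aestronglyMeasurable.smul hf.memLp_gradient.1) ?_
      filter_upwards [hΩae] with x hx
      rw [norm_smul]
      exact mul_le_mul_of_nonneg_right (hB x (subset_closure hx)) (norm_nonneg _)
    · refine (hf.memLp.norm.const_mul B').mono'
        (hf.memLp.1.smul (continuous_gradient hψ1).aestronglyMeasurable) ?_
      filter_upwards [hΩae] with x hx
      rw [norm_smul, mul_comm]
      exact mul_le_mul_of_nonneg_right (hB' x (subset_closure hx)) (norm_nonneg _)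
  · have := hf.integral_eq (fun x => ψ x * φ x) (hψ.mul hφ) v
    calc
      _ = ∫ x in Ω, (f x * fderiv ℝ (fun x => ψ x * φ x) x v + ψ x * φ x * inner ℝ (F x) v) := by
          congr 1 with x
          rw [((hψ.differentiable (by simp) x).hasFDerivAt.fun_mul
            (hφ.differentiable (by simp) x).hasFDerivAt).fderiv, inner_add_left,
            real_inner_smul_left, real_inner_smul_left, inner_gradient]
          simp
          ring
      _ = _ := this
      _ = _ := by
          congr 1 with x
          ring

/-- Green's formula with a smooth weight. -/
theorem HasTrace.integral_mul_mul (h : IsDivergenceMeasure Ω m C) (hn : 0 < n)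
    (hΩ : IsSmoothBoundedDomain Ω) {f₁ g₁ f₂ g₂ ψ : EuclideanSpace ℝ (Fin n) → ℝ}
    {F₁ F₂ : EuclideanSpace ℝ (Fin n) → EuclideanSpace ℝ (Fin n)} (h₁ : HasTrace Ω f₁ F₁ g₁)
    (hg₁ : AEStronglyMeasurable g₁ (boundaryMeasure Ω)) (h₂ : HasWeakTrace Ω m f₂ F₂ g₂)
    (hψ : ContDiff ℝ ∞ ψ) (v : EuclideanSpace ℝ (Fin n)) :
    ∫ x in Ω, (ψ x * (f₂ x * inner ℝ (F₁ x) v + f₁ x * inner ℝ (F₂ x) v) +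
      f₁ x * f₂ x * fderiv ℝ ψ x v) =
      ∫ x, ψ x * (g₁ x * g₂ x) * inner ℝ (outerNormal Ω x) v ∂m := by
  have := h₁.integral_mul h hn hΩ hg₁ (h₂.mul h hΩ hψ) v
  calc
    _ = _ := by
        congr 1 with x
        rw [inner_add_left, real_inner_smul_left, real_inner_smul_left, inner_gradient]
        ring
    _ = _ := this
    _ = _ := by
        congr 1 with x
        ring

end

section

/-! ### The double-well potential -/

theorem hasDerivAt_doubleWell (s : ℝ) : HasDerivAt doubleWell (2 * s * (s ^ 2 - 1)) s := by
  have h : HasDerivAt (fun s : ℝ => (1 / 2) * (1 - s ^ 2) ^ 2)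
      ((1 / 2) * (((2 : ℕ) : ℝ) * (1 - s ^ 2) ^ (2 - 1) * (-(((2 : ℕ) : ℝ) * s ^ (2 - 1))))) s :=
    (((hasDerivAt_pow 2 s).const_sub 1).pow 2).const_mul (1 / 2)
  exact h.congr_deriv (by norm_num; ring)

theorem deriv_doubleWell (s : ℝ) : deriv doubleWell s = 2 * s * (s ^ 2 - 1) :=
  (hasDerivAt_doubleWell s).deriv

theorem doubleWell_nonneg (s : ℝ) : 0 ≤ doubleWell s := by
  unfold doubleWell
  positivity

theorem continuous_doubleWell : Continuous doubleWell := by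
  unfold doubleWell
  fun_prop

theorem continuous_deriv_doubleWell : Continuous (deriv doubleWell) := by
  rw [show deriv doubleWell = fun s => 2 * s * (s ^ 2 - 1) from funext deriv_doubleWell]
  fun_prop

/-- This makes `W(f)` integrable as soon as `W'(f)` is in `L²`, without a bound on `f`. It amounts
to `(1 - s²)³ ≤ 1`. -/
theorem doubleWell_le (s : ℝ) : doubleWell s ≤ 1 / 2 + (deriv doubleWell s) ^ 2 / 8 := by
  rw [deriv_doubleWell, doubleWell]
  nlinarith [sq_nonneg (s * (s ^ 2 - 1)), mul_nonneg (sq_nonneg s) (sq_nonneg s),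
    mul_nonneg (sq_nonneg s) (sq_nonneg (s ^ 2 - 1)), sq_nonneg s, sq_nonneg (s ^ 2 - 1)]

/-- The projection of `s` to `[-M, M]`. -/
def clamp (M s : ℝ) : ℝ := max (-M) (min M s)

theorem lipschitzWith_clamp (M : ℝ) : LipschitzWith 1 (clamp M) := by
  unfold clamp
  exact (LipschitzWith.id.const_min M).const_max (-M)

theorem clamp_of_abs_le {M s : ℝ} (h : |s| ≤ M) : clamp M s = s := by
  rw [abs_le] at h
  rw [clamp, min_eq_right h.2, max_eq_right h.1]

theorem abs_clamp_le {M : ℝ} (hM : 0 ≤ M) (s : ℝ) : |clamp M s| ≤ M := by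
  rw [abs_le, clamp]
  exact ⟨le_max_left _ _, max_le (by linarith) (min_le_left _ _)⟩

theorem clamp_of_le {M s : ℝ} (hM : 0 ≤ M) (h : M ≤ s) : clamp M s = M := by
  rw [clamp, min_eq_left h, max_eq_right (by linarith)]

theorem clamp_of_le_neg {M s : ℝ} (hM : 0 ≤ M) (h : s ≤ -M) : clamp M s = -M := by
  rw [clamp, min_eq_right (by linarith), max_eq_left h]

/-- The double-well potential with its derivative truncated outside `[-M, M]`. -/
def truncatedWell (M s : ℝ) : ℝ := 1 / 2 + ∫ r in (0 : ℝ)..s, deriv doubleWell (clamp M r)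

theorem continuous_deriv_doubleWell_clamp (M : ℝ) :
    Continuous fun r => deriv doubleWell (clamp M r) :=
  continuous_deriv_doubleWell.comp (lipschitzWith_clamp M).continuous

theorem hasDerivAt_truncatedWell (M s : ℝ) :
    HasDerivAt (truncatedWell M) (deriv doubleWell (clamp M s)) s :=
  ((continuous_deriv_doubleWell_clamp M).integral_hasStrictDerivAt 0 s).hasDerivAt.const_add _

/-- `|W'|` is even and increasing on `[1, ∞)`, so moving a point inwards to `±M` cannot enlarge it
once `M ≥ 1`. -/
theorem abs_deriv_clamp_le {M : ℝ} (hM : 1 ≤ M) (s : ℝ) :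
    |deriv doubleWell (clamp M s)| ≤ |deriv doubleWell s| := by
  rcases le_total |s| M with h | h
  · rw [clamp_of_abs_le h]
  · rw [deriv_doubleWell, deriv_doubleWell]
    have key : ∀ {a b : ℝ}, 1 ≤ a → a ≤ b → a * (a ^ 2 - 1) ≤ b * (b ^ 2 - 1) := by
      intro a b ha hab
      have h1 : a ^ 2 - 1 ≤ b ^ 2 - 1 := by nlinarith
      exact mul_le_mul hab h1 (by nlinarith) (by linarith)
    rcases le_abs.1 h with h | h
    · rw [clamp_of_le (by linarith) h, abs_of_nonneg (by nlinarith),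
        abs_of_nonneg (by nlinarith)]
      nlinarith [key hM h]
    · rw [clamp_of_le_neg (by linarith) (by linarith), abs_of_nonpos (by nlinarith),
        abs_of_nonpos (by nlinarith)]
      have := key hM h
      nlinarith

theorem norm_deriv_clamp_le_const {M : ℝ} (hM : 1 ≤ M) (s : ℝ) :
    ‖deriv doubleWell (clamp M s)‖ ≤ 2 * M * (M ^ 2 + 1) := by
  have h := abs_clamp_le (zero_le_one.trans hM) s
  rw [deriv_doubleWell, Real.norm_eq_abs, abs_mul, abs_mul, abs_two]
  have h2 : |clamp M s ^ 2 - 1| ≤ M ^ 2 + 1 := by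
    have := abs_le.1 h
    rw [abs_le]
    constructor <;> nlinarith
  gcongr

/-- Truncation makes `W'` bounded and Lipschitz, as the chain rule `HasTrace.comp_hasWeakTrace`
demands. -/
theorem lipschitzWith_deriv_clamp {M : ℝ} (hM : 1 ≤ M) :
    ∃ L, LipschitzWith L fun s => deriv doubleWell (clamp M s) := by
  refine ⟨(2 * (3 * M ^ 2 + 1)).toNNReal, LipschitzWith.of_dist_le_mul fun s r => ?_⟩
  rw [Real.coe_toNNReal _ (by positivity), Real.dist_eq, Real.dist_eq, deriv_doubleWell,
    deriv_doubleWell]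
  have h := (lipschitzWith_clamp M).dist_le_mul s r
  rw [Real.dist_eq, Real.dist_eq, NNReal.coe_one, one_mul] at h
  have ha := abs_le.1 (abs_clamp_le (zero_le_one.trans hM) s)
  have hb := abs_le.1 (abs_clamp_le (zero_le_one.trans hM) r)
  set a := clamp M s
  set b := clamp M r
  have : 2 * a * (a ^ 2 - 1) - 2 * b * (b ^ 2 - 1) =
      (2 * (a ^ 2 + a * b + b ^ 2 - 1)) * (a - b) := by ring
  rw [this, abs_mul]
  refine mul_le_mul ?_ h (abs_nonneg _) (by positivity)
  rw [abs_le]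
  constructor <;> nlinarith [sq_nonneg (a + b), sq_nonneg (a - b)]

/-- The additive constant `1/2` in `truncatedWell` is `W(0)`. -/
theorem truncatedWell_eq {M s : ℝ} (h : |s| ≤ M) : truncatedWell M s = doubleWell s := by
  have h1 : ∫ r in (0 : ℝ)..s, deriv doubleWell (clamp M r) =
      ∫ r in (0 : ℝ)..s, deriv doubleWell r := by
    refine intervalIntegral.integral_congr fun r hr => ?_
    have hr' : |r| ≤ M := by
      refine le_trans ?_ h
      rcases le_total 0 s with hs | hs
      · rw [uIcc_of_le hs] at hr
        rw [abs_of_nonneg hs, abs_of_nonneg hr.1]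
        exact hr.2
      · rw [uIcc_of_ge hs] at hr
        rw [abs_of_nonpos hs, abs_of_nonpos hr.2]
        linarith [hr.1]
    simp only [clamp_of_abs_le hr']
  rw [truncatedWell, h1, intervalIntegral.integral_eq_sub_of_hasDerivAt
    (fun r _ => (hasDerivAt_doubleWell r).congr_deriv (deriv_doubleWell r).symm)
    (continuous_deriv_doubleWell.intervalIntegrable _ _)]
  simp [doubleWell]

theorem truncatedWell_sub (M a b : ℝ) :
    truncatedWell M b - truncatedWell M a = ∫ r in a..b, deriv doubleWell (clamp M r) :=
  (intervalIntegral.integral_eq_sub_of_hasDerivAt (fun r _ => hasDerivAt_truncatedWell M r)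
    ((continuous_deriv_doubleWell_clamp M).intervalIntegrable _ _)).symm

theorem truncatedWell_nonneg {M : ℝ} (hM : 1 ≤ M) (s : ℝ) : 0 ≤ truncatedWell M s := by
  rcases le_total |s| M with h | h
  · rw [truncatedWell_eq h]
    exact doubleWell_nonneg s
  rcases le_abs.1 h with h | h
  · have h1 := truncatedWell_sub M M s
    have h2 : 0 ≤ ∫ r in M..s, deriv doubleWell (clamp M r) := by
      refine intervalIntegral.integral_nonneg h fun r hr => ?_
      rw [clamp_of_le (by linarith) hr.1, deriv_doubleWell]
      nlinarith
    have h3 := doubleWell_nonneg M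
    rw [← truncatedWell_eq (M := M) (abs_of_nonneg (by linarith : (0 : ℝ) ≤ M)).le] at h3
    linarith
  · have h1 := truncatedWell_sub M s (-M)
    have h2 : 0 ≤ ∫ r in s..(-M), -deriv doubleWell (clamp M r) := by
      refine intervalIntegral.integral_nonneg (by linarith) fun r hr => ?_
      rw [clamp_of_le_neg (by linarith) hr.2, deriv_doubleWell]
      nlinarith
    rw [intervalIntegral.integral_neg] at h2
    have h3 := doubleWell_nonneg (-M)
    rw [← truncatedWell_eq (M := M) (by rw [abs_neg]; exact
      (abs_of_nonneg (by linarith : (0 : ℝ) ≤ M)).le)] at h3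
    linarith

theorem truncatedWell_le {M : ℝ} (hM : 1 ≤ M) (s : ℝ) : truncatedWell M s ≤ doubleWell s := by
  have hW : ∀ a b, doubleWell b - doubleWell a = ∫ r in a..b, deriv doubleWell r := fun a b =>
    (intervalIntegral.integral_eq_sub_of_hasDerivAt
      (fun r _ => (hasDerivAt_doubleWell r).congr_deriv (deriv_doubleWell r).symm)
      (continuous_deriv_doubleWell.intervalIntegrable _ _)).symm
  have hcl : ∀ r, 0 ≤ deriv doubleWell r → deriv doubleWell (clamp M r) ≤ deriv doubleWell r :=
    fun r hr => by
      have := abs_deriv_clamp_le hM r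
      rw [abs_of_nonneg hr] at this
      exact (le_abs_self _).trans this
  have hcl' : ∀ r, deriv doubleWell r ≤ 0 → deriv doubleWell r ≤ deriv doubleWell (clamp M r) :=
    fun r hr => by
      have := abs_deriv_clamp_le hM r
      rw [abs_of_nonpos hr] at this
      linarith [neg_abs_le (deriv doubleWell (clamp M r))]
  rcases le_total |s| M with h | h
  · rw [truncatedWell_eq h]
  rcases le_abs.1 h with h | h
  · have h3 := truncatedWell_eq (M := M) (abs_of_nonneg (by linarith : (0 : ℝ) ≤ M)).le
    have h4 : ∫ r in M..s, deriv doubleWell (clamp M r) ≤ ∫ r in M..s, deriv doubleWell r := by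
      refine intervalIntegral.integral_mono_on h
        ((continuous_deriv_doubleWell_clamp M).intervalIntegrable _ _)
        (continuous_deriv_doubleWell.intervalIntegrable _ _) fun r hr => hcl r ?_
      rw [deriv_doubleWell]
      have := hr.1
      exact mul_nonneg (by linarith) (by nlinarith)
    linarith [truncatedWell_sub M M s, hW M s]
  · have h3 := truncatedWell_eq (M := M) (s := -M) (by rw [abs_neg]; exact
      (abs_of_nonneg (by linarith : (0 : ℝ) ≤ M)).le)
    have h4 : ∫ r in s..(-M), deriv doubleWell r ≤
        ∫ r in s..(-M), deriv doubleWell (clamp M r) := by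
      refine intervalIntegral.integral_mono_on (by linarith)
        (continuous_deriv_doubleWell.intervalIntegrable _ _)
        ((continuous_deriv_doubleWell_clamp M).intervalIntegrable _ _) fun r hr => hcl' r ?_
      rw [deriv_doubleWell]
      have := hr.2
      exact mul_nonpos_of_nonpos_of_nonneg (by linarith) (by nlinarith)
    linarith [truncatedWell_sub M s (-M), hW s (-M)]

end

section

variable {n : ℕ} {Ω : Set (EuclideanSpace ℝ (Fin n))}
  {m : Measure (EuclideanSpace ℝ (Fin n))} {C : ℝ≥0}

/-! ### The Rellich identity -/

/-- `f ∈ W^{2,2}(Ω)` with gradient `F` and second derivatives `A`, and the values of `f` and `F`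
on `∂Ω` are those of their traces. -/
structure IsRegularSlice (Ω : Set (EuclideanSpace ℝ (Fin n)))
    (f : EuclideanSpace ℝ (Fin n) → ℝ)
    (F : EuclideanSpace ℝ (Fin n) → EuclideanSpace ℝ (Fin n))
    (A : EuclideanSpace ℝ (Fin n) → Fin n → EuclideanSpace ℝ (Fin n)) : Prop where
  trace : HasTrace Ω f F f
  trace_grad : ∀ i, HasTrace Ω (fun x => F x i) (fun x => A x i) (fun x => F x i)
  measurable : AEStronglyMeasurable f (boundaryMeasure Ω)
  measurable_grad : AEStronglyMeasurable F (boundaryMeasure Ω)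

theorem inner_single (x : EuclideanSpace ℝ (Fin n)) (i : Fin n) :
    inner ℝ x (EuclideanSpace.single i (1 : ℝ)) = x i := by
  simp [EuclideanSpace.inner_single_right]

theorem IsSobolev.integral_fderiv {f : EuclideanSpace ℝ (Fin n) → ℝ}
    {F : EuclideanSpace ℝ (Fin n) → EuclideanSpace ℝ (Fin n)} (hf : IsSobolev Ω f F)
    (hΩ : IsSmoothBoundedDomain Ω) {φ : EuclideanSpace ℝ (Fin n) → ℝ} (hφ : ContDiff ℝ ∞ φ)
    (hc : HasCompactSupport φ) (hs : tsupport φ ⊆ Ω) (v : EuclideanSpace ℝ (Fin n)) :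
    ∫ x in Ω, f x * fderiv ℝ φ x v = -∫ x in Ω, φ x * inner ℝ (F x) v := by
  have hφ1 : ContDiff ℝ 1 φ := hφ.of_le (by norm_cast)
  have h1 : Integrable (fun x => f x • gradient φ x) (volume.restrict Ω) :=
    memLp_one_iff_integrable.1
      ((hΩ.memLp_of_continuous (continuous_gradient hφ1)).smul (r := 1) hf.memLp)
  have h2 : Integrable (fun x => φ x • F x) (volume.restrict Ω) :=
    memLp_one_iff_integrable.1
      (hf.memLp_gradient.smul (r := 1) (hΩ.memLp_of_continuous hφ.continuous))
  have h3 := congrArg (fun w => inner ℝ v w) (hf.weak_gradient φ hφ hc hs)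
  rw [inner_neg_right, ← integral_inner h1, ← integral_inner h2] at h3
  simpa only [inner_smul_right, ← inner_gradient, real_inner_comm] using h3

/-- Integrated against a test function, each entry becomes the integral of `f` against a mixed
second derivative of that test function, which is symmetric. -/
theorem IsRegularSlice.hess_symm {f : EuclideanSpace ℝ (Fin n) → ℝ}
    {F : EuclideanSpace ℝ (Fin n) → EuclideanSpace ℝ (Fin n)}
    {A : EuclideanSpace ℝ (Fin n) → Fin n → EuclideanSpace ℝ (Fin n)}
    (h : IsRegularSlice Ω f F A) (hΩ : IsSmoothBoundedDomain Ω) (i j : Fin n) :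
    ∀ᵐ x ∂(volume.restrict Ω), A x i j = A x j i := by
  have := hΩ.isFiniteMeasure
  have hA : ∀ i j, MemLp (fun x => A x i j) 2 (volume.restrict Ω) := fun i j => by
    simpa only [inner_single] using
      memLp_inner_const (h.trace_grad i).1.memLp_gradient (EuclideanSpace.single j (1 : ℝ))
  have hint : ∀ i j, Integrable (fun x => A x i j) (volume.restrict Ω) := fun i j =>
    (hA i j).integrable (by norm_num)
  have key : ∀ i j, ∀ φ : EuclideanSpace ℝ (Fin n) → ℝ, ContDiff ℝ ∞ φ → HasCompactSupport φ →
      tsupport φ ⊆ Ω → ∫ x in Ω, φ x * A x i j =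
        ∫ x in Ω, f x * fderiv ℝ (fun y => fderiv ℝ φ y (EuclideanSpace.single j 1)) x
          (EuclideanSpace.single i 1) := by
    intro i j φ hφ hc hs
    have h1 := (h.trace_grad i).1.integral_fderiv hΩ hφ hc hs (EuclideanSpace.single j (1 : ℝ))
    simp only [inner_single] at h1
    have hφ' : ContDiff ℝ ∞ fun y => fderiv ℝ φ y (EuclideanSpace.single j (1 : ℝ)) :=
      (hφ.fderiv_right (m := ∞) (by simp)).clm_apply contDiff_const
    have h2 := h.trace.1.integral_fderiv hΩ hφ' (hc.fderiv_apply ℝ _)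
      ((tsupport_fderiv_apply_subset ℝ _).trans hs) (EuclideanSpace.single i (1 : ℝ))
    simp only [inner_single] at h2
    rw [h2, ← neg_eq_iff_eq_neg.2 h1]
    congr 2 with x
    ring
  have hz := hΩ.isOpen.ae_eq_zero_of_integral_contDiff_smul_eq_zero
    (f := fun x => A x i j - A x j i) (μ := volume)
    (show IntegrableOn (fun x => A x i j - A x j i) Ω volume from
      (hint i j).sub (hint j i)).locallyIntegrableOn (by
      intro φ hφ hc hs
      have h0 : ∫ x, φ x • (A x i j - A x j i) = ∫ x in Ω, φ x • (A x i j - A x j i) := by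
        rw [setIntegral_eq_integral_of_forall_compl_eq_zero]
        intro x hx
        rw [image_eq_zero_of_notMem_tsupport fun h' => hx (hs h'), zero_smul]
      rw [h0]
      simp only [smul_eq_mul, mul_sub]
      rw [integral_sub (integrable_mul_of_memLp (hΩ.memLp_of_continuous hφ.continuous) (hA i j))
        (integrable_mul_of_memLp (hΩ.memLp_of_continuous hφ.continuous) (hA j i)),
        key i j φ hφ hc hs, key j i φ hφ hc hs, sub_eq_zero]
      congr 1 with x
      congr 1
      have hd : DifferentiableAt ℝ (fderiv ℝ φ) x :=
        ((hφ.fderiv_right (m := ∞) (by simp)).differentiable (by simp)) x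
      have hsymm : IsSymmSndFDerivAt ℝ φ x :=
        (hφ.contDiffAt.of_le (m := 2) (by norm_cast)).isSymmSndFDerivAt (by simp)
      have h5 : ∀ a b, fderiv ℝ (fun y => fderiv ℝ φ y a) x b = fderiv ℝ (fderiv ℝ φ) x b a := by
        intro a b
        rw [fderiv_clm_apply hd (differentiableAt_const a)]
        simp
      rw [h5, h5]
      exact hsymm _ _)
  rw [ae_restrict_iff' hΩ.isOpen.measurableSet]
  filter_upwards [hz] with x hx hxΩ
  exact sub_eq_zero.1 (hx hxΩ)

theorem IsRegularSlice.memLp_grad_boundary {f : EuclideanSpace ℝ (Fin n) → ℝ}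
    {F : EuclideanSpace ℝ (Fin n) → EuclideanSpace ℝ (Fin n)}
    {A : EuclideanSpace ℝ (Fin n) → Fin n → EuclideanSpace ℝ (Fin n)}
    (h : IsRegularSlice Ω f F A) (hm : IsDivergenceMeasure Ω m C) (hn : 0 < n)
    (hΩ : IsSmoothBoundedDomain Ω) : MemLp F 2 m := by
  have hi : ∀ i, MemLp (fun x => F x i) 2 m := fun i =>
    memLp_of_hasTrace hm hn hΩ (h.trace_grad i)
      ((EuclideanSpace.proj i : EuclideanSpace ℝ (Fin n) →L[ℝ] ℝ).continuous
        |>.comp_aestronglyMeasurable h.measurable_grad)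
  have hs : MemLp (fun x => ∑ i, ‖F x i‖) 2 m := memLp_finsetSum _ fun i _ => (hi i).norm
  refine hs.mono' (h.measurable_grad.mono_ac hm.absolutelyContinuous)
    (Eventually.of_forall fun x => ?_)
  rw [EuclideanSpace.norm_eq]
  refine Real.sqrt_le_iff.2 ⟨by positivity, ?_⟩
  exact Finset.sum_sq_le_sq_sum_of_nonneg fun i _ => norm_nonneg _

theorem integrable_bdd_mul_mul {α : Type*} [MeasurableSpace α] {μ : Measure α} {b p q : α → ℝ}
    {B : ℝ} (hb : AEStronglyMeasurable b μ) (hB : ∀ᵐ x ∂μ, ‖b x‖ ≤ B) (hp : MemLp p 2 μ)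
    (hq : MemLp q 2 μ) : Integrable (fun x => b x * (p x * q x)) μ :=
  (integrable_mul_of_memLp (memLp_two_bdd_mul hb hB hp) hq).congr
    (Eventually.of_forall fun x => by ring)

/-- The interior integrand of the Rellich identity in coordinates. -/
def rellichInterior (F : EuclideanSpace ℝ (Fin n) → EuclideanSpace ℝ (Fin n))
    (ψ : EuclideanSpace ℝ (Fin n) → ℝ) (i j : Fin n) (x : EuclideanSpace ℝ (Fin n)) : ℝ :=
  F x i * F x j * fderiv ℝ ψ x (EuclideanSpace.single i 1) -
    (1 / 2) * (F x i * F x i) * fderiv ℝ ψ x (EuclideanSpace.single j 1)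

section

variable {f : EuclideanSpace ℝ (Fin n) → ℝ}
  {F : EuclideanSpace ℝ (Fin n) → EuclideanSpace ℝ (Fin n)}
  {A : EuclideanSpace ℝ (Fin n) → Fin n → EuclideanSpace ℝ (Fin n)}

theorem IsRegularSlice.memLp_grad (h : IsRegularSlice Ω f F A) (i : Fin n) :
    MemLp (fun x => F x i) 2 (volume.restrict Ω) :=
  (h.trace_grad i).1.memLp

theorem IsRegularSlice.memLp_hess (h : IsRegularSlice Ω f F A) (i j : Fin n) :
    MemLp (fun x => A x i j) 2 (volume.restrict Ω) := by
  simpa only [inner_single] using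
    memLp_inner_const (h.trace_grad i).1.memLp_gradient (EuclideanSpace.single j (1 : ℝ))

theorem IsRegularSlice.measurable_grad_coord (h : IsRegularSlice Ω f F A) (i : Fin n) :
    AEStronglyMeasurable (fun x => F x i) (boundaryMeasure Ω) :=
  (EuclideanSpace.proj i : EuclideanSpace ℝ (Fin n) →L[ℝ] ℝ).continuous
    |>.comp_aestronglyMeasurable h.measurable_grad

theorem IsSmoothBoundedDomain.integrable_mul_mul (hΩ : IsSmoothBoundedDomain Ω)
    {b p q : EuclideanSpace ℝ (Fin n) → ℝ} (hb : Continuous b)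
    (hp : MemLp p 2 (volume.restrict Ω)) (hq : MemLp q 2 (volume.restrict Ω)) :
    Integrable (fun x => b x * (p x * q x)) (volume.restrict Ω) := by
  obtain ⟨B, -, hB⟩ := hΩ.exists_bound hb
  exact integrable_bdd_mul_mul hb.aestronglyMeasurable
    ((ae_restrict_mem hΩ.isOpen.measurableSet).mono fun x hx => hB x (subset_closure hx)) hp hq

theorem IsDivergenceMeasure.integrable_mul_mul (hm : IsDivergenceMeasure Ω m C) (hn : 0 < n)
    (hΩ : IsSmoothBoundedDomain Ω) {b p q : EuclideanSpace ℝ (Fin n) → ℝ} (hb : Continuous b)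
    (hp : MemLp p 2 m) (hq : MemLp q 2 m) (i : Fin n) :
    Integrable (fun x => b x * (p x * q x) * outerNormal Ω x i) m := by
  obtain ⟨B, -, hB⟩ := hΩ.exists_bound hb
  have h1 : AEStronglyMeasurable (fun x => outerNormal Ω x i) m :=
    (EuclideanSpace.proj i : EuclideanSpace ℝ (Fin n) →L[ℝ] ℝ).continuous
      |>.comp_aestronglyMeasurable (hm.aestronglyMeasurable_outerNormal hn hΩ)
  refine (integrable_bdd_mul_mul (B := B) (hb.aestronglyMeasurable.mul h1) ?_ hp hq).congr
    (Eventually.of_forall fun x => by simp only [Pi.mul_apply]; ring)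
  filter_upwards [hm.ae_mem_frontier] with x hx
  have h2 := PiLp.norm_apply_le (outerNormal Ω x) i
  rw [norm_outerNormal hΩ hx] at h2
  simp only [Pi.mul_apply, norm_mul]
  exact (mul_le_of_le_one_right (norm_nonneg _) h2).trans (hB x (frontier_subset_closure hx))

theorem IsRegularSlice.integrable_rellichInterior (h : IsRegularSlice Ω f F A)
    (hΩ : IsSmoothBoundedDomain Ω) {ψ : EuclideanSpace ℝ (Fin n) → ℝ} (hψ : ContDiff ℝ 1 ψ)
    (i j : Fin n) : Integrable (rellichInterior F ψ i j) (volume.restrict Ω) := by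
  have hψ' : ∀ v, Continuous fun x => fderiv ℝ ψ x v := fun v =>
    (hψ.continuous_fderiv one_ne_zero).clm_apply continuous_const
  refine ((hΩ.integrable_mul_mul (hψ' (EuclideanSpace.single i 1)) (h.memLp_grad i)
    (h.memLp_grad j)).sub ((hΩ.integrable_mul_mul (hψ' (EuclideanSpace.single j 1))
    (h.memLp_grad i) (h.memLp_grad i)).const_mul (1 / 2))).congr
    (Eventually.of_forall fun x => ?_)
  simp only [rellichInterior, Pi.sub_apply]
  ring

theorem IsRegularSlice.integrable_hess_mul (h : IsRegularSlice Ω f F A)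
    (hΩ : IsSmoothBoundedDomain Ω) {ψ : EuclideanSpace ℝ (Fin n) → ℝ} (hψ : Continuous ψ)
    (i j : Fin n) : Integrable (fun x => A x i i * (ψ x * F x j)) (volume.restrict Ω) :=
  (hΩ.integrable_mul_mul hψ (h.memLp_hess i i) (h.memLp_grad j)).congr
    (Eventually.of_forall fun x => by ring)

/-- The Rellich identity in coordinates. -/
theorem IsRegularSlice.rellich_coord
    (h : IsRegularSlice Ω f F A) (hm : IsDivergenceMeasure Ω m C) (hn : 0 < n)
    (hΩ : IsSmoothBoundedDomain Ω) {ψ : EuclideanSpace ℝ (Fin n) → ℝ} (hψs : ContDiff ℝ ∞ ψ)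
    (i j : Fin n) :
    ∫ x in Ω, (A x i i * (ψ x * F x j) + rellichInterior F ψ i j x) =
      ∫ x, (ψ x * (F x i * F x j) * outerNormal Ω x i -
        (1 / 2) * (ψ x * (F x i * F x i) * outerNormal Ω x j)) ∂m := by
  have hψ : ContDiff ℝ 1 ψ := hψs.of_le (by norm_cast)
  have hψ' : ∀ v, Continuous fun x => fderiv ℝ ψ x v := fun v =>
    (hψ.continuous_fderiv one_ne_zero).clm_apply continuous_const
  have hFm := fun k => memLp_of_hasTrace hm hn hΩ (h.trace_grad k) (h.measurable_grad_coord k)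
  -- The identity is `h1 - h2 / 2`: Green's formula for `Fᵢ Fⱼ` in direction `i`, minus half of it
  -- for `Fᵢ Fᵢ` in direction `j`. The remaining terms `Fᵢ (∂ᵢFⱼ - ∂ⱼFᵢ)` cancel by symmetry of the
  -- Hessian.
  have h1 := (h.trace_grad i).integral_mul_mul hm hn hΩ (h.measurable_grad_coord i)
    ((h.trace_grad j).hasWeakTrace hm hn hΩ (h.measurable_grad_coord j)) hψs
    (EuclideanSpace.single i 1)
  have h2 := (h.trace_grad i).integral_mul_mul hm hn hΩ (h.measurable_grad_coord i)
    ((h.trace_grad i).hasWeakTrace hm hn hΩ (h.measurable_grad_coord i)) hψs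
    (EuclideanSpace.single j 1)
  simp only [inner_single] at h1 h2
  have hi := hm.integrable_mul_mul hn hΩ hψ.continuous (hFm i) (hFm j) i
  have hj := hm.integrable_mul_mul hn hΩ hψ.continuous (hFm i) (hFm i) j
  rw [integral_sub hi (hj.const_mul _), integral_const_mul, ← h1, ← h2, ← integral_const_mul,
    ← integral_sub]
  · refine integral_congr_ae ?_
    filter_upwards [h.hess_symm hΩ i j] with x hx
    simp only [rellichInterior, hx]
    ring
  · refine (((hΩ.integrable_mul_mul hψ.continuous (h.memLp_grad j) (h.memLp_hess i i)).add
      (hΩ.integrable_mul_mul hψ.continuous (h.memLp_grad i) (h.memLp_hess j i))).add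
      (hΩ.integrable_mul_mul (hψ' (EuclideanSpace.single i 1)) (h.memLp_grad i)
        (h.memLp_grad j))).congr (Eventually.of_forall fun x => ?_)
    simp only [Pi.add_apply]
    ring
  · refine Integrable.const_mul ?_ _
    refine (((hΩ.integrable_mul_mul hψ.continuous (h.memLp_grad i) (h.memLp_hess i j)).add
      (hΩ.integrable_mul_mul hψ.continuous (h.memLp_grad i) (h.memLp_hess i j))).add
      (hΩ.integrable_mul_mul (hψ' (EuclideanSpace.single j 1)) (h.memLp_grad i)
        (h.memLp_grad i))).congr (Eventually.of_forall fun x => ?_)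
    simp only [Pi.add_apply]
    ring

end

theorem inner_eq_sum (x y : EuclideanSpace ℝ (Fin n)) : inner ℝ x y = ∑ i, x i * y i := by
  rw [PiLp.inner_apply]
  exact Finset.sum_congr rfl fun i _ => by simp [mul_comm]

theorem norm_sq_eq_sum (x : EuclideanSpace ℝ (Fin n)) : ‖x‖ ^ 2 = ∑ i, x i * x i := by
  rw [← real_inner_self_eq_norm_sq, inner_eq_sum]

/-- The Rellich inequality for a vector field that is transversal to the boundary. -/
theorem exists_rellich_le (hm : IsDivergenceMeasure Ω m C) (hn : 0 < n)
    (hΩ : IsSmoothBoundedDomain Ω) {X : EuclideanSpace ℝ (Fin n) → EuclideanSpace ℝ (Fin n)}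
    {c : ℝ} (hX : ContDiff ℝ ∞ X) (hc : 0 < c)
    (hXc : ∀ x ∈ frontier Ω, c ≤ inner ℝ (X x) (outerNormal Ω x)) :
    ∃ K : ℝ, 0 < K ∧ ∀ f F A, IsRegularSlice Ω f F A →
      ∫ x in Ω, (∑ i, A x i i) * inner ℝ (X x) (F x) ≤
        K * ((∫ x in Ω, ‖F x‖ ^ 2) + ∫ x, inner ℝ (F x) (outerNormal Ω x) ^ 2 ∂m) := by
  have hXs : ∀ j, ContDiff ℝ ∞ fun x => X x j := fun j =>
    (EuclideanSpace.proj j : EuclideanSpace ℝ (Fin n) →L[ℝ] ℝ).contDiff.comp hX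
  have hX1 : ∀ j, ContDiff ℝ 1 fun x => X x j := fun j => (hXs j).of_le (by norm_cast)
  obtain ⟨B, hB0, hB⟩ := hΩ.exists_bound hX.continuous
  have hD : ∀ j, ∃ D, 0 < D ∧ ∀ x ∈ closure Ω, ‖fderiv ℝ (fun x => X x j) x‖ ≤ D := fun j =>
    hΩ.exists_bound ((hX1 j).continuous_fderiv one_ne_zero)
  choose D hD0 hD using hD
  set K₁ : ℝ := ∑ _i : Fin n, ∑ j : Fin n, 2 * D j with hK₁
  have hK₁0 : 0 ≤ K₁ := Finset.sum_nonneg fun i _ => Finset.sum_nonneg fun j _ => by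
    linarith [hD0 j]
  -- `K₁` bounds the interior terms through the derivatives of `X`. The summand `B² / (2c)` comes
  -- from Young's inequality on the boundary.
  refine ⟨K₁ + B ^ 2 / (2 * c), by positivity, fun f F A h => ?_⟩
  have hFm := h.memLp_grad_boundary hm hn hΩ
  have hF2 : Integrable (fun x => ‖F x‖ ^ 2) (volume.restrict Ω) :=
    h.trace.1.memLp_gradient.integrable_norm_pow (by norm_num)
  have hFν : Integrable (fun x => inner ℝ (F x) (outerNormal Ω x) ^ 2) m := by
    refine (hFm.integrable_norm_pow (p := 2) (by norm_num)).mono'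
      ((hFm.1.inner (hm.aestronglyMeasurable_outerNormal hn hΩ)).pow 2) ?_
    filter_upwards [hm.ae_norm_outerNormal hΩ] with x hx
    have := norm_inner_le_norm (𝕜 := ℝ) (F x) (outerNormal Ω x)
    rw [hx, mul_one] at this
    rw [norm_pow]
    exact pow_le_pow_left₀ (norm_nonneg _) this 2
  have hFi := fun k => memLp_of_hasTrace hm hn hΩ (h.trace_grad k) (h.measurable_grad_coord k)
  have hbd : ∀ i j, Integrable (fun x => X x j * (F x i * F x j) * outerNormal Ω x i -
      (1 / 2) * (X x j * (F x i * F x i) * outerNormal Ω x j)) m := fun i j =>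
    (hm.integrable_mul_mul hn hΩ (hX1 j).continuous (hFi i) (hFi j) i).sub
      ((hm.integrable_mul_mul hn hΩ (hX1 j).continuous (hFi i) (hFi i) j).const_mul (1 / 2))
  have hAint := fun i j => h.integrable_hess_mul hΩ (hX1 j).continuous i j
  have hRint := fun i j => h.integrable_rellichInterior hΩ (hX1 j) i j
  have e2 : ∀ x, inner ℝ (F x) (outerNormal Ω x) * inner ℝ (X x) (F x) -
      (1 / 2) * (‖F x‖ ^ 2 * inner ℝ (X x) (outerNormal Ω x)) =
      ∑ i, ∑ j, (X x j * (F x i * F x j) * outerNormal Ω x i -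
        (1 / 2) * (X x j * (F x i * F x i) * outerNormal Ω x j)) := fun x => by
    rw [inner_eq_sum, inner_eq_sum, inner_eq_sum, norm_sq_eq_sum, Finset.sum_mul_sum,
      Finset.sum_mul_sum, Finset.mul_sum, ← Finset.sum_sub_distrib]
    refine Finset.sum_congr rfl fun i _ => ?_
    rw [Finset.mul_sum, ← Finset.sum_sub_distrib]
    exact Finset.sum_congr rfl fun j _ => by ring
  have hsum : (∫ x in Ω, (∑ i, A x i i) * inner ℝ (X x) (F x)) +
      ∫ x in Ω, ∑ i, ∑ j, rellichInterior F (fun x => X x j) i j x =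
      ∫ x, (inner ℝ (F x) (outerNormal Ω x) * inner ℝ (X x) (F x) -
        (1 / 2) * (‖F x‖ ^ 2 * inner ℝ (X x) (outerNormal Ω x))) ∂m := by
    have e1 : ∀ x, (∑ i, A x i i) * inner ℝ (X x) (F x) =
        ∑ i, ∑ j, A x i i * (X x j * F x j) := fun x => by
      rw [inner_eq_sum, Finset.sum_mul_sum]
    simp only [e1, e2]
    rw [integral_finsetSum _ fun i _ => integrable_finsetSum _ fun j _ => hAint i j,
      integral_finsetSum _ fun i _ => integrable_finsetSum _ fun j _ => hRint i j,
      integral_finsetSum _ fun i _ => integrable_finsetSum _ fun j _ => hbd i j,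
      ← Finset.sum_add_distrib]
    refine Finset.sum_congr rfl fun i _ => ?_
    rw [integral_finsetSum _ fun j _ => hAint i j, integral_finsetSum _ fun j _ => hRint i j,
      integral_finsetSum _ fun j _ => hbd i j, ← Finset.sum_add_distrib]
    refine Finset.sum_congr rfl fun j _ => ?_
    rw [← integral_add (hAint i j) (hRint i j)]
    exact h.rellich_coord hm hn hΩ (hXs j) i j
  have hint : -(K₁ * ∫ x in Ω, ‖F x‖ ^ 2) ≤
      ∫ x in Ω, ∑ i, ∑ j, rellichInterior F (fun x => X x j) i j x := by
    rw [← integral_const_mul, ← integral_neg]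
    refine integral_mono_ae (hF2.const_mul _).neg
      (integrable_finsetSum _ fun i _ => integrable_finsetSum _ fun j _ => hRint i j) ?_
    filter_upwards [ae_restrict_mem hΩ.isOpen.measurableSet] with x hx
    rw [neg_le, hK₁, Finset.sum_mul, ← Finset.sum_neg_distrib]
    refine Finset.sum_le_sum fun i _ => ?_
    rw [Finset.sum_mul, ← Finset.sum_neg_distrib]
    refine Finset.sum_le_sum fun j _ => ?_
    have hder : ∀ k, |fderiv ℝ (fun x => X x j) x (EuclideanSpace.single k 1)| ≤ D j := fun k => by
      have := (fderiv ℝ (fun x => X x j) x).le_opNorm (EuclideanSpace.single k (1 : ℝ))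
      rw [PiLp.norm_single, norm_one, mul_one] at this
      exact this.trans (hD j x (subset_closure hx))
    have hF : ∀ k, |F x k| ≤ ‖F x‖ := fun k => PiLp.norm_apply_le (F x) k
    have hFF : ∀ k l, |F x k * F x l| ≤ ‖F x‖ ^ 2 := fun k l => by
      rw [abs_mul, sq]
      exact mul_le_mul (hF k) (hF l) (abs_nonneg _) (norm_nonneg _)
    have t1 : |F x i * F x j * fderiv ℝ (fun x => X x j) x (EuclideanSpace.single i 1)| ≤
        ‖F x‖ ^ 2 * D j := by
      rw [abs_mul]
      exact mul_le_mul (hFF i j) (hder i) (abs_nonneg _) (by positivity)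
    have t2 : |F x i * F x i * fderiv ℝ (fun x => X x j) x (EuclideanSpace.single j 1)| ≤
        ‖F x‖ ^ 2 * D j := by
      rw [abs_mul]
      exact mul_le_mul (hFF i i) (hder j) (abs_nonneg _) (by positivity)
    rw [abs_le] at t1 t2
    rw [rellichInterior]
    have : 0 ≤ ‖F x‖ ^ 2 * D j := mul_nonneg (by positivity) (hD0 j).le
    linarith [t1.1, t2.2]
  -- The term `-(1/2)|F|² X · ν ≤ -(c/2)|F|²` absorbs the full gradient appearing in `(F · ν)(X ·
  -- F)`, so that only the normal derivative survives. This is the point where transversality of `X`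
  -- is used.
  have hbdle : ∫ x, (inner ℝ (F x) (outerNormal Ω x) * inner ℝ (X x) (F x) -
        (1 / 2) * (‖F x‖ ^ 2 * inner ℝ (X x) (outerNormal Ω x))) ∂m ≤
      B ^ 2 / (2 * c) * ∫ x, inner ℝ (F x) (outerNormal Ω x) ^ 2 ∂m := by
    rw [← integral_const_mul]
    refine integral_mono_ae ?_ (hFν.const_mul _) ?_
    · simp only [e2]
      exact integrable_finsetSum _ fun i _ => integrable_finsetSum _ fun j _ => hbd i j
    filter_upwards [hm.ae_mem_frontier] with x hx
    have h1 := hXc x hx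
    have h2 : |inner ℝ (X x) (F x)| ≤ B * ‖F x‖ := (norm_inner_le_norm (𝕜 := ℝ) _ _).trans
      (mul_le_mul_of_nonneg_right (hB x (frontier_subset_closure hx)) (norm_nonneg _))
    set a := inner ℝ (F x) (outerNormal Ω x)
    have h3 : a * inner ℝ (X x) (F x) ≤ |a| * (B * ‖F x‖) := by
      refine (le_abs_self _).trans ?_
      rw [abs_mul]
      exact mul_le_mul_of_nonneg_left h2 (abs_nonneg _)
    have h4 : |a| * (B * ‖F x‖) ≤ (1 / 2) * (‖F x‖ ^ 2 * c) + B ^ 2 / (2 * c) * a ^ 2 := by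
      have h5 : (1 / 2) * (‖F x‖ ^ 2 * c) + B ^ 2 / (2 * c) * a ^ 2 - |a| * (B * ‖F x‖) =
          (c * ‖F x‖ - B * |a|) ^ 2 / (2 * c) := by
        rw [← sq_abs a]
        field_simp
        ring
      have h6 : 0 ≤ (c * ‖F x‖ - B * |a|) ^ 2 / (2 * c) := by positivity
      linarith
    have h7 := mul_le_mul_of_nonneg_left h1 (by positivity : 0 ≤ ‖F x‖ ^ 2)
    linarith
  have p1 : 0 ≤ ∫ x in Ω, ‖F x‖ ^ 2 := integral_nonneg fun x => by positivity
  have p2 : 0 ≤ ∫ x, inner ℝ (F x) (outerNormal Ω x) ^ 2 ∂m := integral_nonneg fun x => by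
    positivity
  have p3 : 0 ≤ B ^ 2 / (2 * c) := by positivity
  nlinarith [mul_nonneg p3 p1, mul_nonneg hK₁0 p2]

end

section

variable {n : ℕ} {Ω : Set (EuclideanSpace ℝ (Fin n))}
  {m : Measure (EuclideanSpace ℝ (Fin n))} {C : ℝ≥0}

/-! ### The potential energy on the boundary -/

theorem integrable_doubleWell {α : Type*} [MeasurableSpace α] {μ : Measure α} [IsFiniteMeasure μ]
    {f : α → ℝ} (hf : AEStronglyMeasurable f μ)
    (h : MemLp (fun x => deriv doubleWell (f x)) 2 μ) :
    Integrable (fun x => doubleWell (f x)) μ := by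
  have h1 : Integrable (fun x => 1 / 2 + (deriv doubleWell (f x)) ^ 2 / 8) μ :=
    (integrable_const _).add (h.integrable_sq.div_const 8)
  refine h1.mono' (continuous_doubleWell.comp_aestronglyMeasurable hf)
    (Eventually.of_forall fun x => ?_)
  rw [Real.norm_of_nonneg (doubleWell_nonneg _)]
  exact doubleWell_le _

theorem IsSmoothBoundedDomain.memLp_inner (hΩ : IsSmoothBoundedDomain Ω)
    {X F : EuclideanSpace ℝ (Fin n) → EuclideanSpace ℝ (Fin n)} (hX : Continuous X)
    (hF : MemLp F 2 (volume.restrict Ω)) :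
    MemLp (fun x => inner ℝ (X x) (F x)) 2 (volume.restrict Ω) := by
  obtain ⟨B, -, hB⟩ := hΩ.exists_bound hX
  refine (hF.norm.const_mul B).mono' (hX.aestronglyMeasurable.inner hF.1) ?_
  filter_upwards [ae_restrict_mem hΩ.isOpen.measurableSet] with x hx
  exact (norm_inner_le_norm _ _).trans
    (mul_le_mul_of_nonneg_right (hB x (subset_closure hx)) (norm_nonneg _))

/-- This is the divergence theorem for the field `W(f) X`, bounded below on the boundary by `X · ν ≥
c`. As `f` may be unbounded, it is applied to the truncated wells. The limit uses Fatou's lemma on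
the boundary and dominated convergence inside. The left side is a lower integral because its
finiteness is part of the conclusion. -/
theorem exists_potential_le (hm : IsDivergenceMeasure Ω m C) (hn : 0 < n)
    (hΩ : IsSmoothBoundedDomain Ω) {X : EuclideanSpace ℝ (Fin n) → EuclideanSpace ℝ (Fin n)}
    {c : ℝ} (hX : ContDiff ℝ ∞ X) (hc : 0 < c)
    (hXc : ∀ x ∈ frontier Ω, c ≤ inner ℝ (X x) (outerNormal Ω x)) :
    ∃ K : ℝ, 0 < K ∧ ∀ f F A, IsRegularSlice Ω f F A →
      MemLp (fun x => deriv doubleWell (f x)) 2 (volume.restrict Ω) →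
      ENNReal.ofReal c * ∫⁻ x, ENNReal.ofReal (doubleWell (f x)) ∂m ≤
        ENNReal.ofReal (K * (∫ x in Ω, doubleWell (f x)) +
          ∫ x in Ω, deriv doubleWell (f x) * inner ℝ (X x) (F x)) := by
  have hXs : ∀ j, ContDiff ℝ ∞ fun x => X x j := fun j =>
    (EuclideanSpace.proj j : EuclideanSpace ℝ (Fin n) →L[ℝ] ℝ).contDiff.comp hX
  have hX1 : ∀ j, ContDiff ℝ 1 fun x => X x j := fun j => (hXs j).of_le (by norm_cast)
  have hdiv : Continuous fun x => ∑ j, fderiv ℝ (fun x => X x j) x (EuclideanSpace.single j 1) :=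
    continuous_finsetSum _ fun j _ =>
      ((hX1 j).continuous_fderiv one_ne_zero).clm_apply continuous_const
  obtain ⟨K, hK0, hK⟩ := hΩ.exists_bound hdiv
  refine ⟨K, hK0, fun f F A h hW' => ?_⟩
  have := hΩ.isFiniteMeasure
  have := hm.isFiniteMeasure hn hΩ
  have hfm := memLp_of_hasTrace hm hn hΩ h.trace h.measurable
  have hW : Integrable (fun x => doubleWell (f x)) (volume.restrict Ω) :=
    integrable_doubleWell h.trace.1.memLp.1 hW'
  have hXF := hΩ.memLp_inner hX.continuous h.trace.1.memLp_gradient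
  have hνX : ContinuousOn (fun x => inner ℝ (X x) (outerNormal Ω x)) (frontier Ω) :=
    hX.continuous.continuousOn.inner (continuousOn_outerNormal hn hΩ)
  -- the inequality for the truncated potential
  have hM : ∀ k : ℕ, ENNReal.ofReal c *
      ∫⁻ x, ENNReal.ofReal (truncatedWell (k + 1) (f x)) ∂m ≤
      ENNReal.ofReal (K * (∫ x in Ω, doubleWell (f x)) +
        ∫ x in Ω, deriv doubleWell (clamp (k + 1) (f x)) * inner ℝ (X x) (F x)) := by
    intro k
    have hk : (1 : ℝ) ≤ k + 1 := by
      have : (0 : ℝ) ≤ k := k.cast_nonneg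
      linarith
    set M : ℝ := k + 1
    obtain ⟨L, hL⟩ := lipschitzWith_deriv_clamp hk
    have hwt := h.trace.comp_hasWeakTrace hm hn hΩ h.measurable
      (hasDerivAt_truncatedWell M) hL (norm_deriv_clamp_le_const hk)
    have hGm := hwt.memLp_trace
    have hGint : Integrable (fun x => truncatedWell M (f x)) m := hGm.integrable (by norm_num)
    have hIj1 : ∀ j, Integrable (fun x => truncatedWell M (f x) *
        fderiv ℝ (fun x => X x j) x (EuclideanSpace.single j 1)) (volume.restrict Ω) := fun j =>
      integrable_mul_of_memLp hwt.memLp (hΩ.memLp_of_continuous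
        (((hX1 j).continuous_fderiv one_ne_zero).clm_apply continuous_const))
    have hIj2 : ∀ j, Integrable (fun x => X x j *
        inner ℝ (deriv doubleWell (clamp M (f x)) • F x) (EuclideanSpace.single j (1 : ℝ)))
        (volume.restrict Ω) := fun j =>
      integrable_mul_of_memLp (hΩ.memLp_of_continuous (hX1 j).continuous)
        (memLp_inner_const hwt.memLp_gradient _)
    have hIb : ∀ j, Integrable (fun x => X x j * truncatedWell M (f x) *
        inner ℝ (outerNormal Ω x) (EuclideanSpace.single j (1 : ℝ))) m := by
      intro j
      simp only [inner_single]
      have h1 : MemLp (fun _ => (1 : ℝ)) 2 m := memLp_const _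
      simpa using hm.integrable_mul_mul hn hΩ (hX1 j).continuous hGm h1 j
    have hsum : ∫ x in Ω, (truncatedWell M (f x) *
          (∑ j, fderiv ℝ (fun x => X x j) x (EuclideanSpace.single j 1)) +
          deriv doubleWell (clamp M (f x)) * inner ℝ (X x) (F x)) =
        ∫ x, truncatedWell M (f x) * inner ℝ (X x) (outerNormal Ω x) ∂m := by
      have e1 : ∀ x, truncatedWell M (f x) *
          (∑ j, fderiv ℝ (fun x => X x j) x (EuclideanSpace.single j 1)) +
          deriv doubleWell (clamp M (f x)) * inner ℝ (X x) (F x) =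
          ∑ j, (truncatedWell M (f x) * fderiv ℝ (fun x => X x j) x (EuclideanSpace.single j 1) +
            X x j * inner ℝ (deriv doubleWell (clamp M (f x)) • F x)
              (EuclideanSpace.single j (1 : ℝ))) := fun x => by
        simp only [inner_single, PiLp.smul_apply, smul_eq_mul]
        rw [Finset.sum_add_distrib, Finset.mul_sum, inner_eq_sum, Finset.mul_sum]
        congr 1
        exact Finset.sum_congr rfl fun j _ => by ring
      have e2 : ∀ x, truncatedWell M (f x) * inner ℝ (X x) (outerNormal Ω x) =
          ∑ j, X x j * truncatedWell M (f x) *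
            inner ℝ (outerNormal Ω x) (EuclideanSpace.single j (1 : ℝ)) := fun x => by
        simp only [inner_single]
        rw [inner_eq_sum, Finset.mul_sum]
        exact Finset.sum_congr rfl fun j _ => by ring
      simp only [e1, e2]
      have hIj : ∀ j, Integrable (fun x => truncatedWell M (f x) *
          fderiv ℝ (fun x => X x j) x (EuclideanSpace.single j 1) +
          X x j * inner ℝ (deriv doubleWell (clamp M (f x)) • F x)
            (EuclideanSpace.single j (1 : ℝ))) (volume.restrict Ω) :=
        fun j => (hIj1 j).add (hIj2 j)
      rw [integral_finsetSum _ fun j _ => hIj j, integral_finsetSum _ fun j _ => hIb j]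
      exact Finset.sum_congr rfl fun j _ =>
        hwt.integral_eq (fun x => X x j) (hXs j) (EuclideanSpace.single j 1)
    have hi1 : Integrable (fun x => truncatedWell M (f x) *
        (∑ j, fderiv ℝ (fun x => X x j) x (EuclideanSpace.single j 1))) (volume.restrict Ω) :=
      integrable_mul_of_memLp hwt.memLp (hΩ.memLp_of_continuous hdiv)
    have hi2 : Integrable (fun x => deriv doubleWell (clamp M (f x)) * inner ℝ (X x) (F x))
        (volume.restrict Ω) :=
      integrable_mul_of_memLp (memLp_two_comp hL h.trace.1.memLp) hXF
    rw [integral_add hi1 hi2] at hsum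
    have hle1 : ∫ x in Ω, truncatedWell M (f x) *
        (∑ j, fderiv ℝ (fun x => X x j) x (EuclideanSpace.single j 1)) ≤
        K * ∫ x in Ω, doubleWell (f x) := by
      rw [← integral_const_mul]
      refine integral_mono_ae hi1 (hW.const_mul K) ?_
      filter_upwards [ae_restrict_mem hΩ.isOpen.measurableSet] with x hx
      have h1 := (le_abs_self _).trans (hK x (subset_closure hx))
      calc
        _ ≤ truncatedWell M (f x) * K :=
          mul_le_mul_of_nonneg_left h1 (truncatedWell_nonneg hk _)
        _ ≤ doubleWell (f x) * K := mul_le_mul_of_nonneg_right (truncatedWell_le hk _) hK0.le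
        _ = _ := mul_comm _ _
    have hle2 : c * ∫ x, truncatedWell M (f x) ∂m ≤
        ∫ x, truncatedWell M (f x) * inner ℝ (X x) (outerNormal Ω x) ∂m := by
      rw [← integral_const_mul]
      refine integral_mono_ae (hGint.const_mul c) ?_ ?_
      · have e2 : ∀ x, truncatedWell M (f x) * inner ℝ (X x) (outerNormal Ω x) =
            ∑ j, X x j * truncatedWell M (f x) *
              inner ℝ (outerNormal Ω x) (EuclideanSpace.single j (1 : ℝ)) := fun x => by
          simp only [inner_single]
          rw [inner_eq_sum, Finset.mul_sum]
          exact Finset.sum_congr rfl fun j _ => by ring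
        simp only [e2]
        exact integrable_finsetSum _ fun j _ => hIb j
      · filter_upwards [hm.ae_mem_frontier] with x hx
        rw [mul_comm]
        exact mul_le_mul_of_nonneg_left (hXc x hx) (truncatedWell_nonneg hk _)
    rw [← ofReal_integral_eq_lintegral_ofReal hGint
      (Eventually.of_forall fun x => truncatedWell_nonneg hk _), ← ENNReal.ofReal_mul hc.le]
    exact ENNReal.ofReal_le_ofReal (by linarith)
  -- passage to the limit
  have hlim : Tendsto (fun k : ℕ => ∫ x in Ω, deriv doubleWell (clamp (k + 1) (f x)) *
      inner ℝ (X x) (F x)) atTop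
      (𝓝 (∫ x in Ω, deriv doubleWell (f x) * inner ℝ (X x) (F x))) := by
    refine tendsto_integral_of_dominated_convergence
      (fun x => ‖deriv doubleWell (f x) * inner ℝ (X x) (F x)‖) (fun k => ?_)
      (integrable_mul_of_memLp hW' hXF).norm (fun k => Eventually.of_forall fun x => ?_)
      (Eventually.of_forall fun x => ?_)
    · exact ((continuous_deriv_doubleWell_clamp _).comp_aestronglyMeasurable
        h.trace.1.memLp.1).mul hXF.1
    · rw [norm_mul, norm_mul]
      refine mul_le_mul_of_nonneg_right (abs_deriv_clamp_le ?_ _) (norm_nonneg _)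
      have : (0 : ℝ) ≤ k := k.cast_nonneg
      linarith
    · refine tendsto_const_nhds.congr' ?_
      filter_upwards [eventually_ge_atTop ⌈|f x|⌉₊] with k hk
      rw [clamp_of_abs_le]
      have := (Nat.le_ceil |f x|).trans (Nat.cast_le (α := ℝ).2 hk)
      linarith
  have hfatou : ∫⁻ x, ENNReal.ofReal (doubleWell (f x)) ∂m ≤
      liminf (fun k : ℕ => ∫⁻ x, ENNReal.ofReal (truncatedWell (k + 1) (f x)) ∂m) atTop := by
    refine le_trans (lintegral_mono fun x => ?_) (lintegral_liminf_le' fun k => ?_)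
    · refine le_of_eq (Tendsto.liminf_eq ?_).symm
      refine tendsto_const_nhds.congr' ?_
      filter_upwards [eventually_ge_atTop ⌈|f x|⌉₊] with k hk
      rw [truncatedWell_eq]
      have := (Nat.le_ceil |f x|).trans (Nat.cast_le (α := ℝ).2 hk)
      linarith
    · have : Continuous (truncatedWell (k + 1)) :=
        continuous_iff_continuousAt.2 fun s => (hasDerivAt_truncatedWell _ s).continuousAt
      exact (this.comp_aestronglyMeasurable hfm.1).aemeasurable.ennreal_ofReal
  have hlim' := (ENNReal.continuous_ofReal.tendsto _).comp
    (hlim.const_add (K * ∫ x in Ω, doubleWell (f x)))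
  calc
    _ ≤ ENNReal.ofReal c *
        liminf (fun k : ℕ => ∫⁻ x, ENNReal.ofReal (truncatedWell (k + 1) (f x)) ∂m) atTop := by
        gcongr
    _ = liminf (fun k : ℕ => ENNReal.ofReal c *
        ∫⁻ x, ENNReal.ofReal (truncatedWell (k + 1) (f x)) ∂m) atTop :=
        (ENNReal.liminf_const_mul_of_ne_top ENNReal.ofReal_ne_top).symm
    _ ≤ liminf (fun k : ℕ => ENNReal.ofReal (K * (∫ x in Ω, doubleWell (f x)) +
        ∫ x in Ω, deriv doubleWell (clamp (k + 1) (f x)) * inner ℝ (X x) (F x))) atTop :=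
        liminf_le_liminf (Eventually.of_forall hM)
    _ = _ := hlim'.liminf_eq

/-- For a function that satisfies the Allen–Cahn equation at a fixed time, the potential energy on
the boundary is controlled by the interior energy and the normal derivative. -/
theorem exists_boundary_potential_le (hm : IsDivergenceMeasure Ω m C) (hn : 0 < n)
    (hΩ : IsSmoothBoundedDomain Ω) :
    ∃ K : ℝ, 0 < K ∧ ∀ ε : ℝ, 0 < ε → ∀ f F A, IsRegularSlice Ω f F A → ∀ d,
      MemLp d 2 (volume.restrict Ω) →
      (∀ᵐ x ∂(volume.restrict Ω), d x = (∑ i, A x i i) - (ε ^ 2)⁻¹ * deriv doubleWell (f x)) →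
      ∫⁻ x, ENNReal.ofReal (doubleWell (f x) / ε) ∂m ≤
        ENNReal.ofReal (K * (energy Ω ε f F + ε * (∫ x in Ω, d x ^ 2) +
          ε * ∫ x, inner ℝ (F x) (outerNormal Ω x) ^ 2 ∂m)) := by
  obtain ⟨X, c, hX, hc, hXc⟩ := exists_transversal_field hn hΩ
  obtain ⟨K₁, hK₁, hR⟩ := exists_rellich_le hm hn hΩ hX hc hXc
  obtain ⟨K₂, hK₂, hP⟩ := exists_potential_le hm hn hΩ hX hc hXc
  obtain ⟨B, hB0, hB⟩ := hΩ.exists_bound hX.continuous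
  refine ⟨c⁻¹ * (K₂ + 2 * K₁ + 2 * B), by positivity, fun ε hε f F A h d hd heq => ?_⟩
  have := hΩ.isFiniteMeasure
  have hΔ : MemLp (fun x => ∑ i, A x i i) 2 (volume.restrict Ω) :=
    memLp_finsetSum _ fun i _ => h.memLp_hess i i
  -- Solving the equation for `W'(f)` shows that it is in `L²`, and turns `∫ W'(f) X · F` into `ε²`
  -- times a Rellich term minus a term with `d`, the latter estimated by Young's inequality.
  have hWeq : ∀ᵐ x ∂(volume.restrict Ω),
      deriv doubleWell (f x) = ε ^ 2 * ((∑ i, A x i i) - d x) := by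
    filter_upwards [heq] with x hx
    rw [hx]
    field_simp
    ring
  have hW' : MemLp (fun x => deriv doubleWell (f x)) 2 (volume.restrict Ω) :=
    ((hΔ.sub hd).const_mul (ε ^ 2)).ae_eq (hWeq.mono fun x hx => hx.symm)
  have hW := integrable_doubleWell h.trace.1.memLp.1 hW'
  have hXF := hΩ.memLp_inner hX.continuous h.trace.1.memLp_gradient
  have hF2 : Integrable (fun x => ‖F x‖ ^ 2) (volume.restrict Ω) :=
    h.trace.1.memLp_gradient.integrable_norm_pow (by norm_num)
  have h1 := hR f F A h
  have h2 := hP f F A h hW'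
  have h3 : ∫ x in Ω, deriv doubleWell (f x) * inner ℝ (X x) (F x) =
      ε ^ 2 * ((∫ x in Ω, (∑ i, A x i i) * inner ℝ (X x) (F x)) -
        ∫ x in Ω, d x * inner ℝ (X x) (F x)) := by
    rw [← integral_sub (integrable_mul_of_memLp hΔ hXF) (integrable_mul_of_memLp hd hXF),
      ← integral_const_mul]
    refine integral_congr_ae ?_
    filter_upwards [hWeq] with x hx
    rw [hx]
    ring
  have h4 : -∫ x in Ω, d x * inner ℝ (X x) (F x) ≤
      B * ((∫ x in Ω, d x ^ 2) + ∫ x in Ω, ‖F x‖ ^ 2) := by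
    rw [← integral_add hd.integrable_sq hF2, ← integral_const_mul, ← integral_neg]
    refine integral_mono_ae (integrable_mul_of_memLp hd hXF).neg
      ((hd.integrable_sq.add hF2).const_mul B) ?_
    filter_upwards [ae_restrict_mem hΩ.isOpen.measurableSet] with x hx
    have h5 : |inner ℝ (X x) (F x)| ≤ B * ‖F x‖ := (norm_inner_le_norm (𝕜 := ℝ) _ _).trans
      (mul_le_mul_of_nonneg_right (hB x (subset_closure hx)) (norm_nonneg _))
    have h6 : -(d x * inner ℝ (X x) (F x)) ≤ |d x| * (B * ‖F x‖) := by
      refine (neg_le_abs _).trans ?_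
      rw [abs_mul]
      exact mul_le_mul_of_nonneg_left h5 (abs_nonneg _)
    refine h6.trans ?_
    rw [← sq_abs (d x)]
    nlinarith [mul_nonneg hB0.le (sq_nonneg (|d x| - ‖F x‖)),
      mul_nonneg hB0.le (sq_nonneg (|d x|)), mul_nonneg hB0.le (sq_nonneg ‖F x‖)]
  have henergy : energy Ω ε f F =
      ε / 2 * (∫ x in Ω, ‖F x‖ ^ 2) + ε⁻¹ * ∫ x in Ω, doubleWell (f x) := by
    rw [energy, ← integral_const_mul, ← integral_const_mul, ← integral_add (hF2.const_mul _)
      (hW.const_mul _)]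
    congr 1 with x
    ring
  have p1 : 0 ≤ ∫ x in Ω, ‖F x‖ ^ 2 := integral_nonneg fun x => by positivity
  have p2 : 0 ≤ ∫ x, inner ℝ (F x) (outerNormal Ω x) ^ 2 ∂m := integral_nonneg fun x => by
    positivity
  have p3 : 0 ≤ ∫ x in Ω, d x ^ 2 := integral_nonneg fun x => by positivity
  have p4 : 0 ≤ ∫ x in Ω, doubleWell (f x) := integral_nonneg fun x => doubleWell_nonneg _
  have hL : ∫⁻ x, ENNReal.ofReal (doubleWell (f x) / ε) ∂m =
      ENNReal.ofReal (c⁻¹ * ε⁻¹) * (ENNReal.ofReal c *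
        ∫⁻ x, ENNReal.ofReal (doubleWell (f x)) ∂m) := by
    rw [← mul_assoc, ← ENNReal.ofReal_mul (by positivity), ← lintegral_const_mul' _ _ (by simp)]
    congr 1 with x
    rw [← ENNReal.ofReal_mul (by positivity)]
    congr 1
    field_simp
  rw [hL]
  refine (mul_le_mul_right h2 _).trans ?_
  rw [← ENNReal.ofReal_mul (by positivity)]
  refine ENNReal.ofReal_le_ofReal ?_
  rw [h3, henergy]
  set a := ∫ x in Ω, ‖F x‖ ^ 2
  set b := ∫ x, inner ℝ (F x) (outerNormal Ω x) ^ 2 ∂m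
  set e := ∫ x in Ω, d x ^ 2
  set w := ∫ x in Ω, doubleWell (f x)
  rw [mul_assoc, mul_assoc]
  refine mul_le_mul_of_nonneg_left ?_ (by positivity)
  have hle : ε⁻¹ * (K₂ * w + ε ^ 2 * ((∫ x in Ω, (∑ i, A x i i) * inner ℝ (X x) (F x)) -
      ∫ x in Ω, d x * inner ℝ (X x) (F x))) ≤
      ε⁻¹ * (K₂ * w + ε ^ 2 * (K₁ * (a + b) + B * (e + a))) := by
    refine mul_le_mul_of_nonneg_left ?_ (by positivity)
    have := mul_le_mul_of_nonneg_left (add_le_add h1 h4) (sq_nonneg ε)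
    linarith
  refine hle.trans ?_
  have heq2 : ε⁻¹ * (K₂ * w + ε ^ 2 * (K₁ * (a + b) + B * (e + a))) =
      K₂ * (ε⁻¹ * w) + ε * (K₁ * (a + b) + B * (e + a)) := by
    field_simp
  rw [heq2]
  have q1 : 0 ≤ ε⁻¹ * w := by positivity
  have q2 : 0 ≤ ε * a := by positivity
  have q3 : 0 ≤ ε * b := by positivity
  have q4 : 0 ≤ ε * e := by positivity
  nlinarith [mul_nonneg hK₁.le q1, mul_nonneg hK₁.le q2, mul_nonneg hK₁.le q3,
    mul_nonneg hK₁.le q4, mul_nonneg hK₂.le q2, mul_nonneg hK₂.le q3, mul_nonneg hK₂.le q4,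
    mul_nonneg hB0.le q1, mul_nonneg hB0.le q2, mul_nonneg hB0.le q3, mul_nonneg hB0.le q4]

end

section

/-! ### Steklov averages -/

section Steklov

variable {X : Type*}

/-- The average of `b(x, ·)` over the interval with endpoints `t` and `t + h`. -/
def steklov (h : ℝ) (b : X × ℝ → ℝ) (z : X × ℝ) : ℝ :=
  ∫ θ in Ioc (0 : ℝ) 1, b (z.1, z.2 + h * θ)

/-- Averaging over `θ` in the unit interval, rather than dividing by `h`, makes this identity valid
for every real `h`. Negative `h` gives the backward averages used below. -/
theorem mul_steklov (h : ℝ) (b : X × ℝ → ℝ) (x : X) (t : ℝ) :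
    h * steklov h b (x, t) = ∫ s in t..t + h, b (x, s) := by
  have := intervalIntegral.mul_integral_comp_add_mul (a := 0) (b := 1) (f := fun s => b (x, s)) h t
  simp only [mul_zero, add_zero, mul_one] at this
  rw [← this, steklov, intervalIntegral.integral_of_le zero_le_one]

variable [MeasurableSpace X] {μ : Measure X}

theorem sq_lintegral_mul_le {f g : X → ℝ≥0∞} (hf : AEMeasurable f μ) (hg : AEMeasurable g μ) :
    (∫⁻ x, f x * g x ∂μ) ^ 2 ≤ (∫⁻ x, f x ^ 2 ∂μ) * ∫⁻ x, g x ^ 2 ∂μ := by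
  have h := ENNReal.lintegral_mul_le_Lp_mul_Lq μ Real.HolderConjugate.two_two hf hg
  simp only [Pi.mul_apply, ENNReal.rpow_two] at h
  calc
    _ ≤ ((∫⁻ x, f x ^ 2 ∂μ) ^ (1 / (2 : ℝ)) * (∫⁻ x, g x ^ 2 ∂μ) ^ (1 / (2 : ℝ))) ^ 2 := by
        gcongr
    _ = _ := by
        rw [mul_pow, ← ENNReal.rpow_two, ← ENNReal.rpow_two, ← ENNReal.rpow_mul,
          ← ENNReal.rpow_mul]
        norm_num

theorem measurable_steklov {b : X × ℝ → ℝ} (hb : Measurable b) (h : ℝ) :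
    Measurable (steklov h b) := by
  have : StronglyMeasurable fun w : (X × ℝ) × ℝ => b (w.1.1, w.1.2 + h * w.2) := by
    refine (hb.comp ?_).stronglyMeasurable
    fun_prop
  exact (this.integral_prod_right' (ν := volume.restrict (Ioc (0 : ℝ) 1))).measurable

/-- Cauchy–Schwarz in `θ` on an interval of length one and translation invariance in time. The
constant `1` matters in the Fatou argument of `le_integral_mul_of_steklov`. -/
theorem lintegral_steklov_sq_le [SFinite μ] {b : X × ℝ → ℝ} (hb : Measurable b) (h : ℝ) :
    ∫⁻ z, ‖steklov h b z‖ₑ ^ 2 ∂(μ.prod volume) ≤ ∫⁻ z, ‖b z‖ₑ ^ 2 ∂(μ.prod volume) := by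
  have hm : Measurable fun w : (X × ℝ) × ℝ => ‖b (w.1.1, w.1.2 + h * w.2)‖ₑ ^ 2 := by
    fun_prop
  calc
    _ ≤ ∫⁻ z, (∫⁻ θ in Ioc (0 : ℝ) 1, ‖b (z.1, z.2 + h * θ)‖ₑ ^ 2) ∂(μ.prod volume) := by
        refine lintegral_mono fun z => ?_
        have h1 : ‖steklov h b z‖ₑ ≤ ∫⁻ θ in Ioc (0 : ℝ) 1, ‖b (z.1, z.2 + h * θ)‖ₑ :=
          enorm_integral_le_lintegral_enorm _
        have h2 := sq_lintegral_mul_le (μ := volume.restrict (Ioc (0 : ℝ) 1))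
          (f := fun θ => ‖b (z.1, z.2 + h * θ)‖ₑ) (g := fun _ => 1) (by fun_prop) (by fun_prop)
        simp only [mul_one, one_pow, lintegral_const, Measure.restrict_apply_univ,
          Real.volume_Ioc, sub_zero, ENNReal.ofReal_one] at h2
        exact (pow_le_pow_left₀ zero_le h1 2).trans h2
    _ = ∫⁻ θ in Ioc (0 : ℝ) 1, ∫⁻ z, ‖b (z.1, z.2 + h * θ)‖ₑ ^ 2 ∂(μ.prod volume) :=
        lintegral_lintegral_swap hm.aemeasurable
    _ = ∫⁻ _ in Ioc (0 : ℝ) 1, ∫⁻ z, ‖b z‖ₑ ^ 2 ∂(μ.prod volume) := by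
        congr 1 with θ
        rw [lintegral_prod _ (by fun_prop), lintegral_prod _ (by fun_prop)]
        congr 1 with x
        exact lintegral_add_right_eq_self (fun t => ‖b (x, t)‖ₑ ^ 2) (h * θ)
    _ = _ := by simp

theorem memLp_steklov [SFinite μ] {b : X × ℝ → ℝ} (hb : Measurable b)
    (hb2 : MemLp b 2 (μ.prod volume)) (h : ℝ) : MemLp (steklov h b) 2 (μ.prod volume) := by
  refine ⟨(measurable_steklov hb h).aestronglyMeasurable, ?_⟩
  rw [eLpNorm_lt_top_iff_lintegral_rpow_enorm_lt_top (by simp) (by simp)]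
  have h2 := hb2.2
  rw [eLpNorm_lt_top_iff_lintegral_rpow_enorm_lt_top (by simp) (by simp)] at h2
  simp only [ENNReal.toReal_ofNat, ENNReal.rpow_two] at h2 ⊢
  exact (lintegral_steklov_sq_le hb h).trans_lt h2

theorem lintegral_enorm_sq {f : X → ℝ} (hf : MemLp f 2 μ) :
    ∫⁻ x, ‖f x‖ₑ ^ 2 ∂μ = ENNReal.ofReal (∫ x, f x ^ 2 ∂μ) := by
  rw [ofReal_integral_eq_lintegral_ofReal hf.integrable_sq
    (Eventually.of_forall fun x => sq_nonneg _)]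
  congr 1 with x
  rw [← ofReal_norm, ← ENNReal.ofReal_pow (norm_nonneg _), Real.norm_eq_abs, sq_abs]

theorem integral_steklov_sq_le [SFinite μ] {b : X × ℝ → ℝ} (hb : Measurable b)
    (hb2 : MemLp b 2 (μ.prod volume)) (h : ℝ) :
    ∫ z, steklov h b z ^ 2 ∂(μ.prod volume) ≤ ∫ z, b z ^ 2 ∂(μ.prod volume) := by
  have h1 := lintegral_steklov_sq_le (μ := μ) hb h
  rwa [lintegral_enorm_sq hb2, lintegral_enorm_sq (memLp_steklov hb hb2 h),
    ENNReal.ofReal_le_ofReal_iff (integral_nonneg fun z => sq_nonneg _)] at h1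

/-- Lebesgue differentiation on almost every line `{x} × ℝ`, combined by Fubini, since the set of
convergence is measurable. -/
theorem ae_tendsto_steklov [SFinite μ] {b : X × ℝ → ℝ} (hb : Measurable b)
    (hb2 : MemLp b 2 (μ.prod volume)) {h : ℕ → ℝ} (h0 : ∀ k, h k ≠ 0)
    (ht : Tendsto h atTop (𝓝 0)) :
    ∀ᵐ z ∂(μ.prod volume), Tendsto (fun k => steklov (h k) b z) atTop (𝓝 (b z)) := by
  refine (Measure.ae_prod_mem_iff_ae_ae_mem
    (measurableSet_tendsto_fun (fun k => measurable_steklov hb (h k)) hb)).2 ?_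
  have h1 := hb2.integrable_sq.prod_right_ae
  filter_upwards [h1] with x hx
  have hloc : LocallyIntegrable (fun t => b (x, t)) volume := by
    refine MemLp.locallyIntegrable (p := 2) ?_ (by norm_num)
    exact (memLp_two_iff_integrable_sq (hb.comp measurable_prodMk_left).aestronglyMeasurable).2 hx
  filter_upwards [LocallyIntegrable.ae_hasDerivAt_integral hloc] with t htd
  have h2 := (htd t).tendsto_slope_zero
  have h3 : Tendsto h atTop (𝓝[≠] 0) :=
    tendsto_nhdsWithin_iff.2 ⟨ht, Eventually.of_forall fun k => h0 k⟩
  refine (h2.comp h3).congr fun k => ?_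
  simp only [Function.comp_apply, intervalIntegral.integral_same, sub_zero, smul_eq_mul,
    ← mul_steklov]
  rw [inv_mul_cancel_left₀ (h0 k)]

/-- Fatou's lemma for products with Steklov averages. -/
theorem le_integral_mul_of_steklov [SFinite μ] {A b : X × ℝ → ℝ} (hb : Measurable b)
    (hb2 : MemLp b 2 (μ.prod volume)) (hA : MemLp A 2 (μ.prod volume)) {h r : ℕ → ℝ} {r' : ℝ}
    (h0 : ∀ k, h k ≠ 0) (ht : Tendsto h atTop (𝓝 0)) (hr : Tendsto r atTop (𝓝 r'))
    (hle : ∀ k, r k ≤ ∫ z, A z * steklov (h k) b z ∂(μ.prod volume)) :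
    r' ≤ ∫ z, A z * b z ∂(μ.prod volume) := by
  set π := μ.prod (volume : Measure ℝ)
  -- As Steklov averages do not increase the `L²` norm, expanding the square turns the lower bound
  -- on `∫ A · steklov` into an upper bound on `∫ (A - steklov)²`. Fatou's lemma then needs only
  -- almost everywhere convergence.
  have expand : ∀ {c : X × ℝ → ℝ}, MemLp c 2 π → ∫ z, (A z - c z) ^ 2 ∂π =
      (∫ z, A z ^ 2 ∂π) + (∫ z, c z ^ 2 ∂π) - 2 * ∫ z, A z * c z ∂π := by
    intro c hc
    have h1 : Integrable (fun z => A z ^ 2 + c z ^ 2) π := hA.integrable_sq.add hc.integrable_sq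
    rw [← integral_const_mul, ← integral_add hA.integrable_sq hc.integrable_sq,
      ← integral_sub h1 ((integrable_mul_of_memLp hA hc).const_mul 2)]
    congr 1 with z
    ring
  have hsub : ∀ {c : X × ℝ → ℝ}, MemLp c 2 π → Integrable (fun z => (A z - c z) ^ 2) π :=
    fun hc => (hA.sub hc).integrable_sq
  have hk : ∀ k, ∫⁻ z, ENNReal.ofReal ((A z - steklov (h k) b z) ^ 2) ∂π ≤
      ENNReal.ofReal ((∫ z, A z ^ 2 ∂π) + (∫ z, b z ^ 2 ∂π) - 2 * r k) := by
    intro k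
    have hS := memLp_steklov hb hb2 (h k)
    rw [← ofReal_integral_eq_lintegral_ofReal (hsub hS)
      (Eventually.of_forall fun z => sq_nonneg _)]
    refine ENNReal.ofReal_le_ofReal ?_
    rw [expand hS]
    have := integral_steklov_sq_le hb hb2 (h k)
    have := hle k
    linarith
  have hlim : Tendsto (fun k => ENNReal.ofReal
      ((∫ z, A z ^ 2 ∂π) + (∫ z, b z ^ 2 ∂π) - 2 * r k)) atTop
      (𝓝 (ENNReal.ofReal ((∫ z, A z ^ 2 ∂π) + (∫ z, b z ^ 2 ∂π) - 2 * r'))) :=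
    (ENNReal.continuous_ofReal.tendsto _).comp (tendsto_const_nhds.sub (hr.const_mul 2))
  have hfatou : ∫⁻ z, ENNReal.ofReal ((A z - b z) ^ 2) ∂π ≤
      liminf (fun k => ∫⁻ z, ENNReal.ofReal ((A z - steklov (h k) b z) ^ 2) ∂π) atTop := by
    refine le_trans (lintegral_mono_ae ?_) (lintegral_liminf_le' fun k => ?_)
    · filter_upwards [ae_tendsto_steklov hb hb2 h0 ht] with z hz
      refine le_of_eq (Tendsto.liminf_eq ?_).symm
      exact (ENNReal.continuous_ofReal.tendsto _).comp ((tendsto_const_nhds.sub hz).pow 2)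
    · exact ((hA.1.aemeasurable.sub
        (measurable_steklov hb (h k)).aemeasurable).pow_const 2).ennreal_ofReal
  have h1 := hfatou.trans ((liminf_le_liminf (Eventually.of_forall hk)).trans hlim.liminf_eq.le)
  rw [← ofReal_integral_eq_lintegral_ofReal (hsub hb2)
    (Eventually.of_forall fun z => sq_nonneg _)] at h1
  have hnn : 0 ≤ (∫ z, A z ^ 2 ∂π) + (∫ z, b z ^ 2 ∂π) - 2 * r' := by
    refine ge_of_tendsto (tendsto_const_nhds.sub (hr.const_mul 2))
      (Eventually.of_forall fun k => ?_)
    have hS := memLp_steklov hb hb2 (h k)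
    have h2 : 0 ≤ ∫ z, (A z - steklov (h k) b z) ^ 2 ∂π := integral_nonneg fun z => sq_nonneg _
    rw [expand hS] at h2
    have := integral_steklov_sq_le hb hb2 (h k)
    have := hle k
    linarith
  rw [ENNReal.ofReal_le_ofReal_iff hnn] at h1
  rw [expand hb2] at h1
  linarith

/-- Integration in time of an inequality between a difference and a Steklov average. -/
theorem integral_le_integral_mul_steklov [SFinite μ] {A b : X × ℝ → ℝ} (hb : Measurable b)
    (hb2 : MemLp b 2 (μ.prod volume)) (hA : MemLp A 2 (μ.prod volume)) {T h : ℝ} (hT : 0 ≤ T)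
    (hA0 : ∀ z : X × ℝ, z.2 ∉ Ioc 0 T → A z = 0) {c : ℝ → ℝ}
    (hc : IntervalIntegrable c volume 0 T)
    (hle : ∀ᵐ t, t ∈ Ioc 0 T → c t ≤ ∫ x, A (x, t) * steklov h b (x, t) ∂μ) :
    ∫ t in (0 : ℝ)..T, c t ≤ ∫ z, A z * steklov h b z ∂(μ.prod volume) := by
  have hint := integrable_mul_of_memLp hA (memLp_steklov hb hb2 h)
  rw [integral_prod_symm _ hint, intervalIntegral.integral_of_le hT,
    ← setIntegral_eq_integral_of_forall_compl_eq_zero (s := Ioc 0 T)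
      (f := fun t => ∫ x, A (x, t) * steklov h b (x, t) ∂μ)]
  · exact integral_mono_ae hc.1 hint.integral_prod_right.restrict
      ((ae_restrict_iff' measurableSet_Ioc).2 hle)
  · intro t ht
    simp [hA0 (_, t) ht]

/-- Averaged over `(0, T]`, the differences `a(t) - a(t - h)` telescope to the mean of `a` over `(T
- h, T]` minus `a₀`. The first mean tends to `a(T)` by the differentiability assumption. The
constant extension of `a` to negative times gives a meaning to `a(t - h)` for small `t`. -/
theorem sub_le_integral_mul_of_backward [SFinite μ] {A b : X × ℝ → ℝ} (hb : Measurable b)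
    (hb2 : MemLp b 2 (μ.prod volume)) (hA : MemLp A 2 (μ.prod volume)) {T : ℝ} (hT : 0 < T)
    (hA0 : ∀ z : X × ℝ, z.2 ∉ Ioc 0 T → A z = 0) {a : ℝ → ℝ} {a₀ : ℝ}
    (ha : LocallyIntegrable a volume) (ha₀ : ∀ t ≤ 0, a t = a₀)
    (haT : HasDerivAt (fun t => ∫ s in (0 : ℝ)..t, a s) (a T) T)
    (hle : ∀ h > 0, ∀ᵐ t, t ∈ Ioc 0 T →
      a t - a (t - h) ≤ h * ∫ x, A (x, t) * steklov (-h) b (x, t) ∂μ) :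
    a T - a₀ ≤ ∫ z, A z * b z ∂(μ.prod volume) := by
  have hint : ∀ s t, IntervalIntegrable a volume s t := fun s t =>
    intervalIntegrable_iff.2 ((ha.integrableOn_isCompact isCompact_uIcc).mono_set uIoc_subset_uIcc)
  set h : ℕ → ℝ := fun k => 1 / ((k : ℝ) + 1)
  have hpos : ∀ k, 0 < h k := fun k => Nat.one_div_pos_of_nat
  have hlim : Tendsto h atTop (𝓝 0) := tendsto_one_div_add_atTop_nhds_zero_nat
  have hlim' : Tendsto (fun k => -h k) atTop (𝓝 0) := by simpa using hlim.neg
  have h0 : ∀ k, -h k ≠ 0 := fun k => (neg_neg_of_pos (hpos k)).ne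
  refine le_integral_mul_of_steklov hb hb2 hA h0 hlim'
    (r := fun k => (-h k)⁻¹ * ((∫ s in (0 : ℝ)..T + -h k, a s) - ∫ s in (0 : ℝ)..T, a s) - a₀)
    ?_ fun k => ?_
  · have h3 : Tendsto (fun k => -h k) atTop (𝓝[≠] 0) :=
      tendsto_nhdsWithin_iff.2 ⟨hlim', Eventually.of_forall fun k => h0 k⟩
    exact (haT.tendsto_slope_zero.comp h3).sub tendsto_const_nhds
  · have hc : IntervalIntegrable (fun t => (h k)⁻¹ * (a t - a (t - h k))) volume 0 T := by
      have := (hint (0 - h k) (T - h k)).comp_sub_right (h k)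
      simp only [sub_add_cancel] at this
      exact ((hint 0 T).sub this).const_mul _
    have h1 := integral_le_integral_mul_steklov hb hb2 hA hT.le hA0 hc (h := -h k) (by
      filter_upwards [hle (h k) (hpos k)] with t ht htT
      rw [inv_mul_le_iff₀ (hpos k)]
      exact ht htT)
    refine le_trans (le_of_eq ?_) h1
    have hsh : IntervalIntegrable (fun t => a (t - h k)) volume 0 T := by
      have := (hint (0 - h k) (T - h k)).comp_sub_right (h k)
      simpa only [sub_add_cancel] using this
    rw [intervalIntegral.integral_const_mul, intervalIntegral.integral_sub (hint 0 T) hsh,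
      intervalIntegral.integral_comp_sub_right, zero_sub, ← sub_eq_add_neg,
      ← intervalIntegral.integral_add_adjacent_intervals (hint (-h k) 0) (hint 0 (T - h k))]
    have h2 : ∫ t in (-h k)..0, a t = h k * a₀ := by
      rw [intervalIntegral.integral_congr (g := fun _ => a₀) fun t ht => ?_]
      · simp
      · rw [uIcc_of_le (by linarith [hpos k])] at ht
        exact ha₀ t ht.2
    rw [h2]
    have := (hpos k).ne'
    field_simp
    ring

/-- Forward differences telescope without any information on `a` at time `0`. Thus the mean of `a`
just after `0` can be controlled before the initial trace is known. -/
theorem integral_le_of_forward [SFinite μ] {A b : X × ℝ → ℝ} (hb : Measurable b)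
    (hb2 : MemLp b 2 (μ.prod volume)) (hA : MemLp A 2 (μ.prod volume)) {T : ℝ} (hT : 0 ≤ T)
    (hA0 : ∀ z : X × ℝ, z.2 ∉ Ioc 0 T → A z = 0) {a : ℝ → ℝ}
    (ha : LocallyIntegrable a volume) {h : ℝ} (hh : 0 < h)
    (hle : ∀ᵐ t, t ∈ Ioc 0 T →
      a t - a (t + h) ≤ -(h * ∫ x, A (x, t) * steklov h b (x, t) ∂μ)) :
    ∫ t in (0 : ℝ)..h, a t ≤ (∫ t in T..T + h, a t) + h * ((1 / 2) *
      ((∫ z, A z ^ 2 ∂(μ.prod volume)) + ∫ z, b z ^ 2 ∂(μ.prod volume))) := by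
  have hint : ∀ s t, IntervalIntegrable a volume s t := fun s t =>
    intervalIntegrable_iff.2 ((ha.integrableOn_isCompact isCompact_uIcc).mono_set uIoc_subset_uIcc)
  have hsh : IntervalIntegrable (fun t => a (t + h)) volume 0 T := by
    have := (hint (0 + h) (T + h)).comp_add_right h
    simpa only [add_sub_cancel_right] using this
  have hc : IntervalIntegrable (fun t => h⁻¹ * (a t - a (t + h))) volume 0 T :=
    ((hint 0 T).sub hsh).const_mul _
  have h1 := integral_le_integral_mul_steklov hb hb2 hA.neg hT
    (fun z hz => by simp [hA0 z hz]) hc (h := h) (by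
      filter_upwards [hle] with t ht htT
      rw [inv_mul_le_iff₀ hh]
      simpa [integral_neg] using ht htT)
  have hS := memLp_steklov hb hb2 h
  have h2 : ∫ z, (-A) z * steklov h b z ∂(μ.prod volume) ≤ (1 / 2) *
      ((∫ z, A z ^ 2 ∂(μ.prod volume)) + ∫ z, b z ^ 2 ∂(μ.prod volume)) := by
    have h3 : ∫ z, (-A) z * steklov h b z ∂(μ.prod volume) ≤ (1 / 2) *
        ((∫ z, A z ^ 2 ∂(μ.prod volume)) + ∫ z, steklov h b z ^ 2 ∂(μ.prod volume)) := by
      rw [← integral_add hA.integrable_sq hS.integrable_sq, ← integral_const_mul]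
      refine integral_mono (integrable_mul_of_memLp hA.neg hS)
        ((hA.integrable_sq.add hS.integrable_sq).const_mul _) fun z => ?_
      simp only [Pi.neg_apply]
      nlinarith [sq_nonneg (A z + steklov h b z)]
    linarith [integral_steklov_sq_le hb hb2 h]
  have h4 := h1.trans h2
  rw [intervalIntegral.integral_const_mul, inv_mul_le_iff₀ hh,
    intervalIntegral.integral_sub (hint 0 T) hsh, intervalIntegral.integral_comp_add_right,
    zero_add] at h4
  have h5 := intervalIntegral.integral_add_adjacent_intervals (hint 0 h) (hint h (T + h))
  have h6 := intervalIntegral.integral_add_adjacent_intervals (hint 0 T) (hint T (T + h))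
  linarith

end Steklov

end

section

variable {n : ℕ} {Ω : Set (EuclideanSpace ℝ (Fin n))}
  {m : Measure (EuclideanSpace ℝ (Fin n))} {C : ℝ≥0}

/-! ### Limits of weak traces -/

theorem IsSmoothBoundedDomain.exists_cutoff (hΩ : IsSmoothBoundedDomain Ω) :
    ∃ χ : ℕ → EuclideanSpace ℝ (Fin n) → ℝ, (∀ k, ContDiff ℝ ∞ (χ k)) ∧
      (∀ k, HasCompactSupport (χ k)) ∧ (∀ k, tsupport (χ k) ⊆ Ω) ∧ (∀ k x, χ k x ∈ Icc 0 1) ∧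
      ∀ x ∈ Ω, ∀ᶠ k in atTop, χ k x = 1 := by
  obtain ⟨K, hK, hKΩ, hKU, hKm⟩ := hΩ.isOpen.exists_iUnion_isClosed
  have := fun k => exists_contMDiffMap_zero_one_nhds_of_isClosed
    𝓘(ℝ, EuclideanSpace ℝ (Fin n)) (n := ⊤) hΩ.isOpen.isClosed_compl (hK k)
    (disjoint_compl_left_iff_subset.2 (hKΩ k))
  choose χ h0 h1 h01 using this
  have hsupp : ∀ k, tsupport (χ k) ⊆ Ω := fun k x hx => by
    by_contra hxΩ
    have h2 := eventually_nhdsSet_iff_forall.1 (h0 k) x hxΩ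
    exact (notMem_tsupport_iff_eventuallyEq.2 h2) hx
  refine ⟨fun k => χ k, fun k => (χ k).contMDiff.contDiff, fun k => ?_, hsupp, h01,
    fun x hx => ?_⟩
  · exact HasCompactSupport.of_support_subset_isCompact hΩ.isBounded.isCompact_closure
      ((subset_tsupport _).trans ((hsupp k).trans subset_closure))
  · rw [← hKU, mem_iUnion] at hx
    obtain ⟨k₀, hk₀⟩ := hx
    filter_upwards [eventually_ge_atTop k₀] with k hk
    exact (h1 k).self_of_nhdsSet x (hKm hk hk₀)

theorem abs_integral_mul_le {α : Type*} [MeasurableSpace α] {μ : Measure α} {a b : α → ℝ}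
    (ha : MemLp a 2 μ) (hb : MemLp b 2 μ) :
    (∫ x, a x * b x ∂μ) ^ 2 ≤ (∫ x, a x ^ 2 ∂μ) * ∫ x, b x ^ 2 ∂μ := by
  have key : ∀ {c d : α → ℝ} (hc : MemLp c 2 μ) (hd : MemLp d 2 μ),
      inner ℝ (hc.toLp c) (hd.toLp d) = ∫ x, c x * d x ∂μ := by
    intro c d hc hd
    rw [L2.inner_def]
    refine integral_congr_ae ?_
    filter_upwards [hc.coeFn_toLp, hd.coeFn_toLp] with x hx hy
    rw [hx, hy]
    simp [mul_comm]
  have h := real_inner_mul_inner_self_le (ha.toLp a) (hb.toLp b)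
  rw [key, key, key] at h
  simpa only [← sq] using h

/-- Weak traces are stable under `L²` convergence with bounded gradients. -/
theorem hasWeakTrace_of_tendsto (hm : IsDivergenceMeasure Ω m C) (hn : 0 < n)
    (hΩ : IsSmoothBoundedDomain Ω) {f g : EuclideanSpace ℝ (Fin n) → ℝ}
    {F : EuclideanSpace ℝ (Fin n) → EuclideanSpace ℝ (Fin n)} (hf : IsSobolev Ω f F)
    (hg : MemLp g 2 m) {f' g' : ℕ → EuclideanSpace ℝ (Fin n) → ℝ}
    {F' : ℕ → EuclideanSpace ℝ (Fin n) → EuclideanSpace ℝ (Fin n)}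
    (h : ∀ k, HasWeakTrace Ω m (f' k) (F' k) (g' k))
    (hf' : Tendsto (fun k => eLpNorm (fun x => f' k x - f x) 2 (volume.restrict Ω)) atTop (𝓝 0))
    (hg' : Tendsto (fun k => eLpNorm (fun x => g' k x - g x) 2 m) atTop (𝓝 0)) {K : ℝ}
    (hK : ∀ k, ∫ x in Ω, ‖F' k x‖ ^ 2 ≤ K) : HasWeakTrace Ω m f F g := by
  refine ⟨hf.memLp, hf.memLp_gradient, hg, fun φ hφ v => ?_⟩
  have hν : AEStronglyMeasurable (fun x => inner ℝ (outerNormal Ω x) v) m :=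
    (hm.aestronglyMeasurable_outerNormal hn hΩ).inner aestronglyMeasurable_const
  have hνB : ∀ᵐ x ∂m, ‖inner ℝ (outerNormal Ω x) v‖ ≤ ‖v‖ := by
    filter_upwards [hm.ae_norm_outerNormal hΩ] with x hx
    have := norm_inner_le_norm (𝕜 := ℝ) (outerNormal Ω x) v
    rwa [hx, one_mul] at this
  have hFv := memLp_inner_const hf.memLp_gradient v
  have hder : ∀ {ψ : EuclideanSpace ℝ (Fin n) → ℝ}, ContDiff ℝ ∞ ψ →
      MemLp (fun x => fderiv ℝ ψ x v) 2 (volume.restrict Ω) := fun hψ =>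
    hΩ.memLp_of_continuous ((hψ.continuous_fderiv (by simp)).clm_apply continuous_const)
  have hψν : ∀ {ψ : EuclideanSpace ℝ (Fin n) → ℝ}, ContDiff ℝ ∞ ψ →
      MemLp (fun x => inner ℝ (outerNormal Ω x) v * ψ x) 2 m := fun hψ =>
    memLp_two_bdd_mul hν hνB (hm.memLp_of_continuous hn hΩ hψ.continuous)
  have hψΩ : ∀ {ψ : EuclideanSpace ℝ (Fin n) → ℝ}, ContDiff ℝ ∞ ψ →
      MemLp ψ 2 (volume.restrict Ω) := fun hψ => hΩ.memLp_of_continuous hψ.continuous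
  -- the defect in Green's formula is continuous in `L²`
  set Λ : (EuclideanSpace ℝ (Fin n) → ℝ) → ℝ := fun ψ =>
    (∫ x, g x * (inner ℝ (outerNormal Ω x) v * ψ x) ∂m) - (∫ x in Ω, f x * fderiv ℝ ψ x v) -
      ∫ x in Ω, ψ x * inner ℝ (F x) v with hΛ
  -- The defect of each approximating function is zero, so in the limit only `∫ ψ (F' k - F) · v`
  -- has to be bounded. A uniform `L²` bound on the gradients suffices; they need not converge.
  have hΛb : ∀ ψ, ContDiff ℝ ∞ ψ →
      Λ ψ ^ 2 ≤ 2 * (‖v‖ ^ 2 * K + ∫ x in Ω, inner ℝ (F x) v ^ 2) * ∫ x in Ω, ψ x ^ 2 := by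
    intro ψ hψ
    have hlim1 := tendsto_integral_mul_of_eLpNorm (fun k => (h k).memLp_trace) hg
      (fun _ => hψν hψ) (hψν hψ) hg' (by simp)
    have hlim2 := tendsto_integral_mul_of_eLpNorm (fun k => (h k).memLp) hf.memLp
      (fun _ => hder hψ) (hder hψ) hf' (by simp)
    have hlim := ((hlim1.sub hlim2).sub
      (tendsto_const_nhds (x := ∫ x in Ω, ψ x * inner ℝ (F x) v))).pow 2
    refine le_of_tendsto hlim (Eventually.of_forall fun k => ?_)
    have h1 := (h k).integral_eq ψ hψ v
    have hF'v := memLp_inner_const (h k).memLp_gradient v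
    rw [integral_add (integrable_mul_of_memLp (h k).memLp (hder hψ))
      (integrable_mul_of_memLp (hψΩ hψ) hF'v)] at h1
    have h2 : ∫ x, g' k x * (inner ℝ (outerNormal Ω x) v * ψ x) ∂m =
        ∫ x, ψ x * g' k x * inner ℝ (outerNormal Ω x) v ∂m := by
      congr 1 with x
      ring
    rw [h2, ← h1, add_sub_cancel_left]
    have h3 := abs_integral_mul_le (hψΩ hψ) hF'v
    have h4 := abs_integral_mul_le (hψΩ hψ) hFv
    have h5 : ∫ x in Ω, inner ℝ (F' k x) v ^ 2 ≤ ‖v‖ ^ 2 * K := by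
      refine le_trans ?_ (mul_le_mul_of_nonneg_left (hK k) (sq_nonneg _))
      rw [← integral_const_mul]
      refine integral_mono hF'v.integrable_sq
        (((h k).memLp_gradient.integrable_norm_pow (by norm_num)).const_mul _) fun x => ?_
      have := norm_inner_le_norm (𝕜 := ℝ) (F' k x) v
      rw [← sq_abs (inner ℝ (F' k x) v), mul_comm, ← mul_pow]
      exact pow_le_pow_left₀ (abs_nonneg _) this 2
    have h6 : 0 ≤ ∫ x in Ω, ψ x ^ 2 := integral_nonneg fun x => sq_nonneg _
    have h7 := mul_le_mul_of_nonneg_left h5 h6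
    nlinarith [sq_nonneg ((∫ x in Ω, ψ x * inner ℝ (F' k x) v) +
      ∫ x in Ω, ψ x * inner ℝ (F x) v)]
  obtain ⟨χ, hχ, hχc, hχs, hχ01, hχ1⟩ := hΩ.exists_cutoff
  -- `Λ` vanishes on test functions supported in `Ω`, by the definition of the weak gradient. Hence
  -- `φ` may be replaced by `(1 - χ k) φ`, whose `L²(Ω)` norm tends to zero.
  have hsplit : ∀ k, Λ φ = Λ (fun x => (1 - χ k x) * φ x) := by
    intro k
    have hχφ : ContDiff ℝ ∞ fun x => χ k x * φ x := (hχ k).mul hφ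
    have hχφ' : ContDiff ℝ ∞ fun x => (1 - χ k x) * φ x := (contDiff_const.sub (hχ k)).mul hφ
    have h0 : Λ (fun x => χ k x * φ x) = 0 := by
      have h1 := hf.integral_fderiv hΩ hχφ (HasCompactSupport.mul_right (hχc k))
        ((tsupport_mul_subset_left).trans (hχs k)) v
      have h2 : ∫ x, g x * (inner ℝ (outerNormal Ω x) v * (χ k x * φ x)) ∂m = 0 := by
        refine integral_eq_zero_of_ae ?_
        filter_upwards [hm.ae_mem_frontier] with x hx
        have : χ k x = 0 := by
          refine image_eq_zero_of_notMem_tsupport fun hx' => ?_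
          have := hΩ.isOpen.inter_frontier_eq
          exact (this ▸ ⟨hχs k hx', hx⟩ : x ∈ (∅ : Set (EuclideanSpace ℝ (Fin n))))
        simp [this]
      simp only [hΛ, h1, h2]
      ring
    have hadd : Λ φ = Λ (fun x => χ k x * φ x) + Λ (fun x => (1 - χ k x) * φ x) := by
      have hd : ∀ x, fderiv ℝ φ x v = fderiv ℝ (fun x => χ k x * φ x) x v +
          fderiv ℝ (fun x => (1 - χ k x) * φ x) x v := fun x => by
        rw [← add_apply, ← fderiv_fun_add (hχφ.differentiable (by simp) x)
          (hχφ'.differentiable (by simp) x)]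
        congr 2
        ext y
        ring
      have e1 : ∫ x, g x * (inner ℝ (outerNormal Ω x) v * φ x) ∂m =
          (∫ x, g x * (inner ℝ (outerNormal Ω x) v * (χ k x * φ x)) ∂m) +
          ∫ x, g x * (inner ℝ (outerNormal Ω x) v * ((1 - χ k x) * φ x)) ∂m := by
        rw [← integral_add (integrable_mul_of_memLp hg (hψν hχφ))
          (integrable_mul_of_memLp hg (hψν hχφ'))]
        congr 1 with x
        ring
      have e2 : ∫ x in Ω, f x * fderiv ℝ φ x v =
          (∫ x in Ω, f x * fderiv ℝ (fun x => χ k x * φ x) x v) +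
          ∫ x in Ω, f x * fderiv ℝ (fun x => (1 - χ k x) * φ x) x v := by
        rw [← integral_add (integrable_mul_of_memLp hf.memLp (hder hχφ))
          (integrable_mul_of_memLp hf.memLp (hder hχφ'))]
        congr 1 with x
        rw [hd]
        ring
      have e3 : ∫ x in Ω, φ x * inner ℝ (F x) v =
          (∫ x in Ω, χ k x * φ x * inner ℝ (F x) v) +
          ∫ x in Ω, (1 - χ k x) * φ x * inner ℝ (F x) v := by
        rw [← integral_add (integrable_mul_of_memLp (hψΩ hχφ) hFv)
          (integrable_mul_of_memLp (hψΩ hχφ') hFv)]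
        congr 1 with x
        ring
      simp only [hΛ]
      rw [e1, e2, e3]
      ring
    rw [hadd, h0, zero_add]
  have hzero : Tendsto (fun k => ∫ x in Ω, ((1 - χ k x) * φ x) ^ 2) atTop (𝓝 0) := by
    have : Tendsto (fun k => ∫ x in Ω, ((1 - χ k x) * φ x) ^ 2) atTop (𝓝 (∫ x in Ω, (0 : ℝ))) := by
      refine tendsto_integral_of_dominated_convergence (fun x => φ x ^ 2) (fun k => ?_)
        (hψΩ hφ).integrable_sq (fun k => Eventually.of_forall fun x => ?_) ?_
      · exact (((continuous_const.sub (hχ k).continuous).mul hφ.continuous).pow 2)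
          |>.aestronglyMeasurable
      · rw [Real.norm_eq_abs, abs_of_nonneg (sq_nonneg _), mul_pow]
        have := hχ01 k x
        have h1 : (1 - χ k x) ^ 2 ≤ 1 := by nlinarith [this.1, this.2]
        nlinarith [sq_nonneg (φ x)]
      · filter_upwards [ae_restrict_mem hΩ.isOpen.measurableSet] with x hx
        refine tendsto_const_nhds.congr' ?_
        filter_upwards [hχ1 x hx] with k hk
        simp [hk]
    simpa using this
  have hfin : Λ φ ^ 2 ≤ 0 := by
    have h1 := hzero.const_mul (2 * (‖v‖ ^ 2 * K + ∫ x in Ω, inner ℝ (F x) v ^ 2))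
    rw [mul_zero] at h1
    refine ge_of_tendsto h1 (Eventually.of_forall fun k => ?_)
    rw [hsplit k]
    exact hΛb _ ((contDiff_const.sub (hχ k)).mul hφ)
  have hΛ0 : Λ φ = 0 := pow_eq_zero_iff two_ne_zero |>.1 (le_antisymm hfin (sq_nonneg _))
  rw [integral_add (integrable_mul_of_memLp hf.memLp (hder hφ))
    (integrable_mul_of_memLp (hψΩ hφ) hFv)]
  have h2 : ∫ x, g x * (inner ℝ (outerNormal Ω x) v * φ x) ∂m =
      ∫ x, φ x * g x * inner ℝ (outerNormal Ω x) v ∂m := by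
    congr 1 with x
    ring
  simp only [hΛ, h2] at hΛ0
  linarith

/-! ### Convexity of the Dirichlet integral -/

section

variable {f : EuclideanSpace ℝ (Fin n) → ℝ}
  {F : EuclideanSpace ℝ (Fin n) → EuclideanSpace ℝ (Fin n)}
  {A : EuclideanSpace ℝ (Fin n) → Fin n → EuclideanSpace ℝ (Fin n)}

theorem memLp_normal_derivative (hm : IsDivergenceMeasure Ω m C) (hn : 0 < n)
    (hΩ : IsSmoothBoundedDomain Ω) (hF : MemLp F 2 m) :
    MemLp (fun x => inner ℝ (F x) (outerNormal Ω x)) 2 m := by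
  refine hF.norm.mono' (hF.1.inner (hm.aestronglyMeasurable_outerNormal hn hΩ)) ?_
  filter_upwards [hm.ae_norm_outerNormal hΩ] with x hx
  have := norm_inner_le_norm (𝕜 := ℝ) (F x) (outerNormal Ω x)
  rwa [hx, mul_one] at this

theorem IsRegularSlice.memLp_laplacian (h : IsRegularSlice Ω f F A) :
    MemLp (fun x => ∑ i, A x i i) 2 (volume.restrict Ω) :=
  memLp_finsetSum _ fun i _ => h.memLp_hess i i

/-- Green's first identity. -/
theorem IsRegularSlice.integral_laplacian_mul (h : IsRegularSlice Ω f F A)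
    (hm : IsDivergenceMeasure Ω m C) (hn : 0 < n) (hΩ : IsSmoothBoundedDomain Ω)
    {f₂ g₂ : EuclideanSpace ℝ (Fin n) → ℝ}
    {F₂ : EuclideanSpace ℝ (Fin n) → EuclideanSpace ℝ (Fin n)} (h₂ : HasWeakTrace Ω m f₂ F₂ g₂) :
    (∫ x in Ω, (∑ i, A x i i) * f₂ x) + ∫ x in Ω, inner ℝ (F x) (F₂ x) =
      ∫ x, inner ℝ (F x) (outerNormal Ω x) * g₂ x ∂m := by
  have hF₂ : ∀ i, MemLp (fun x => F₂ x i) 2 (volume.restrict Ω) := fun i => by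
    simpa only [inner_single] using memLp_inner_const h₂.memLp_gradient (EuclideanSpace.single i 1)
  have hFm := fun i => memLp_of_hasTrace hm hn hΩ (h.trace_grad i) (h.measurable_grad_coord i)
  have hi1 : ∀ i, Integrable (fun x => f₂ x * A x i i) (volume.restrict Ω) := fun i =>
    integrable_mul_of_memLp h₂.memLp (h.memLp_hess i i)
  have hi2 : ∀ i, Integrable (fun x => F x i * F₂ x i) (volume.restrict Ω) := fun i =>
    integrable_mul_of_memLp (h.memLp_grad i) (hF₂ i)
  have hi3 : ∀ i, Integrable (fun x => F x i * g₂ x * outerNormal Ω x i) m := fun i => by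
    simpa using hm.integrable_mul_mul hn hΩ (b := fun _ => 1) continuous_const (hFm i)
      h₂.memLp_trace i
  have key : ∀ i, (∫ x in Ω, f₂ x * A x i i) + (∫ x in Ω, F x i * F₂ x i) =
      ∫ x, F x i * g₂ x * outerNormal Ω x i ∂m := fun i => by
    have := (h.trace_grad i).integral_mul hm hn hΩ (h.measurable_grad_coord i) h₂
      (EuclideanSpace.single i 1)
    simp only [inner_single] at this
    rw [← this, integral_add (hi1 i) (hi2 i)]
  have e1 : ∫ x in Ω, (∑ i, A x i i) * f₂ x = ∑ i, ∫ x in Ω, f₂ x * A x i i := by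
    rw [← integral_finsetSum _ fun i _ => hi1 i]
    congr 1 with x
    rw [Finset.sum_mul]
    exact Finset.sum_congr rfl fun i _ => mul_comm _ _
  have e2 : ∫ x in Ω, inner ℝ (F x) (F₂ x) = ∑ i, ∫ x in Ω, F x i * F₂ x i := by
    rw [← integral_finsetSum _ fun i _ => hi2 i]
    congr 1 with x
    rw [inner_eq_sum]
  have e3 : ∫ x, inner ℝ (F x) (outerNormal Ω x) * g₂ x ∂m =
      ∑ i, ∫ x, F x i * g₂ x * outerNormal Ω x i ∂m := by
    rw [← integral_finsetSum _ fun i _ => hi3 i]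
    congr 1 with x
    rw [inner_eq_sum, Finset.sum_mul]
    exact Finset.sum_congr rfl fun i _ => by ring
  rw [e1, e2, e3, ← Finset.sum_add_distrib]
  exact Finset.sum_congr rfl fun i _ => key i

/-- Convexity, `|a|²/2 - |b|²/2 ≤ a · (a - b)`, followed by Green's first identity. The comparison
function needs only a weak trace, so that the initial datum is admissible. -/
theorem IsRegularSlice.dirichlet_sub_le (h : IsRegularSlice Ω f F A)
    (hm : IsDivergenceMeasure Ω m C) (hn : 0 < n) (hΩ : IsSmoothBoundedDomain Ω)
    {f₂ g₂ : EuclideanSpace ℝ (Fin n) → ℝ}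
    {F₂ : EuclideanSpace ℝ (Fin n) → EuclideanSpace ℝ (Fin n)} (h₂ : HasWeakTrace Ω m f₂ F₂ g₂) :
    (1 / 2) * (∫ x in Ω, ‖F x‖ ^ 2) - (1 / 2) * (∫ x in Ω, ‖F₂ x‖ ^ 2) ≤
      (∫ x in Ω, -(∑ i, A x i i) * (f x - f₂ x)) +
        ∫ x, inner ℝ (F x) (outerNormal Ω x) * (f x - g₂ x) ∂m := by
  have h₁ := h.trace.hasWeakTrace hm hn hΩ h.measurable
  have hF := h.trace.1.memLp_gradient
  have hν := memLp_normal_derivative hm hn hΩ (h.memLp_grad_boundary hm hn hΩ)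
  have g1 := h.integral_laplacian_mul hm hn hΩ h₁
  have g2 := h.integral_laplacian_mul hm hn hΩ h₂
  have e1 : ∫ x in Ω, -(∑ i, A x i i) * (f x - f₂ x) =
      (∫ x in Ω, (∑ i, A x i i) * f₂ x) - ∫ x in Ω, (∑ i, A x i i) * f x := by
    rw [← integral_sub (integrable_mul_of_memLp h.memLp_laplacian h₂.memLp)
      (integrable_mul_of_memLp h.memLp_laplacian h₁.memLp)]
    congr 1 with x
    ring
  have e2 : ∫ x, inner ℝ (F x) (outerNormal Ω x) * (f x - g₂ x) ∂m =
      (∫ x, inner ℝ (F x) (outerNormal Ω x) * f x ∂m) -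
        ∫ x, inner ℝ (F x) (outerNormal Ω x) * g₂ x ∂m := by
    rw [← integral_sub (integrable_mul_of_memLp hν h₁.memLp_trace)
      (integrable_mul_of_memLp hν h₂.memLp_trace)]
    congr 1 with x
    ring
  have hF2 : Integrable (fun x => ‖F x‖ ^ 2) (volume.restrict Ω) :=
    hF.integrable_norm_pow (by norm_num)
  have hF₂2 : Integrable (fun x => ‖F₂ x‖ ^ 2) (volume.restrict Ω) :=
    h₂.memLp_gradient.integrable_norm_pow (by norm_num)
  have hii : ∀ {G : EuclideanSpace ℝ (Fin n) → EuclideanSpace ℝ (Fin n)},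
      MemLp G 2 (volume.restrict Ω) → Integrable (fun x => inner ℝ (F x) (G x))
        (volume.restrict Ω) := fun {G} hG => by
    refine (integrable_mul_of_memLp hF.norm hG.norm).mono' (hF.1.inner hG.1)
      (Eventually.of_forall fun x => norm_inner_le_norm _ _)
  have h3 : (1 / 2) * (∫ x in Ω, ‖F x‖ ^ 2) - (1 / 2) * (∫ x in Ω, ‖F₂ x‖ ^ 2) ≤
      (∫ x in Ω, inner ℝ (F x) (F x)) - ∫ x in Ω, inner ℝ (F x) (F₂ x) := by
    rw [← integral_const_mul, ← integral_const_mul,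
      ← integral_sub (hF2.const_mul _) (hF₂2.const_mul _), ← integral_sub (hii hF)
        (hii h₂.memLp_gradient)]
    refine integral_mono ((hF2.const_mul _).sub (hF₂2.const_mul _))
      ((hii hF).sub (hii h₂.memLp_gradient)) fun x => ?_
    have h4 := norm_sub_sq_real (F x) (F₂ x)
    rw [real_inner_self_eq_norm_sq]
    nlinarith [sq_nonneg ‖F x - F₂ x‖]
  rw [e1, e2]
  linarith

end

end

section

/-! ### The energy inequality -/

section Product

variable {α β : Type*} [MeasurableSpace α] [MeasurableSpace β] {μ μ' : Measure α} {ν : Measure β}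

theorem memLp_two_add_measure {f : α → ℝ} (h : MemLp f 2 μ) (h' : MemLp f 2 μ') :
    MemLp f 2 (μ + μ') := by
  have hm : AEStronglyMeasurable f (μ + μ') := aestronglyMeasurable_add_measure_iff.2 ⟨h.1, h'.1⟩
  exact (memLp_two_iff_integrable_sq hm).2
    (integrable_add_measure.2 ⟨h.integrable_sq, h'.integrable_sq⟩)

/-- Exchanging the order of the two null-set conditions requires a measurable set, which is obtained
from measurable representatives of both functions. -/
theorem ae_prod_eq_of_ae_ae_eq [SFinite μ] [SFinite ν] {f g : α × β → ℝ}
    (hf : AEStronglyMeasurable f (μ.prod ν)) (hg : AEStronglyMeasurable g (μ.prod ν))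
    (h : ∀ᵐ y ∂ν, ∀ᵐ x ∂μ, f (x, y) = g (x, y)) : f =ᵐ[μ.prod ν] g := by
  have hfg : MeasurableSet {z : α × β | hf.mk f z = hg.mk g z} :=
    measurableSet_eq_fun hf.stronglyMeasurable_mk.measurable hg.stronglyMeasurable_mk.measurable
  have hsw : ∀ {p : α × β → Prop}, (∀ᵐ z ∂(μ.prod ν), p z) → ∀ᵐ y ∂ν, ∀ᵐ x ∂μ, p (x, y) := by
    intro p hp
    have : ∀ᵐ z ∂(ν.prod μ), p z.swap :=
      (Measure.measurePreserving_swap (μ := ν) (ν := μ)).quasiMeasurePreserving.ae hp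
    exact Measure.ae_ae_of_ae_prod this
  have h1 : ∀ᵐ y ∂ν, ∀ᵐ x ∂μ, (x, y) ∈ {z : α × β | hf.mk f z = hg.mk g z} := by
    filter_upwards [h, hsw hf.ae_eq_mk, hsw hg.ae_eq_mk] with y h1 h2 h3
    filter_upwards [h1, h2, h3] with x h1 h2 h3
    exact (h2.symm.trans h1).trans h3
  have h2 : ∀ᵐ x ∂μ, ∀ᵐ y ∂ν, (x, y) ∈ {z : α × β | hf.mk f z = hg.mk g z} :=
    (Measure.ae_ae_comm (p := fun x y => (x, y) ∈ {z : α × β | hf.mk f z = hg.mk g z}) hfg).2 h1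
  filter_upwards [(Measure.ae_prod_mem_iff_ae_ae_mem hfg).2 h2, hf.ae_eq_mk, hg.ae_eq_mk]
    with z h1 h2 h3
  exact (h2.trans h1).trans h3.symm

theorem memLp_indicator_time [SFinite μ] {f : α × ℝ → ℝ} {T : ℝ}
    (hf : MemLp f 2 (μ.prod (volume.restrict (Ioc 0 T)))) :
    MemLp ({z : α × ℝ | z.2 ∈ Ioc 0 T}.indicator f) 2 (μ.prod volume) := by
  have hs : MeasurableSet {z : α × ℝ | z.2 ∈ Ioc 0 T} := measurable_snd measurableSet_Ioc
  rw [memLp_indicator_iff_restrict hs]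
  have h1 : {z : α × ℝ | z.2 ∈ Ioc 0 T} = univ ×ˢ Ioc 0 T := by
    ext z
    simp
  rwa [h1, ← Measure.prod_restrict, Measure.restrict_univ]

end Product

variable {n : ℕ} {Ω : Set (EuclideanSpace ℝ (Fin n))}
  {m : Measure (EuclideanSpace ℝ (Fin n))} {C : ℝ≥0} {ε σ : ℝ}
  {u₀ : EuclideanSpace ℝ (Fin n) → ℝ}
  {gradu₀ : EuclideanSpace ℝ (Fin n) → EuclideanSpace ℝ (Fin n)} {v : PhaseField n}

open Classical in
/-- The negative `L²` gradient of the Dirichlet integral: `-Δu` in `Ω` and `∂u/∂ν` on `∂Ω`. -/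
def dirichletGradient (Ω : Set (EuclideanSpace ℝ (Fin n))) (v : PhaseField n)
    (z : EuclideanSpace ℝ (Fin n) × ℝ) : ℝ :=
  if z.1 ∈ Ω then -∑ i, v.hess z.1 z.2 i i
  else inner ℝ (v.grad z.1 z.2) (outerNormal Ω z.1)

theorem IsDivergenceMeasure.ae_notMem (hm : IsDivergenceMeasure Ω m C)
    (hΩ : IsSmoothBoundedDomain Ω) : ∀ᵐ x ∂m, x ∉ Ω := by
  filter_upwards [hm.ae_mem_frontier] with x hx hxΩ
  have := hΩ.isOpen.inter_frontier_eq
  exact (this ▸ ⟨hxΩ, hx⟩ : x ∈ (∅ : Set (EuclideanSpace ℝ (Fin n))))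

theorem IsDivergenceMeasure.prod_le (hm : IsDivergenceMeasure Ω m C) (hn : 0 < n)
    (hΩ : IsSmoothBoundedDomain Ω) (ν : Measure ℝ) [SFinite ν] :
    m.prod ν ≤ (C : ℝ≥0∞) • (boundaryMeasure Ω).prod ν := by
  have := boundaryMeasure_lt_top hn hΩ
  rw [← Measure.prod_smul_left]
  exact Measure.prod_mono hm.le le_rfl

theorem IsSolution.memLp_dt_total (hv : IsSolution Ω ε σ u₀ v) (hm : IsDivergenceMeasure Ω m C)
    (hn : 0 < n) (hΩ : IsSmoothBoundedDomain Ω) {T : ℝ} (hT : 0 < T) :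
    MemLp (fun z : EuclideanSpace ℝ (Fin n) × ℝ => v.dt z.1 z.2) 2
      ((volume.restrict Ω + m).prod (volume.restrict (Ioc 0 T))) := by
  have := hΩ.isFiniteMeasure
  have := hm.isFiniteMeasure hn hΩ
  rw [Measure.add_prod]
  exact memLp_two_add_measure (hv.memLp_dt T hT)
    ((hv.memLp_dt_boundary T hT).of_measure_le_smul ENNReal.coe_ne_top (hm.prod_le hn hΩ _))

theorem ae_prod_fst {α β : Type*} [MeasurableSpace α] [MeasurableSpace β] {μ : Measure α}
    {ν : Measure β} [SFinite ν] {p : α → Prop} (h : ∀ᵐ x ∂μ, p x) :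
    ∀ᵐ z ∂(μ.prod ν), p z.1 :=
  Measure.quasiMeasurePreserving_fst.ae h

theorem IsSolution.boundary_condition_total (hv : IsSolution Ω ε σ u₀ v)
    (hm : IsDivergenceMeasure Ω m C) (T : ℝ) :
    ∀ᵐ z ∂(m.prod (volume.restrict (Ioc 0 T))),
      v.dt z.1 z.2 + σ * inner ℝ (v.grad z.1 z.2) (outerNormal Ω z.1) = 0 :=
  (Measure.AbsolutelyContinuous.prod hm.absolutelyContinuous
    (Measure.absolutelyContinuous_of_le (Measure.restrict_mono Ioc_subset_Ioi_self le_rfl))).ae_le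
    hv.boundary_condition

theorem IsSolution.equation_total (hv : IsSolution Ω ε σ u₀ v) (T : ℝ) :
    ∀ᵐ z ∂((volume.restrict Ω).prod (volume.restrict (Ioc 0 T))),
      v.dt z.1 z.2 = (∑ i, v.hess z.1 z.2 i i) - (ε ^ 2)⁻¹ * deriv doubleWell (v.u z.1 z.2) :=
  (Measure.AbsolutelyContinuous.prod (Measure.AbsolutelyContinuous.refl _)
    (Measure.absolutelyContinuous_of_le (Measure.restrict_mono Ioc_subset_Ioi_self le_rfl))).ae_le
    hv.equation

theorem IsSolution.memLp_laplacian (hv : IsSolution Ω ε σ u₀ v) {T : ℝ} (hT : 0 < T) :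
    MemLp (fun z : EuclideanSpace ℝ (Fin n) × ℝ => ∑ i, v.hess z.1 z.2 i i) 2
      ((volume.restrict Ω).prod (volume.restrict (Ioc 0 T))) := by
  refine memLp_finsetSum _ fun i _ => ?_
  simpa only [inner_single] using
    memLp_inner_const (hv.memLp_hess T hT i) (EuclideanSpace.single i (1 : ℝ))

/-- On the boundary the integrability comes from the dynamic boundary condition, `∂u/∂ν = -σ⁻¹ ∂ₜu`.
This is where `σ ≠ 0` enters. -/
theorem IsSolution.memLp_dirichletGradient (hv : IsSolution Ω ε σ u₀ v) (hσ : σ ≠ 0)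
    (hm : IsDivergenceMeasure Ω m C) (hn : 0 < n) (hΩ : IsSmoothBoundedDomain Ω) {T : ℝ}
    (hT : 0 < T) : MemLp (dirichletGradient Ω v) 2
      ((volume.restrict Ω + m).prod (volume.restrict (Ioc 0 T))) := by
  have := hΩ.isFiniteMeasure
  have := hm.isFiniteMeasure hn hΩ
  rw [Measure.add_prod]
  refine memLp_two_add_measure ((hv.memLp_laplacian hT).neg.ae_eq ?_)
    (((((hv.memLp_dt_boundary T hT).of_measure_le_smul ENNReal.coe_ne_top
      (hm.prod_le hn hΩ _))).const_mul (-σ⁻¹)).ae_eq ?_)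
  · filter_upwards [ae_prod_fst (ae_restrict_mem hΩ.isOpen.measurableSet)] with z hz
    simp [dirichletGradient, hz]
  · filter_upwards [ae_prod_fst (hm.ae_notMem hΩ), hv.boundary_condition_total hm T] with z hz hz'
    rw [dirichletGradient, if_neg hz]
    field_simp
    linarith

theorem IsSolution.ae_isRegularSlice (hv : IsSolution Ω ε σ u₀ v) (hn : 0 < n)
    (hΩ : IsSmoothBoundedDomain Ω) : ∀ᵐ t, 0 < t →
      IsRegularSlice Ω (fun x => v.u x t) (fun x => v.grad x t) (fun x => v.hess x t) := by
  have := boundaryMeasure_lt_top hn hΩ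
  have h1 := hv.measurable_grad_boundary.prodMk_right
  have key : ∀ᵐ t ∂(volume.restrict (Ioi (0 : ℝ))),
      IsRegularSlice Ω (fun x => v.u x t) (fun x => v.grad x t) (fun x => v.hess x t) := by
    filter_upwards [hv.trace_u, hv.trace_grad, hv.tangential_gradient, h1] with t h1 h2 h3 h4
    exact ⟨h1, h2, h3.1.1, h4⟩
  exact (ae_restrict_iff' measurableSet_Ioi).1 key

/-- The function `b` is a jointly measurable version of `∂ₜu`, extended by zero in time, so that
Steklov averages make sense at all times. One function serves the interior and the boundary at once.
-/
theorem IsSolution.exists_timeDerivative (hv : IsSolution Ω ε σ u₀ v)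
    (hm : IsDivergenceMeasure Ω m C) (hn : 0 < n) (hΩ : IsSmoothBoundedDomain Ω) {T : ℝ}
    (hT : 0 < T) : ∃ b : EuclideanSpace ℝ (Fin n) × ℝ → ℝ, Measurable b ∧
      MemLp b 2 ((volume.restrict Ω + m).prod volume) ∧
      (∀ z : EuclideanSpace ℝ (Fin n) × ℝ, z.2 ∉ Ioc 0 T → b z = 0) ∧
      (∀ᵐ z ∂((volume.restrict Ω + m).prod (volume.restrict (Ioc 0 T))), b z = v.dt z.1 z.2) ∧
      ∀ s ∈ Icc 0 T, ∀ t ∈ Icc 0 T, ∀ᵐ x ∂(volume.restrict Ω + m),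
        v.u x t - v.u x s = ∫ r in s..t, b (x, r) := by
  have := hΩ.isFiniteMeasure
  have := hm.isFiniteMeasure hn hΩ
  have hdt := hv.memLp_dt_total hm hn hΩ hT
  set b₀ := hdt.1.mk _
  have hb₀ : Measurable b₀ := hdt.1.stronglyMeasurable_mk.measurable
  have hS : MeasurableSet {z : EuclideanSpace ℝ (Fin n) × ℝ | z.2 ∈ Ioc 0 T} :=
    measurable_snd measurableSet_Ioc
  have hb2 : MemLp ({z : EuclideanSpace ℝ (Fin n) × ℝ | z.2 ∈ Ioc 0 T}.indicator b₀) 2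
      ((volume.restrict Ω + m).prod volume) :=
    memLp_indicator_time (hdt.ae_eq hdt.1.ae_eq_mk)
  have hsnd : ∀ᵐ z ∂((volume.restrict Ω + m).prod (volume.restrict (Ioc 0 T))), z.2 ∈ Ioc 0 T :=
    Measure.quasiMeasurePreserving_snd.ae (ae_restrict_mem measurableSet_Ioc)
  have heq : ∀ᵐ z ∂((volume.restrict Ω + m).prod (volume.restrict (Ioc 0 T))),
      {z : EuclideanSpace ℝ (Fin n) × ℝ | z.2 ∈ Ioc 0 T}.indicator b₀ z = v.dt z.1 z.2 := by
    filter_upwards [hdt.1.ae_eq_mk, hsnd] with z h1 h2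
    rw [indicator_of_mem (show z ∈ {z : EuclideanSpace ℝ (Fin n) × ℝ | z.2 ∈ Ioc 0 T} from h2)]
    exact h1.symm
  refine ⟨_, hb₀.indicator hS, hb2, fun z hz => indicator_of_notMem
    (s := {z : EuclideanSpace ℝ (Fin n) × ℝ | z.2 ∈ Ioc 0 T}) hz _, heq,
    fun s hs t ht => ?_⟩
  set b := {z : EuclideanSpace ℝ (Fin n) × ℝ | z.2 ∈ Ioc 0 T}.indicator b₀ with hb
  have hint : ∀ᵐ x ∂(volume.restrict Ω + m), ∀ p q, IntervalIntegrable (fun r => b (x, r))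
      volume p q := by
    filter_upwards [hb2.integrable_sq.prod_right_ae] with x hx p q
    have hloc : LocallyIntegrable (fun t => b (x, t)) volume := by
      refine MemLp.locallyIntegrable (p := 2) ?_ (by norm_num)
      exact (memLp_two_iff_integrable_sq
        ((hb₀.indicator hS).comp measurable_prodMk_left).aestronglyMeasurable).2 hx
    exact intervalIntegrable_iff.2
      ((hloc.integrableOn_isCompact isCompact_uIcc).mono_set uIoc_subset_uIcc)
  have hcongr : ∀ᵐ x ∂(volume.restrict Ω + m), ∀ p ∈ Icc 0 T,
      ∫ r in (0 : ℝ)..p, v.dt x r = ∫ r in (0 : ℝ)..p, b (x, r) := by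
    filter_upwards [Measure.ae_ae_of_ae_prod heq] with x hx p hp
    refine intervalIntegral.integral_congr_ae ?_
    rw [uIoc_of_le hp.1]
    filter_upwards [(ae_restrict_iff' measurableSet_Ioc).1 hx] with r hr hrp
    exact (hr ⟨hrp.1, hrp.2.trans hp.2⟩).symm
  have hconv : ∀ᵐ x ∂(volume.restrict Ω + m), ∀ w : ℝ,
      v.u x t = w + ∫ r in (0 : ℝ)..t, v.dt x r → v.u x s = w + ∫ r in (0 : ℝ)..s, v.dt x r →
      v.u x t - v.u x s = ∫ r in s..t, b (x, r) := by
    filter_upwards [hint, hcongr] with x h1 h2 w h3 h4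
    rw [h3, h4, h2 t ht, h2 s hs, add_sub_add_left_eq_sub,
      intervalIntegral.integral_interval_sub_left (h1 0 t) (h1 0 s)]
  rw [ae_add_measure_iff] at hconv ⊢
  refine ⟨?_, ?_⟩
  · filter_upwards [hconv.1, hv.time_derivative t ht.1, hv.time_derivative s hs.1] with x h1 h2 h3
    exact h1 _ h2 h3
  · filter_upwards [hconv.2,
      hm.absolutelyContinuous.ae_le (hv.time_derivative_boundary t ht.1),
      hm.absolutelyContinuous.ae_le (hv.time_derivative_boundary s hs.1)] with x h1 h2 h3
    exact h1 _ h2 h3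

/-- The measure `volume.restrict Ω + m` represents `L²(Ω) ⊕ L²(∂Ω)`: its summands live on disjoint
sets, so the single function `w` carries both the interior values and the trace. -/
theorem dirichlet_sub_le_integral (hm : IsDivergenceMeasure Ω m C) (hn : 0 < n)
    (hΩ : IsSmoothBoundedDomain Ω) {t : ℝ}
    (h : IsRegularSlice Ω (fun x => v.u x t) (fun x => v.grad x t) (fun x => v.hess x t))
    {f₂ w : EuclideanSpace ℝ (Fin n) → ℝ}
    {F₂ : EuclideanSpace ℝ (Fin n) → EuclideanSpace ℝ (Fin n)} (h₂ : HasWeakTrace Ω m f₂ F₂ w)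
    (hw : ∀ᵐ x ∂(volume.restrict Ω), w x = f₂ x) {d : EuclideanSpace ℝ (Fin n) → ℝ}
    (hd : ∀ᵐ x ∂(volume.restrict Ω + m), v.u x t - w x = d x) :
    (1 / 2) * (∫ x in Ω, ‖v.grad x t‖ ^ 2) - (1 / 2) * (∫ x in Ω, ‖F₂ x‖ ^ 2) ≤
      ∫ x, dirichletGradient Ω v (x, t) * d x ∂(volume.restrict Ω + m) := by
  have h1 := h.dirichlet_sub_le hm hn hΩ h₂
  rw [ae_add_measure_iff] at hd
  have h₁ := h.trace.hasWeakTrace hm hn hΩ h.measurable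
  have hν := memLp_normal_derivative hm hn hΩ (h.memLp_grad_boundary hm hn hΩ)
  have e1 : ∀ᵐ x ∂(volume.restrict Ω), dirichletGradient Ω v (x, t) * d x =
      -(∑ i, v.hess x t i i) * (v.u x t - f₂ x) := by
    filter_upwards [hd.1, hw, ae_restrict_mem hΩ.isOpen.measurableSet] with x h2 h3 h4
    rw [dirichletGradient, if_pos h4, ← h2, h3]
  have e2 : ∀ᵐ x ∂m, dirichletGradient Ω v (x, t) * d x =
      inner ℝ (v.grad x t) (outerNormal Ω x) * (v.u x t - w x) := by
    filter_upwards [hd.2, hm.ae_notMem hΩ] with x h2 h4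
    rw [dirichletGradient, if_neg h4, ← h2]
  rw [integral_add_measure, integral_congr_ae e1, integral_congr_ae e2]
  · exact h1
  · exact (integrable_mul_of_memLp h.memLp_laplacian.neg (h₁.memLp.sub h₂.memLp)).congr
      (e1.mono fun x hx => hx.symm)
  · exact (integrable_mul_of_memLp hν (h₁.memLp_trace.sub h₂.memLp_trace)).congr
      (e2.mono fun x hx => hx.symm)

end

/-! ### The Dirichlet integral as a function of time. -/

section

variable {n : ℕ} {Ω : Set (EuclideanSpace ℝ (Fin n))}
  {m : Measure (EuclideanSpace ℝ (Fin n))} {C : ℝ≥0} {ε σ : ℝ}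
  {u₀ : EuclideanSpace ℝ (Fin n) → ℝ}
  {gradu₀ : EuclideanSpace ℝ (Fin n) → EuclideanSpace ℝ (Fin n)} {v : PhaseField n}

/-- The Dirichlet integral of `u(·, t)` for `0 < t ≤ T`, with the value `a₀` for `t ≤ 0`. -/
def dirichletIntegral (Ω : Set (EuclideanSpace ℝ (Fin n))) (v : PhaseField n) (a₀ T t : ℝ) : ℝ :=
  (Iic (0 : ℝ)).indicator (fun _ => a₀) t +
    (Ioc 0 T).indicator (fun t => (1 / 2) * ∫ x in Ω, ‖v.grad x t‖ ^ 2) t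

theorem dirichletIntegral_of_nonpos {a₀ T t : ℝ} (ht : t ≤ 0) :
    dirichletIntegral Ω v a₀ T t = a₀ := by
  have : t ∉ Ioc 0 T := fun h => h.1.not_ge ht
  simp [dirichletIntegral, ht, this]

theorem dirichletIntegral_of_mem {a₀ T t : ℝ} (ht : t ∈ Ioc 0 T) :
    dirichletIntegral Ω v a₀ T t = (1 / 2) * ∫ x in Ω, ‖v.grad x t‖ ^ 2 := by
  have : t ∉ Iic (0 : ℝ) := fun h => ht.1.not_ge h
  rw [dirichletIntegral, indicator_of_notMem this, indicator_of_mem ht, zero_add]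

theorem IsSolution.locallyIntegrable_dirichletIntegral (hv : IsSolution Ω ε σ u₀ v)
    (hΩ : IsSmoothBoundedDomain Ω) (a₀ : ℝ) {T : ℝ} (hT : 0 < T) :
    LocallyIntegrable (dirichletIntegral Ω v a₀ T) volume := by
  have := hΩ.isFiniteMeasure
  refine LocallyIntegrable.add ((locallyIntegrable_const a₀).indicator measurableSet_Iic) ?_
  have h1 : Integrable (fun z : EuclideanSpace ℝ (Fin n) × ℝ => ‖v.grad z.1 z.2‖ ^ 2)
      ((volume.restrict Ω).prod (volume.restrict (Ioc 0 T))) :=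
    (hv.memLp_grad T hT).integrable_norm_pow (by norm_num)
  have h2 : Integrable (fun t => (1 / 2) * ∫ x in Ω, ‖v.grad x t‖ ^ 2)
      (volume.restrict (Ioc 0 T)) := h1.integral_prod_right.const_mul _
  exact ((integrable_indicator_iff measurableSet_Ioc).2 h2).locallyIntegrable

theorem ae_comp_add {p : ℝ → Prop} (h : ∀ᵐ t, p t) (c : ℝ) : ∀ᵐ t, p (t + c) :=
  (measurePreserving_add_right volume c).quasiMeasurePreserving.ae h

/-- Cauchy–Schwarz in time; it gives continuity of `u` at time `0` with values in `L²`, with rate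
`t^(1/2)`. -/
theorem eLpNorm_intervalIntegral_le {X : Type*} [MeasurableSpace X] {μ : Measure X} [SFinite μ]
    {b : X × ℝ → ℝ} (hb : Measurable b) {t : ℝ} (ht : 0 ≤ t) :
    eLpNorm (fun x => ∫ r in (0 : ℝ)..t, b (x, r)) 2 μ ≤
      (ENNReal.ofReal t * ∫⁻ z, ‖b z‖ₑ ^ 2 ∂(μ.prod volume)) ^ (1 / (2 : ℝ)) := by
  rw [eLpNorm_eq_lintegral_rpow_enorm_toReal (by simp) (by simp)]
  simp only [ENNReal.toReal_ofNat, ENNReal.rpow_two]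
  refine ENNReal.rpow_le_rpow ?_ (by norm_num)
  rw [lintegral_prod _ (by fun_prop), ← lintegral_const_mul _ (by fun_prop)]
  refine lintegral_mono fun x => ?_
  rw [intervalIntegral.integral_of_le ht]
  have h2 := sq_lintegral_mul_le (μ := volume.restrict (Ioc (0 : ℝ) t))
    (f := fun r => ‖b (x, r)‖ₑ) (g := fun _ => 1) (by fun_prop) (by fun_prop)
  simp only [mul_one, one_pow, lintegral_const, Measure.restrict_apply_univ,
    Real.volume_Ioc, sub_zero, one_mul] at h2
  refine (pow_le_pow_left₀ zero_le (enorm_integral_le_lintegral_enorm _) 2).trans (h2.trans ?_)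
  rw [mul_comm]
  gcongr
  exact Measure.restrict_le_self

/-- The Dirichlet integral is bounded along times that tend to `0`. -/
theorem IsSolution.exists_dirichlet_le (hv : IsSolution Ω ε σ u₀ v) (hσ : σ ≠ 0)
    (hm : IsDivergenceMeasure Ω m C) (hn : 0 < n) (hΩ : IsSmoothBoundedDomain Ω) :
    ∃ K : ℝ, ∀ δ > 0, ∃ t ∈ Ioc 0 δ,
      IsRegularSlice Ω (fun x => v.u x t) (fun x => v.grad x t) (fun x => v.hess x t) ∧
      ∫ x in Ω, ‖v.grad x t‖ ^ 2 ≤ K := by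
  have := hΩ.isFiniteMeasure
  have := hm.isFiniteMeasure hn hΩ
  obtain ⟨b, hb, hb2, -, -, hbu⟩ := hv.exists_timeDerivative hm hn hΩ (T := 3) (by norm_num)
  set a := dirichletIntegral Ω v 0 3
  have ha : LocallyIntegrable a volume :=
    hv.locallyIntegrable_dirichletIntegral hΩ 0 (by norm_num)
  -- At such a `T` the mean of `a` over `[T, T + h]` tends to `a T`. With `T < 1` and `h ≤ 1`, all
  -- times `t + h` stay below the horizon `3`.
  obtain ⟨T, hT, haT⟩ := ((frequently_ae_mem_iff (μ := volume) (s := Ioo (0 : ℝ) 1)).2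
    (by simp)).and_eventually (LocallyIntegrable.ae_hasDerivAt_integral ha) |>.exists
  have hreg := hv.ae_isRegularSlice hn hΩ
  set A := {z : EuclideanSpace ℝ (Fin n) × ℝ | z.2 ∈ Ioc 0 T}.indicator (dirichletGradient Ω v)
  have hA : MemLp A 2 ((volume.restrict Ω + m).prod volume) :=
    memLp_indicator_time (hv.memLp_dirichletGradient hσ hm hn hΩ hT.1)
  have hA0 : ∀ z : EuclideanSpace ℝ (Fin n) × ℝ, z.2 ∉ Ioc 0 T → A z = 0 := fun z hz =>
    indicator_of_notMem (s := {z : EuclideanSpace ℝ (Fin n) × ℝ | z.2 ∈ Ioc 0 T}) hz _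
  set K₁ := (1 / 2) * ((∫ z, A z ^ 2 ∂((volume.restrict Ω + m).prod volume)) +
    ∫ z, b z ^ 2 ∂((volume.restrict Ω + m).prod volume))
  have hfw : ∀ h ∈ Ioc (0 : ℝ) 1, ∫ t in (0 : ℝ)..h, a t ≤ (∫ t in T..T + h, a t) + h * K₁ := by
    intro h hh
    refine integral_le_of_forward hb hb2 hA hT.1.le hA0 ha hh.1 ?_
    filter_upwards [hreg, ae_comp_add hreg h] with t h1 h2 ht
    have ht3 : t ∈ Ioc (0 : ℝ) 3 := ⟨ht.1, by linarith [ht.2, hT.2]⟩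
    have hth : t + h ∈ Ioc (0 : ℝ) 3 := ⟨by linarith [ht.1, hh.1], by linarith [ht.2, hT.2, hh.2]⟩
    have h4 := h2 hth.1
    have h3 := dirichlet_sub_le_integral hm hn hΩ (h1 ht.1)
      (h4.trace.hasWeakTrace hm hn hΩ h4.measurable) (Eventually.of_forall fun x => rfl)
      (d := fun x => -(h * steklov h b (x, t))) (by
        filter_upwards [hbu t (Ioc_subset_Icc_self ht3) (t + h) (Ioc_subset_Icc_self hth)]
          with x hx
        rw [mul_steklov, ← hx]
        ring)
    rw [show a t = _ from dirichletIntegral_of_mem ht3,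
      show a (t + h) = _ from dirichletIntegral_of_mem hth]
    refine h3.trans (le_of_eq ?_)
    rw [← integral_const_mul, ← integral_neg]
    congr 1 with x
    rw [show A (x, t) = dirichletGradient Ω v (x, t) from
      indicator_of_mem (s := {z : EuclideanSpace ℝ (Fin n) × ℝ | z.2 ∈ Ioc 0 T}) ht _]
    ring
  have hint : ∀ s t, IntervalIntegrable a volume s t := fun s t =>
    intervalIntegrable_iff.2 ((ha.integrableOn_isCompact isCompact_uIcc).mono_set uIoc_subset_uIcc)
  have hev : ∀ᶠ h in 𝓝[>] (0 : ℝ), ∫ t in T..T + h, a t ≤ h * (a T + 1) := by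
    have h1 := (haT T).tendsto_slope_zero.mono_left
      (nhdsWithin_mono 0 fun h (hh : 0 < h) => (ne_of_gt hh : h ≠ 0))
    filter_upwards [h1.eventually (gt_mem_nhds (lt_add_one (a T))), self_mem_nhdsWithin] with h h2 h3
    rw [intervalIntegral.integral_same, sub_zero, smul_eq_mul, inv_mul_lt_iff₀ h3] at h2
    exact h2.le
  refine ⟨2 * (a T + 1 + K₁ + 1), fun δ hδ => ?_⟩
  obtain ⟨h, ⟨h1, h2⟩, h3, h4⟩ := ((hev.and (Ioc_mem_nhdsGT (zero_lt_one' ℝ))).and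
    (Ioc_mem_nhdsGT hδ)).exists
  -- If the Dirichlet integral exceeded the bound at every regular time in `(0, δ]`, the mean of `a`
  -- over `(0, h]` would be at least `a T + K₁ + 2`. The forward estimate allows at most `a T + K₁ +
  -- 1`.
  by_contra! hcon
  have h5 := (hfw h h2).trans (add_le_add_left h1 _)
  have h6 : ∫ t in (0 : ℝ)..h, (a T + 1 + K₁ + 1) ≤ ∫ t in (0 : ℝ)..h, a t := by
    rw [intervalIntegral.integral_of_le h3.le, intervalIntegral.integral_of_le h3.le]
    refine integral_mono_ae (by simp) (hint 0 h).1 ?_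
    filter_upwards [ae_restrict_mem measurableSet_Ioc, ae_restrict_of_ae hreg] with t ht hr
    have h7 := hcon t ⟨ht.1, ht.2.trans h4⟩ (hr ht.1)
    rw [show a t = _ from dirichletIntegral_of_mem (⟨ht.1, by linarith [ht.2, h2.2]⟩ :
      t ∈ Ioc (0 : ℝ) 3)]
    linarith
  simp only [intervalIntegral.integral_const, sub_zero, smul_eq_mul] at h6
  nlinarith

/-- The definition of a solution does not relate `u(·, 0)` on `∂Ω` to `u₀`. The relation is
recovered along times tending to zero with bounded Dirichlet integrals: the functions and their
traces converge in `L²` because `∂ₜu` is in `L²`, and `hasWeakTrace_of_tendsto` passes to the limit.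
-/
theorem IsSolution.hasWeakTrace_initial (hv : IsSolution Ω ε σ u₀ v) (hσ : σ ≠ 0)
    (hm : IsDivergenceMeasure Ω m C) (hn : 0 < n) (hΩ : IsSmoothBoundedDomain Ω)
    (hu₀ : IsSobolev Ω u₀ gradu₀) : HasWeakTrace Ω m u₀ gradu₀ (fun x => v.u x 0) := by
  have := hΩ.isFiniteMeasure
  have := hm.isFiniteMeasure hn hΩ
  obtain ⟨b, hb, hb2, -, -, hbu⟩ := hv.exists_timeDerivative hm hn hΩ (T := 1) (by norm_num)
  obtain ⟨K, hK⟩ := hv.exists_dirichlet_le hσ hm hn hΩ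
  choose t ht hreg htK using fun k : ℕ => hK (1 / ((k : ℝ) + 1)) Nat.one_div_pos_of_nat
  have ht1 : ∀ k, t k ∈ Icc (0 : ℝ) 1 := fun k => ⟨(ht k).1.le, (ht k).2.trans (by
    rw [div_le_one (by positivity)]
    linarith [(k.cast_nonneg : (0 : ℝ) ≤ k)])⟩
  have htlim : Tendsto t atTop (𝓝 0) :=
    tendsto_of_tendsto_of_tendsto_of_le_of_le tendsto_const_nhds
      tendsto_one_div_add_atTop_nhds_zero_nat (fun k => (ht k).1.le) fun k => (ht k).2
  have hI : ∫⁻ z, ‖b z‖ₑ ^ 2 ∂((volume.restrict Ω + m).prod volume) ≠ ⊤ := by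
    rw [lintegral_enorm_sq hb2]
    exact ENNReal.ofReal_ne_top
  have hlim : Tendsto (fun k => eLpNorm (fun x => v.u x (t k) - v.u x 0) 2
      (volume.restrict Ω + m)) atTop (𝓝 0) := by
    have h1 : Tendsto (fun k => (ENNReal.ofReal (t k) *
        ∫⁻ z, ‖b z‖ₑ ^ 2 ∂((volume.restrict Ω + m).prod volume)) ^ (1 / (2 : ℝ))) atTop (𝓝 0) := by
      have h2 : Tendsto (fun k => ENNReal.ofReal (t k) *
          ∫⁻ z, ‖b z‖ₑ ^ 2 ∂((volume.restrict Ω + m).prod volume)) atTop (𝓝 0) := by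
        have h3 := (ENNReal.continuous_ofReal.tendsto 0).comp htlim
        rw [ENNReal.ofReal_zero] at h3
        simpa using ENNReal.Tendsto.mul_const h3 (Or.inr hI)
      have h4 := (ENNReal.continuous_rpow_const (y := 1 / (2 : ℝ))).tendsto 0 |>.comp h2
      rwa [ENNReal.zero_rpow_of_pos (by norm_num)] at h4
    refine tendsto_of_tendsto_of_tendsto_of_le_of_le tendsto_const_nhds h1 (fun k => zero_le)
      fun k => ?_
    refine le_trans (le_of_eq (eLpNorm_congr_ae ?_)) (eLpNorm_intervalIntegral_le hb (ht k).1.le)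
    exact hbu 0 ⟨le_rfl, zero_le_one⟩ (t k) (ht1 k)
  have hlimΩ : Tendsto (fun k => eLpNorm (fun x => v.u x (t k) - u₀ x) 2 (volume.restrict Ω))
      atTop (𝓝 0) := by
    refine tendsto_of_tendsto_of_tendsto_of_le_of_le tendsto_const_nhds hlim (fun k => zero_le)
      fun k => ?_
    refine le_trans (le_of_eq (eLpNorm_congr_ae ?_))
      (eLpNorm_mono_measure _ (Measure.le_add_right le_rfl))
    filter_upwards [hv.time_derivative 0 le_rfl] with x hx
    rw [intervalIntegral.integral_same, add_zero] at hx
    rw [hx]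
  have hlimm : Tendsto (fun k => eLpNorm (fun x => v.u x (t k) - v.u x 0) 2 m) atTop (𝓝 0) :=
    tendsto_of_tendsto_of_tendsto_of_le_of_le tendsto_const_nhds hlim (fun k => zero_le)
      fun k => eLpNorm_mono_measure _ (Measure.le_add_left le_rfl)
  have htr := fun k => (hreg k).trace.hasWeakTrace hm hn hΩ (hreg k).measurable
  have hu0 : MemLp (fun x => v.u x 0) 2 m := by
    have h1 : AEStronglyMeasurable (fun x => ∫ r in (0 : ℝ)..t 0, b (x, r)) m := by
      have : Measurable fun x => t 0 * steklov (t 0) b (x, 0) :=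
        ((measurable_steklov hb (t 0)).comp measurable_prodMk_right).const_mul _
      simp only [mul_steklov, zero_add] at this
      exact this.aestronglyMeasurable
    have h2 := hbu 0 ⟨le_rfl, zero_le_one⟩ (t 0) (ht1 0)
    rw [ae_add_measure_iff] at h2
    refine memLp_of_tendsto_eLpNorm (fun k => (htr k).memLp_trace) ?_ hlimm
    refine ((htr 0).memLp_trace.1.sub h1).congr ?_
    filter_upwards [h2.2] with x hx
    simp only [Pi.sub_apply]
    linarith
  exact hasWeakTrace_of_tendsto hm hn hΩ hu₀ hu0 htr hlimΩ hlimm htK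

/-- The Dirichlet integral decreases along the gradient flow. -/
theorem IsSolution.dirichlet_sub_le_time (hv : IsSolution Ω ε σ u₀ v) (hσ : σ ≠ 0)
    (hm : IsDivergenceMeasure Ω m C) (hn : 0 < n) (hΩ : IsSmoothBoundedDomain Ω)
    (hu₀ : IsSobolev Ω u₀ gradu₀) {T₀ : ℝ} (hT₀ : 0 < T₀) :
    ∀ᵐ T, T ∈ Ioc 0 T₀ →
      (1 / 2) * (∫ x in Ω, ‖v.grad x T‖ ^ 2) - (1 / 2) * (∫ x in Ω, ‖gradu₀ x‖ ^ 2) ≤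
        ∫ z, dirichletGradient Ω v z * v.dt z.1 z.2
          ∂((volume.restrict Ω + m).prod (volume.restrict (Ioc 0 T))) := by
  have := hΩ.isFiniteMeasure
  have := hm.isFiniteMeasure hn hΩ
  obtain ⟨b, hb, hb2, hb0, hbdt, hbu⟩ := hv.exists_timeDerivative hm hn hΩ hT₀
  set a₀ := (1 / 2) * (∫ x in Ω, ‖gradu₀ x‖ ^ 2)
  set a := dirichletIntegral Ω v a₀ T₀
  have ha : LocallyIntegrable a volume := hv.locallyIntegrable_dirichletIntegral hΩ a₀ hT₀
  have hreg := hv.ae_isRegularSlice hn hΩ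
  have hinit := hv.hasWeakTrace_initial hσ hm hn hΩ hu₀
  filter_upwards [LocallyIntegrable.ae_hasDerivAt_integral ha] with T haT hT
  set S : Set (EuclideanSpace ℝ (Fin n) × ℝ) := {z | z.2 ∈ Ioc 0 T} with hS
  have hSm : MeasurableSet S := measurable_snd measurableSet_Ioc
  set A := S.indicator (dirichletGradient Ω v)
  have hA : MemLp A 2 ((volume.restrict Ω + m).prod volume) :=
    memLp_indicator_time (hv.memLp_dirichletGradient hσ hm hn hΩ hT.1)
  have hA0 : ∀ z : EuclideanSpace ℝ (Fin n) × ℝ, z.2 ∉ Ioc 0 T → A z = 0 := fun z hz =>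
    indicator_of_notMem (s := S) hz _
  have key := sub_le_integral_mul_of_backward hb hb2 hA hT.1 hA0 ha
    (fun t ht => dirichletIntegral_of_nonpos ht) (haT 0) fun h hh => by
      filter_upwards [hreg, ae_comp_add hreg (-h)] with t h1 h2 ht
      have htT : t ∈ Ioc 0 T₀ := ⟨ht.1, ht.2.trans hT.2⟩
      have hAt : ∀ x, A (x, t) = dirichletGradient Ω v (x, t) := fun x =>
        indicator_of_mem (s := S) ht _
      have hst : ∀ x, h * steklov (-h) b (x, t) = ∫ r in (t - h)..t, b (x, r) := fun x => by
        have := mul_steklov (-h) b x t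
        rw [intervalIntegral.integral_symm, ← sub_eq_add_neg] at this
        linarith
      have hfin : ∀ c, c ≤ ∫ x, dirichletGradient Ω v (x, t) * (∫ r in (t - h)..t, b (x, r))
          ∂(volume.restrict Ω + m) →
          c ≤ h * ∫ x, A (x, t) * steklov (-h) b (x, t) ∂(volume.restrict Ω + m) := fun c hc => by
        refine hc.trans (le_of_eq ?_)
        rw [← integral_const_mul]
        congr 1 with x
        rw [hAt, ← hst]
        ring
      refine hfin _ ?_
      rw [show a t = _ from dirichletIntegral_of_mem htT]
      -- If `t - h ≤ 0`, the comparison function is the initial datum. The integral of `b` from `t -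
      -- h` equals the one from `0`, because `b` vanishes at nonpositive times.
      rcases le_or_gt (t - h) 0 with hth | hth
      · rw [show a (t - h) = _ from dirichletIntegral_of_nonpos hth]
        refine dirichlet_sub_le_integral hm hn hΩ (h1 ht.1) hinit ?_ ?_
        · filter_upwards [hv.time_derivative 0 le_rfl] with x hx
          rw [hx, intervalIntegral.integral_same, add_zero]
        · filter_upwards [hbu 0 ⟨le_rfl, hT₀.le⟩ t (Ioc_subset_Icc_self htT)] with x hx
          rw [hx, intervalIntegral.integral_of_le ht.1.le,
            intervalIntegral.integral_of_le (by linarith)]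
          refine setIntegral_eq_of_subset_of_forall_sdiff_eq_zero measurableSet_Ioc
            (Ioc_subset_Ioc_left hth) (fun r hr => hb0 _ fun hr' => hr.2 ⟨hr'.1, hr.1.2⟩) |>.symm
      · have hthT : t - h ∈ Ioc 0 T₀ := ⟨hth, by linarith [htT.2]⟩
        rw [show a (t - h) = _ from dirichletIntegral_of_mem hthT]
        have h4 := h2 (by linarith)
        rw [← sub_eq_add_neg] at h4
        exact dirichlet_sub_le_integral hm hn hΩ (h1 ht.1)
          (h4.trace.hasWeakTrace hm hn hΩ h4.measurable) (Eventually.of_forall fun x => rfl)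
          (hbu (t - h) (Ioc_subset_Icc_self hthT) t (Ioc_subset_Icc_self htT))
  rw [show a T = _ from dirichletIntegral_of_mem hT] at key
  refine key.trans (le_of_eq ?_)
  have e1 : ∀ z, A z * b z = S.indicator (fun z => dirichletGradient Ω v z * b z) z := fun z =>
    (indicator_mul_left S (dirichletGradient Ω v) b).symm
  have hSeq : S = univ ×ˢ Ioc 0 T := by
    ext z
    simp [hS]
  simp only [e1]
  rw [integral_indicator hSm, hSeq, ← Measure.prod_restrict, Measure.restrict_univ]
  refine integral_congr_ae ?_
  have hac : (volume.restrict Ω + m).prod (volume.restrict (Ioc 0 T)) ≪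
      (volume.restrict Ω + m).prod (volume.restrict (Ioc 0 T₀)) :=
    Measure.AbsolutelyContinuous.prod (Measure.AbsolutelyContinuous.refl _)
      (Measure.absolutelyContinuous_of_le
        (Measure.restrict_mono (Ioc_subset_Ioc_right hT.2) le_rfl))
  filter_upwards [hac.ae_le hbdt] with z hz
  rw [hz]

end

/-! ### The potential energy in time and the energy inequality. -/

section

variable {n : ℕ} {Ω : Set (EuclideanSpace ℝ (Fin n))}
  {m : Measure (EuclideanSpace ℝ (Fin n))} {C : ℝ≥0} {ε σ : ℝ}
  {u₀ : EuclideanSpace ℝ (Fin n) → ℝ}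
  {gradu₀ : EuclideanSpace ℝ (Fin n) → EuclideanSpace ℝ (Fin n)} {v : PhaseField n}

/-- The fundamental theorem of calculus for `W` along an absolutely continuous function. -/
theorem integral_deriv_doubleWell_mul {β : ℝ → ℝ} {T : ℝ} (hT : 0 ≤ T)
    (hβ : IntervalIntegrable β volume 0 T) (w : ℝ) :
    ∫ r in Ioc 0 T, deriv doubleWell (w + ∫ s in (0 : ℝ)..r, β s) * β r =
      doubleWell (w + ∫ s in (0 : ℝ)..T, β s) - doubleWell w := by
  have hconst : ∀ c : ℝ, AbsolutelyContinuousOnInterval (fun _ : ℝ => c) 0 T := fun c =>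
    ((LipschitzWith.const c).lipschitzOnWith (s := uIcc 0 T)).absolutelyContinuousOnInterval
  have hI : AbsolutelyContinuousOnInterval (fun r => ∫ s in (0 : ℝ)..r, β s) 0 T :=
    hβ.absolutelyContinuousOnInterval_intervalIntegral left_mem_uIcc
  set U : ℝ → ℝ := fun r => w + ∫ s in (0 : ℝ)..r, β s
  have hU : AbsolutelyContinuousOnInterval U 0 T := (hconst w).add hI
  -- `W` is a polynomial, so absolute continuity of `W(U)` follows from that of `U` by sums and
  -- products.
  have hV := (hconst 1).sub (hU.mul hU)
  have hW := (hconst (1 / 2)).mul (hV.mul hV)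
  have hWeq : ((fun _ : ℝ => (1 / 2 : ℝ)) *
      (((fun _ : ℝ => (1 : ℝ)) - U * U) * ((fun _ : ℝ => (1 : ℝ)) - U * U))) =
      fun r => doubleWell (U r) := by
    ext r
    simp only [Pi.mul_apply, Pi.sub_apply, doubleWell]
    ring
  rw [hWeq] at hW
  have h1 := hW.integral_deriv_eq_sub
  simp only [U, intervalIntegral.integral_same, add_zero] at h1
  rw [← h1, ← intervalIntegral.integral_of_le hT]
  refine intervalIntegral.integral_congr_ae ?_
  filter_upwards [hβ.ae_hasDerivAt_integral] with r hr hrT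
  have h2 := (hr (uIoc_subset_uIcc hrT) 0 left_mem_uIcc).const_add w
  have h3 := (hasDerivAt_doubleWell (w + ∫ s in (0 : ℝ)..r, β s)).comp r h2
  rw [deriv_doubleWell]
  exact h3.deriv.symm

/-- The equation reads `W'(u) = ε² (Δu - ∂ₜu)`, and the right side is in `L²`, whether or not `u` is
bounded. -/
theorem IsSolution.memLp_deriv_doubleWell (hv : IsSolution Ω ε σ u₀ v) (hε : ε ≠ 0) {T : ℝ}
    (hT : 0 < T) :
    MemLp (fun z : EuclideanSpace ℝ (Fin n) × ℝ => deriv doubleWell (v.u z.1 z.2)) 2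
      ((volume.restrict Ω).prod (volume.restrict (Ioc 0 T))) := by
  refine (((hv.memLp_laplacian hT).sub (hv.memLp_dt T hT)).const_mul (ε ^ 2)).ae_eq ?_
  filter_upwards [hv.equation_total T] with z hz
  simp only [Pi.sub_apply]
  rw [hz]
  field_simp
  ring

/-- The potential energy is absolutely continuous in time. -/
theorem IsSolution.doubleWell_sub (hv : IsSolution Ω ε σ u₀ v) (hε : ε ≠ 0)
    (hm : IsDivergenceMeasure Ω m C) (hn : 0 < n) (hΩ : IsSmoothBoundedDomain Ω)
    (hu₀ : AEStronglyMeasurable u₀ (volume.restrict Ω)) {T : ℝ} (hT : 0 < T) :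
    Integrable (fun x => doubleWell (v.u x T) - doubleWell (u₀ x)) (volume.restrict Ω) ∧
    ∫ x in Ω, (doubleWell (v.u x T) - doubleWell (u₀ x)) =
      ∫ z, deriv doubleWell (v.u z.1 z.2) * v.dt z.1 z.2
        ∂((volume.restrict Ω).prod (volume.restrict (Ioc 0 T))) := by
  have := hΩ.isFiniteMeasure
  have := hm.isFiniteMeasure hn hΩ
  obtain ⟨b, hb, hb2, -, hbdt, hbu⟩ := hv.exists_timeDerivative hm hn hΩ hT
  have hint := integrable_mul_of_memLp (hv.memLp_deriv_doubleWell hε hT) (hv.memLp_dt T hT)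
  have hbu0 : ∀ t ∈ Icc 0 T, ∀ᵐ x ∂(volume.restrict Ω),
      v.u x t = u₀ x + ∫ r in (0 : ℝ)..t, b (x, r) := fun t ht => by
    have h1 := hbu 0 ⟨le_rfl, hT.le⟩ t ht
    rw [ae_add_measure_iff] at h1
    filter_upwards [h1.1, hv.time_derivative 0 le_rfl] with x h1 h2
    rw [intervalIntegral.integral_same, add_zero] at h2
    linarith
  have hg : AEStronglyMeasurable (fun z : EuclideanSpace ℝ (Fin n) × ℝ =>
      u₀ z.1 + ∫ r in (0 : ℝ)..z.2, b (z.1, r))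
      ((volume.restrict Ω).prod (volume.restrict (Ioc 0 T))) := by
    refine hu₀.comp_fst.add ?_
    have h1 : StronglyMeasurable fun w : (EuclideanSpace ℝ (Fin n) × ℝ) × ℝ =>
        b (w.1.1, w.1.2 * w.2) := (hb.comp (by fun_prop)).stronglyMeasurable
    have h2 := h1.integral_prod_right' (ν := volume.restrict (Ioc (0 : ℝ) 1))
    have h3 : Measurable fun z : EuclideanSpace ℝ (Fin n) × ℝ =>
        z.2 * ∫ θ in Ioc (0 : ℝ) 1, b (z.1, z.2 * θ) := measurable_snd.mul h2.measurable
    refine h3.aestronglyMeasurable.congr (Eventually.of_forall fun z => ?_)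
    have := mul_steklov z.2 b z.1 0
    simpa only [steklov, zero_add] using this
  -- The representation of `u` by its time derivative holds for each time and almost every `x`. It
  -- is needed for almost every `x` and almost every time, so that the one-dimensional chain rule
  -- applies on vertical lines.
  have hugz := ae_prod_eq_of_ae_ae_eq (hv.memLp_u T hT).1 hg (by
    filter_upwards [ae_restrict_mem measurableSet_Ioc] with t ht
    exact hbu0 t (Ioc_subset_Icc_self ht))
  have hug := Measure.ae_ae_of_ae_prod hugz
  rw [Measure.add_prod, ae_add_measure_iff] at hbdt
  have hdtx := Measure.ae_ae_of_ae_prod hbdt.1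
  have hb2' : MemLp b 2 ((volume.restrict Ω).prod volume) :=
    hb2.mono_measure (Measure.prod_mono (Measure.le_add_right le_rfl) le_rfl)
  have hx : ∀ᵐ x ∂(volume.restrict Ω),
      ∫ r in Ioc 0 T, deriv doubleWell (v.u x r) * v.dt x r =
        doubleWell (v.u x T) - doubleWell (u₀ x) := by
    filter_upwards [hug, hdtx, hb2'.integrable_sq.prod_right_ae, hbu0 T ⟨hT.le, le_rfl⟩]
      with x h1 h2 h3 h4
    have hloc : LocallyIntegrable (fun t => b (x, t)) volume := by
      refine MemLp.locallyIntegrable (p := 2) ?_ (by norm_num)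
      exact (memLp_two_iff_integrable_sq
        (hb.comp measurable_prodMk_left).aestronglyMeasurable).2 h3
    have h5 := integral_deriv_doubleWell_mul hT.le (w := u₀ x) (intervalIntegrable_iff.2
      ((hloc.integrableOn_isCompact isCompact_uIcc).mono_set uIoc_subset_uIcc))
    rw [h4, ← h5]
    refine integral_congr_ae ?_
    filter_upwards [h1, h2] with r h1 h2
    rw [h1, h2]
  have hI := hint.integral_prod_left
  exact ⟨hI.congr hx, by rw [integral_prod _ hint, integral_congr_ae hx]⟩

/-- The energy inequality. -/
theorem IsSolution.energy_le (hv : IsSolution Ω ε σ u₀ v) (hε : 0 < ε) (hσ : 0 < σ)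
    (hm : IsDivergenceMeasure Ω m C) (hn : 0 < n) (hΩ : IsSmoothBoundedDomain Ω)
    (hu₀ : IsSobolev Ω u₀ gradu₀) (hu₀_le : ∀ᵐ x ∂(volume.restrict Ω), |u₀ x| ≤ 1) {T₀ : ℝ}
    (hT₀ : 0 < T₀) :
    ∀ᵐ T, T ∈ Ioc 0 T₀ → energy Ω ε (fun x => v.u x T) (fun x => v.grad x T) +
      ε * ∫ z, v.dt z.1 z.2 ^ 2 ∂((volume.restrict Ω).prod (volume.restrict (Ioc 0 T))) ≤
        energy Ω ε u₀ gradu₀ := by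
  have := hΩ.isFiniteMeasure
  have := hm.isFiniteMeasure hn hΩ
  filter_upwards [hv.dirichlet_sub_le_time hσ.ne' hm hn hΩ hu₀ hT₀, hv.ae_isRegularSlice hn hΩ]
    with T hdir hreg hT
  replace hdir := hdir hT
  replace hreg := hreg hT.1
  obtain ⟨hWi, hW⟩ := hv.doubleWell_sub hε.ne' hm hn hΩ hu₀.memLp.1 hT.1
  have hW₀ : Integrable (fun x => doubleWell (u₀ x)) (volume.restrict Ω) := by
    refine Integrable.of_bound (continuous_doubleWell.comp_aestronglyMeasurable hu₀.memLp.1)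
      (1 / 2) ?_
    filter_upwards [hu₀_le] with x hx
    rw [Real.norm_eq_abs, abs_of_nonneg (doubleWell_nonneg _), doubleWell]
    have h1 : u₀ x ^ 2 ≤ 1 := (sq_le_one_iff_abs_le_one _).2 hx
    nlinarith [sq_nonneg (u₀ x)]
  have hWT : Integrable (fun x => doubleWell (v.u x T)) (volume.restrict Ω) :=
    (hWi.add hW₀).congr (Eventually.of_forall fun x => by simp)
  have hF : Integrable (fun x => ‖v.grad x T‖ ^ 2) (volume.restrict Ω) :=
    hreg.trace.1.memLp_gradient.integrable_norm_pow (by norm_num)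
  have hF₀ : Integrable (fun x => ‖gradu₀ x‖ ^ 2) (volume.restrict Ω) :=
    hu₀.memLp_gradient.integrable_norm_pow (by norm_num)
  have henergy : ∀ {f : EuclideanSpace ℝ (Fin n) → ℝ}
      {F : EuclideanSpace ℝ (Fin n) → EuclideanSpace ℝ (Fin n)},
      Integrable (fun x => ‖F x‖ ^ 2) (volume.restrict Ω) →
      Integrable (fun x => doubleWell (f x)) (volume.restrict Ω) → energy Ω ε f F =
      ε * ((1 / 2) * ∫ x in Ω, ‖F x‖ ^ 2) + ε⁻¹ * ∫ x in Ω, doubleWell (f x) := by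
    intro f F h1 h2
    rw [energy, ← mul_assoc, ← integral_const_mul, ← integral_const_mul,
      ← integral_add (h1.const_mul _) (h2.const_mul _)]
    congr 1 with x
    ring
  rw [integral_sub hWT hW₀] at hW
  rw [henergy hF hWT, henergy hF₀ hW₀]
  -- the dissipation
  have hgd := hv.memLp_dirichletGradient hσ.ne' hm hn hΩ hT.1
  have hdt := hv.memLp_dt_total hm hn hΩ hT.1
  have hprod := integrable_mul_of_memLp hgd hdt
  rw [Measure.add_prod] at hprod hdir
  rw [integral_add_measure (integrable_add_measure.1 hprod).1
    (integrable_add_measure.1 hprod).2] at hdir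
  -- On `∂Ω` the integrand is `∂u/∂ν · ∂ₜu = -σ (∂u/∂ν)²`, a dissipation term that may be dropped.
  have hbd : ∫ z, dirichletGradient Ω v z * v.dt z.1 z.2
      ∂(m.prod (volume.restrict (Ioc 0 T))) ≤ 0 := by
    refine integral_nonpos_of_ae ?_
    filter_upwards [ae_prod_fst (hm.ae_notMem hΩ), hv.boundary_condition_total hm T] with z h1 h2
    rw [dirichletGradient, if_neg h1]
    have h3 : v.dt z.1 z.2 = -(σ * inner ℝ (v.grad z.1 z.2) (outerNormal Ω z.1)) := by linarith
    rw [h3]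
    simp only [Pi.zero_apply]
    nlinarith [mul_nonneg hσ.le (sq_nonneg (inner ℝ (v.grad z.1 z.2) (outerNormal Ω z.1)))]
  -- Inside, `-Δu ∂ₜu = -(∂ₜu)² - ε⁻² W'(u) ∂ₜu`, and the last term integrates to the increment of
  -- the potential energy.
  have hint : ∫ z, dirichletGradient Ω v z * v.dt z.1 z.2
      ∂((volume.restrict Ω).prod (volume.restrict (Ioc 0 T))) =
      -(∫ z, v.dt z.1 z.2 ^ 2 ∂((volume.restrict Ω).prod (volume.restrict (Ioc 0 T)))) -
      (ε ^ 2)⁻¹ * ∫ z, deriv doubleWell (v.u z.1 z.2) * v.dt z.1 z.2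
        ∂((volume.restrict Ω).prod (volume.restrict (Ioc 0 T))) := by
    have hi1 : Integrable (fun z : EuclideanSpace ℝ (Fin n) × ℝ => -v.dt z.1 z.2 ^ 2)
        ((volume.restrict Ω).prod (volume.restrict (Ioc 0 T))) :=
      (hv.memLp_dt T hT.1).integrable_sq.neg
    have hi2 := integrable_mul_of_memLp (hv.memLp_deriv_doubleWell hε.ne' hT.1)
      (hv.memLp_dt T hT.1)
    rw [← integral_neg, ← integral_const_mul, ← integral_sub hi1 (hi2.const_mul _)]
    refine integral_congr_ae ?_
    filter_upwards [ae_prod_fst (ae_restrict_mem hΩ.isOpen.measurableSet), hv.equation_total T]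
      with z h1 h2
    rw [dirichletGradient, if_pos h1]
    have h3 : ∑ i, v.hess z.1 z.2 i i =
        v.dt z.1 z.2 + (ε ^ 2)⁻¹ * deriv doubleWell (v.u z.1 z.2) := by linarith
    rw [h3]
    ring
  rw [hint, ← hW] at hdir
  set I := ∫ z, v.dt z.1 z.2 ^ 2 ∂((volume.restrict Ω).prod (volume.restrict (Ioc 0 T)))
  have h5 := mul_le_mul_of_nonneg_left (hdir.trans (add_le_add_right hbd _)) hε.le
  have h6 : ε * (ε ^ 2)⁻¹ = ε⁻¹ := by
    field_simp
  have h7 : ε * (-I - (ε ^ 2)⁻¹ * ((∫ x in Ω, doubleWell (v.u x T)) -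
      ∫ x in Ω, doubleWell (u₀ x)) + 0) = -(ε * I) -
      ε⁻¹ * ((∫ x in Ω, doubleWell (v.u x T)) - ∫ x in Ω, doubleWell (u₀ x)) := by
    rw [← h6]
    ring
  rw [h7] at h5
  linarith

end

section

/-! ### The Poincaré inequality on convex sets -/

section Convex

variable {G : Type*} [NormedAddCommGroup G] [NormedSpace ℝ G]

theorem enorm_sub_le_lintegral {ψ : G → ℝ} (hψ : ContDiff ℝ 1 ψ) {R : ℝ} {y z : G}
    (hR : ‖y - z‖ ≤ R) :
    ‖ψ y - ψ z‖ₑ ≤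
      ENNReal.ofReal R * ∫⁻ t in Ioc (0 : ℝ) 1, ‖fderiv ℝ ψ ((1 - t) • z + t • y)‖ₑ := by
  have hd : ∀ t : ℝ, HasDerivAt (fun t : ℝ => ψ ((1 - t) • z + t • y))
      (fderiv ℝ ψ ((1 - t) • z + t • y) (y - z)) t := fun t => by
    have h1 : HasDerivAt (fun t : ℝ => (1 - t) • z + t • y) (y - z) t := by
      have h2 : HasDerivAt (fun t : ℝ => (1 - t) • z + t • y) ((-1 : ℝ) • z + (1 : ℝ) • y) t :=
        (((hasDerivAt_id t).const_sub 1).smul_const z).add ((hasDerivAt_id t).smul_const y)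
      rwa [neg_one_smul, one_smul, neg_add_eq_sub] at h2
    exact (hψ.differentiable one_ne_zero _).hasFDerivAt.comp_hasDerivAt t h1
  have hc : Continuous fun t : ℝ => fderiv ℝ ψ ((1 - t) • z + t • y) (y - z) :=
    ((hψ.continuous_fderiv one_ne_zero).comp (by fun_prop)).clm_apply continuous_const
  have h1 := intervalIntegral.integral_eq_sub_of_hasDerivAt (fun t _ => hd t)
    (hc.intervalIntegrable 0 1)
  simp only [sub_self, zero_smul, one_smul, zero_add, sub_zero, add_zero] at h1
  rw [← h1, intervalIntegral.integral_of_le zero_le_one,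
    ← lintegral_const_mul' _ _ ENNReal.ofReal_ne_top]
  refine (enorm_integral_le_lintegral_enorm _).trans (lintegral_mono fun t => ?_)
  rw [mul_comm]
  refine (ContinuousLinearMap.le_opENorm _ _).trans ?_
  gcongr
  rw [← ofReal_norm]
  exact ENNReal.ofReal_le_ofReal hR

variable [FiniteDimensional ℝ G] [MeasurableSpace G] [BorelSpace G] {μ : Measure G} [μ.IsAddHaarMeasure] {s : Set G}

/-- For `z ∈ s`, convexity keeps `y ↦ (1 - t) z + t y` inside `s`, and its Jacobian `t ^ dim` is at
least `2 ^ (-dim)`. -/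
theorem lintegral_comp_lineMap_le (hs : Convex ℝ s) (hsm : MeasurableSet s) {g : G → ℝ≥0∞}
    (hg : Measurable g) {z : G} (hz : z ∈ s) {t : ℝ} (ht : t ∈ Icc (1 / 2 : ℝ) 1) :
    ∫⁻ y in s, g ((1 - t) • z + t • y) ∂μ ≤ 2 ^ Module.finrank ℝ G * ∫⁻ y in s, g y ∂μ := by
  have ht0 : 0 < t := by linarith [ht.1]
  have hm : Measurable fun x => s.indicator g ((1 - t) • z + x) :=
    (hg.indicator hsm).comp (measurable_const_add _)
  calc
    _ = ∫⁻ y in s, s.indicator g ((1 - t) • z + t • y) ∂μ := by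
        refine setLIntegral_congr_fun hsm fun y hy => ?_
        exact (indicator_of_mem (hs hz hy (by linarith [ht.2]) ht0.le (by ring)) g).symm
    _ ≤ ∫⁻ y, s.indicator g ((1 - t) • z + t • y) ∂μ := setLIntegral_le_lintegral _ _
    _ = ∫⁻ x, s.indicator g ((1 - t) • z + x) ∂(μ.map fun y => t • y) :=
        (lintegral_map hm (measurable_const_smul t)).symm
    _ = ENNReal.ofReal |(t ^ Module.finrank ℝ G)⁻¹| * ∫⁻ x, s.indicator g x ∂μ := by
        rw [Measure.map_addHaar_smul μ ht0.ne', lintegral_smul_measure, smul_eq_mul,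
          lintegral_add_left_eq_self]
    _ ≤ _ := by
        rw [lintegral_indicator hsm]
        gcongr
        rw [abs_of_nonneg (by positivity), ← inv_pow]
        have h1 : t⁻¹ ≤ 2 := by
          rw [inv_le_comm₀ ht0 two_pos]
          linarith [ht.1]
        calc
          _ ≤ ENNReal.ofReal (2 ^ Module.finrank ℝ G) :=
            ENNReal.ofReal_le_ofReal (pow_le_pow_left₀ (by positivity) h1 _)
          _ = _ := by rw [ENNReal.ofReal_pow two_pos.le, ENNReal.ofReal_ofNat]

/-- The change of variables is made in `y` when `t ≥ 1/2` and in `z` when `t ≤ 1/2`, so its Jacobian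
never degenerates. -/
theorem lintegral_lintegral_lineMap_le (hs : Convex ℝ s) (hsm : MeasurableSet s) {g : G → ℝ≥0∞}
    (hg : Measurable g) {t : ℝ} (ht : t ∈ Icc (0 : ℝ) 1) :
    ∫⁻ z in s, ∫⁻ y in s, g ((1 - t) • z + t • y) ∂μ ∂μ ≤
      2 ^ Module.finrank ℝ G * (∫⁻ y in s, g y ∂μ) * μ s := by
  rcases le_total (1 / 2) t with h | h
  · calc
      _ ≤ ∫⁻ _ in s, (2 ^ Module.finrank ℝ G * (∫⁻ y in s, g y ∂μ)) ∂μ :=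
        setLIntegral_mono' hsm fun z hz => lintegral_comp_lineMap_le hs hsm hg hz ⟨h, ht.2⟩
      _ = _ := by simp
  · rw [lintegral_lintegral_swap (by fun_prop)]
    calc
      _ ≤ ∫⁻ _ in s, (2 ^ Module.finrank ℝ G * (∫⁻ y in s, g y ∂μ)) ∂μ := by
        refine setLIntegral_mono' hsm fun y hy => ?_
        have := lintegral_comp_lineMap_le (μ := μ) hs hsm hg hy (t := 1 - t)
          ⟨by linarith, by linarith [ht.1]⟩
        simpa only [sub_sub_cancel, add_comm] using this
      _ = _ := by simp

/-- Integrate the derivative along the segment from `z` to `y`, exchange the integrals, and estimate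
for each fixed position `t` on the segment. -/
theorem lintegral_lintegral_enorm_sub_le [SFinite μ] (hs : Convex ℝ s) (hsm : MeasurableSet s)
    {ψ : G → ℝ} (hψ : ContDiff ℝ 1 ψ) {R : ℝ} (hR : ∀ y ∈ s, ∀ z ∈ s, ‖y - z‖ ≤ R) :
    ∫⁻ z in s, ∫⁻ y in s, ‖ψ y - ψ z‖ₑ ∂μ ∂μ ≤ ENNReal.ofReal R *
      (2 ^ Module.finrank ℝ G * (∫⁻ y in s, ‖fderiv ℝ ψ y‖ₑ ∂μ) * μ s) := by
  have hg : Continuous fun x => ‖fderiv ℝ ψ x‖ₑ := (hψ.continuous_fderiv one_ne_zero).enorm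
  have hgm : Measurable fun x => ‖fderiv ℝ ψ x‖ₑ := hg.measurable
  have hm3 : Measurable fun w : (G × G) × ℝ =>
      ‖fderiv ℝ ψ ((1 - w.2) • w.1.1 + w.2 • w.1.2)‖ₑ := hgm.comp (by fun_prop)
  calc
    _ ≤ ∫⁻ z in s, ∫⁻ y in s, ENNReal.ofReal R *
        (∫⁻ t in Ioc (0 : ℝ) 1, ‖fderiv ℝ ψ ((1 - t) • z + t • y)‖ₑ) ∂μ ∂μ :=
        setLIntegral_mono' hsm fun z hz => setLIntegral_mono' hsm fun y hy =>
          enorm_sub_le_lintegral hψ (hR y hy z hz)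
    _ = ENNReal.ofReal R * ∫⁻ z in s, ∫⁻ y in s,
        (∫⁻ t in Ioc (0 : ℝ) 1, ‖fderiv ℝ ψ ((1 - t) • z + t • y)‖ₑ) ∂μ ∂μ := by
        simp_rw [lintegral_const_mul' _ _ ENNReal.ofReal_ne_top]
    _ = ENNReal.ofReal R * ∫⁻ w, (∫⁻ t in Ioc (0 : ℝ) 1,
        ‖fderiv ℝ ψ ((1 - t) • w.1 + t • w.2)‖ₑ) ∂((μ.restrict s).prod (μ.restrict s)) := by
        rw [lintegral_prod]
        exact hm3.lintegral_prod_right'.aemeasurable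
    _ = ENNReal.ofReal R * ∫⁻ t in Ioc (0 : ℝ) 1, ∫⁻ w,
        ‖fderiv ℝ ψ ((1 - t) • w.1 + t • w.2)‖ₑ ∂((μ.restrict s).prod (μ.restrict s)) := by
        rw [lintegral_lintegral_swap hm3.aemeasurable]
    _ ≤ ENNReal.ofReal R * ∫⁻ _ in Ioc (0 : ℝ) 1,
        2 ^ Module.finrank ℝ G * (∫⁻ y in s, ‖fderiv ℝ ψ y‖ₑ ∂μ) * μ s := by
        gcongr ENNReal.ofReal R * ?_
        refine setLIntegral_mono' measurableSet_Ioc fun t ht => ?_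
        rw [lintegral_prod]
        · exact lintegral_lintegral_lineMap_le hs hsm hgm (Ioc_subset_Icc_self ht)
        · exact (hgm.comp (by fun_prop)).aemeasurable
    _ = _ := by simp

end Convex

/-! ### The Poincaré inequality on a boundary component -/

variable {n : ℕ} {Ω Q : Set (EuclideanSpace ℝ (Fin n))}
  {T : (EuclideanSpace ℝ (Fin (n - 1)) × ℝ) ≃L[ℝ] EuclideanSpace ℝ (Fin n)}
  {f : EuclideanSpace ℝ (Fin (n - 1)) → ℝ}

theorem IsGraphChart.contDiff_graphMap (h : IsGraphChart Ω Q T f) :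
    ContDiff ℝ 1 (graphMap T f) :=
  T.contDiff.comp (contDiff_id.prodMk h.contDiff)

/-- The conormal annihilates the tangent vectors of the graph. Hence only the tangential part of an
ambient gradient enters derivatives along the boundary. -/
theorem IsGraphChart.inner_outerNormal_fderiv (h : IsGraphChart Ω Q T f)
    (hΩ : IsSmoothBoundedDomain Ω) {y : EuclideanSpace ℝ (Fin (n - 1))} (hy : graphMap T f y ∈ Q)
    (w : EuclideanSpace ℝ (Fin (n - 1))) :
    inner ℝ (outerNormal Ω (graphMap T f y)) (fderiv ℝ (graphMap T f) y w) = 0 := by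
  have h1 : HasFDerivAt (graphMap T f) ((T : _ →L[ℝ] _).comp
      ((ContinuousLinearMap.id ℝ _).prod (fderiv ℝ f y))) y :=
    T.hasFDerivAt.comp y
      ((hasFDerivAt_id y).prodMk (h.contDiff.differentiable one_ne_zero y).hasFDerivAt)
  have h2 := h.conormal_eq hΩ hy (fderiv ℝ (graphMap T f) y w)
  rw [h1.fderiv] at h2 ⊢
  have h3 : conormal T f y (T (w, fderiv ℝ f y w)) = 0 := by
    rw [conormal_apply]
    simp
  have h4 : ((T : _ →L[ℝ] _).comp ((ContinuousLinearMap.id ℝ _).prod (fderiv ℝ f y))) w =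
      T (w, fderiv ℝ f y w) := rfl
  rw [h4] at h2 ⊢
  rw [h3] at h2
  exact (mul_eq_zero.1 h2.symm).resolve_left (norm_ne_zero_iff.2 (conormal_ne_zero T f y))

theorem IsGraphChart.norm_fderiv_comp_le (h : IsGraphChart Ω Q T f)
    (hΩ : IsSmoothBoundedDomain Ω) {K : ℝ≥0} (hK : LipschitzWith K (graphMap T f))
    {φ : EuclideanSpace ℝ (Fin n) → ℝ} (hφ : ContDiff ℝ 1 φ)
    {y : EuclideanSpace ℝ (Fin (n - 1))} (hy : graphMap T f y ∈ Q) :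
    ‖fderiv ℝ (φ ∘ graphMap T f) y‖ ≤
      K * ‖tangentialPart Ω (graphMap T f y) (gradient φ (graphMap T f y))‖ := by
  refine ContinuousLinearMap.opNorm_le_bound _ (by positivity) fun w => ?_
  rw [fderiv_comp y (hφ.differentiable one_ne_zero _)
    (h.contDiff_graphMap.differentiable one_ne_zero y), ContinuousLinearMap.comp_apply,
    ← inner_gradient]
  have h1 : inner ℝ (gradient φ (graphMap T f y)) (fderiv ℝ (graphMap T f) y w) =
      inner ℝ (tangentialPart Ω (graphMap T f y) (gradient φ (graphMap T f y)))
        (fderiv ℝ (graphMap T f) y w) := by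
    rw [tangentialPart, inner_sub_left, real_inner_smul_left,
      h.inner_outerNormal_fderiv hΩ hy w, mul_zero, sub_zero]
  rw [h1]
  calc
    _ ≤ ‖tangentialPart Ω (graphMap T f y) (gradient φ (graphMap T f y))‖ *
        ‖fderiv ℝ (graphMap T f) y w‖ := norm_inner_le_norm _ _
    _ ≤ ‖tangentialPart Ω (graphMap T f y) (gradient φ (graphMap T f y))‖ * (K * ‖w‖) := by
        gcongr
        exact (ContinuousLinearMap.le_opNorm _ _).trans
          (mul_le_mul_of_nonneg_right (norm_fderiv_le_of_lipschitz ℝ hK) (norm_nonneg _))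
    _ = _ := by ring

end

section

variable {n : ℕ} {Ω Q : Set (EuclideanSpace ℝ (Fin n))}
  {T : (EuclideanSpace ℝ (Fin (n - 1)) × ℝ) ≃L[ℝ] EuclideanSpace ℝ (Fin n)}
  {f : EuclideanSpace ℝ (Fin (n - 1)) → ℝ}

/-- In a chart the neighbourhood contains the image of a nonempty open parameter set, which has
positive Lebesgue measure. -/
theorem boundaryMeasure_pos (hn : 0 < n) (hΩ : IsSmoothBoundedDomain Ω)
    {p : EuclideanSpace ℝ (Fin n)} (hp : p ∈ frontier Ω) {V : Set (EuclideanSpace ℝ (Fin n))}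
    (hV : V ∈ 𝓝 p) : 0 < boundaryMeasure Ω V := by
  obtain ⟨Q, T, f, hpQ, h⟩ := exists_isGraphChart hn hΩ hp
  obtain ⟨C, -, hC⟩ := h.exists_measure_le
  obtain ⟨V', hV'V, hV', hpV'⟩ := mem_nhds_iff.1 hV
  have hpr : p ∈ range (graphMap T f) :=
    (h.frontier_inter_eq hΩ.isOpen ▸ ⟨hp, hpQ⟩ : p ∈ range (graphMap T f) ∩ Q).1
  obtain ⟨y, hy⟩ := hpr
  have hop : IsOpen (graphMap T f ⁻¹' (V' ∩ Q)) :=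
    (hV'.inter h.isOpen).preimage h.continuous_graphMap
  have h1 : 0 < volume (graphMap T f ⁻¹' (V' ∩ Q)) :=
    hop.measure_pos volume ⟨y, by rw [mem_preimage, hy]; exact ⟨hpV', hpQ⟩⟩
  have hm : MeasurableSet (V' ∩ Q) := (hV'.inter h.isOpen).measurableSet
  have h2 := hC (V' ∩ Q)
  rw [Measure.map_apply h.continuous_graphMap.measurable hm] at h2
  have h3 := h1.trans_le h2
  rw [Measure.smul_apply, Measure.restrict_apply hm] at h3
  have h4 : V' ∩ Q ∩ range (graphMap T f) ⊆ V ∩ frontier Ω := by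
    rintro x ⟨⟨hx1, hx2⟩, hx3⟩
    exact ⟨hV'V hx1, (h.frontier_inter_eq hΩ.isOpen ▸ ⟨hx3, hx2⟩ : x ∈ frontier Ω ∩ Q).1⟩
  have h5 : 0 < Measure.euclideanHausdorffMeasure (n - 1) (V ∩ frontier Ω) := by
    refine lt_of_lt_of_le ?_ (measure_mono h4)
    rw [pos_iff_ne_zero] at h3 ⊢
    intro h0
    rw [h0] at h3
    simp at h3
  exact h5.trans_le (Measure.le_restrict_apply _ _)

/-- Every boundary point has a neighbourhood in `∂Ω` on which a Poincaré inequality holds. -/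
theorem exists_poincare_patch (hn : 0 < n) (hΩ : IsSmoothBoundedDomain Ω)
    {p : EuclideanSpace ℝ (Fin n)} (hp : p ∈ frontier Ω) :
    ∃ U, IsOpen U ∧ p ∈ U ∧ IsPreconnected (U ∩ frontier Ω) ∧ ∃ K : ℝ≥0,
      ∀ φ : EuclideanSpace ℝ (Fin n) → ℝ, ContDiff ℝ 1 φ →
        ∫⁻ x in U, ∫⁻ y in U, ‖φ y - φ x‖ₑ ∂(boundaryMeasure Ω) ∂(boundaryMeasure Ω) ≤
          K * ∫⁻ x in U, ‖tangentialPart Ω x (gradient φ x)‖ₑ ∂(boundaryMeasure Ω) := by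
  obtain ⟨Q, T, f, hpQ, h⟩ := exists_isGraphChart hn hΩ hp
  obtain ⟨C, hC, hC'⟩ := h.exists_measure_le
  obtain ⟨L, hL⟩ := h.exists_lipschitzWith
  set q := graphMap T f
  have hq : Continuous q := h.continuous_graphMap
  have hqe := h.isClosedEmbedding_graphMap
  obtain ⟨y₀, hy₀⟩ : p ∈ range q :=
    (h.frontier_inter_eq hΩ.isOpen ▸ ⟨hp, hpQ⟩ : p ∈ range (graphMap T f) ∩ Q).1
  obtain ⟨r, hr, hrQ⟩ := Metric.isOpen_iff.1 (h.isOpen.preimage hq) y₀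
    (by rw [mem_preimage, hy₀]; exact hpQ)
  -- The patch is arranged to be exactly the image of a ball in the parameter space: convex, for the
  -- Poincaré inequality, and with a connected image.
  set B := Metric.ball y₀ r
  obtain ⟨V, hV, hVB⟩ := hqe.isInducing.isOpen_iff.1 (Metric.isOpen_ball : IsOpen B)
  have hUeq : (Q ∩ V) ∩ frontier Ω = q '' B := by
    ext x
    constructor
    · rintro ⟨⟨hx1, hx2⟩, hx3⟩
      obtain ⟨y, rfl⟩ := (h.frontier_inter_eq hΩ.isOpen ▸ ⟨hx3, hx1⟩ : x ∈ range q ∩ Q).1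
      exact ⟨y, hVB.subset hx2, rfl⟩
    · rintro ⟨y, hy, rfl⟩
      have h1 : q y ∈ frontier Ω ∩ Q := by
        rw [h.frontier_inter_eq hΩ.isOpen]
        exact ⟨mem_range_self y, hrQ hy⟩
      have h2 : y ∈ q ⁻¹' V := hVB.symm ▸ hy
      exact ⟨⟨h1.2, h2⟩, h1.1⟩
  have hUo : IsOpen (Q ∩ V) := h.isOpen.inter hV
  have hBm : MeasurableSet (q '' B) :=
    hqe.measurableEmbedding.measurableSet_image.2 Metric.isOpen_ball.measurableSet
  have hpre : q ⁻¹' (q '' B) = B := preimage_image_eq B hqe.injective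
  have hH : (boundaryMeasure Ω).restrict (Q ∩ V) =
      ((Measure.euclideanHausdorffMeasure (n - 1)).restrict (range q)).restrict (q '' B) := by
    rw [boundaryMeasure, Measure.restrict_restrict hUo.measurableSet, hUeq,
      Measure.restrict_restrict hBm, inter_eq_left.2 (image_subset_range q B)]
  have hle1 : (boundaryMeasure Ω).restrict (Q ∩ V) ≤ C • (volume.restrict B).map q := by
    rw [hH]
    refine (Measure.restrict_mono le_rfl hC).trans (le_of_eq ?_)
    rw [Measure.restrict_smul, Measure.restrict_map hq.measurable hBm, hpre]
  have hle2 : (volume.restrict B).map q ≤ C • (boundaryMeasure Ω).restrict (Q ∩ V) := by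
    rw [hH, ← Measure.restrict_smul]
    refine le_trans (le_of_eq ?_) (Measure.restrict_mono le_rfl hC')
    rw [Measure.restrict_map hq.measurable hBm, hpre]
  have hpU : p ∈ Q ∩ V :=
    (hUeq ▸ ⟨y₀, Metric.mem_ball_self hr, hy₀⟩ : p ∈ (Q ∩ V) ∩ frontier Ω).1
  have hvB : volume B ≠ ⊤ := measure_ball_lt_top.ne
  refine ⟨Q ∩ V, hUo, hpU, ?_, C * C * ((2 * r).toNNReal *
    (2 ^ Module.finrank ℝ (EuclideanSpace ℝ (Fin (n - 1))) * (L * C) * (volume B).toNNReal)),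
    fun φ hφ => ?_⟩
  · rw [hUeq]
    exact (convex_ball y₀ r).isPreconnected.image q hq.continuousOn
  have hψ : ContDiff ℝ 1 (φ ∘ q) := hφ.comp h.contDiff_graphMap
  have hball := lintegral_lintegral_enorm_sub_le (μ := volume) (convex_ball y₀ r)
    measurableSet_ball hψ (R := 2 * r) fun y hy z hz => by
      rw [← dist_eq_norm]
      have h1 := dist_triangle_right y z y₀
      rw [Metric.mem_ball] at hy hz
      linarith
  have hφc : Continuous φ := hφ.continuous
  have hgrad : ∫⁻ y in B, ‖fderiv ℝ (φ ∘ q) y‖ₑ ≤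
      L * (C * ∫⁻ x in Q ∩ V, ‖tangentialPart Ω x (gradient φ x)‖ₑ ∂(boundaryMeasure Ω)) := by
    calc
      _ ≤ ∫⁻ y in B, L * ‖tangentialPart Ω (q y) (gradient φ (q y))‖ₑ := by
          refine setLIntegral_mono' measurableSet_ball fun y hy => ?_
          have h1 := h.norm_fderiv_comp_le hΩ hL hφ (hrQ hy)
          rw [← ofReal_norm, ← ofReal_norm, ← ENNReal.ofReal_coe_nnreal,
            ← ENNReal.ofReal_mul L.coe_nonneg]
          exact ENNReal.ofReal_le_ofReal h1
      _ = L * ∫⁻ y in B, ‖tangentialPart Ω (q y) (gradient φ (q y))‖ₑ :=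
          lintegral_const_mul' _ _ ENNReal.coe_ne_top
      _ = L * ∫⁻ x, ‖tangentialPart Ω x (gradient φ x)‖ₑ ∂((volume.restrict B).map q) := by
          rw [hqe.measurableEmbedding.lintegral_map]
      _ ≤ L * ∫⁻ x, ‖tangentialPart Ω x (gradient φ x)‖ₑ
          ∂(C • (boundaryMeasure Ω).restrict (Q ∩ V)) := by
          gcongr
      _ = _ := by
          rw [lintegral_smul_measure]
          rfl
  calc
    _ ≤ ∫⁻ x, ∫⁻ y, ‖φ y - φ x‖ₑ ∂(C • (volume.restrict B).map q)
        ∂(C • (volume.restrict B).map q) :=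
        lintegral_mono' hle1 fun x => lintegral_mono' hle1 le_rfl
    _ = C * (C * ∫⁻ z in B, ∫⁻ y in B, ‖φ (q y) - φ (q z)‖ₑ) := by
        simp only [lintegral_smul_measure, ENNReal.smul_def, smul_eq_mul]
        rw [lintegral_const_mul' _ _ ENNReal.coe_ne_top, hqe.measurableEmbedding.lintegral_map]
        congr 2
        exact lintegral_congr fun z => hqe.measurableEmbedding.lintegral_map _
    _ ≤ C * (C * (ENNReal.ofReal (2 * r) *
        (2 ^ Module.finrank ℝ (EuclideanSpace ℝ (Fin (n - 1))) *
          (L * (C * ∫⁻ x in Q ∩ V, ‖tangentialPart Ω x (gradient φ x)‖ₑ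
            ∂(boundaryMeasure Ω))) * volume B))) := by
        gcongr
        exact hball.trans (by gcongr)
    _ = _ := by
        rw [ENNReal.ofReal, ← ENNReal.coe_toNNReal hvB]
        push_cast
        simp only [ENNReal.toNNReal_coe]
        ring

/-- The closure of the component is again preconnected and stays inside `F`, so maximality applies.
-/
theorem isClosed_connectedComponentIn {X : Type*} [TopologicalSpace X] {F : Set X}
    (hF : IsClosed F) (x : X) : IsClosed (connectedComponentIn F x) := by
  by_cases hx : x ∈ F
  · refine isClosed_of_closure_subset ?_
    exact isPreconnected_connectedComponentIn.closure.subset_connectedComponentIn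
      (subset_closure (mem_connectedComponentIn hx))
      (closure_minimal (connectedComponentIn_subset F x) hF)
  · rw [connectedComponentIn_eq_empty hx]
    exact isClosed_empty

/-- The Poincaré inequality on a connected component of `∂Ω`. -/
theorem exists_poincare (hn : 0 < n) (hΩ : IsSmoothBoundedDomain Ω)
    (p : EuclideanSpace ℝ (Fin n)) :
    ∃ K : ℝ≥0, ∀ φ : EuclideanSpace ℝ (Fin n) → ℝ, ContDiff ℝ 1 φ →
      ∫⁻ z, ‖φ z.2 - φ z.1‖ₑ ∂(((boundaryMeasure Ω).restrict
          (connectedComponentIn (frontier Ω) p)).prod ((boundaryMeasure Ω).restrict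
          (connectedComponentIn (frontier Ω) p))) ≤
        K * ∫⁻ x in connectedComponentIn (frontier Ω) p,
          ‖tangentialPart Ω x (gradient φ x)‖ₑ ∂(boundaryMeasure Ω) := by
  have := boundaryMeasure_lt_top hn hΩ
  set Γ := connectedComponentIn (frontier Ω) p
  have hΓc : IsClosed Γ := isClosed_connectedComponentIn isClosed_frontier p
  have hΓF : Γ ⊆ frontier Ω := connectedComponentIn_subset _ _
  have hΓk : IsCompact Γ := hΩ.isCompact_frontier.of_isClosed_subset hΓc hΓF
  set H := (boundaryMeasure Ω).restrict Γ with hH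
  set D : (EuclideanSpace ℝ (Fin n) → ℝ) → ℝ≥0∞ := fun φ =>
    ∫⁻ x, ‖tangentialPart Ω x (gradient φ x)‖ₑ ∂H
  -- `P x y` is a Poincaré estimate between some neighbourhoods of `x` and `y`. It holds locally,
  -- and it is symmetric and transitive, so connectedness of `Γ` gives it for all pairs. Compactness
  -- of `Γ × Γ` then combines finitely many estimates.
  set P : EuclideanSpace ℝ (Fin n) → EuclideanSpace ℝ (Fin n) → Prop := fun x y =>
    ∃ U ∈ 𝓝 x, ∃ V ∈ 𝓝 y, ∃ K : ℝ≥0, ∀ φ : EuclideanSpace ℝ (Fin n) → ℝ, ContDiff ℝ 1 φ →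
      ∫⁻ x in U, ∫⁻ y in V, ‖φ y - φ x‖ₑ ∂H ∂H ≤ K * D φ with hP
  have hmeas : ∀ {φ : EuclideanSpace ℝ (Fin n) → ℝ}, ContDiff ℝ 1 φ →
      Measurable fun z : EuclideanSpace ℝ (Fin n) × EuclideanSpace ℝ (Fin n) =>
        ‖φ z.2 - φ z.1‖ₑ := fun hφ =>
    ((hφ.continuous.comp continuous_snd).sub (hφ.continuous.comp continuous_fst)).enorm.measurable
  have hpatch : ∀ x ∈ Γ, ∃ U, IsOpen U ∧ x ∈ U ∧ U ∩ frontier Ω ⊆ Γ ∧ ∃ K : ℝ≥0,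
      ∀ φ : EuclideanSpace ℝ (Fin n) → ℝ, ContDiff ℝ 1 φ →
        ∫⁻ x in U, ∫⁻ y in U, ‖φ y - φ x‖ₑ ∂H ∂H ≤ K * D φ := by
    intro x hx
    obtain ⟨U, hU, hxU, hUc, K, hK⟩ := exists_poincare_patch hn hΩ (hΓF hx)
    -- A connected patch that meets `Γ` lies inside `Γ`, so `H` and the full boundary measure
    -- coincide on it.
    have hUΓ : U ∩ frontier Ω ⊆ Γ := by
      have h1 := hUc.subset_connectedComponentIn ⟨hxU, hΓF hx⟩ inter_subset_right
      rwa [← connectedComponentIn_eq hx] at h1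
    have hres : H.restrict U = (boundaryMeasure Ω).restrict U := by
      rw [hH, boundaryMeasure, Measure.restrict_restrict hU.measurableSet,
        Measure.restrict_restrict (hU.measurableSet.inter hΓc.measurableSet),
        Measure.restrict_restrict hU.measurableSet]
      congr 1
      ext z
      exact ⟨fun hz => ⟨hz.1.1, hz.2⟩, fun hz => ⟨⟨hz.1, hUΓ hz⟩, hz.2⟩⟩
    refine ⟨U, hU, hxU, hUΓ, K, fun φ hφ => ?_⟩
    rw [hres]
    refine (hK φ hφ).trans ?_
    rw [← hres]
    exact mul_le_mul_right (lintegral_mono' Measure.restrict_le_self le_rfl) _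
  have hpos : ∀ x ∈ Γ, ∀ V ∈ 𝓝 x, 0 < H V := by
    intro x hx V hV
    obtain ⟨U, hU, hxU, hUΓ, -⟩ := hpatch x hx
    have h1 := boundaryMeasure_pos hn hΩ (hΓF hx) (inter_mem hV (hU.mem_nhds hxU))
    have h2 : boundaryMeasure Ω (V ∩ U) = boundaryMeasure Ω (V ∩ U ∩ frontier Ω) := by
      refine (measure_inter_conull ?_).symm
      rw [boundaryMeasure, Measure.restrict_apply isClosed_frontier.measurableSet.compl]
      simp
    rw [h2] at h1
    refine h1.trans_le ((measure_mono ?_).trans (Measure.le_restrict_apply _ _))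
    exact fun z hz => ⟨hz.1.1, hUΓ ⟨hz.1.2, hz.2⟩⟩
  have hPall : ∀ {x y}, x ∈ Γ → y ∈ Γ → P x y := by
    refine isPreconnected_connectedComponentIn.induction₂ P ?_ ?_ ?_
    · intro x hx
      obtain ⟨U, hU, hxU, -, K, hK⟩ := hpatch x hx
      filter_upwards [mem_nhdsWithin_of_mem_nhds (hU.mem_nhds hxU)] with y hy
      exact ⟨U, hU.mem_nhds hxU, U, hU.mem_nhds hy, K, hK⟩
    · rintro x y z hx hy hz ⟨U, hU, V, hV, K, hK⟩ ⟨V', hV', W, hW, K', hK'⟩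
      -- For transitivity an intermediate point is inserted by the triangle inequality and averaged
      -- over `S`. This needs `S` to have positive measure.
      set S := V ∩ V'
      have hS : 0 < H S := hpos y hy S (inter_mem hV hV')
      have hSt : H S ≠ ⊤ := measure_ne_top _ _
      refine ⟨U, hU, W, hW, ((H S)⁻¹ * (H W * K + H U * K')).toNNReal, fun φ hφ => ?_⟩
      have hfin : (H S)⁻¹ * (H W * K + H U * K') ≠ ⊤ :=
        ENNReal.mul_ne_top (ENNReal.inv_ne_top.2 hS.ne')
          (ENNReal.add_ne_top.2 ⟨ENNReal.mul_ne_top (measure_ne_top _ _) ENNReal.coe_ne_top,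
            ENNReal.mul_ne_top (measure_ne_top _ _) ENNReal.coe_ne_top⟩)
      rw [ENNReal.coe_toNNReal hfin]
      have hc := hφ.continuous
      have m1 : ∀ x, Measurable fun y => ‖φ y - φ x‖ₑ := fun x => by fun_prop
      have m2 : ∀ y, Measurable fun x => ‖φ y - φ x‖ₑ := fun y => by fun_prop
      have key : H S * ∫⁻ x in U, ∫⁻ z in W, ‖φ z - φ x‖ₑ ∂H ∂H ≤
          H W * (∫⁻ x in U, ∫⁻ s in S, ‖φ s - φ x‖ₑ ∂H ∂H) +
          H U * ∫⁻ s in S, ∫⁻ z in W, ‖φ z - φ s‖ₑ ∂H ∂H := by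
        have e1 : H S * ∫⁻ x in U, ∫⁻ z in W, ‖φ z - φ x‖ₑ ∂H ∂H =
            ∫⁻ x in U, ∫⁻ s in S, (∫⁻ z in W, ‖φ z - φ x‖ₑ ∂H) ∂H ∂H := by
          simp only [lintegral_const, Measure.restrict_apply_univ]
          rw [lintegral_mul_const' _ _ hSt, mul_comm]
        have e2 : ∀ x s, ∫⁻ z in W, ‖φ z - φ x‖ₑ ∂H ≤
            ‖φ s - φ x‖ₑ * H W + ∫⁻ z in W, ‖φ z - φ s‖ₑ ∂H := fun x s => by
          calc
            _ ≤ ∫⁻ z in W, (‖φ s - φ x‖ₑ + ‖φ z - φ s‖ₑ) ∂H := by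
                refine lintegral_mono fun z => ?_
                have : φ z - φ x = (φ s - φ x) + (φ z - φ s) := by ring
                rw [this]
                exact enorm_add_le _ _
            _ = _ := by
                rw [lintegral_add_left (by fun_prop)]
                simp
        rw [e1]
        calc
          _ ≤ ∫⁻ x in U, ∫⁻ s in S, (‖φ s - φ x‖ₑ * H W +
              ∫⁻ z in W, ‖φ z - φ s‖ₑ ∂H) ∂H ∂H :=
              lintegral_mono fun x => lintegral_mono fun s => e2 x s
          _ = ∫⁻ x in U, ((∫⁻ s in S, ‖φ s - φ x‖ₑ ∂H) * H W +
              ∫⁻ s in S, ∫⁻ z in W, ‖φ z - φ s‖ₑ ∂H ∂H) ∂H := by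
              congr 1 with x
              rw [lintegral_add_left (by fun_prop),
                lintegral_mul_const' _ _ (measure_ne_top _ _)]
          _ = _ := by
              rw [lintegral_add_right _ measurable_const,
                lintegral_mul_const' _ _ (measure_ne_top _ _)]
              simp only [lintegral_const, Measure.restrict_apply_univ]
              ring
      have h1 : ∫⁻ x in U, ∫⁻ s in S, ‖φ s - φ x‖ₑ ∂H ∂H ≤ K * D φ :=
        (lintegral_mono fun x => lintegral_mono_set inter_subset_left).trans (hK φ hφ)
      have h2 : ∫⁻ s in S, ∫⁻ z in W, ‖φ z - φ s‖ₑ ∂H ∂H ≤ K' * D φ :=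
        (lintegral_mono_set inter_subset_right).trans (hK' φ hφ)
      calc
        _ = (H S)⁻¹ * (H S * ∫⁻ x in U, ∫⁻ z in W, ‖φ z - φ x‖ₑ ∂H ∂H) := by
            rw [← mul_assoc, ENNReal.inv_mul_cancel hS.ne' hSt, one_mul]
        _ ≤ (H S)⁻¹ * (H W * (K * D φ) + H U * (K' * D φ)) := by
            gcongr
            exact key.trans (by gcongr)
        _ = _ := by ring
    · rintro x y hx hy ⟨U, hU, V, hV, K, hK⟩
      refine ⟨V, hV, U, hU, K, fun φ hφ => ?_⟩
      rw [lintegral_lintegral_swap ((hmeas hφ).aemeasurable)]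
      refine le_trans (le_of_eq ?_) (hK φ hφ)
      congr 1 with x
      congr 1 with y
      rw [enorm_sub_rev]
  have hcov := (hΓk.prod hΓk).induction_on
    (p := fun S => ∃ K : ℝ≥0, ∀ φ : EuclideanSpace ℝ (Fin n) → ℝ, ContDiff ℝ 1 φ →
      ∫⁻ z in S, ‖φ z.2 - φ z.1‖ₑ ∂(H.prod H) ≤ K * D φ)
    ⟨0, fun φ _ => by simp⟩
    (fun S S' hSS' ⟨K, hK⟩ => ⟨K, fun φ hφ => (lintegral_mono_set hSS').trans (hK φ hφ)⟩)
    (fun S S' ⟨K, hK⟩ ⟨K', hK'⟩ => ⟨K + K', fun φ hφ => by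
      refine (lintegral_union_le _ _ _).trans ((add_le_add (hK φ hφ) (hK' φ hφ)).trans ?_)
      rw [ENNReal.coe_add, add_mul]⟩)
    (fun z hz => by
      obtain ⟨U, hU, V, hV, K, hK⟩ := hPall hz.1 hz.2
      refine ⟨U ×ˢ V, mem_nhdsWithin_of_mem_nhds (prod_mem_nhds hU hV), K, fun φ hφ => ?_⟩
      rw [← Measure.prod_restrict, lintegral_prod _ (hmeas hφ).aemeasurable]
      exact hK φ hφ)
  obtain ⟨K, hK⟩ := hcov
  refine ⟨K, fun φ hφ => ?_⟩
  have h1 := hK φ hφ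
  rwa [← Measure.prod_restrict, hH, Measure.restrict_restrict hΓc.measurableSet,
    inter_self] at h1

end

section

/-! ### The truncated primitive of `√(2W)` -/

/-- `√(2W)` truncated outside `[-1, 1]`. -/
def wellDensity (s : ℝ) : ℝ := max (1 - s ^ 2) 0

/-- The primitive of `wellDensity`; it is `s - s³/3` on `[-1, 1]` and constant on either side. -/
def wellPrimitive (s : ℝ) : ℝ := ∫ r in (0 : ℝ)..s, wellDensity r

theorem continuous_wellDensity : Continuous wellDensity := by
  unfold wellDensity
  fun_prop

theorem wellDensity_nonneg (s : ℝ) : 0 ≤ wellDensity s := le_max_right _ _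

theorem wellDensity_le_one (s : ℝ) : wellDensity s ≤ 1 :=
  max_le (by nlinarith [sq_nonneg s]) zero_le_one

theorem wellDensity_of_abs_le {s : ℝ} (hs : |s| ≤ 1) : wellDensity s = 1 - s ^ 2 :=
  max_eq_left (by have := (sq_le_one_iff_abs_le_one s).2 hs; linarith)

theorem wellDensity_of_one_le_abs {s : ℝ} (hs : 1 ≤ |s|) : wellDensity s = 0 :=
  max_eq_right (by have := (one_le_sq_iff_one_le_abs s).2 hs; linarith)

theorem sq_wellDensity_le (s : ℝ) : wellDensity s ^ 2 ≤ 2 * doubleWell s := by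
  rw [doubleWell]
  rcases le_total |s| 1 with hs | hs
  · rw [wellDensity_of_abs_le hs]
    linarith
  · rw [wellDensity_of_one_le_abs hs]
    nlinarith [sq_nonneg (1 - s ^ 2)]

theorem abs_wellDensity_sub_le (s t : ℝ) : |wellDensity s - wellDensity t| ≤ 2 * |s - t| := by
  -- With the projection of `s` to `[-1, 1]` the density is `1` minus a square. The projection is
  -- 1-Lipschitz with values bounded by one, hence the factor `2`.
  have hc : ∀ s, wellDensity s = 1 - max (-1) (min s 1) ^ 2 := by
    intro s
    rcases le_total |s| 1 with hs | hs
    · rw [wellDensity_of_abs_le hs, min_eq_left (abs_le.1 hs).2, max_eq_right (abs_le.1 hs).1]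
    · rw [wellDensity_of_one_le_abs hs]
      rcases le_abs.1 hs with h | h
      · rw [min_eq_right h, max_eq_right (by norm_num)]; norm_num
      · rw [min_eq_left (by linarith), max_eq_left (by linarith)]; norm_num
  have hb : ∀ s, |max (-1) (min s 1)| ≤ (1 : ℝ) := fun s =>
    abs_le.2 ⟨le_max_left _ _, max_le (by norm_num) (min_le_right _ _)⟩
  rw [hc, hc, show (1 - max (-1) (min s 1) ^ 2 - (1 - max (-1) (min t 1) ^ 2) : ℝ) =
    (max (-1) (min t 1) + max (-1) (min s 1)) * (max (-1) (min t 1) - max (-1) (min s 1)) by ring,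
    abs_mul]
  refine mul_le_mul ((abs_add_le _ _).trans (by linarith [hb s, hb t])) ?_ (abs_nonneg _)
    (by norm_num)
  rw [abs_sub_comm]
  have h1 := abs_max_sub_max_le_max (-1) (min s 1) (-1) (min t 1)
  have h2 := abs_min_sub_min_le_max s 1 t 1
  rw [sub_self, abs_zero, max_eq_right (a := (0 : ℝ)) (abs_nonneg _)] at h1
  rw [sub_self, abs_zero, max_eq_left (b := (0 : ℝ)) (abs_nonneg _)] at h2
  exact h1.trans h2

theorem hasDerivAt_wellPrimitive (s : ℝ) : HasDerivAt wellPrimitive (wellDensity s) s :=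
  intervalIntegral.integral_hasDerivAt_right (continuous_wellDensity.intervalIntegrable _ _)
    (continuous_wellDensity.stronglyMeasurableAtFilter _ _) continuous_wellDensity.continuousAt

theorem contDiff_wellPrimitive : ContDiff ℝ 1 wellPrimitive := by
  rw [contDiff_one_iff_deriv]
  refine ⟨fun s => (hasDerivAt_wellPrimitive s).differentiableAt, ?_⟩
  rw [show deriv wellPrimitive = wellDensity from
    funext fun s => (hasDerivAt_wellPrimitive s).deriv]
  exact continuous_wellDensity

theorem lipschitzWith_wellPrimitive : LipschitzWith 1 wellPrimitive :=
  lipschitzWith_of_nnnorm_deriv_le (fun s => (hasDerivAt_wellPrimitive s).differentiableAt)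
    fun s => by
      rw [(hasDerivAt_wellPrimitive s).deriv, ← NNReal.coe_le_coe, coe_nnnorm, Real.norm_eq_abs,
        abs_of_nonneg (wellDensity_nonneg s)]
      exact wellDensity_le_one s

theorem wellPrimitive_of_abs_le {s : ℝ} (hs : |s| ≤ 1) : wellPrimitive s = s - s ^ 3 / 3 := by
  have h1 : wellPrimitive s = ∫ r in (0 : ℝ)..s, (1 - r ^ 2) := by
    refine intervalIntegral.integral_congr fun r hr => wellDensity_of_abs_le ?_
    have := abs_sub_left_of_mem_uIcc hr
    rw [sub_zero, sub_zero] at this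
    exact this.trans hs
  rw [h1, intervalIntegral.integral_sub (by simp) (by simp), integral_pow]
  simp
  ring

theorem wellPrimitive_of_one_le {s : ℝ} (hs : 1 ≤ s) : wellPrimitive s = 2 / 3 := by
  have h1 : wellPrimitive s = wellPrimitive 1 + ∫ r in (1 : ℝ)..s, wellDensity r :=
    (intervalIntegral.integral_add_adjacent_intervals
      (continuous_wellDensity.intervalIntegrable _ _)
      (continuous_wellDensity.intervalIntegrable _ _)).symm
  have h2 : ∫ r in (1 : ℝ)..s, wellDensity r = ∫ r in (1 : ℝ)..s, 0 :=
    intervalIntegral.integral_congr fun r hr => wellDensity_of_one_le_abs (by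
      rw [uIcc_of_le hs] at hr
      exact hr.1.trans (le_abs_self r))
  rw [h1, h2, wellPrimitive_of_abs_le (by simp)]
  norm_num

theorem wellPrimitive_neg (s : ℝ) : wellPrimitive (-s) = -wellPrimitive s := by
  have h := intervalIntegral.integral_comp_neg (a := 0) (b := s) wellDensity
  rw [neg_zero, intervalIntegral.integral_symm 0 (-s)] at h
  rw [wellPrimitive, wellPrimitive, ← neg_eq_iff_eq_neg, ← h]
  exact intervalIntegral.integral_congr fun r _ => by simp [wellDensity]

/-- This allows `w` to be replaced by the truncated primitive at the cost of the potential energy.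
For `s ≥ 1` both sides vanish to second order at `1`: the difference is `(s - 1)² (s + 2) / 3` and
`2W` is `(s - 1)² (s + 1)²`. -/
theorem abs_wellPrimitive_sub_le (s : ℝ) :
    |wellPrimitive s - (s - 1 / 3 * s ^ 3)| ≤ 2 * doubleWell s := by
  have hpos : ∀ s, 1 ≤ s → |wellPrimitive s - (s - 1 / 3 * s ^ 3)| ≤ 2 * doubleWell s := by
    intro s hs
    rw [wellPrimitive_of_one_le hs, doubleWell, show (2 / 3 - (s - 1 / 3 * s ^ 3) : ℝ) =
      (s - 1) ^ 2 * ((s + 2) / 3) by ring, abs_of_nonneg (by positivity),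
      show (2 * (1 / 2 * (1 - s ^ 2) ^ 2) : ℝ) = (s - 1) ^ 2 * (1 + s) ^ 2 by ring]
    exact mul_le_mul_of_nonneg_left (by nlinarith) (sq_nonneg _)
  rcases le_total |s| 1 with hs | hs
  · rw [wellPrimitive_of_abs_le hs, show s - s ^ 3 / 3 - (s - 1 / 3 * s ^ 3) = 0 by ring, abs_zero,
      doubleWell]
    positivity
  · rcases le_abs.1 hs with h | h
    · exact hpos s h
    · have := hpos (-s) h
      rw [wellPrimitive_neg, doubleWell, neg_sq, show (-wellPrimitive s - (-s - 1 / 3 * (-s) ^ 3)) =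
        -(wellPrimitive s - (s - 1 / 3 * s ^ 3)) by ring, abs_neg] at this
      exact this

/-- The primitive has modulus `2/3` at both wells. Its distance from that value vanishes to second
order there, as `W` does. -/
theorem sub_abs_wellPrimitive_le (s : ℝ) : 2 / 3 - |wellPrimitive s| ≤ 2 * doubleWell s := by
  have hpos : ∀ s, 0 ≤ s → 2 / 3 - |wellPrimitive s| ≤ 2 * doubleWell s := by
    intro s hs
    rcases le_total s 1 with h | h
    · have h1 := wellPrimitive_of_abs_le (abs_le.2 ⟨by linarith, h⟩)
      have h2 := le_abs_self (wellPrimitive s)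
      rw [h1] at h2 ⊢
      refine (sub_le_sub_left h2 _).trans ?_
      rw [doubleWell, show (2 / 3 - (s - s ^ 3 / 3) : ℝ) =
        (s - 1) ^ 2 * ((s + 2) / 3) by ring,
        show (2 * (1 / 2 * (1 - s ^ 2) ^ 2) : ℝ) = (s - 1) ^ 2 * (1 + s) ^ 2 by ring]
      exact mul_le_mul_of_nonneg_left (by nlinarith) (sq_nonneg _)
    · rw [wellPrimitive_of_one_le h, abs_of_nonneg (by norm_num), sub_self, doubleWell]
      positivity
  rcases le_total 0 s with h | h
  · exact hpos s h
  · have := hpos (-s) (by linarith)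
    rwa [wellPrimitive_neg, abs_neg, doubleWell, neg_sq] at this

variable {n : ℕ} {Ω : Set (EuclideanSpace ℝ (Fin n))}

theorem lintegral_enorm_mul_le {X E F : Type*} [MeasurableSpace X] {μ : Measure X}
    [NormedAddCommGroup E] [NormedAddCommGroup F] {f : X → E} {g : X → F}
    (hf : AEStronglyMeasurable f μ) (hg : AEStronglyMeasurable g μ) :
    ∫⁻ x, ‖f x‖ₑ * ‖g x‖ₑ ∂μ ≤ eLpNorm f 2 μ * eLpNorm g 2 μ := by
  have h := ENNReal.lintegral_mul_le_Lp_mul_Lq μ Real.HolderConjugate.two_two hf.enorm hg.enorm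
  rw [eLpNorm_eq_lintegral_rpow_enorm_toReal two_ne_zero ENNReal.ofNat_ne_top,
    eLpNorm_eq_lintegral_rpow_enorm_toReal two_ne_zero ENNReal.ofNat_ne_top]
  exact h

theorem gradient_wellPrimitive_comp {φ : EuclideanSpace ℝ (Fin n) → ℝ}
    (hφ : Differentiable ℝ φ) (x : EuclideanSpace ℝ (Fin n)) :
    gradient (fun x => wellPrimitive (φ x)) x = wellDensity (φ x) • gradient φ x := by
  have h := (hasDerivAt_wellPrimitive (φ x)).comp_hasFDerivAt x (hφ x).hasFDerivAt
  rw [gradient, gradient, ← map_smul]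
  congr 1
  exact h.fderiv

theorem tangentialPart_smul (x F : EuclideanSpace ℝ (Fin n)) (c : ℝ) :
    tangentialPart Ω x (c • F) = c • tangentialPart Ω x F := by
  rw [tangentialPart, tangentialPart, inner_smul_left, smul_sub, smul_smul]
  rfl

theorem aestronglyMeasurable_tangentialPart (hn : 0 < n) (hΩ : IsSmoothBoundedDomain Ω)
    {F : EuclideanSpace ℝ (Fin n) → EuclideanSpace ℝ (Fin n)}
    (hF : AEStronglyMeasurable F (boundaryMeasure Ω)) :
    AEStronglyMeasurable (fun x => tangentialPart Ω x (F x)) (boundaryMeasure Ω) := by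
  have h : AEStronglyMeasurable (outerNormal Ω) (boundaryMeasure Ω) :=
    (continuousOn_outerNormal hn hΩ).aestronglyMeasurable isClosed_frontier.measurableSet
  exact hF.sub (AEStronglyMeasurable.smul (hF.inner (𝕜 := ℝ) h) h)

/-- A Poincaré inequality for the truncated phase field on a connected component of `∂Ω`. -/
theorem exists_poincare_wellPrimitive (hn : 0 < n) (hΩ : IsSmoothBoundedDomain Ω)
    (p : EuclideanSpace ℝ (Fin n)) :
    ∃ K : ℝ≥0, ∀ g G, IsBoundarySobolev Ω g G →
      ∫⁻ z, ‖wellPrimitive (g z.2) - wellPrimitive (g z.1)‖ₑ ∂(((boundaryMeasure Ω).restrict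
          (connectedComponentIn (frontier Ω) p)).prod ((boundaryMeasure Ω).restrict
            (connectedComponentIn (frontier Ω) p))) ≤
        K * ∫⁻ x in connectedComponentIn (frontier Ω) p, ‖wellDensity (g x)‖ₑ * ‖G x‖ₑ
          ∂(boundaryMeasure Ω) := by
  have := boundaryMeasure_lt_top hn hΩ
  obtain ⟨K, hK⟩ := exists_poincare hn hΩ p
  refine ⟨K, fun g G ⟨hg, hG, φ, hφ, hφg, hφG⟩ => ?_⟩
  set H := boundaryMeasure Ω
  set H₁ := H.restrict (connectedComponentIn (frontier Ω) p)
  have hle : H₁ ≤ H := Measure.restrict_le_self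
  have hg1 := hg.1.mono_measure hle
  have hG1 := hG.1.mono_measure hle
  have hφc : ∀ k, Continuous (φ k) := fun k => (hφ k).continuous
  set a : ℕ → ℝ≥0∞ := fun k => eLpNorm (fun x => φ k x - g x) 2 H
  set b : ℕ → ℝ≥0∞ := fun k =>
    eLpNorm (fun x => tangentialPart Ω x (gradient (φ k) x) - G x) 2 H
  set c := eLpNorm (fun _ : EuclideanSpace ℝ (Fin n) => (1 : ℝ)) 2 H
  have hc : c ≠ ⊤ := (memLp_const (1 : ℝ)).2.ne
  set I := ∫⁻ x, ‖wellDensity (g x)‖ₑ * ‖G x‖ₑ ∂H₁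
  have hlip : ∀ s t, ‖wellPrimitive s - wellPrimitive t‖ₑ ≤ ‖s - t‖ₑ := fun s t => by
    have := lipschitzWith_wellPrimitive.edist_le_mul s t
    rwa [ENNReal.coe_one, one_mul, edist_eq_enorm_sub, edist_eq_enorm_sub] at this
  have hL1 : ∀ k, ∫⁻ x, ‖φ k x - g x‖ₑ ∂H₁ ≤ a k * c := fun k => by
    have h := lintegral_enorm_mul_le ((hφc k).aestronglyMeasurable.sub hg.1)
      (aestronglyMeasurable_const (μ := H) (b := (1 : ℝ)))
    simp only [enorm_one, mul_one] at h
    exact (lintegral_mono' hle le_rfl).trans h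
  have hleft : ∀ k, ∫⁻ z, ‖wellPrimitive (g z.2) - wellPrimitive (g z.1)‖ₑ ∂(H₁.prod H₁) ≤
      (∫⁻ z, ‖wellPrimitive (φ k z.2) - wellPrimitive (φ k z.1)‖ₑ ∂(H₁.prod H₁)) +
        2 * (H₁ univ * (a k * c)) := by
    intro k
    have hm : AEMeasurable (fun x => ‖φ k x - g x‖ₑ) H₁ :=
      ((hφc k).aestronglyMeasurable.sub hg1).enorm
    have hm1 : AEMeasurable (fun z : EuclideanSpace ℝ (Fin n) × EuclideanSpace ℝ (Fin n) =>
        ‖φ k z.1 - g z.1‖ₑ) (H₁.prod H₁) := hm.comp_fst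
    have hm2 : AEMeasurable (fun z : EuclideanSpace ℝ (Fin n) × EuclideanSpace ℝ (Fin n) =>
        ‖φ k z.2 - g z.2‖ₑ) (H₁.prod H₁) := hm.comp_snd
    calc
      _ ≤ ∫⁻ z, (‖wellPrimitive (φ k z.2) - wellPrimitive (φ k z.1)‖ₑ + ‖φ k z.2 - g z.2‖ₑ +
          ‖φ k z.1 - g z.1‖ₑ) ∂(H₁.prod H₁) := by
          refine lintegral_mono fun z => ?_
          have h1 := hlip (g z.2) (φ k z.2)
          have h2 := hlip (φ k z.1) (g z.1)
          rw [enorm_sub_rev (g z.2)] at h1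
          rw [show wellPrimitive (g z.2) - wellPrimitive (g z.1) =
            (wellPrimitive (φ k z.2) - wellPrimitive (φ k z.1)) +
            (wellPrimitive (g z.2) - wellPrimitive (φ k z.2)) +
            (wellPrimitive (φ k z.1) - wellPrimitive (g z.1)) by ring]
          exact (enorm_add_le _ _).trans
            (add_le_add ((enorm_add_le _ _).trans (add_le_add le_rfl h1)) h2)
      _ = (∫⁻ z, ‖wellPrimitive (φ k z.2) - wellPrimitive (φ k z.1)‖ₑ ∂(H₁.prod H₁)) +
          (∫⁻ x, ‖φ k x - g x‖ₑ ∂H₁) * H₁ univ + (∫⁻ x, ‖φ k x - g x‖ₑ ∂H₁) * H₁ univ := by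
          rw [lintegral_add_right' _ hm1, lintegral_add_right' _ hm2,
            lintegral_prod _ hm1, lintegral_prod _ hm2]
          simp only [lintegral_const]
          rw [lintegral_mul_const'' _ hm]
      _ ≤ (∫⁻ z, ‖wellPrimitive (φ k z.2) - wellPrimitive (φ k z.1)‖ₑ ∂(H₁.prod H₁)) +
          (a k * c) * H₁ univ + (a k * c) * H₁ univ := by
          gcongr <;> exact hL1 k
      _ = _ := by ring
  -- With `ρ = wellDensity`, the gradient splits as `ρ(φ)∇φ = ρ(g)G + ρ(φ)(∇φ - G) + (ρ(φ) -
  -- ρ(g))G`. The second term is small because `ρ ≤ 1`, the third because `ρ` is Lipschitz and `G`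
  -- is in `L²`.
  have hright : ∀ k, ∫⁻ x, ‖tangentialPart Ω x (gradient (fun x => wellPrimitive (φ k x)) x)‖ₑ
      ∂H₁ ≤ I + b k * c + 2 * (a k * eLpNorm G 2 H) := by
    intro k
    have hgr : Continuous (gradient (φ k)) := continuous_gradient ((hφ k).of_le (by simp))
    have hT := (aestronglyMeasurable_tangentialPart hn hΩ hgr.aestronglyMeasurable).sub hG.1
    have hmd : AEMeasurable (fun x => ‖wellDensity (φ k x) - wellDensity (g x)‖ₑ * ‖G x‖ₑ) H₁ :=
      (((continuous_wellDensity.comp (hφc k)).aestronglyMeasurable.sub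
        (continuous_wellDensity.comp_aestronglyMeasurable hg1)).enorm).mul hG1.enorm
    have hmi : AEMeasurable (fun x => ‖wellDensity (g x)‖ₑ * ‖G x‖ₑ) H₁ :=
      (continuous_wellDensity.comp_aestronglyMeasurable hg1).enorm.mul hG1.enorm
    calc
      _ ≤ ∫⁻ x, (‖wellDensity (g x)‖ₑ * ‖G x‖ₑ +
          ‖tangentialPart Ω x (gradient (φ k) x) - G x‖ₑ +
          ‖wellDensity (φ k x) - wellDensity (g x)‖ₑ * ‖G x‖ₑ) ∂H₁ := by
          refine lintegral_mono fun x => ?_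
          dsimp only
          rw [gradient_wellPrimitive_comp ((hφ k).differentiable (by simp)), tangentialPart_smul,
            show wellDensity (φ k x) • tangentialPart Ω x (gradient (φ k) x) =
              wellDensity (g x) • G x +
              wellDensity (φ k x) • (tangentialPart Ω x (gradient (φ k) x) - G x) +
              (wellDensity (φ k x) - wellDensity (g x)) • G x by module]
          have h1 : ‖wellDensity (φ k x)‖ₑ ≤ 1 := by
            rw [Real.enorm_eq_ofReal (wellDensity_nonneg _)]
            exact ENNReal.ofReal_le_one.2 (wellDensity_le_one _)
          refine (enorm_add_le _ _).trans
            (add_le_add ((enorm_add_le _ _).trans (add_le_add ?_ ?_)) ?_)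
          · rw [enorm_smul]
          · rw [enorm_smul]
            exact mul_le_of_le_one_left' h1
          · rw [enorm_smul]
      _ = I + (∫⁻ x, ‖tangentialPart Ω x (gradient (φ k) x) - G x‖ₑ ∂H₁) +
          ∫⁻ x, ‖wellDensity (φ k x) - wellDensity (g x)‖ₑ * ‖G x‖ₑ ∂H₁ := by
          rw [lintegral_add_right' _ hmd, lintegral_add_left' hmi]
      _ ≤ I + b k * c + 2 * (a k * eLpNorm G 2 H) := by
          gcongr
          · have h := lintegral_enorm_mul_le hT
              (aestronglyMeasurable_const (μ := H) (b := (1 : ℝ)))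
            simp only [enorm_one, mul_one] at h
            exact (lintegral_mono' hle le_rfl).trans h
          · have h := lintegral_enorm_mul_le ((hφc k).aestronglyMeasurable.sub hg.1) hG.1
            calc
              _ ≤ ∫⁻ x, 2 * (‖φ k x - g x‖ₑ * ‖G x‖ₑ) ∂H := by
                  refine lintegral_mono' hle fun x => ?_
                  rw [← mul_assoc]
                  gcongr
                  have h3 := abs_wellDensity_sub_le (φ k x) (g x)
                  rw [← ofReal_norm, ← ofReal_norm, Real.norm_eq_abs, Real.norm_eq_abs,
                    show (2 : ℝ≥0∞) = ENNReal.ofReal 2 by simp,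
                    ← ENNReal.ofReal_mul zero_le_two]
                  exact ENNReal.ofReal_le_ofReal h3
              _ = 2 * ∫⁻ x, ‖φ k x - g x‖ₑ * ‖G x‖ₑ ∂H :=
                  lintegral_const_mul' _ _ ENNReal.ofNat_ne_top
              _ ≤ _ := by gcongr; exact h
  have hmain : ∀ k, ∫⁻ z, ‖wellPrimitive (g z.2) - wellPrimitive (g z.1)‖ₑ ∂(H₁.prod H₁) ≤
      K * (I + b k * c + 2 * (a k * eLpNorm G 2 H)) + 2 * (H₁ univ * (a k * c)) := fun k =>
    (hleft k).trans (add_le_add ((hK _ (contDiff_wellPrimitive.comp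
      ((hφ k).of_le (by simp)))).trans (mul_le_mul_right (hright k) _)) le_rfl)
  have hlim : Tendsto (fun k => K * (I + b k * c + 2 * (a k * eLpNorm G 2 H)) +
      2 * (H₁ univ * (a k * c))) atTop
      (𝓝 (K * (I + 0 * c + 2 * (0 * eLpNorm G 2 H)) + 2 * (H₁ univ * (0 * c)))) := by
    have ha : Tendsto a atTop (𝓝 0) := hφg
    have hb : Tendsto b atTop (𝓝 0) := hφG
    have t1 := ENNReal.Tendsto.mul_const ha (Or.inr hc)
    have t2 := ENNReal.Tendsto.mul_const hb (Or.inr hc)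
    have t3 := ENNReal.Tendsto.mul_const ha (Or.inr hG.2.ne)
    refine (ENNReal.Tendsto.const_mul ((tendsto_const_nhds.add t2).add
      (ENNReal.Tendsto.const_mul t3 (Or.inr ENNReal.ofNat_ne_top)))
      (Or.inr ENNReal.coe_ne_top)).add ?_
    exact ENNReal.Tendsto.const_mul (ENNReal.Tendsto.const_mul t1
      (Or.inr (measure_ne_top _ _))) (Or.inr ENNReal.ofNat_ne_top)
  have := ge_of_tendsto' hlim hmain
  simpa using this

end

section

/-! ### Space-time estimates on the boundary -/

/-- A compact null set of the vague limit has asymptotically vanishing measure. -/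
theorem VagueTendsto.eventually_measure_le {X : Type*} [TopologicalSpace X] [R1Space X]
    [LocallyCompactSpace X] [MeasurableSpace X] [BorelSpace X] {α : ℕ → Measure X} {β : Measure X}
    [β.OuterRegular] [IsFiniteMeasureOnCompacts β] [∀ j, IsFiniteMeasureOnCompacts (α j)]
    (h : VagueTendsto α β) {K : Set X} (hK : IsCompact K) (hKc : IsClosed K) (h0 : β K = 0)
    {δ : ℝ} (hδ : 0 < δ) : ∀ᶠ j in atTop, α j K ≤ ENNReal.ofReal δ := by
  -- Outer regularity gives an open set of small `β`-measure around `K`. A continuous function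
  -- between the indicators of `K` and `U` then transfers the smallness to the sequence.
  obtain ⟨U, hKU, hU, hUδ⟩ := K.exists_isOpen_lt_of_lt (ENNReal.ofReal δ)
    (by rw [h0]; exact ENNReal.ofReal_pos.2 hδ)
  obtain ⟨f, hf1, hfc, hfU, hf⟩ := exists_continuousMap_one_of_isCompact_subset_isOpen hK hU hKU
  have hcs : HasCompactSupport f := hfc
  have hint : ∀ (μ : Measure X) [IsFiniteMeasureOnCompacts μ], Integrable f μ := fun μ _ =>
    f.continuous.integrable_of_hasCompactSupport hcs
  have hβ : ∫ z, f z ∂β < δ := by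
    rw [← ENNReal.ofReal_lt_ofReal_iff hδ, ofReal_integral_eq_lintegral_ofReal (hint β)
      (Eventually.of_forall fun x => (hf x).1)]
    refine lt_of_le_of_lt ?_ hUδ
    rw [← lintegral_indicator_one hU.measurableSet]
    refine lintegral_mono fun x => ?_
    by_cases hx : x ∈ U
    · rw [indicator_of_mem hx]
      exact ENNReal.ofReal_le_one.2 (hf x).2
    · have : f x = 0 := image_eq_zero_of_notMem_tsupport fun h => hx (hfU h)
      rw [this, ENNReal.ofReal_zero]
      exact zero_le
  filter_upwards [(h f f.continuous hcs).eventually_lt_const hβ] with j hj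
  refine le_trans ?_ (ENNReal.ofReal_le_ofReal hj.le)
  rw [ofReal_integral_eq_lintegral_ofReal (hint (α j)) (Eventually.of_forall fun x => (hf x).1),
    ← lintegral_indicator_one hKc.measurableSet]
  refine lintegral_mono fun x => ?_
  by_cases hx : x ∈ K
  · rw [indicator_of_mem hx, hf1 hx]
    simp
  · rw [indicator_of_notMem hx]
    exact zero_le

variable {n : ℕ} {Ω : Set (EuclideanSpace ℝ (Fin n))} {ε σ : ℝ}
  {u₀ : EuclideanSpace ℝ (Fin n) → ℝ} {v : PhaseField n}

theorem two_mul_ofReal (a : ℝ) : 2 * ENNReal.ofReal a = ENNReal.ofReal (2 * a) := by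
  rw [ENNReal.ofReal_mul zero_le_two, ENNReal.ofReal_ofNat]

theorem lintegral_ofReal_mul_norm_sq {X E : Type*} [MeasurableSpace X] {μ : Measure X}
    [NormedAddCommGroup E] (hε : 0 ≤ ε) (f : X → E) :
    ∫⁻ x, ENNReal.ofReal (ε * ‖f x‖ ^ 2) ∂μ = ENNReal.ofReal ε * ∫⁻ x, ‖f x‖ₑ ^ 2 ∂μ := by
  rw [← lintegral_const_mul' _ _ ENNReal.ofReal_ne_top]
  refine lintegral_congr fun x => ?_
  rw [ENNReal.ofReal_mul hε, ENNReal.ofReal_pow (norm_nonneg _), ofReal_norm]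

theorem lintegral_enorm_sq_lt_top {X E : Type*} [MeasurableSpace X] {μ : Measure X}
    [NormedAddCommGroup E] {f : X → E} (hf : MemLp f 2 μ) : ∫⁻ x, ‖f x‖ₑ ^ 2 ∂μ < ⊤ := by
  have := lintegral_rpow_enorm_lt_top_of_eLpNorm_lt_top two_ne_zero ENNReal.ofNat_ne_top hf.2
  simpa using this

/-- The endpoint `t₁` is a null set in time, and `t₁ ≥ 0` makes the restriction to `[0, ∞)`
invisible. -/
theorem weightedBoundaryArea_prod_Icc (hn : 0 < n) (hΩ : IsSmoothBoundedDomain Ω)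
    {Γ : Set (EuclideanSpace ℝ (Fin n))} (hΓ : MeasurableSet Γ) (hε : 0 ≤ ε) {t₁ t₂ : ℝ}
    (ht₁ : 0 ≤ t₁) :
    weightedBoundaryArea Ω ε v (Γ ×ˢ Icc t₁ t₂) = ENNReal.ofReal ε * ∫⁻ z, ‖v.tgrad z.1 z.2‖ₑ ^ 2
      ∂(((boundaryMeasure Ω).restrict Γ).prod (volume.restrict (Ioc t₁ t₂))) := by
  have := boundaryMeasure_lt_top hn hΩ
  rw [weightedBoundaryArea, withDensity_apply _ (hΓ.prod measurableSet_Icc),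
    ← Measure.prod_restrict, Measure.restrict_restrict measurableSet_Icc,
    inter_eq_left.2 (Icc_subset_Ici_self.trans (Ici_subset_Ici.2 ht₁)),
    ← restrict_Ioc_eq_restrict_Icc, lintegral_ofReal_mul_norm_sq hε]

theorem IsSolution.isFiniteMeasureOnCompacts (hv : IsSolution Ω ε σ u₀ v) (hn : 0 < n)
    (hΩ : IsSmoothBoundedDomain Ω) (hε : 0 ≤ ε) :
    IsFiniteMeasureOnCompacts (weightedBoundaryArea Ω ε v) := by
  have := boundaryMeasure_lt_top hn hΩ
  refine ⟨fun L hL => ?_⟩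
  obtain ⟨T, hT⟩ := (hL.image continuous_snd).bddAbove
  have hsub : L ⊆ univ ×ˢ Iic (max T 1) := fun z hz =>
    ⟨mem_univ _, (hT (mem_image_of_mem _ hz)).trans (le_max_left _ _)⟩
  refine (measure_mono hsub).trans_lt ?_
  rw [weightedBoundaryArea, withDensity_apply _ (MeasurableSet.univ.prod measurableSet_Iic),
    ← Measure.prod_restrict, Measure.restrict_restrict measurableSet_Iic, inter_comm,
    Ici_inter_Iic, ← restrict_Ioc_eq_restrict_Icc, Measure.restrict_univ,
    lintegral_ofReal_mul_norm_sq hε]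
  exact ENNReal.mul_lt_top ENNReal.ofReal_lt_top
    (lintegral_enorm_sq_lt_top (hv.memLp_tgrad _ (lt_max_of_lt_right one_pos)))

/-- The space-time bound of the potential energy on the boundary. -/
theorem exists_spacetime_potential_le (hn : 0 < n) (hΩ : IsSmoothBoundedDomain Ω) :
    ∃ K : ℝ≥0, ∀ ε σ u₀ gradu₀ v, 0 < ε → 0 < σ → IsSolution Ω ε σ u₀ v →
      IsSobolev Ω u₀ gradu₀ → (∀ᵐ x ∂(volume.restrict Ω), |u₀ x| ≤ 1) →
      ∀ D, energy Ω ε u₀ gradu₀ ≤ D → ∀ t₁ t₂, 0 ≤ t₁ → t₁ < t₂ →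
      ∫⁻ t in Ioc t₁ t₂, ∫⁻ x, ENNReal.ofReal (doubleWell (v.u x t) / ε) ∂(boundaryMeasure Ω) ≤
        K * (ENNReal.ofReal D * ENNReal.ofReal (t₂ - t₁) + ENNReal.ofReal D +
          ∫⁻ t in Ioc t₁ t₂, ∫⁻ x, ENNReal.ofReal
            (ε / 2 * (inner ℝ (v.grad x t) (outerNormal Ω x)) ^ 2) ∂(boundaryMeasure Ω)) := by
  have := boundaryMeasure_lt_top hn hΩ
  have := hΩ.isFiniteMeasure
  obtain ⟨m, C, hm⟩ := exists_isDivergenceMeasure hn hΩ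
  obtain ⟨K, hK, hpot⟩ := exists_boundary_potential_le hm hn hΩ
  -- The first `C` passes from the surface measure to `m`, the second one back again. The `2` undoes
  -- the normalization `ε / 2` of the normal energy.
  refine ⟨C * K.toNNReal * max 1 (2 * C),
    fun ε σ u₀ gradu₀ v hε hσ hv hu₀ hu₀_le D hD t₁ t₂ ht₁ ht => ?_⟩
  have ht₂ : 0 < t₂ := ht₁.trans_lt ht
  have hen := hv.energy_le hε hσ hm hn hΩ hu₀ hu₀_le (T₀ := t₂ + 1) (by linarith)
  set N : ℝ → ℝ≥0∞ := fun t => ∫⁻ x, ENNReal.ofReal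
    (ε / 2 * (inner ℝ (v.grad x t) (outerNormal Ω x)) ^ 2) ∂(boundaryMeasure Ω)
  set B : ℝ → ℝ≥0∞ := fun t => ∫⁻ x in Ω, ‖v.dt x t‖ₑ ^ 2
  have hdt := hv.memLp_dt _ ht₂
  have hdtm : AEMeasurable (fun z : EuclideanSpace ℝ (Fin n) × ℝ => ‖v.dt z.1 z.2‖ₑ ^ 2)
      ((volume.restrict Ω).prod (volume.restrict (Ioc 0 t₂))) := hdt.1.enorm.pow_const 2
  have hsub : volume.restrict (Ioc t₁ t₂) ≤ volume.restrict (Ioc 0 t₂) :=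
    Measure.restrict_mono (Ioc_subset_Ioc_left ht₁) le_rfl
  have hBm : AEMeasurable B (volume.restrict (Ioc 0 t₂)) := hdtm.lintegral_prod_left'
  have hBint : ∫⁻ t in Ioc 0 t₂, B t =
      ∫⁻ z, ‖v.dt z.1 z.2‖ₑ ^ 2 ∂((volume.restrict Ω).prod (volume.restrict (Ioc 0 t₂))) :=
    (lintegral_prod_symm _ hdtm).symm
  -- The energy inequality holds only for almost every time, so the dissipation up to `t₂` is
  -- bounded by that up to a good time `T` slightly after `t₂`.
  have hBD : ENNReal.ofReal ε * ∫⁻ t in Ioc 0 t₂, B t ≤ ENNReal.ofReal D := by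
    obtain ⟨T, hT, hTt⟩ : ∃ T, (T ∈ Ioc 0 (t₂ + 1) →
        energy Ω ε (fun x => v.u x T) (fun x => v.grad x T) +
          ε * ∫ z, v.dt z.1 z.2 ^ 2 ∂((volume.restrict Ω).prod (volume.restrict (Ioc 0 T))) ≤
        energy Ω ε u₀ gradu₀) ∧ T ∈ Ioo t₂ (t₂ + 1) := by
      have h1 : ∃ᵐ T, T ∈ Ioo t₂ (t₂ + 1) := by
        rw [frequently_ae_mem_iff, Real.volume_Ioo]
        simp
      exact (h1.and_eventually hen).exists.imp fun T h => ⟨h.2, h.1⟩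
    have hT0 : 0 < T := ht₂.trans hTt.1
    have h1 := hT ⟨hT0, hTt.2.le⟩
    have h2 : 0 ≤ energy Ω ε (fun x => v.u x T) (fun x => v.grad x T) :=
      integral_nonneg fun x => add_nonneg (by positivity)
        (div_nonneg (doubleWell_nonneg _) hε.le)
    rw [hBint]
    refine le_trans ?_ (ENNReal.ofReal_le_ofReal (by linarith : ε * ∫ z, v.dt z.1 z.2 ^ 2
      ∂((volume.restrict Ω).prod (volume.restrict (Ioc 0 T))) ≤ D))
    rw [ENNReal.ofReal_mul hε.le, ← lintegral_enorm_sq (hv.memLp_dt T hT0)]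
    have hsubT : volume.restrict (Ioc 0 t₂) ≤ volume.restrict (Ioc 0 T) :=
      Measure.restrict_mono (Ioc_subset_Ioc_right hTt.1.le) le_rfl
    exact mul_le_mul_right (lintegral_mono' (Measure.prod_mono le_rfl hsubT) le_rfl) _
  have hslice : ∀ᵐ t ∂(volume.restrict (Ioc 0 t₂)), MemLp (fun x => v.dt x t) 2
      (volume.restrict Ω) := by
    have hfin : ∫⁻ t in Ioc 0 t₂, B t ≠ ⊤ := by
      rw [hBint]
      exact (lintegral_enorm_sq_lt_top hdt).ne
    filter_upwards [ae_lt_top' hBm hfin, hdt.1.prodMk_right] with t h1 h2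
    refine ⟨h2, ?_⟩
    rw [eLpNorm_lt_top_iff_lintegral_rpow_enorm_lt_top two_ne_zero ENNReal.ofNat_ne_top]
    simpa using h1
  have heqn : ∀ᵐ t ∂(volume.restrict (Ioc 0 t₂)), ∀ᵐ x ∂(volume.restrict Ω),
      v.dt x t = (∑ i, v.hess x t i i) - (ε ^ 2)⁻¹ * deriv doubleWell (v.u x t) := by
    have := (Measure.measurePreserving_swap (μ := volume.restrict (Ioc 0 t₂))
      (ν := volume.restrict Ω)).quasiMeasurePreserving.ae (hv.equation_total t₂)
    exact Measure.ae_ae_of_ae_prod this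
  have key : ∀ᵐ t ∂(volume.restrict (Ioc 0 t₂)),
      ∫⁻ x, ENNReal.ofReal (doubleWell (v.u x t) / ε) ∂(boundaryMeasure Ω) ≤
        C * ENNReal.ofReal K * (ENNReal.ofReal D + ENNReal.ofReal ε * B t + 2 * C * N t) := by
    filter_upwards [hslice, heqn, ae_restrict_of_ae (hv.ae_isRegularSlice hn hΩ),
      ae_restrict_of_ae hen, ae_restrict_mem measurableSet_Ioc] with t h1 h2 h3 h4 h5
    have h3 := h3 h5.1
    have h4 := h4 ⟨h5.1, h5.2.trans (by linarith)⟩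
    have hp := hpot ε hε _ _ _ h3 _ h1 h2
    have hN2 := memLp_normal_derivative hm hn hΩ (h3.memLp_grad_boundary hm hn hΩ)
    have hE : energy Ω ε (fun x => v.u x t) (fun x => v.grad x t) ≤ D := by
      have : 0 ≤ ε * ∫ z, v.dt z.1 z.2 ^ 2
          ∂((volume.restrict Ω).prod (volume.restrict (Ioc 0 t))) :=
        mul_nonneg hε.le (integral_nonneg fun z => sq_nonneg _)
      linarith
    have hNm : ENNReal.ofReal (ε * ∫ x, inner ℝ (v.grad x t) (outerNormal Ω x) ^ 2 ∂m) ≤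
        2 * C * N t := by
      have e1 : (fun x => ENNReal.ofReal (ε * inner ℝ (v.grad x t) (outerNormal Ω x) ^ 2)) =
          fun x => 2 * ENNReal.ofReal
            (ε / 2 * (inner ℝ (v.grad x t) (outerNormal Ω x)) ^ 2) := by
        funext x
        rw [two_mul_ofReal]
        congr 1
        ring
      rw [← integral_const_mul, ofReal_integral_eq_lintegral_ofReal (hN2.integrable_sq.const_mul ε)
        (Eventually.of_forall fun x => by positivity), e1,
        lintegral_const_mul' _ _ ENNReal.ofNat_ne_top, mul_assoc]
      gcongr
      refine (lintegral_mono' hm.le le_rfl).trans (le_of_eq ?_)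
      rw [lintegral_smul_measure]
      rfl
    calc
      _ ≤ ∫⁻ x, ENNReal.ofReal (doubleWell (v.u x t) / ε) ∂(C • m) := lintegral_mono' hm.ge le_rfl
      _ = C * ∫⁻ x, ENNReal.ofReal (doubleWell (v.u x t) / ε) ∂m := by
          rw [lintegral_smul_measure]
          rfl
      _ ≤ C * (ENNReal.ofReal K * (ENNReal.ofReal D + ENNReal.ofReal ε * B t + 2 * C * N t)) := by
          gcongr
          refine hp.trans ?_
          rw [ENNReal.ofReal_mul hK.le]
          gcongr
          refine ENNReal.ofReal_add_le.trans (add_le_add (ENNReal.ofReal_add_le.trans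
            (add_le_add (ENNReal.ofReal_le_ofReal hE) ?_)) hNm)
          rw [ENNReal.ofReal_mul hε.le, ← lintegral_enorm_sq h1]
      _ = _ := by ring
  have hBm' : AEMeasurable (fun t => ENNReal.ofReal D + ENNReal.ofReal ε * B t)
      (volume.restrict (Ioc t₁ t₂)) :=
    ((hBm.mono_measure hsub).const_mul _).const_add _
  have hsum : ∫⁻ t in Ioc t₁ t₂, (ENNReal.ofReal D + ENNReal.ofReal ε * B t + 2 * C * N t) ≤
      (max 1 (2 * C) : ℝ≥0) * (ENNReal.ofReal D * ENNReal.ofReal (t₂ - t₁) + ENNReal.ofReal D +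
        ∫⁻ t in Ioc t₁ t₂, N t) := by
    have hM1 : (1 : ℝ≥0∞) ≤ (max 1 (2 * C) : ℝ≥0) := by
      exact_mod_cast le_max_left 1 (2 * C)
    have hM2 : (2 * C : ℝ≥0∞) ≤ (max 1 (2 * C) : ℝ≥0) := by
      exact_mod_cast le_max_right 1 (2 * C)
    rw [lintegral_add_left' hBm', lintegral_add_left measurable_const, lintegral_const,
      Measure.restrict_apply_univ, Real.volume_Ioc,
      lintegral_const_mul' _ _ ENNReal.ofReal_ne_top,
      lintegral_const_mul' _ _ (ENNReal.mul_ne_top ENNReal.ofNat_ne_top ENNReal.coe_ne_top),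
      mul_add]
    have h1 : ENNReal.ofReal ε * ∫⁻ t in Ioc t₁ t₂, B t ≤ ENNReal.ofReal D :=
      (mul_le_mul_right (lintegral_mono' hsub le_rfl) _).trans hBD
    exact add_le_add ((add_le_add le_rfl h1).trans (le_mul_of_one_le_left' hM1))
      (mul_le_mul_left hM2 _)
  calc
    _ ≤ ∫⁻ t in Ioc t₁ t₂, C * ENNReal.ofReal K *
        (ENNReal.ofReal D + ENNReal.ofReal ε * B t + 2 * C * N t) :=
        lintegral_mono_ae (ae_mono hsub key)
    _ = C * ENNReal.ofReal K * ∫⁻ t in Ioc t₁ t₂,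
        (ENNReal.ofReal D + ENNReal.ofReal ε * B t + 2 * C * N t) :=
        lintegral_const_mul' _ _ (ENNReal.mul_ne_top ENNReal.coe_ne_top ENNReal.ofReal_ne_top)
    _ ≤ C * ENNReal.ofReal K * ((max 1 (2 * C) : ℝ≥0) * (ENNReal.ofReal D *
        ENNReal.ofReal (t₂ - t₁) + ENNReal.ofReal D + ∫⁻ t in Ioc t₁ t₂, N t)) := by
        gcongr
    _ = _ := by
        rw [ENNReal.coe_mul, ENNReal.coe_mul, ← mul_assoc]
        rfl

/-- The cube is not controlled by `g ∈ L²` alone. The function differs from the Lipschitz image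
`wellPrimitive ∘ g` by at most `2W(g)`, which is integrable. -/
theorem integrable_sub_cube {X : Type*} [MeasurableSpace X] {μ : Measure X} [IsFiniteMeasure μ]
    {g : X → ℝ} (hg : MemLp g 2 μ) (hW : ∫⁻ x, ENNReal.ofReal (doubleWell (g x)) ∂μ ≠ ⊤) :
    Integrable (fun x => g x - 1 / 3 * g x ^ 3) μ := by
  have hWi : Integrable (fun x => doubleWell (g x)) μ := by
    refine ⟨continuous_doubleWell.comp_aestronglyMeasurable hg.1, ?_⟩
    rw [hasFiniteIntegral_iff_ofReal (Eventually.of_forall fun x => doubleWell_nonneg _)]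
    exact hW.lt_top
  have hh : Integrable (fun x => wellPrimitive (g x)) μ :=
    (memLp_two_comp lipschitzWith_wellPrimitive hg).integrable one_le_two
  have hd : Integrable (fun x => wellPrimitive (g x) - (g x - 1 / 3 * g x ^ 3)) μ := by
    refine (hWi.const_mul 2).mono' (hh.1.sub ?_)
      (Eventually.of_forall fun x => abs_wellPrimitive_sub_le _)
    exact (by fun_prop : Continuous fun s : ℝ => s - 1 / 3 * s ^ 3).comp_aestronglyMeasurable hg.1
  exact (hh.sub hd).congr (Eventually.of_forall fun x => by simp)

/-- If the mean of `g - g³/3` is small, then `g` takes values away from `±1` or has large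
oscillation. -/
theorem sq_measure_univ_le {X : Type*} [MeasurableSpace X] {μ : Measure X} [IsFiniteMeasure μ]
    {g : X → ℝ} (hg : MemLp g 2 μ) :
    ENNReal.ofReal (2 / 3) * μ univ ^ 2 ≤ μ univ * ‖∫ x, (g x - 1 / 3 * g x ^ 3) ∂μ‖ₑ +
      4 * μ univ * (∫⁻ x, ENNReal.ofReal (doubleWell (g x)) ∂μ) +
      ∫⁻ z, ‖wellPrimitive (g z.2) - wellPrimitive (g z.1)‖ₑ ∂(μ.prod μ) := by
  rcases eq_or_ne (μ univ) 0 with h0 | h0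
  · simp [h0]
  set J := ∫⁻ x, ENNReal.ofReal (doubleWell (g x)) ∂μ with hJ
  by_cases hW : J = ⊤
  · rw [hW, ENNReal.mul_top (by simp [h0])]
    simp
  have hw := integrable_sub_cube hg hW
  have hWm : AEMeasurable (fun x => ENNReal.ofReal (doubleWell (g x))) μ :=
    (continuous_doubleWell.comp_aestronglyMeasurable hg.1).aemeasurable.ennreal_ofReal
  have hh : Integrable (fun x => wellPrimitive (g x)) μ :=
    (memLp_two_comp lipschitzWith_wellPrimitive hg).integrable one_le_two
  set w := ∫ x, (g x - 1 / 3 * g x ^ 3) ∂μ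
  have hmean : ‖∫ y, wellPrimitive (g y) ∂μ‖ₑ ≤ ‖w‖ₑ + 2 * J := by
    have e1 : ∫ y, wellPrimitive (g y) ∂μ =
        w + ∫ y, (wellPrimitive (g y) - (g y - 1 / 3 * g y ^ 3)) ∂μ := by
      rw [integral_sub hh hw]
      ring
    rw [e1]
    refine (enorm_add_le _ _).trans (add_le_add le_rfl ?_)
    refine (enorm_integral_le_lintegral_enorm _).trans ?_
    rw [hJ, ← lintegral_const_mul' _ _ ENNReal.ofNat_ne_top]
    refine lintegral_mono fun x => ?_
    rw [← ofReal_norm, two_mul_ofReal]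
    exact ENNReal.ofReal_le_ofReal (abs_wellPrimitive_sub_le _)
  -- Pointwise, `2/3` is at most `|h(g x)| + 2W(g x)`, and `h(g x)` differs from the mean of `h(g)`
  -- by at most the averaged oscillation seen from `x`. Integration in `x` gives the claim.
  have hpt : ∀ x, ENNReal.ofReal (2 / 3) * μ univ ≤ ‖w‖ₑ + 2 * J +
      (∫⁻ y, ‖wellPrimitive (g y) - wellPrimitive (g x)‖ₑ ∂μ) +
      2 * ENNReal.ofReal (doubleWell (g x)) * μ univ := by
    intro x
    have h1 : ENNReal.ofReal (2 / 3) ≤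
        ‖wellPrimitive (g x)‖ₑ + 2 * ENNReal.ofReal (doubleWell (g x)) := by
      rw [← ofReal_norm, two_mul_ofReal,
        ← ENNReal.ofReal_add (norm_nonneg _) (mul_nonneg zero_le_two (doubleWell_nonneg _))]
      refine ENNReal.ofReal_le_ofReal ?_
      have := sub_abs_wellPrimitive_le (g x)
      rw [Real.norm_eq_abs]
      linarith
    have h2 : ‖wellPrimitive (g x)‖ₑ * μ univ ≤ ‖w‖ₑ + 2 * J +
        ∫⁻ y, ‖wellPrimitive (g y) - wellPrimitive (g x)‖ₑ ∂μ := by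
      have e1 : μ.real univ * wellPrimitive (g x) = (∫ y, wellPrimitive (g y) ∂μ) -
          ∫ y, (wellPrimitive (g y) - wellPrimitive (g x)) ∂μ := by
        rw [integral_sub hh (integrable_const _), integral_const, smul_eq_mul]
        ring
      have e2 : ‖wellPrimitive (g x)‖ₑ * μ univ = ‖μ.real univ * wellPrimitive (g x)‖ₑ := by
        rw [enorm_mul, mul_comm, Real.enorm_eq_ofReal measureReal_nonneg, ofReal_measureReal]
      rw [e2, e1]
      exact enorm_sub_le.trans (add_le_add hmean (enorm_integral_le_lintegral_enorm _))
    calc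
      _ ≤ (‖wellPrimitive (g x)‖ₑ + 2 * ENNReal.ofReal (doubleWell (g x))) * μ univ := by gcongr
      _ = ‖wellPrimitive (g x)‖ₑ * μ univ + 2 * ENNReal.ofReal (doubleWell (g x)) * μ univ := by
          ring
      _ ≤ _ := by gcongr
  have hosc : AEMeasurable (fun z : X × X => ‖wellPrimitive (g z.2) - wellPrimitive (g z.1)‖ₑ)
      (μ.prod μ) := (hh.1.comp_snd.sub hh.1.comp_fst).enorm
  calc
    _ = ∫⁻ _, ENNReal.ofReal (2 / 3) * μ univ ∂μ := by
        rw [lintegral_const]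
        ring
    _ ≤ ∫⁻ x, (‖w‖ₑ + 2 * J + (∫⁻ y, ‖wellPrimitive (g y) - wellPrimitive (g x)‖ₑ ∂μ) +
        2 * ENNReal.ofReal (doubleWell (g x)) * μ univ) ∂μ := lintegral_mono hpt
    _ = (‖w‖ₑ + 2 * J) * μ univ +
        (∫⁻ z, ‖wellPrimitive (g z.2) - wellPrimitive (g z.1)‖ₑ ∂(μ.prod μ)) +
        2 * J * μ univ := by
        rw [lintegral_add_right' _ ((hWm.const_mul 2).mul_const _),
          lintegral_add_left measurable_const, lintegral_const, lintegral_prod _ hosc,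
          lintegral_mul_const'' _ (hWm.const_mul 2),
          lintegral_const_mul' _ _ ENNReal.ofNat_ne_top]
    _ = _ := by ring

end

/-! ### Lower bound for the time-integrated means and passage to the limit. -/

section

variable {n : ℕ} {Ω : Set (EuclideanSpace ℝ (Fin n))}

/-- The time-integrated mean of `u - u³/3` on a component of `∂Ω` is bounded below in terms of the
potential energy and of the tangential Dirichlet energy on that component. -/
theorem exists_mean_lower_bound (hn : 0 < n) (hΩ : IsSmoothBoundedDomain Ω)
    {p : EuclideanSpace ℝ (Fin n)} {Γ : Set (EuclideanSpace ℝ (Fin n))}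
    (hΓ : Γ = connectedComponentIn (frontier Ω) p) :
    ∃ K : ℝ≥0, ∀ ε σ u₀ v, 0 < ε → IsSolution Ω ε σ u₀ v → ∀ t₁ t₂, 0 ≤ t₁ → t₁ < t₂ →
      ∀ B : ℝ≥0∞, B ≠ ⊤ → ∫⁻ t in Ioc t₁ t₂, ∫⁻ x, ENNReal.ofReal (doubleWell (v.u x t) / ε)
        ∂(boundaryMeasure Ω) ≤ B →
      ENNReal.ofReal (2 / 3) * boundaryMeasure Ω Γ ^ 2 * ENNReal.ofReal (t₂ - t₁) ≤
        boundaryMeasure Ω Γ * ENNReal.ofReal (∫ t in t₁..t₂,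
          |∫ x in Γ, (v.u x t - 1 / 3 * v.u x t ^ 3) ∂(boundaryMeasure Ω)|) +
        4 * boundaryMeasure Ω Γ * (ENNReal.ofReal ε * B) +
        K * (2 * B * weightedBoundaryArea Ω ε v (Γ ×ˢ Icc t₁ t₂)) ^ (1 / 2 : ℝ) := by
  have := boundaryMeasure_lt_top hn hΩ
  obtain ⟨K, hK⟩ := exists_poincare_wellPrimitive hn hΩ p
  rw [← hΓ] at hK
  refine ⟨K, fun ε σ u₀ v hε hv t₁ t₂ ht₁ ht B hB hWB => ?_⟩
  have hΓm : MeasurableSet Γ :=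
    hΓ ▸ (isClosed_connectedComponentIn isClosed_frontier p).measurableSet
  have ht₂ : 0 < t₂ := ht₁.trans_lt ht
  set H := boundaryMeasure Ω
  set H₁ := H.restrict Γ with hH₁
  set τ := volume.restrict (Ioc t₁ t₂) with hτ
  have hH₁u : H₁ univ = H Γ := Measure.restrict_apply_univ Γ
  have hsub : τ ≤ volume.restrict (Ioc 0 t₂) :=
    Measure.restrict_mono (Ioc_subset_Ioc_left ht₁) le_rfl
  have hprod : H₁.prod τ ≤ H.prod (volume.restrict (Ioc 0 t₂)) :=
    Measure.prod_mono Measure.restrict_le_self hsub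
  have hu : MemLp (fun z : EuclideanSpace ℝ (Fin n) × ℝ => v.u z.1 z.2) 2 (H₁.prod τ) :=
    (hv.memLp_u_boundary t₂ ht₂).mono_measure hprod
  have hG : MemLp (fun z : EuclideanSpace ℝ (Fin n) × ℝ => v.tgrad z.1 z.2) 2 (H₁.prod τ) :=
    (hv.memLp_tgrad t₂ ht₂).mono_measure hprod
  have hWm : AEMeasurable (fun z : EuclideanSpace ℝ (Fin n) × ℝ =>
      ENNReal.ofReal (doubleWell (v.u z.1 z.2))) (H₁.prod τ) :=
    (continuous_doubleWell.comp_aestronglyMeasurable hu.1).aemeasurable.ennreal_ofReal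
  have hW : ∫⁻ z, ENNReal.ofReal (doubleWell (v.u z.1 z.2)) ∂(H₁.prod τ) ≤
      ENNReal.ofReal ε * B := by
    rw [lintegral_prod_symm _ hWm]
    calc
      _ ≤ ∫⁻ t, ENNReal.ofReal ε * ∫⁻ x, ENNReal.ofReal (doubleWell (v.u x t) / ε) ∂H ∂τ := by
          refine lintegral_mono fun t => ?_
          rw [← lintegral_const_mul' _ _ ENNReal.ofReal_ne_top]
          refine lintegral_mono' Measure.restrict_le_self fun x => ?_
          rw [← ENNReal.ofReal_mul hε.le, mul_div_cancel₀ _ hε.ne']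
      _ = ENNReal.ofReal ε * ∫⁻ t, ∫⁻ x, ENNReal.ofReal (doubleWell (v.u x t) / ε) ∂H ∂τ :=
          lintegral_const_mul' _ _ ENNReal.ofReal_ne_top
      _ ≤ _ := by gcongr
  have hw : Integrable (fun z : EuclideanSpace ℝ (Fin n) × ℝ =>
      v.u z.1 z.2 - 1 / 3 * v.u z.1 z.2 ^ 3) (H₁.prod τ) :=
    integrable_sub_cube hu (hW.trans_lt (ENNReal.mul_lt_top ENNReal.ofReal_lt_top hB.lt_top)).ne
  have hwt : Integrable (fun t => ∫ x, (v.u x t - 1 / 3 * v.u x t ^ 3) ∂H₁) τ :=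
    hw.integral_prod_right
  have hmean : ∫⁻ t, ‖∫ x, (v.u x t - 1 / 3 * v.u x t ^ 3) ∂H₁‖ₑ ∂τ =
      ENNReal.ofReal (∫ t in t₁..t₂, |∫ x in Γ, (v.u x t - 1 / 3 * v.u x t ^ 3) ∂H|) := by
    rw [intervalIntegral.integral_of_le ht.le]
    exact (ofReal_integral_norm_eq_lintegral_enorm hwt).symm
  have hρm : AEMeasurable (fun z : EuclideanSpace ℝ (Fin n) × ℝ => ‖wellDensity (v.u z.1 z.2)‖ₑ)
      (H₁.prod τ) := (continuous_wellDensity.comp_aestronglyMeasurable hu.1).enorm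
  -- Cauchy–Schwarz in space-time with `wellDensity² ≤ 2W = 2ε · W/ε`. The factor `ε` is exactly the
  -- weight in the measure of the tangential energy, so the estimate is uniform in `ε`.
  have hgrad : ∫⁻ t, ∫⁻ x, ‖wellDensity (v.u x t)‖ₑ * ‖v.tgrad x t‖ₑ ∂H₁ ∂τ ≤
      (2 * B * weightedBoundaryArea Ω ε v (Γ ×ˢ Icc t₁ t₂)) ^ (1 / 2 : ℝ) := by
    rw [← lintegral_prod_symm (fun z : EuclideanSpace ℝ (Fin n) × ℝ =>
      ‖wellDensity (v.u z.1 z.2)‖ₑ * ‖v.tgrad z.1 z.2‖ₑ) (hρm.mul hG.1.enorm),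
      one_div, ENNReal.le_rpow_inv_iff two_pos, ENNReal.rpow_two]
    refine (sq_lintegral_mul_le hρm hG.1.enorm).trans ?_
    rw [weightedBoundaryArea_prod_Icc hn hΩ hΓm hε.le ht₁]
    calc
      _ ≤ (2 * (ENNReal.ofReal ε * B)) * ∫⁻ z, ‖v.tgrad z.1 z.2‖ₑ ^ 2 ∂(H₁.prod τ) := by
          gcongr
          refine le_trans ?_ (mul_le_mul_right hW 2)
          rw [← lintegral_const_mul' _ _ ENNReal.ofNat_ne_top]
          refine lintegral_mono fun z => ?_
          dsimp only
          rw [two_mul_ofReal, ← ofReal_norm, ← ENNReal.ofReal_pow (norm_nonneg _),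
            Real.norm_eq_abs, sq_abs]
          exact ENNReal.ofReal_le_ofReal (sq_wellDensity_le _)
      _ = _ := by ring
  have hslice : ∀ᵐ t ∂τ, ENNReal.ofReal (2 / 3) * H Γ ^ 2 ≤
      H Γ * ‖∫ x, (v.u x t - 1 / 3 * v.u x t ^ 3) ∂H₁‖ₑ +
      4 * H Γ * (∫⁻ x, ENNReal.ofReal (doubleWell (v.u x t)) ∂H₁) +
      K * ∫⁻ x, ‖wellDensity (v.u x t)‖ₑ * ‖v.tgrad x t‖ₑ ∂H₁ := by
    have hle : τ ≤ volume.restrict (Ioi 0) :=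
      hsub.trans (Measure.restrict_mono Ioc_subset_Ioi_self le_rfl)
    filter_upwards [ae_mono hle hv.tangential_gradient] with t h1
    have h2 := sq_measure_univ_le (h1.1.mono_measure (Measure.restrict_le_self : H₁ ≤ H))
    rw [hH₁u] at h2
    exact h2.trans (add_le_add le_rfl (hK _ _ h1))
  have m1 : AEMeasurable (fun t => ‖∫ x, (v.u x t - 1 / 3 * v.u x t ^ 3) ∂H₁‖ₑ) τ := hwt.1.enorm
  have m2 : AEMeasurable (fun t => ∫⁻ x, ENNReal.ofReal (doubleWell (v.u x t)) ∂H₁) τ :=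
    hWm.lintegral_prod_left'
  have m3 : AEMeasurable (fun t => ∫⁻ x, ‖wellDensity (v.u x t)‖ₑ * ‖v.tgrad x t‖ₑ ∂H₁) τ :=
    AEMeasurable.lintegral_prod_left' (f := fun z => ‖wellDensity (v.u z.1 z.2)‖ₑ *
      ‖v.tgrad z.1 z.2‖ₑ) (hρm.mul hG.1.enorm)
  have hHt : H Γ ≠ ⊤ := measure_ne_top _ _
  calc
    _ = ∫⁻ _, ENNReal.ofReal (2 / 3) * H Γ ^ 2 ∂τ := by
        rw [lintegral_const, hτ, Measure.restrict_apply_univ, Real.volume_Ioc]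
    _ ≤ _ := lintegral_mono_ae hslice
    _ = H Γ * ENNReal.ofReal (∫ t in t₁..t₂, |∫ x in Γ, (v.u x t - 1 / 3 * v.u x t ^ 3) ∂H|) +
        4 * H Γ * (∫⁻ z, ENNReal.ofReal (doubleWell (v.u z.1 z.2)) ∂(H₁.prod τ)) +
        K * ∫⁻ t, ∫⁻ x, ‖wellDensity (v.u x t)‖ₑ * ‖v.tgrad x t‖ₑ ∂H₁ ∂τ := by
        rw [lintegral_add_right' _ (m3.const_mul _),
          lintegral_add_left' (m1.const_mul _), lintegral_const_mul' _ _ hHt, hmean,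
          lintegral_const_mul' _ _ (ENNReal.mul_ne_top ENNReal.ofNat_ne_top hHt),
          lintegral_const_mul' _ _ ENNReal.coe_ne_top, lintegral_prod_symm _ hWm]
    _ ≤ _ := by gcongr

/-- If the limit measure of the tangential Dirichlet energies vanishes on `Γ × [t₁, t₂]`, then the
time-integrated means of `uʲ - (uʲ)³/3` on `Γ` are asymptotically maximal. -/
theorem le_limsup_mean (hn : 0 < n) (hΩ : IsSmoothBoundedDomain Ω) {ε σ : ℕ → ℝ}
    (hε : ∀ j, 0 < ε j) (hσ : ∀ j, 0 < σ j) (hε0 : Tendsto ε atTop (𝓝 0))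
    {u₀ : ℕ → EuclideanSpace ℝ (Fin n) → ℝ}
    {gradu₀ : ℕ → EuclideanSpace ℝ (Fin n) → EuclideanSpace ℝ (Fin n)}
    (hu₀ : ∀ j, IsSobolev Ω (u₀ j) (gradu₀ j))
    (hu₀_le : ∀ j, ∀ᵐ x ∂(volume.restrict Ω), |u₀ j x| ≤ 1)
    {D : ℝ} (hD : ∀ j, energy Ω (ε j) (u₀ j) (gradu₀ j) ≤ D)
    {v : ℕ → PhaseField n} (hv : ∀ j, IsSolution Ω (ε j) (σ j) (u₀ j) (v j))
    {t₁ t₂ : ℝ} (ht₁ : 0 ≤ t₁) (ht : t₁ < t₂) {C₀ : ℝ}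
    (hbound : ∀ j, ∫⁻ t in Ioc t₁ t₂, ∫⁻ x, ENNReal.ofReal
        (ε j / 2 * (inner ℝ ((v j).grad x t) (outerNormal Ω x)) ^ 2)
          ∂(boundaryMeasure Ω) ≤ ENNReal.ofReal C₀)
    {α : Measure (EuclideanSpace ℝ (Fin n) × ℝ)} [IsLocallyFiniteMeasure α]
    (hα : VagueTendsto (fun j => weightedBoundaryArea Ω (ε j) (v j)) α)
    {p : EuclideanSpace ℝ (Fin n)} (hp : p ∈ frontier Ω) {Γ : Set (EuclideanSpace ℝ (Fin n))}
    (hΓ : Γ = connectedComponentIn (frontier Ω) p) (h0 : α (Γ ×ˢ Icc t₁ t₂) = 0) :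
    ((2 / 3 * (boundaryMeasure Ω).real Γ * (t₂ - t₁) : ℝ) : EReal) ≤
      limsup (fun j => ((∫ t in t₁..t₂, |∫ x in Γ, ((v j).u x t - 1 / 3 * (v j).u x t ^ 3)
        ∂(boundaryMeasure Ω)| : ℝ) : EReal)) atTop := by
  have := boundaryMeasure_lt_top hn hΩ
  -- The upper limit is taken in `EReal`, so no boundedness of the means is needed to extract a real
  -- level `L` strictly below the claimed value.
  by_contra! hlt
  obtain ⟨L, hL1, hL2⟩ := EReal.lt_iff_exists_real_btwn.1 hlt
  have hJ : ∀ᶠ j in atTop, ∫ t in t₁..t₂, |∫ x in Γ, ((v j).u x t - 1 / 3 * (v j).u x t ^ 3)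
      ∂(boundaryMeasure Ω)| < L :=
    (eventually_lt_of_limsup_lt hL1).mono fun j hj => EReal.coe_lt_coe_iff.1 hj
  rw [EReal.coe_lt_coe_iff] at hL2
  obtain ⟨K₁, hK₁⟩ := exists_spacetime_potential_le hn hΩ
  obtain ⟨K₂, hK₂⟩ := exists_mean_lower_bound hn hΩ hΓ
  set B : ℝ≥0∞ := K₁ * (ENNReal.ofReal D * ENNReal.ofReal (t₂ - t₁) + ENNReal.ofReal D +
    ENNReal.ofReal C₀)
  have hB : B ≠ ⊤ := ENNReal.mul_ne_top ENNReal.coe_ne_top (ENNReal.add_ne_top.2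
    ⟨ENNReal.add_ne_top.2 ⟨ENNReal.mul_ne_top ENNReal.ofReal_ne_top ENNReal.ofReal_ne_top,
      ENNReal.ofReal_ne_top⟩, ENNReal.ofReal_ne_top⟩)
  have hpot : ∀ j, ∫⁻ t in Ioc t₁ t₂, ∫⁻ x, ENNReal.ofReal (doubleWell ((v j).u x t) / ε j)
      ∂(boundaryMeasure Ω) ≤ B := fun j =>
    (hK₁ _ _ _ _ _ (hε j) (hσ j) (hv j) (hu₀ j) (hu₀_le j) D (hD j) t₁ t₂ ht₁ ht).trans
      (mul_le_mul_right (add_le_add le_rfl (hbound j)) _)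
  have hΓc : IsClosed Γ := hΓ ▸ isClosed_connectedComponentIn isClosed_frontier p
  have hΓk : IsCompact Γ := hΩ.isCompact_frontier.of_isClosed_subset hΓc
    (hΓ ▸ connectedComponentIn_subset _ _)
  have hfin : ∀ j, IsFiniteMeasureOnCompacts (weightedBoundaryArea Ω (ε j) (v j)) := fun j =>
    (hv j).isFiniteMeasureOnCompacts hn hΩ (hε j).le
  set A : ℕ → ℝ≥0∞ := fun j => weightedBoundaryArea Ω (ε j) (v j) (Γ ×ˢ Icc t₁ t₂)
  have hA : Tendsto A atTop (𝓝 0) := by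
    refine ENNReal.tendsto_nhds_zero.2 fun δ hδ => ?_
    -- The minimum with `1` makes the tolerance finite, so that it can be converted to a real
    -- number.
    obtain ⟨δ', hδ', hδδ⟩ := exists_between (lt_min hδ one_pos)
    have hδt : δ' ≠ ⊤ := ((hδδ.trans_le (min_le_right _ _)).trans ENNReal.one_lt_top).ne
    filter_upwards [hα.eventually_measure_le (hΓk.prod isCompact_Icc)
      (hΓc.prod isClosed_Icc) h0 (ENNReal.toReal_pos hδ'.ne' hδt)] with j hj
    rw [ENNReal.ofReal_toReal hδt] at hj
    exact hj.trans (hδδ.le.trans (min_le_left _ _))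
  set h := boundaryMeasure Ω Γ
  have hht : h ≠ ⊤ := measure_ne_top _ _
  -- A connected patch of positive measure around `p` lies in `Γ`. Positivity is needed to cancel
  -- one factor `h` at the end.
  have hpos : 0 < h := by
    obtain ⟨U, hU, hpU, hUc, -⟩ := exists_poincare_patch hn hΩ hp
    have hUΓ : U ∩ frontier Ω ⊆ Γ :=
      hΓ ▸ hUc.subset_connectedComponentIn ⟨hpU, hp⟩ inter_subset_right
    refine (boundaryMeasure_pos hn hΩ hp (hU.mem_nhds hpU)).trans_le ?_
    rw [boundaryMeasure, Measure.restrict_apply hU.measurableSet]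
    refine (measure_mono (subset_inter hUΓ inter_subset_right)).trans ?_
    exact Measure.le_restrict_apply _ _
  have hle : ∀ᶠ j in atTop, ENNReal.ofReal (2 / 3) * h ^ 2 * ENNReal.ofReal (t₂ - t₁) ≤
      h * ENNReal.ofReal L + 4 * h * (ENNReal.ofReal (ε j) * B) +
        K₂ * (2 * B * A j) ^ (1 / 2 : ℝ) := by
    filter_upwards [hJ] with j hj
    refine (hK₂ _ _ _ _ (hε j) (hv j) t₁ t₂ ht₁ ht B hB (hpot j)).trans ?_
    gcongr
  have hlim : Tendsto (fun j => h * ENNReal.ofReal L + 4 * h * (ENNReal.ofReal (ε j) * B) +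
      K₂ * (2 * B * A j) ^ (1 / 2 : ℝ)) atTop (𝓝 (h * ENNReal.ofReal L +
        4 * h * (ENNReal.ofReal 0 * B) + K₂ * (2 * B * 0) ^ (1 / 2 : ℝ))) := by
    refine (tendsto_const_nhds.add (ENNReal.Tendsto.const_mul (ENNReal.Tendsto.mul_const
      (ENNReal.tendsto_ofReal hε0) (Or.inr hB))
      (Or.inr (ENNReal.mul_ne_top ENNReal.ofNat_ne_top hht)))).add ?_
    exact ENNReal.Tendsto.const_mul ((ENNReal.continuous_rpow_const.tendsto _).comp
      (ENNReal.Tendsto.const_mul hA (Or.inr (ENNReal.mul_ne_top ENNReal.ofNat_ne_top hB))))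
      (Or.inr ENNReal.coe_ne_top)
  -- In the limit the potential term vanishes with `ε j` and the gradient term with `A j`. What
  -- remains is `(2/3) h² (t₂ - t₁) ≤ h L`, which contradicts the choice of `L`.
  have hfinal := ge_of_tendsto hlim hle
  rw [ENNReal.ofReal_zero, zero_mul, mul_zero, mul_zero, add_zero,
    ENNReal.zero_rpow_of_pos (by norm_num), mul_zero, add_zero,
    show ENNReal.ofReal (2 / 3) * h ^ 2 * ENNReal.ofReal (t₂ - t₁) =
      h * (ENNReal.ofReal (2 / 3) * h * ENNReal.ofReal (t₂ - t₁)) by ring,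
    ENNReal.mul_le_mul_iff_right hpos.ne' hht, show h = ENNReal.ofReal ((boundaryMeasure Ω).real Γ) from
      (ofReal_measureReal hht).symm,
    ← ENNReal.ofReal_mul (by norm_num),
    ← ENNReal.ofReal_mul (mul_nonneg (by norm_num) measureReal_nonneg)] at hfinal
  have hprod : 0 < 2 / 3 * (boundaryMeasure Ω).real Γ * (t₂ - t₁) :=
    mul_pos (mul_pos (by norm_num) (ENNReal.toReal_pos hpos.ne' hht)) (sub_pos.2 ht)
  exact absurd hfinal (not_le.2 ((ENNReal.ofReal_lt_ofReal_iff hprod).2 hL2))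

end

end AllenCahn

end

/-! ### The theorem. -/

theorem lemma3p2p1 (n : ℕ) (hn : 2 < n)
    (Ω : Set (EuclideanSpace ℝ (Fin n))) (hΩ : AllenCahn.IsSmoothBoundedDomain Ω)
    -- the parameters
    (ε σ : ℕ → ℝ) (hε : ∀ j, ε j ∈ Set.Ioo (0 : ℝ) 1) (hσ : ∀ j, σ j ∈ Set.Ioo (0 : ℝ) 1)
    (hε0 : Filter.Tendsto ε Filter.atTop (nhds 0)) (hσ0 : Filter.Tendsto σ Filter.atTop (nhds 0))
    -- the initial data
    (u₀ : ℕ → EuclideanSpace ℝ (Fin n) → ℝ)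
    (gradu₀ : ℕ → EuclideanSpace ℝ (Fin n) → EuclideanSpace ℝ (Fin n))
    (hu₀ : ∀ j, AllenCahn.IsSobolev Ω (u₀ j) (gradu₀ j))
    (hu₀_le : ∀ j, ∀ᵐ x ∂(MeasureTheory.volume.restrict Ω), |u₀ j x| ≤ 1)
    (D : ℝ) (hD : ∀ j, AllenCahn.energy Ω (ε j) (u₀ j) (gradu₀ j) ≤ D)
    -- the solutions
    (v : ℕ → AllenCahn.PhaseField n)
    (hv : ∀ j, AllenCahn.IsSolution Ω (ε j) (σ j) (u₀ j) (v j))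
    -- the local-in-time uniform bound of the normal Dirichlet energy on the boundary
    (hbound : ∀ s₁ s₂ : ℝ, 0 ≤ s₁ → s₁ < s₂ → ∃ C₀ : ℝ, ∀ j,
      ∫⁻ t in Set.Ioc s₁ s₂, ∫⁻ x, ENNReal.ofReal
        (ε j / 2 * (inner ℝ ((v j).grad x t) (AllenCahn.outerNormal Ω x)) ^ 2)
          ∂(AllenCahn.boundaryMeasure Ω) ≤ ENNReal.ofReal C₀)
    -- the limit measure on `∂Ω × [0,∞)`
    (α : MeasureTheory.Measure (EuclideanSpace ℝ (Fin n) × ℝ))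
    [MeasureTheory.IsLocallyFiniteMeasure α]
    (hα_supp : α (frontier Ω ×ˢ Set.Ici (0 : ℝ))ᶜ = 0)
    (hα : AllenCahn.VagueTendsto
      (fun j => AllenCahn.weightedBoundaryArea Ω (ε j) (v j)) α)
    -- the phase boundary is present on `Γ₁` during `[t₁, t₂]`
    (t₁ t₂ : ℝ) (ht₁ : 0 ≤ t₁) (ht : t₁ < t₂)
    (p : EuclideanSpace ℝ (Fin n)) (hp : p ∈ frontier Ω)
    (Γ₁ : Set (EuclideanSpace ℝ (Fin n))) (hΓ₁ : Γ₁ = connectedComponentIn (frontier Ω) p)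
    (hw : Filter.limsup (fun j => ((∫ t in t₁..t₂,
        |∫ x in Γ₁, ((v j).u x t - (1 / 3) * (v j).u x t ^ 3)
          ∂(AllenCahn.boundaryMeasure Ω)| : ℝ) : EReal)) Filter.atTop
      < ((2 / 3 * (AllenCahn.boundaryMeasure Ω).real Γ₁ * (t₂ - t₁) : ℝ) : EReal)) :
    (∃ C : ℝ, 0 < C ∧ ENNReal.ofReal C ≤ α (Γ₁ ×ˢ Set.Icc t₁ t₂)) ∧ α ≠ 0 := by
  have hn' : 0 < n := by omega
  have hne : α (Γ₁ ×ˢ Set.Icc t₁ t₂) ≠ 0 := by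
    intro h0
    obtain ⟨C₀, hC₀⟩ := hbound t₁ t₂ ht₁ ht
    exact absurd hw (not_lt.2 (AllenCahn.le_limsup_mean hn' hΩ (fun j => (hε j).1)
      (fun j => (hσ j).1) hε0 hu₀ hu₀_le hD hv ht₁ ht hC₀ hα hp hΓ₁ h0))
  -- Any number strictly between `0` and the mass serves as the constant. Being strictly below the
  -- mass, it is finite without further argument.
  obtain ⟨c, hc0, hc⟩ := exists_between (pos_iff_ne_zero.2 hne)
  have hct : c ≠ ⊤ := (hc.trans_le le_top).ne
  refine ⟨⟨c.toReal, ENNReal.toReal_pos hc0.ne' hct, ?_⟩, fun h => hne (by simp [h])⟩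
  rw [ENNReal.ofReal_toReal hct]
  exact hc.le
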